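/- **Setting.** Let $(\cdot,\cdot)$ be the Hilbert symbol of $\mathbb Q_2$ and let $\mu_2=\{\pm1\}$. For $g=\begin{pmatrix}a&b\\c&d\end{pmatrix}\in\mathrm{SL}_2(\mathbb Q_2)$ put $x(g)=c$ if $c\ne0$ and $x(g)=d$ if $c=0$; put $s(g)=(c,d)$ if $cd\neq0$ and $\mathrm{ord}(c)$ is odd, and $s(g)=1$ otherwise. Let $G=\mathrm{SL}_2(\mathbb Q_2)\times\mu_2$ be the two-fold central extension of $\mathrm{SL}_2(\mathbb Q_2)$ with group law $$(g_1,\epsilon_1)(g_2,\epsilon_2)=(g_1g_2,\ \epsilon_1\epsilon_2\,\sigma(g_1,g_2)),\qquad \sigma(g_1,g_2)=(x(g_1g_2)x(g_1),\,x(g_1g_2)x(g_2))\,s(g_1)s(g_2)s(g_1g_2),$$ with the topology in which the sets $g\cdot\{(k,1): k\in\mathrm{SL}_2(\mathbb Z_2),\ k\equiv1 \bmod 2^n\}$, $n\ge2$, form a basis of open neighbourhoods of $g$. Put $h(t)=(\mathrm{diag}(t,t^{-1}),1)$ and $w(t)=\left(\begin{pmatrix}0&t\\-t^{-1}&0\end{pmatrix},1\right)$.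 Let $M$ be the centre of $G$, let $K_0$ be the inverse image in $G$ of $\{k\in\mathrm{SL}_2(\mathbb Z_2): c\in4\mathbb Z_2\}$, and let $K_1=\{(k,1): k\in\mathrm{SL}_2(\mathbb Z_2),\ a\in1+4\mathbb Z_2,\ c\in4\mathbb Z_2\}$; then $K_0=M\times K_1$. Let $\gamma$ be a genuine character of $M$, that is, one that is nontrivial on $\mu_2$; extend it to $K_0$ so that it is trivial on $K_1$, and put $\zeta=(1+\gamma(h(-1)))/\sqrt2$. Let $H(\gamma)$ be the convolution algebra of the locally constant compactly supported functions $f:G\to\mathbb C$ with $f(k_0gk_0')=\overline{\gamma}(k_0)f(g)\overline{\gamma}(k_0')$ for $k_0,k_0'\in K_0$ (Haar measure with $\mathrm{vol}(K_0)=1$). Let $T_w,U_1\in H(\gamma)$ be the functions supported on $K_0w(1)K_0$ and on $K_0w(2^{-1})K_0$, respectively, with $T_w(w(1))=\overline\zeta/\sqrt2$ and $U_1(w(2^{-1}))=\overline\zeta$. For a smooth representation $V$ of $G$ let $V^\gamma$ be the space of vectors on which $K_0$ acts by $\gamma$; it is a left $H(\gamma)$-module. Let $G'=\mathrm{PGL}_2(\mathbb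 Q_2)$, let $I$ be its Iwahori subgroup, the image of the matrices in $\mathrm{GL}_2(\mathbb Z_2)$ that are upper triangular modulo $2$, and let $H'$ be the convolution algebra of the $I$-bi-invariant compactly supported functions $G'\to\mathbb C$ (Haar measure with $\mathrm{vol}(I)=1$). Let $T_w',U_1'\in H'$ be the characteristic functions of $I\begin{pmatrix}0&1\\1&0\end{pmatrix}I$ and $I\begin{pmatrix}0&1\\2&0\end{pmatrix}I$. Let $\mathcal R(G,\gamma)$ be the category of admissible smooth complex representations $V$ of $G$ that are generated by $V^\gamma$, let $\mathcal R(G',I)$ be the category of admissible smooth complex representations $V$ of $G'$ that are generated by $V^I$, and let $\mathcal R(H(\gamma))$, $\mathcal R(H')$ be the categories of finite dimensional left modules. **Statement.** There is an isomorphism of $\mathbb C$-algebras $\Phi:H(\gamma)\to H'$ with $\Phi(T_w)=T_w'$ and $\Phi(U_1)=U_1'$. Moreover, the functors $$\mathcal R(G,\gamma)\to\mathcal R(H(\gamma)),\ V\mapsto V^\gamma;\qquad \Phi^*:\mathcal R(H')\to\mathcal R(H(\gamma));\qquad \mathcal R(G',I)\to\mathcal R(H'),\ V\mapsto V^I$$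 are equivalences of categories, where $\Phi^*$ is restriction along $\Phi$. Consequently there is an equivalence of categories $\mathrm{Sh}:\mathcal R(G,\gamma)\to\mathcal R(G',I)$ (the local Shimura correspondence) such that $V^\gamma\cong\Phi^*\bigl(\mathrm{Sh}(V)^I\bigr)$ as $H(\gamma)$-modules, naturally in $V$. -/

import Mathlib

open CategoryTheory
open scoped MatrixGroups

open scoped Classical in
/-- The Hilbert symbol of `ℚ₂`. -/
noncomputable def hilbertSymbol (a b : ℚ_[2]) : ℤˣ :=
  if ∃ x y z : ℚ_[2], (x ≠ 0 ∨ y ≠ 0 ∨ z ≠ 0) ∧ z ^ 2 = a * x ^ 2 + b * y ^ 2 then 1 else -1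

/-! Facts about the Hilbert symbol that are needed for the group law of the double cover. -/

namespace HS

def Sol (a b : ℚ_[2]) : Prop :=
  ∃ x y z : ℚ_[2], (x ≠ 0 ∨ y ≠ 0 ∨ z ≠ 0) ∧ z ^ 2 = a * x ^ 2 + b * y ^ 2

theorem eq_one_iff {a b : ℚ_[2]} : hilbertSymbol a b = 1 ↔ Sol a b := by
  unfold hilbertSymbol Sol
  split_ifs with h
  · simp [h]
  · simp only [h, iff_false]; decide

theorem congr {a b a' b' : ℚ_[2]} (h : Sol a b ↔ Sol a' b') :
    hilbertSymbol a b = hilbertSymbol a' b' := by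
  rw [← eq_one_iff, ← eq_one_iff] at h
  rcases Int.units_eq_one_or (hilbertSymbol a b) with h1 | h1 <;>
    rcases Int.units_eq_one_or (hilbertSymbol a' b') with h2 | h2 <;> simp_all

theorem Sol.symm {a b : ℚ_[2]} (h : Sol a b) : Sol b a := by
  obtain ⟨x, y, z, h0, h⟩ := h
  exact ⟨y, x, z, by tauto, by rw [h]; ring⟩

theorem Sol.sq {a b c : ℚ_[2]} (hc : c ≠ 0) (h : Sol a b) : Sol a (b * c ^ 2) := by
  obtain ⟨x, y, z, h0, h⟩ := h
  refine ⟨x, y / c, z, ?_, ?_⟩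
  · rcases h0 with h | h | h
    · exact Or.inl h
    · exact Or.inr (Or.inl (div_ne_zero h hc))
    · exact Or.inr (Or.inr h)
  · rw [h]; field_simp

theorem sol_sq_iff {a b c : ℚ_[2]} (hc : c ≠ 0) : Sol a (b * c ^ 2) ↔ Sol a b := by
  refine ⟨fun h => ?_, fun h => h.sq hc⟩
  have := h.sq (inv_ne_zero hc)
  rwa [mul_assoc, ← mul_pow, mul_inv_cancel₀ hc, one_pow, mul_one] at this

theorem comm (a b : ℚ_[2]) : hilbertSymbol a b = hilbertSymbol b a :=
  congr ⟨Sol.symm, Sol.symm⟩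

theorem mul_sq {a b c : ℚ_[2]} (hc : c ≠ 0) : hilbertSymbol a (b * c ^ 2) = hilbertSymbol a b :=
  congr (sol_sq_iff hc)

theorem of_sq {a b : ℚ_[2]} (h : ∃ z, z ^ 2 = b) : hilbertSymbol a b = 1 := by
  obtain ⟨z, rfl⟩ := h
  exact eq_one_iff.2 ⟨0, 1, z, by simp, by simp⟩

theorem neg_self (a : ℚ_[2]) : hilbertSymbol a (-a) = 1 :=
  eq_one_iff.2 ⟨1, 1, 0, by simp, by ring⟩

theorem of_add {a b : ℚ_[2]} (h : ∃ z, z ^ 2 = a + b) : hilbertSymbol a b = 1 := by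
  obtain ⟨z, h⟩ := h
  exact eq_one_iff.2 ⟨1, 1, z, by simp, by rw [h]; ring⟩

/-- Units congruent to `1` modulo `8` are squares. -/
theorem isSq_int {u : ℤ_[2]} (h : (8 : ℤ_[2]) ∣ u - 1) : ∃ z : ℤ_[2], z ^ 2 = u := by
  have h8 : ‖u - 1‖ ≤ 1 / 8 := by
    obtain ⟨k, hk⟩ := h
    rw [hk, norm_mul]
    have : ‖(8 : ℤ_[2])‖ = 1 / 8 := by
      have := PadicInt.norm_p_pow (p := 2) 3
      norm_num at this ⊢
      convert this using 2
    rw [this]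
    have := PadicInt.norm_le_one k
    linarith
  have h2 : ‖(2 : ℤ_[2])‖ = 1 / 2 := by
    have := PadicInt.norm_p (p := 2)
    norm_num at this ⊢
    exact this
  obtain ⟨z, hz, -⟩ := hensels_lemma (p := 2) (R := ℤ_[2])
    (F := (Polynomial.X ^ 2 - Polynomial.C u)) (a := (1 : ℤ_[2])) (by
      simp only [map_sub, map_pow, Polynomial.aeval_X, one_pow, Polynomial.aeval_C,
        Algebra.algebraMap_self, RingHom.id_apply, 
        Polynomial.derivative_X_pow, Polynomial.derivative_C, sub_zero, map_mul]
      rw [norm_sub_rev]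
      simp [h2]
      norm_num at h8 ⊢
      linarith)
  refine ⟨z, ?_⟩
  simpa [sub_eq_zero] using hz

theorem isSq {u : ℤ_[2]} (h : (8 : ℤ_[2]) ∣ u - 1) : ∃ z : ℚ_[2], z ^ 2 = u := by
  obtain ⟨z, hz⟩ := isSq_int h
  exact ⟨z, by rw [← hz]; push_cast; rfl⟩

/-- Representatives of `ℚ₂ˣ` modulo squares. -/
def rep : Fin 8 → ℤ := ![1, 3, 5, 7, 2, 6, 10, 14]
def good (n : ℤ) : Bool :=
  n % 8 = 1 || (n % 4 = 0 && n / 4 % 8 = 1) || (n % 16 = 0 && n / 16 % 8 = 1)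
def tab (i j : Fin 8) : Bool := (List.range 4).any fun x => (List.range 4).any fun y =>
  good (rep i * x ^ 2 + rep j * y ^ 2)

theorem good_sq {n : ℤ} (h : good n = true) : ∃ z : ℚ_[2], z ≠ 0 ∧ z ^ 2 = n := by
  have key : ∀ m : ℤ, m % 8 = 1 → ∃ z : ℚ_[2], z ≠ 0 ∧ z ^ 2 = m := by
    intro m hm
    obtain ⟨z, hz⟩ := isSq (u := (m : ℤ_[2])) (by
      have : (8 : ℤ) ∣ m - 1 := by omega
      exact_mod_cast (Int.castRingHom ℤ_[2]).map_dvd this)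
    refine ⟨z, ?_, by rw [hz]; simp⟩
    rintro rfl
    have : (m : ℚ_[2]) = 0 := by simpa using hz.symm
    have : m = 0 := by exact_mod_cast this
    omega
  simp only [good, Bool.or_eq_true, decide_eq_true_eq, Bool.and_eq_true] at h
  rcases h with (h | ⟨h, h'⟩) | ⟨h, h'⟩
  · exact key n h
  · obtain ⟨z, h0, hz⟩ := key _ h'
    refine ⟨2 * z, by simpa using h0, ?_⟩
    have : n = 4 * (n / 4) := by omega
    rw [this, mul_pow, hz]; push_cast; norm_num
  · obtain ⟨z, h0, hz⟩ := key _ h'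
    refine ⟨4 * z, by simpa using h0, ?_⟩
    have : n = 16 * (n / 16) := by omega
    rw [this, mul_pow, hz]; push_cast; norm_num

theorem sol_of_tab {i j : Fin 8} (h : tab i j = true) : Sol (rep i) (rep j) := by
  simp only [tab, List.any_eq_true] at h
  obtain ⟨x, -, y, -, h⟩ := h
  obtain ⟨z, h0, hz⟩ := good_sq h
  exact ⟨x, y, z, by tauto, by rw [hz]; push_cast; rfl⟩

theorem tab_false : ∀ i j : Fin 8, tab i j = false → ∀ X ∈ ({0, 1, 4, 9} : Finset (ZMod 16)),
    ∀ Y ∈ ({0, 1, 4, 9} : Finset (ZMod 16)), ∀ Z ∈ ({0, 1, 4, 9} : Finset (ZMod 16)),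
    Z = rep i * X + rep j * Y → (X = 0 ∨ X = 4) ∧ (Y = 0 ∨ Y = 4) ∧ (Z = 0 ∨ Z = 4) := by
  decide +kernel

theorem sq_mem : ∀ t : ZMod 16, t ^ 2 ∈ ({0, 1, 4, 9} : Finset (ZMod 16)) := by decide
theorem sq_even : ∀ t : ZMod 16, (t ^ 2 = 0 ∨ t ^ 2 = 4) → 8 * t = 0 := by decide

theorem two_dvd {x : ℤ_[2]} (h : 8 * PadicInt.toZModPow (p := 2) 4 x = 0) : (2 : ℤ_[2]) ∣ x := by
  have h' : PadicInt.toZModPow (p := 2) 4 (8 * x) = 0 := by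
    rw [map_mul, map_ofNat]; exact h
  rw [← RingHom.mem_ker, PadicInt.ker_toZModPow, Ideal.mem_span_singleton] at h'
  obtain ⟨k, hk⟩ := h'
  refine ⟨k, mul_left_cancel₀ (a := (8 : ℤ_[2])) (by norm_num) ?_⟩
  rw [hk]; push_cast; ring

/-- A common denominator power of `2` can be removed, keeping one coordinate odd. -/
theorem primitive {x y z : ℚ_[2]} (h : x ≠ 0 ∨ y ≠ 0 ∨ z ≠ 0) :
    ∃ (c : ℚ_[2]) (x' y' z' : ℤ_[2]), c ≠ 0 ∧ x = c * x' ∧ y = c * y' ∧ z = c * z' ∧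
      ¬ ((2 : ℤ_[2]) ∣ x' ∧ (2 : ℤ_[2]) ∣ y' ∧ (2 : ℤ_[2]) ∣ z') := by
  have key : ∀ x y z : ℚ_[2], x ≠ 0 → ‖y‖ ≤ ‖x‖ → ‖z‖ ≤ ‖x‖ →
      ∃ (c : ℚ_[2]) (x' y' z' : ℤ_[2]), c ≠ 0 ∧ x = c * x' ∧ y = c * y' ∧ z = c * z' ∧
      ¬ ((2 : ℤ_[2]) ∣ x') := by
    intro x y z hx hy hz
    have hx' : 0 < ‖x‖ := norm_pos_iff.2 hx
    refine ⟨x, 1, ⟨y / x, ?_⟩, ⟨z / x, ?_⟩, hx, by simp, ?_, ?_, ?_⟩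
    · rw [norm_div]; exact (div_le_one hx').2 hy
    · rw [norm_div]; exact (div_le_one hx').2 hz
    · simp only; field_simp
    · simp only; field_simp
    · intro h
      exact (PadicInt.prime_p (p := 2)).not_isUnit (by exact_mod_cast isUnit_of_dvd_one h)
  have n0 : ∀ {a b : ℚ_[2]}, ‖a‖ ≤ ‖b‖ → a ≠ 0 → b ≠ 0 := by
    rintro a b h ha rfl
    simp at h; exact ha h
  have M : (‖y‖ ≤ ‖x‖ ∧ ‖z‖ ≤ ‖x‖) ∨ (‖x‖ ≤ ‖y‖ ∧ ‖z‖ ≤ ‖y‖) ∨ (‖x‖ ≤ ‖z‖ ∧ ‖y‖ ≤ ‖z‖) := by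
    grind
  rcases M with ⟨h1, h2⟩ | ⟨h1, h2⟩ | ⟨h1, h2⟩
  · obtain ⟨c, x', y', z', h⟩ := key x y z (by
      rcases h with h | h | h
      exacts [h, n0 h1 h, n0 h2 h]) h1 h2
    exact ⟨c, x', y', z', by tauto⟩
  · obtain ⟨c, y', x', z', h⟩ := key y x z (by
      rcases h with h | h | h
      exacts [n0 h1 h, h, n0 h2 h]) h1 h2
    exact ⟨c, x', y', z', by tauto⟩
  · obtain ⟨c, z', x', y', h⟩ := key z x y (by
      rcases h with h | h | h
      exacts [n0 h1 h, n0 h2 h, h]) h1 h2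
    exact ⟨c, x', y', z', by tauto⟩

theorem tab_of_sol {i j : Fin 8} (h : Sol (rep i) (rep j)) : tab i j = true := by
  by_contra hf
  rw [Bool.not_eq_true] at hf
  obtain ⟨x, y, z, h0, h⟩ := h
  obtain ⟨c, x, y, z, hc, rfl, rfl, rfl, hp⟩ := primitive h0
  have h1 : z ^ 2 = rep i * x ^ 2 + rep j * y ^ 2 := by
    have : (z : ℚ_[2]) ^ 2 = rep i * x ^ 2 + rep j * y ^ 2 := by
      apply mul_left_cancel₀ (pow_ne_zero 2 hc)
      linear_combination h
    apply Subtype.ext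
    push_cast
    exact this
  have h2 := congrArg (PadicInt.toZModPow (p := 2) 4) h1
  simp only [map_pow, map_add, map_mul, map_intCast] at h2
  have h3 := tab_false i j hf _ (sq_mem _) _ (sq_mem _) _ (sq_mem _) h2
  exact hp ⟨two_dvd (sq_even _ h3.1), two_dvd (sq_even _ h3.2.1), two_dvd (sq_even _ h3.2.2)⟩

theorem odd_rep (u : ℤ_[2]) (hu : ¬ (2 : ℤ_[2]) ∣ u) :
    ∃ (i : Fin 8) (c : ℚ_[2]), i.val < 4 ∧ c ≠ 0 ∧ (u : ℚ_[2]) = rep i * c ^ 2 := by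
  have key : ∃ i : Fin 8, i.val < 4 ∧ (8 : ℤ_[2]) ∣ u * rep i - 1 := by
    have h1 : ∀ t : ZMod (2 ^ 3), 4 * t = 0 ∨ ∃ i : Fin 8, i.val < 4 ∧ t * rep i = 1 := by decide
    have dv : ∀ v : ℤ_[2], PadicInt.toZModPow (p := 2) 3 v = 0 → (8 : ℤ_[2]) ∣ v := by
      intro v hv
      rw [← RingHom.mem_ker, PadicInt.ker_toZModPow, Ideal.mem_span_singleton] at hv
      norm_num at hv; exact hv
    rcases h1 (PadicInt.toZModPow (p := 2) 3 u) with h | ⟨i, hi, h⟩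
    · obtain ⟨k, hk⟩ := dv (4 * u) (by rw [map_mul, map_ofNat]; exact h)
      exact absurd ⟨k, mul_left_cancel₀ (a := (4 : ℤ_[2])) (by norm_num) (by rw [hk]; ring)⟩ hu
    · exact ⟨i, hi, dv _ (by simp [h])⟩
  obtain ⟨i, hi, h⟩ := key
  obtain ⟨z, hz⟩ := isSq h
  have hr : (rep i : ℚ_[2]) ≠ 0 := by
    have : ∀ i, rep i ≠ 0 := by decide
    exact_mod_cast this i
  have hu0 : (u : ℚ_[2]) ≠ 0 := by
    intro h0
    have : u = 0 := Subtype.ext h0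
    exact hu (this ▸ dvd_zero _)
  push_cast at hz
  refine ⟨i, z / rep i, hi, div_ne_zero ?_ hr, ?_⟩
  · rintro rfl
    rw [zero_pow two_ne_zero] at hz
    exact mul_ne_zero hu0 hr hz.symm
  · rw [div_pow, hz]; field_simp

theorem exists_unit_mul (a : ℚ_[2]) (ha : a ≠ 0) :
    ∃ u : ℤ_[2], ¬ (2 : ℤ_[2]) ∣ u ∧ a = u * 2 ^ a.valuation := by
  have hn : ‖a * 2 ^ (-a.valuation)‖ = 1 := by
    rw [norm_mul, Padic.norm_eq_zpow_neg_valuation ha]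
    have : ‖(2 : ℚ_[2])‖ = 2⁻¹ := by simpa using Padic.norm_p (p := 2)
    rw [norm_zpow, this, inv_zpow, zpow_neg, zpow_neg, inv_inv]
    push_cast
    exact inv_mul_cancel₀ (by positivity)
  refine ⟨⟨_, hn.le⟩, ?_, ?_⟩
  · rintro ⟨k, hk⟩
    have h1 : (1 : ℝ) = ‖2 * k‖ := hn.symm.trans (congrArg norm (congrArg Subtype.val hk))
    rw [norm_mul] at h1
    have h2 : ‖(2 : ℤ_[2])‖ = 2⁻¹ := by simpa using PadicInt.norm_p (p := 2)
    have := PadicInt.norm_le_one k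
    rw [h2] at h1; linarith
  · simp only
    rw [mul_assoc, ← zpow_add₀ (by norm_num)]; simp

theorem exists_rep (a : ℚ_[2]) (ha : a ≠ 0) :
    ∃ (i : Fin 8) (c : ℚ_[2]), c ≠ 0 ∧ a = rep i * c ^ 2 := by
  obtain ⟨u, hu, h⟩ := exists_unit_mul a ha
  obtain ⟨i, c, hi, hc, hu⟩ := odd_rep u hu
  rw [hu] at h
  rcases Int.even_or_odd a.valuation with ⟨k, hk⟩ | ⟨k, hk⟩
  · refine ⟨i, c * 2 ^ k, mul_ne_zero hc (zpow_ne_zero _ two_ne_zero), ?_⟩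
    rw [h, hk, zpow_add₀ (by norm_num)]; ring
  · have : ∀ i : Fin 8, i.val < 4 → ∃ j : Fin 8, rep j = 2 * rep i := by decide
    obtain ⟨j, hj⟩ := this i hi
    refine ⟨j, c * 2 ^ k, mul_ne_zero hc (zpow_ne_zero _ two_ne_zero), ?_⟩
    rw [h, hk, hj, zpow_add₀ (by norm_num), two_mul, zpow_add₀ (by norm_num)]
    push_cast; ring

theorem sq_mul {a b c : ℚ_[2]} (hc : c ≠ 0) : hilbertSymbol (a * c ^ 2) b = hilbertSymbol a b := by
  rw [comm, mul_sq hc, comm]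

theorem rep_eq (i j : Fin 8) : hilbertSymbol (rep i) (rep j) = if tab i j then 1 else -1 := by
  by_cases h : tab i j = true
  · rw [if_pos h, eq_one_iff]; exact sol_of_tab h
  · rw [if_neg h]
    have : ¬ hilbertSymbol (rep i) (rep j) = 1 := fun h' => h (tab_of_sol (eq_one_iff.1 h'))
    exact (Int.units_eq_one_or _).resolve_left this

theorem mul_right {a b c : ℚ_[2]} (ha : a ≠ 0) (hb : b ≠ 0) (hc : c ≠ 0) :
    hilbertSymbol a (b * c) = hilbertSymbol a b * hilbertSymbol a c := by
  obtain ⟨i, x, hx, rfl⟩ := exists_rep a ha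
  obtain ⟨j, y, hy, rfl⟩ := exists_rep b hb
  obtain ⟨k, z, hz, rfl⟩ := exists_rep c hc
  have h1 : ∀ j k : Fin 8, ∃ l, good (rep j * rep k * rep l) = true ∧ ∀ i,
      (if tab i l then (1 : ℤˣ) else -1) =
        (if tab i j then 1 else -1) * (if tab i k then 1 else -1) := by decide +kernel
  obtain ⟨l, hl, h⟩ := h1 j k
  obtain ⟨w, hw0, hw⟩ := good_sq hl
  have hr : (rep l : ℚ_[2]) ≠ 0 := by
    have : ∀ i, rep i ≠ 0 := by decide
    exact_mod_cast this l
  have e : (rep j : ℚ_[2]) * y ^ 2 * (rep k * z ^ 2) = rep l * (w * y * z / rep l) ^ 2 := by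
    push_cast at hw
    field_simp
    rw [hw]
  rw [e, mul_sq (by positivity), mul_sq hy, mul_sq hz, sq_mul hx, sq_mul hx, sq_mul hx,
    rep_eq, rep_eq, rep_eq, h]

end HS

/-! ### The double cover of `SL₂(ℚ₂)` -/

/-- `x(g)`: the lower left entry of `g` if it is nonzero, the lower right entry otherwise. -/
noncomputable def cocycleX (g : SL(2, ℚ_[2])) : ℚ_[2] :=
  open scoped Classical in if g 1 0 ≠ 0 then g 1 0 else g 1 1

/-- `s(g) = (c, d)` if `c d ≠ 0` and `ord c` is odd, and `s(g) = 1` otherwise. -/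
noncomputable def cocycleS (g : SL(2, ℚ_[2])) : ℤˣ :=
  open scoped Classical in
  if g 1 0 * g 1 1 ≠ 0 ∧ Odd (g 1 0).valuation then hilbertSymbol (g 1 0) (g 1 1) else 1

/-- The cocycle `σ` of the double cover. -/
noncomputable def cocycle (g h : SL(2, ℚ_[2])) : ℤˣ :=
  hilbertSymbol (cocycleX (g * h) * cocycleX g) (cocycleX (g * h) * cocycleX h) *
    cocycleS g * cocycleS h * cocycleS (g * h)

namespace HS

theorem self_mul (u : ℤˣ) : u * u = 1 := Int.units_mul_self u

theorem mul_left {a b c : ℚ_[2]} (ha : a ≠ 0) (hb : b ≠ 0) (hc : c ≠ 0) :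
    hilbertSymbol (a * b) c = hilbertSymbol a c * hilbertSymbol b c := by
  rw [comm, mul_right hc ha hb, comm c a, comm c b]

theorem det_eq (g : SL(2, ℚ_[2])) : g 0 0 * g 1 1 - g 0 1 * g 1 0 = 1 := by
  have := g.det_coe
  rwa [Matrix.det_fin_two] at this

theorem X_ne (g : SL(2, ℚ_[2])) : cocycleX g ≠ 0 := by
  unfold cocycleX
  split_ifs with h
  · exact h
  · intro h1
    have := det_eq g
    rw [not_not] at h
    rw [h, h1] at this
    simp at this

theorem X_of_ne {g : SL(2, ℚ_[2])} (h : g 1 0 ≠ 0) : cocycleX g = g 1 0 := if_pos h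
theorem X_of_eq {g : SL(2, ℚ_[2])} (h : g 1 0 = 0) : cocycleX g = g 1 1 := if_neg (by simpa using h)

theorem mul_10 (g h : SL(2, ℚ_[2])) : (g * h) 1 0 = g 1 0 * h 0 0 + g 1 1 * h 1 0 := by
  simp [Matrix.mul_apply]
theorem mul_11 (g h : SL(2, ℚ_[2])) : (g * h) 1 1 = g 1 0 * h 0 1 + g 1 1 * h 1 1 := by
  simp [Matrix.mul_apply]
theorem mul_00 (g h : SL(2, ℚ_[2])) : (g * h) 0 0 = g 0 0 * h 0 0 + g 0 1 * h 1 0 := by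
  simp [Matrix.mul_apply]
theorem mul_01 (g h : SL(2, ℚ_[2])) : (g * h) 0 1 = g 0 0 * h 0 1 + g 0 1 * h 1 1 := by
  simp [Matrix.mul_apply]

/-- The ratio `x(gh) / (x(g) x(h))`. -/
noncomputable def ratio (g h : SL(2, ℚ_[2])) : ℚ_[2] :=
  cocycleX (g * h) / (cocycleX g * cocycleX h)

theorem ratio_ne (g h : SL(2, ℚ_[2])) : ratio g h ≠ 0 :=
  div_ne_zero (X_ne _) (mul_ne_zero (X_ne _) (X_ne _))

theorem X_mul (g h : SL(2, ℚ_[2])) : cocycleX (g * h) = ratio g h * (cocycleX g * cocycleX h) := by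
  unfold ratio
  rw [div_mul_cancel₀ _ (mul_ne_zero (X_ne _) (X_ne _))]

theorem alpha_eq (g h : SL(2, ℚ_[2])) :
    hilbertSymbol (cocycleX (g * h) * cocycleX g) (cocycleX (g * h) * cocycleX h) =
      hilbertSymbol (ratio g h) (-1) * hilbertSymbol (ratio g h) (cocycleX g) *
      hilbertSymbol (ratio g h) (cocycleX h) * hilbertSymbol (cocycleX g) (cocycleX h) := by
  have hp := ratio_ne g h
  have hx := X_ne g
  have hy := X_ne h
  rw [X_mul]
  set p := ratio g h
  set x := cocycleX g
  set y := cocycleX h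
  rw [show p * (x * y) * x = (p * y) * x ^ 2 by ring, show p * (x * y) * y = (p * x) * y ^ 2 by ring,
    sq_mul hx, mul_sq hy, mul_left hp hy (mul_ne_zero hp hx), mul_right hp hp hx,
    mul_right hy hp hx]
  have : hilbertSymbol p p = hilbertSymbol p (-1) := by
    have h1 := neg_self p
    rw [show -p = (-1) * p by ring, mul_right hp (by norm_num) hp] at h1
    rcases Int.units_eq_one_or (hilbertSymbol p p) with h | h <;>
    rcases Int.units_eq_one_or (hilbertSymbol p (-1)) with h' | h' <;> simp_all
  rw [this, comm y p, comm y x]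
  ac_rfl

theorem sq_left {a b : ℚ_[2]} (h : ∃ z, z ^ 2 = a) : hilbertSymbol a b = 1 := by
  rw [comm]; exact of_sq h

theorem ratio_left {g h : SL(2, ℚ_[2])} (hg : g 1 0 = 0) : ratio g h = 1 := by
  have h0 := X_ne g
  have h1 := X_ne h
  have : cocycleX (g * h) = cocycleX g * cocycleX h := by
    rw [X_of_eq hg] at h0 ⊢
    by_cases hh : h 1 0 = 0
    · rw [X_of_eq hh, X_of_eq (by rw [mul_10, hg, hh]; ring), mul_11, hg]; ring
    · rw [X_of_ne hh, X_of_ne (by rw [mul_10, hg, zero_mul, zero_add]; exact mul_ne_zero h0 hh),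
        mul_10, hg]; ring
  unfold ratio
  rw [this, div_self (mul_ne_zero h0 h1)]

theorem ratio_right {g h : SL(2, ℚ_[2])} (hh : h 1 0 = 0) : ∃ z, z ^ 2 = ratio g h := by
  have h0 := X_ne g
  have h1 := X_ne h
  have hd := det_eq h
  rw [hh, mul_zero, sub_zero] at hd
  rw [X_of_eq hh] at h1
  have ha : h 0 0 = (h 1 1)⁻¹ := eq_inv_of_mul_eq_one_left hd
  unfold ratio
  rw [X_of_eq hh]
  by_cases hg : g 1 0 = 0
  · rw [X_of_eq hg] at h0 ⊢
    rw [X_of_eq (by rw [mul_10, hg, hh]; ring), mul_11, hg]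
    exact ⟨1, by field_simp; ring⟩
  · rw [X_of_ne hg, X_of_ne (by rw [mul_10, hh, ha, mul_zero, add_zero]; positivity), mul_10, hh, ha]
    exact ⟨(h 1 1)⁻¹, by field_simp; ring⟩

/-- The ratio in the generic case. -/
theorem ratio_gen {g h : SL(2, ℚ_[2])} (hg : g 1 0 ≠ 0) (hh : h 1 0 ≠ 0) (hgh : (g * h) 1 0 ≠ 0) :
    ratio g h = g 1 1 / g 1 0 + h 0 0 / h 1 0 := by
  unfold ratio
  rw [X_of_ne hg, X_of_ne hh, X_of_ne hgh, mul_10]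
  field_simp
  ring

/-- The ratio in the degenerate case. -/
theorem ratio_deg {g h : SL(2, ℚ_[2])} (hg : g 1 0 ≠ 0) (hh : h 1 0 ≠ 0) (hgh : (g * h) 1 0 = 0) :
    ratio g h = -(1 / h 1 0 ^ 2) ∧ g 1 1 / g 1 0 + h 0 0 / h 1 0 = 0 := by
  unfold ratio
  have e := hgh
  rw [X_of_ne hg, X_of_ne hh, X_of_eq hgh, mul_11]
  rw [mul_10] at e
  have hd := det_eq h
  constructor
  · field_simp
    linear_combination (h 1 1) * e - (g 1 0) * hd
  · field_simp
    linear_combination e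

theorem ratio_cocycle (g h k : SL(2, ℚ_[2])) :
    ratio g h * ratio (g * h) k = ratio g (h * k) * ratio h k := by
  have h1 := X_ne g
  have h2 := X_ne h
  have h3 := X_ne k
  have h4 := X_ne (g * h)
  have h5 := X_ne (h * k)
  unfold ratio
  rw [mul_assoc g h k]
  field_simp

theorem pair_symm {p q r t : ℚ_[2]} (hp : p ≠ 0) (hq : q ≠ 0) (hr : r ≠ 0) (ht : t ≠ 0)
    (e : p * q = r * t) (c : ℚ_[2]) (h : p * t = p * q + c ^ 2) :
    hilbertSymbol p q = hilbertSymbol r t := by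
  have n1 : (-1 : ℚ_[2]) ≠ 0 := by norm_num
  have h1 : hilbertSymbol (p * t) (-(p * q)) = 1 := of_add ⟨c, by rw [h]; ring⟩
  have h2 := neg_self p
  have h3 := neg_self t
  have h4 : hilbertSymbol t (p * q) = hilbertSymbol t (r * t) := by rw [e]
  rw [show -(p * q) = -1 * (p * q) by ring, mul_left hp ht (by positivity), mul_right hp n1 (by positivity),
    mul_right ht n1 (by positivity), mul_right hp hp hq, h4, mul_right ht hr ht] at h1
  rw [show -p = -1 * p by ring, mul_right hp n1 hp] at h2
  rw [show -t = -1 * t by ring, mul_right ht n1 ht] at h3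
  rw [comm r t]
  have : ∀ a b c d e f : ℤˣ, a * (b * c) * (d * (e * f)) = 1 → a * b = 1 → d * f = 1 → c = e := by
    decide
  exact this _ _ _ _ _ _ h1 h2 h3

theorem ratio_symbol (g h k : SL(2, ℚ_[2])) :
    hilbertSymbol (ratio g h) (ratio (g * h) k) = hilbertSymbol (ratio g (h * k)) (ratio h k) := by
  by_cases hg : g 1 0 = 0
  · rw [ratio_left hg, ratio_left hg, sq_left ⟨1, by norm_num⟩, sq_left ⟨1, by norm_num⟩]
  by_cases hk : k 1 0 = 0
  · rw [of_sq (ratio_right hk), of_sq (ratio_right hk)]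
  by_cases hh : h 1 0 = 0
  · rw [sq_left (ratio_right hh), ratio_left hh, of_sq ⟨1, by norm_num⟩]
  have e := ratio_cocycle g h k
  have np := ratio_ne g h
  have nq := ratio_ne (g * h) k
  have nr := ratio_ne g (h * k)
  have nt := ratio_ne h k
  have one : ∀ a : ℚ_[2], hilbertSymbol a 1 = 1 := fun a => of_sq ⟨1, by norm_num⟩
  have hdet := det_eq h
  by_cases hgh : (g * h) 1 0 = 0
  · have p := ratio_deg hg hh hgh
    have q : ratio (g * h) k = 1 := ratio_left hgh
    rw [q, one]
    rw [q, p.1, mul_one] at e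
    rw [← sq_mul (c := h 1 0 * ratio h k) (mul_ne_zero hh nt)]
    have : ratio g (h * k) * (h 1 0 * ratio h k) ^ 2 = -ratio h k := by
      rw [show ratio g (h * k) * (h 1 0 * ratio h k) ^ 2 =
        (ratio g (h * k) * ratio h k) * ratio h k * h 1 0 ^ 2 by ring, ← e]
      field_simp
    rw [this, comm, neg_self]
  have id1 : ratio g h * (h 1 1 / h 1 0 - (g * h) 1 1 / (g * h) 1 0) = (1 / h 1 0) ^ 2 := by
    unfold ratio
    rw [X_of_ne hg, X_of_ne hh, X_of_ne hgh]
    field_simp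
    rw [mul_10, mul_11]
    linear_combination (g 1 0) * hdet
  by_cases hhk : (h * k) 1 0 = 0
  · have t := ratio_deg hh hk hhk
    obtain ⟨z, hz⟩ := ratio_right (g := g) hhk
    rw [sq_left ⟨z, hz⟩]
    have hz0 : z ≠ 0 := by
      rintro rfl
      exact nr (by rw [← hz]; norm_num)
    rw [← hz, t.1] at e
    rw [← mul_sq (c := ratio g h * k 1 0 / z) (div_ne_zero (mul_ne_zero np hk) hz0)]
    have : ratio (g * h) k * (ratio g h * k 1 0 / z) ^ 2 = -ratio g h := by
      rw [show ratio (g * h) k * (ratio g h * k 1 0 / z) ^ 2 =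
        (ratio g h * ratio (g * h) k) * ratio g h * (k 1 0 / z) ^ 2 by ring, e]
      field_simp
    rw [this, neg_self]
  by_cases hghk : (g * h * k) 1 0 = 0
  · have q := ratio_deg hgh hk hghk
    have r := ratio_deg hg hhk (by rw [← mul_assoc]; exact hghk)
    have t := ratio_gen hh hk hhk
    have m1 : ∀ (a c : ℚ_[2]), c ≠ 0 → hilbertSymbol a (-(1 / c ^ 2)) = hilbertSymbol a (-1) := by
      intro a c hc
      rw [← mul_sq (b := -(1 / c ^ 2)) hc]
      congr 1
      field_simp
    rw [q.1, r.1, m1 _ _ hk, comm _ (ratio h k), m1 _ _ hhk]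
    have : ratio g h = ratio h k * (1 / (h 1 0 * ratio h k)) ^ 2 := by
      have h1 : ratio g h * ratio h k = (1 / h 1 0) ^ 2 := by
        rw [← id1, t]
        linear_combination ratio g h * q.2
      field_simp
      field_simp at h1
      linear_combination h1
    rw [this, sq_mul (one_div_ne_zero (mul_ne_zero hh nt))]
  · have q := ratio_gen hgh hk hghk
    have t := ratio_gen hh hk hhk
    refine pair_symm np nq nr nt e (1 / h 1 0) ?_
    rw [← id1, q, t]; ring

theorem cocycle_assoc (g h k : SL(2, ℚ_[2])) :
    cocycle g h * cocycle (g * h) k = cocycle g (h * k) * cocycle h k := by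
  have e := ratio_cocycle g h k
  have np := ratio_ne g h
  have nq := ratio_ne (g * h) k
  have nr := ratio_ne g (h * k)
  have nt := ratio_ne h k
  have h1 := X_ne g
  have h2 := X_ne h
  have h3 := X_ne k
  have n1 : (-1 : ℚ_[2]) ≠ 0 := by norm_num
  have key := ratio_symbol g h k
  unfold cocycle
  rw [alpha_eq, alpha_eq, alpha_eq, alpha_eq, X_mul g h, X_mul h k, mul_assoc g h k]
  have E : ∀ a, a ≠ 0 → hilbertSymbol (ratio g h) a * hilbertSymbol (ratio (g * h) k) a =
      hilbertSymbol (ratio g (h * k)) a * hilbertSymbol (ratio h k) a := by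
    intro a ha
    rw [← mul_left np nq ha, ← mul_left nr nt ha, e]
  have E1 := E _ n1
  have E2 := E _ h1
  have E3 := E _ h2
  have E4 := E _ h3
  generalize ratio g h = p at *
  generalize ratio (g * h) k = q at *
  generalize ratio g (h * k) = r at *
  generalize ratio h k = t at *
  generalize cocycleX g = x at *
  generalize cocycleX h = y at *
  generalize cocycleX k = z at *
  generalize cocycleS g = s1
  generalize cocycleS h = s2
  generalize cocycleS k = s3
  generalize cocycleS (g * h) = s4
  generalize cocycleS (h * k) = s5
  generalize cocycleS (g * (h * k)) = s6
  rw [mul_right nq np (mul_ne_zero h1 h2), mul_right nq h1 h2, mul_left np (mul_ne_zero h1 h2) h3,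
    mul_left h1 h2 h3, mul_right nr nt (mul_ne_zero h2 h3), mul_right nr h2 h3,
    mul_right h1 nt (mul_ne_zero h2 h3), mul_right h1 h2 h3, comm q p, key, comm x t]
  have S4 := self_mul s4
  have S5 := self_mul s5
  generalize hilbertSymbol p (-1) = a1 at *
  generalize hilbertSymbol q (-1) = a2 at *
  generalize hilbertSymbol r (-1) = a3 at *
  generalize hilbertSymbol t (-1) = a4 at *
  generalize hilbertSymbol p x = b1 at *
  generalize hilbertSymbol q x = b2 at *
  generalize hilbertSymbol r x = b3 at *
  generalize hilbertSymbol t x = b4 at *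
  generalize hilbertSymbol p y = c1 at *
  generalize hilbertSymbol q y = c2 at *
  generalize hilbertSymbol r y = c3 at *
  generalize hilbertSymbol t y = c4 at *
  generalize hilbertSymbol p z = d1 at *
  generalize hilbertSymbol q z = d2 at *
  generalize hilbertSymbol r z = d3 at *
  generalize hilbertSymbol t z = d4 at *
  generalize hilbertSymbol r t = f at *
  generalize hilbertSymbol x y = f1 at *
  generalize hilbertSymbol x z = f2 at *
  generalize hilbertSymbol y z = f3 at *
  calc _ = (a1 * a2) * (b1 * b2) * (c1 * c2) * (d1 * d2) * f * f1 * f2 * f3 * s1 * s2 * s3 * s6 *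
      (s4 * s4) := by ac_rfl
    _ = (a3 * a4) * (b3 * b4) * (c3 * c4) * (d3 * d4) * f * f1 * f2 * f3 * s1 * s2 * s3 * s6 *
      (s5 * s5) := by rw [E1, E2, E3, E4, S4, S5]
    _ = _ := by ac_rfl

theorem X_one : cocycleX 1 = 1 := by
  rw [X_of_eq (by simp)]; simp

theorem S_one : cocycleS 1 = 1 := by
  unfold cocycleS
  rw [if_neg (by simp)]

theorem cocycle_one_left (g : SL(2, ℚ_[2])) : cocycle 1 g = 1 := by
  unfold cocycle
  rw [one_mul, X_one, S_one, of_sq ⟨cocycleX g, by ring⟩, one_mul, one_mul, self_mul]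

end HS

/-- The double cover `G = SL₂(ℚ₂) × μ₂` with the group law twisted by the cocycle `σ`. -/
@[ext]
structure Mp where
  /-- the image in `SL₂(ℚ₂)` -/
  mat : SL(2, ℚ_[2])
  /-- the component in `μ₂` -/
  sgn : ℤˣ

namespace Mp

noncomputable instance : Mul Mp := ⟨fun a b => ⟨a.mat * b.mat, a.sgn * b.sgn * cocycle a.mat b.mat⟩⟩
noncomputable instance : One Mp := ⟨⟨1, 1⟩⟩
noncomputable instance : Inv Mp := ⟨fun a => ⟨a.mat⁻¹, a.sgn * cocycle a.mat⁻¹ a.mat⟩⟩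

theorem mul_def (a b : Mp) : a * b = ⟨a.mat * b.mat, a.sgn * b.sgn * cocycle a.mat b.mat⟩ := rfl
theorem one_def : (1 : Mp) = ⟨1, 1⟩ := rfl
theorem inv_def (a : Mp) : a⁻¹ = ⟨a.mat⁻¹, a.sgn * cocycle a.mat⁻¹ a.mat⟩ := rfl

noncomputable instance : Group Mp :=
  Group.ofLeftAxioms
    (by
      intro a b c
      simp only [mul_def]
      ext1
      · exact mul_assoc _ _ _
      · have := HS.cocycle_assoc a.mat b.mat c.mat
        simp only
        calc _ = a.sgn * b.sgn * c.sgn * (cocycle a.mat b.mat * cocycle (a.mat * b.mat) c.mat) := by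
              ac_rfl
          _ = _ := by rw [this]; ac_rfl)
    (by
      intro a
      simp only [mul_def, one_def, HS.cocycle_one_left, one_mul, mul_one])
    (by
      intro a
      simp only [mul_def, one_def, inv_def]
      ext1
      · exact inv_mul_cancel _
      · simp only
        rw [mul_right_comm, mul_assoc a.sgn, HS.self_mul, mul_one, HS.self_mul])

end Mp

/-- The inclusion `SL₂(ℤ₂) → SL₂(ℚ₂)`. -/
noncomputable def inclSL : SL(2, ℤ_[2]) →* SL(2, ℚ_[2]) :=
  Matrix.SpecialLinearGroup.map PadicInt.Coe.ringHom

/-- `{A ∈ SL₂(ℤ₂) : c ∈ 4ℤ₂}`. -/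
def Gamma0Four : Subgroup SL(2, ℤ_[2]) where
  carrier := {A | (4 : ℤ_[2]) ∣ A 1 0}
  mul_mem' {A B} hA hB := by
    simp only [Set.mem_ofPred_eq, Matrix.SpecialLinearGroup.coe_mul, Matrix.mul_apply,
      Fin.sum_univ_two] at *
    exact dvd_add (hA.mul_right _) (hB.mul_left _)
  one_mem' := by simp
  inv_mem' {A} hA := by
    change (4 : ℤ_[2]) ∣ A⁻¹ 1 0
    rw [Matrix.SpecialLinearGroup.SL2_inv_expl]
    simpa using hA

/-- `{A ∈ SL₂(ℤ₂) : a ∈ 1 + 4ℤ₂, c ∈ 4ℤ₂}`. -/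
def Gamma1Four : Subgroup SL(2, ℤ_[2]) where
  carrier := {A | (4 : ℤ_[2]) ∣ A 0 0 - 1 ∧ (4 : ℤ_[2]) ∣ A 1 0}
  mul_mem' {A B} hA hB := by
    simp only [Set.mem_ofPred_eq, Matrix.SpecialLinearGroup.coe_mul, Matrix.mul_apply,
      Fin.sum_univ_two] at *
    refine ⟨?_, dvd_add (hA.2.mul_right _) (hB.2.mul_left _)⟩
    rw [show A 0 0 * B 0 0 + A 0 1 * B 1 0 - 1 =
      (A 0 0 - 1) * B 0 0 + (B 0 0 - 1) + A 0 1 * B 1 0 by ring]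
    exact dvd_add (dvd_add (hA.1.mul_right _) hB.1) (hB.2.mul_left _)
  one_mem' := by simp
  inv_mem' {A} hA := by
    change (4 : ℤ_[2]) ∣ A⁻¹ 0 0 - 1 ∧ (4 : ℤ_[2]) ∣ A⁻¹ 1 0
    rw [Matrix.SpecialLinearGroup.SL2_inv_expl]
    have hd := A.det_coe
    rw [Matrix.det_fin_two] at hd
    refine ⟨?_, by simpa using hA.2⟩
    have : A 1 1 - 1 = A 0 1 * A 1 0 - (A 0 0 - 1) * A 1 1 := by linear_combination hd
    change (4 : ℤ_[2]) ∣ A 1 1 - 1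
    rw [this]
    exact dvd_sub (hA.2.mul_left _) (hA.1.mul_right _)

/-- The principal congruence subgroup of level `2ⁿ` in `SL₂(ℤ₂)`. -/
noncomputable def GammaTwoPow (n : ℕ) : Subgroup SL(2, ℤ_[2]) :=
  (Matrix.SpecialLinearGroup.map (PadicInt.toZModPow (p := 2) n)).ker

namespace HS

theorem parity (x : ℤ_[2]) : (2 : ℤ_[2]) ∣ x ∨ (2 : ℤ_[2]) ∣ x - 1 := by
  have dv : ∀ v : ℤ_[2], PadicInt.toZModPow (p := 2) 1 v = 0 → (2 : ℤ_[2]) ∣ v := by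
    intro v hv
    rw [← RingHom.mem_ker, PadicInt.ker_toZModPow, Ideal.mem_span_singleton] at hv
    norm_num at hv; exact hv
  have h : ∀ t : ZMod (2 ^ 1), t = 0 ∨ t - 1 = 0 := by decide
  rcases h (PadicInt.toZModPow (p := 2) 1 x) with h | h
  · exact Or.inl (dv x h)
  · exact Or.inr (dv _ (by rw [map_sub, map_one]; exact h))

theorem two_not_dvd_one : ¬ (2 : ℤ_[2]) ∣ 1 := fun h =>
  (PadicInt.prime_p (p := 2)).not_isUnit (by exact_mod_cast isUnit_of_dvd_one h)

theorem odd_of_four {u : ℤ_[2]} (hu : (4 : ℤ_[2]) ∣ u - 1) : ¬ (2 : ℤ_[2]) ∣ u := by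
  rintro ⟨k, hk⟩
  obtain ⟨l, hl⟩ := hu
  exact two_not_dvd_one ⟨k - 2 * l, by linear_combination hk - hl⟩

theorem coe_four : ((4 : ℤ_[2]) : ℚ_[2]) = 4 := map_ofNat PadicInt.Coe.ringHom 4

theorem unit_symbol {c u : ℤ_[2]} (hc : ¬ (2 : ℤ_[2]) ∣ c) (hu : (4 : ℤ_[2]) ∣ u - 1) :
    hilbertSymbol c u = 1 := by
  obtain ⟨k, hk⟩ := hu
  rcases parity k with ⟨l, hl⟩ | ⟨l, hl⟩
  · exact of_sq (isSq ⟨l, by rw [hk, hl]; ring⟩)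
  · obtain ⟨m, hm⟩ := (parity c).resolve_left hc
    obtain ⟨z, hz⟩ := isSq (u := u + 4 * c)
      ⟨1 + l + m, by linear_combination hk + 4 * hl + 4 * hm⟩
    exact eq_one_iff.2 ⟨2, 1, z, by norm_num, by rw [hz]; push_cast [coe_four]; ring⟩

theorem four_symbol {c u : ℤ_[2]} (h0 : (c : ℚ_[2]) ≠ 0) (hc : (4 : ℤ_[2]) ∣ c)
    (hu : (4 : ℤ_[2]) ∣ u - 1) (h : (8 : ℤ_[2]) ∣ c → (8 : ℤ_[2]) ∣ u - 1) :
    hilbertSymbol c u = 1 := by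
  obtain ⟨k, rfl⟩ := hc
  by_cases hk : (2 : ℤ_[2]) ∣ k
  · obtain ⟨l, rfl⟩ := hk
    exact of_sq (isSq (h ⟨l, by ring⟩))
  · rw [show ((4 * k : ℤ_[2]) : ℚ_[2]) = k * 2 ^ 2 by push_cast [coe_four]; ring, sq_mul two_ne_zero]
    exact unit_symbol hk hu

theorem incl_apply (A : SL(2, ℤ_[2])) (i j : Fin 2) : inclSL A i j = (A i j : ℚ_[2]) := rfl

theorem four_d {A : SL(2, ℤ_[2])} (hA : A ∈ Gamma1Four) : (4 : ℤ_[2]) ∣ A 1 1 - 1 := by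
  have := (Gamma1Four.inv_mem hA).1
  rw [Matrix.SpecialLinearGroup.SL2_inv_expl] at this
  exact this

theorem ne_of_odd {u : ℤ_[2]} (hu : ¬ (2 : ℤ_[2]) ∣ u) : (u : ℚ_[2]) ≠ 0 := by
  intro h
  have : u = 0 := Subtype.ext h
  exact hu (this ▸ dvd_zero _)

/-- `s(g) = (x(g), d)` on `Γ₁(4)`. -/
theorem S_Gamma1 {A : SL(2, ℤ_[2])} (hA : A ∈ Gamma1Four) :
    cocycleS (inclSL A) = hilbertSymbol (cocycleX (inclSL A)) (A 1 1) := by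
  have hd := four_d hA
  have hd' := odd_of_four hd
  unfold cocycleS
  rw [incl_apply, incl_apply]
  by_cases hc : (A 1 0 : ℚ_[2]) = 0
  · rw [if_neg (by simp [hc]), X_of_eq hc, incl_apply, unit_symbol hd' hd]
  · rw [X_of_ne hc, incl_apply]
    split_ifs with h
    · rfl
    · have he : Even (A 1 0 : ℚ_[2]).valuation := by
        rw [← Int.not_odd_iff_even]
        exact fun ho => h ⟨mul_ne_zero hc (ne_of_odd hd'), ho⟩
      obtain ⟨u, hu, e⟩ := exists_unit_mul _ hc
      obtain ⟨k, hk⟩ := he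
      rw [e, hk, zpow_add₀ two_ne_zero, ← sq, sq_mul (zpow_ne_zero _ two_ne_zero),
        unit_symbol hu hd]

theorem cocycle_Gamma1 {A B : SL(2, ℤ_[2])} (hA : A ∈ Gamma1Four) (hB : B ∈ Gamma1Four) :
    cocycle (inclSL A) (inclSL B) = 1 := by
  classical
  have hAB := Gamma1Four.mul_mem hA hB
  unfold cocycle
  rw [← map_mul, S_Gamma1 hA, S_Gamma1 hB, S_Gamma1 hAB]
  have o1 := four_d hA
  have o2 := four_d hB
  have o12 := four_d hAB
  have oa := hB.1
  have f1 := hA.2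
  have f2 := hB.2
  have f12 := hAB.2
  have det1 := A.det_coe
  have det2 := B.det_coe
  rw [Matrix.det_fin_two] at det1 det2
  have e10 : (A * B) 1 0 = A 1 0 * B 0 0 + A 1 1 * B 1 0 := by simp [Matrix.mul_apply]
  have e11 : (A * B) 1 1 = A 1 0 * B 0 1 + A 1 1 * B 1 1 := by simp [Matrix.mul_apply]
  have x1 : cocycleX (inclSL A) = if (A 1 0 : ℚ_[2]) ≠ 0 then (A 1 0 : ℚ_[2]) else A 1 1 := by
    split_ifs with h
    exacts [X_of_ne h, X_of_eq (not_not.1 h)]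
  have x2 : cocycleX (inclSL B) = if (B 1 0 : ℚ_[2]) ≠ 0 then (B 1 0 : ℚ_[2]) else B 1 1 := by
    split_ifs with h
    exacts [X_of_ne h, X_of_eq (not_not.1 h)]
  have x12 : cocycleX (inclSL (A * B)) =
      if ((A * B) 1 0 : ℚ_[2]) ≠ 0 then ((A * B) 1 0 : ℚ_[2]) else (A * B) 1 1 := by
    split_ifs with h
    exacts [X_of_ne h, X_of_eq (not_not.1 h)]
  rw [x1, x2, x12]
  clear x1 x2 x12
  generalize (A * B) 1 0 = c3 at *
  generalize (A * B) 1 1 = d3 at *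
  generalize A 1 0 = c1 at *
  generalize A 1 1 = d1 at *
  generalize A 0 0 = a1 at *
  generalize A 0 1 = b1 at *
  generalize B 1 0 = c2 at *
  generalize B 1 1 = d2 at *
  generalize B 0 0 = a2 at *
  generalize B 0 1 = b2 at *
  have n1 := ne_of_odd (odd_of_four o1)
  have n2 := ne_of_odd (odd_of_four o2)
  have n3 := ne_of_odd (odd_of_four o12)
  have na := ne_of_odd (odd_of_four oa)
  have u11 := unit_symbol (odd_of_four o1) o1
  have u12 := unit_symbol (odd_of_four o1) o2
  have u13 := unit_symbol (odd_of_four o1) o12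
  have u22 := unit_symbol (odd_of_four o2) o2
  have u33 := unit_symbol (odd_of_four o12) o12
  have ua1 := unit_symbol (odd_of_four oa) o1
  have ua3 := unit_symbol (odd_of_four oa) o12
  have u31 := unit_symbol (odd_of_four o12) o1
  have eight : (8 : ℤ_[2]) ∣ d1 ^ 2 - 1 := by
    obtain ⟨k, hk⟩ := o1
    exact ⟨k * (1 + 2 * k), by linear_combination (d1 + 1 + 4 * k) * hk⟩
  have four_mul : ∀ {x y : ℤ_[2]}, (4 : ℤ_[2]) ∣ x - 1 → (4 : ℤ_[2]) ∣ y - 1 →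
      (4 : ℤ_[2]) ∣ x * y - 1 := by
    rintro x y ⟨k, hk⟩ ⟨l, hl⟩
    exact ⟨k * y + l, by linear_combination y * hk + hl⟩
  have E10 : (c3 : ℚ_[2]) = c1 * a2 + d1 * c2 := by rw [e10]; push_cast; ring
  have E11 : (d3 : ℚ_[2]) = c1 * b2 + d1 * d2 := by rw [e11]; push_cast; ring
  have D2 : (a2 : ℚ_[2]) * d2 - b2 * c2 = 1 := by exact_mod_cast congrArg (Subtype.val) det2
  by_cases hc1 : (c1 : ℚ_[2]) = 0
  · have E11' : (d3 : ℚ_[2]) = d1 * d2 := by rw [E11, hc1]; ring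
    rw [if_neg (c := (c1 : ℚ_[2]) ≠ 0) (not_not.2 hc1)]
    obtain ⟨x, hx, hx0⟩ : ∃ x, x = (if (c2 : ℚ_[2]) ≠ 0 then (c2 : ℚ_[2]) else d2) ∧ x ≠ 0 := by
      refine ⟨_, rfl, ?_⟩
      split_ifs with h
      exacts [h, n2]
    have hx3 : (if (c3 : ℚ_[2]) ≠ 0 then (c3 : ℚ_[2]) else d3) = d1 * x := by
      rw [hx, E10, hc1, E11']
      by_cases h : (c2 : ℚ_[2]) = 0
      · simp [h]
      · rw [if_pos (by simp [h, n1]), if_pos h]; ring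
    rw [hx3, ← hx, E11', show (d1 : ℚ_[2]) * x * d1 = x * d1 ^ 2 by ring,
      show (d1 : ℚ_[2]) * x * x = d1 * x ^ 2 by ring, sq_mul n1, mul_sq hx0,
      mul_left n1 hx0 (mul_ne_zero n1 n2), mul_right n1 n1 n2, mul_right hx0 n1 n2, u11, u12]
    generalize hilbertSymbol x d1 = s
    generalize hilbertSymbol x d2 = t
    revert s t; decide
  rw [if_pos (c := (c1 : ℚ_[2]) ≠ 0) hc1]
  have hdiff : (4 : ℤ_[2]) ∣ a2 * d1 * d3 - 1 := four_mul (four_mul oa o1) o12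
  by_cases hc2 : (c2 : ℚ_[2]) = 0
  · have hc3 : (c3 : ℚ_[2]) ≠ 0 := by
      rw [E10, hc2]; simp [hc1, na]
    rw [if_neg (c := (c2 : ℚ_[2]) ≠ 0) (not_not.2 hc2), if_pos (c := (c3 : ℚ_[2]) ≠ 0) hc3]
    have hc2' : c2 = 0 := Subtype.ext hc2
    rw [hc2, mul_zero, sub_zero] at D2
    rw [E10, hc2, mul_zero, add_zero, show (c1 : ℚ_[2]) * a2 * c1 = a2 * c1 ^ 2 by ring,
      show (c1 : ℚ_[2]) * a2 * d2 = c1 by linear_combination (c1 : ℚ_[2]) * D2, sq_mul hc1,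
      mul_left hc1 na n3, u22, ua3]
    have L := four_symbol (c := c1) (u := a2 * d1 * d3) hc1 f1 hdiff (by
      intro h
      have : a2 * d1 * d3 - 1 = c1 * (a2 * d1 * b2) + (d1 ^ 2 - 1) := by
        rw [e11]; rw [hc2'] at det2; linear_combination d1 ^ 2 * det2
      rw [this]
      exact dvd_add (h.mul_right _) eight)
    push_cast at L
    rw [mul_right hc1 (mul_ne_zero na n1) n3, mul_right hc1 na n1] at L
    rw [comm (a2 : ℚ_[2])]
    simpa using L
  rw [if_pos (c := (c2 : ℚ_[2]) ≠ 0) hc2]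
  by_cases hc3 : (c3 : ℚ_[2]) = 0
  · rw [if_neg (c := (c3 : ℚ_[2]) ≠ 0) (not_not.2 hc3), u33]
    have hc3' : c3 = 0 := Subtype.ext hc3
    rw [hc3'] at e10
    have hc : c1 = -c2 * d3 := by
      linear_combination (-c1) * det2 - d2 * e10 + c2 * e11
    have hcQ : (c1 : ℚ_[2]) = -c2 * d3 := by rw [hc]; push_cast; ring
    have nc2 : -(c2 : ℚ_[2]) ≠ 0 := neg_ne_zero.2 hc2
    rw [hcQ, show (d3 : ℚ_[2]) * (-c2 * d3) = -c2 * d3 ^ 2 by ring, sq_mul n3,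
      mul_right nc2 n3 hc2, mul_left nc2 n3 n1, u31]
    have h1 : hilbertSymbol (-(c2 : ℚ_[2])) c2 = 1 := by rw [comm]; exact neg_self _
    have h2 : hilbertSymbol (-(c2 : ℚ_[2])) d2 = hilbertSymbol c2 d2 := by
      have hm : hilbertSymbol (-1 : ℚ_[2]) d2 = 1 := by
        have := unit_symbol (c := -1) (u := d2) (by simpa using two_not_dvd_one) o2
        simpa using this
      rw [show -(c2 : ℚ_[2]) = -1 * c2 by ring, mul_left (by norm_num) hc2 n2, hm, one_mul]
    have L := four_symbol (c := -c2) (u := d3 * d1 * d2) (by simpa using hc2)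
      ((dvd_neg).2 f2) (four_mul (four_mul o12 o1) o2) (by
        intro h
        have h8 : (8 : ℤ_[2]) ∣ c1 := hc ▸ h.mul_right _
        obtain ⟨k, hk⟩ := o2
        have : d3 * d1 * d2 - 1 = c1 * (b2 * d1 * d2) + (d1 ^ 2 - 1) * d2 ^ 2 + (d2 ^ 2 - 1) := by
          rw [e11]; ring
        rw [this]
        exact dvd_add (dvd_add (h8.mul_right _) (eight.mul_right _))
          ⟨k * (1 + 2 * k), by linear_combination (d2 + 1 + 4 * k) * hk⟩)
    push_cast at L
    rw [mul_right nc2 (mul_ne_zero n3 n1) n2, mul_right nc2 n3 n1, h2] at L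
    rw [h1]
    simpa using L
  · rw [if_pos (c := (c3 : ℚ_[2]) ≠ 0) hc3]
    have key : hilbertSymbol ((c1 : ℚ_[2]) * a2 * c3) (d1 * c2 * c3) = 1 :=
      of_add ⟨c3, by rw [E10]; ring⟩
    have L1 := four_symbol (c := c2) (u := a2 * d2) hc2 f2 (four_mul oa o2) (by
      intro h
      rw [show a2 * d2 - 1 = c2 * b2 by linear_combination det2]
      exact h.mul_right _)
    have L2 := four_symbol (c := c3) (u := a2 * d1 * d3) hc3 f12 hdiff (by
      intro h
      rw [show a2 * d1 * d3 - 1 = c3 * (b2 * d1) + (d1 ^ 2 - 1) by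
        rw [e11, e10]; linear_combination d1 ^ 2 * det2]
      exact dvd_add (h.mul_right _) eight)
    push_cast at L1 L2
    rw [mul_right hc2 na n2] at L1
    rw [mul_right hc3 (mul_ne_zero na n1) n3, mul_right hc3 na n1] at L2
    rw [show (c1 : ℚ_[2]) * a2 * c3 = a2 * (c3 * c1) by ring,
      show (d1 : ℚ_[2]) * c2 * c3 = d1 * (c3 * c2) by ring,
      mul_left na (mul_ne_zero hc3 hc1) (mul_ne_zero n1 (mul_ne_zero hc3 hc2)),
      mul_right na n1 (mul_ne_zero hc3 hc2), mul_right na hc3 hc2,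
      mul_right (mul_ne_zero hc3 hc1) n1 (mul_ne_zero hc3 hc2), mul_left hc3 hc1 n1, ua1,
      comm (a2 : ℚ_[2]) c3, comm (a2 : ℚ_[2]) c2] at key
    generalize hilbertSymbol ((c3 : ℚ_[2]) * c1) (c3 * c2) = s0 at *
    generalize hilbertSymbol (c3 : ℚ_[2]) d1 = s1 at *
    generalize hilbertSymbol (c3 : ℚ_[2]) a2 = s2 at *
    generalize hilbertSymbol (c3 : ℚ_[2]) d3 = s3 at *
    generalize hilbertSymbol (c2 : ℚ_[2]) a2 = s4 at *
    generalize hilbertSymbol (c2 : ℚ_[2]) d2 = s5 at *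
    generalize hilbertSymbol (c1 : ℚ_[2]) d1 = s6 at *
    clear * - key L1 L2
    revert s0 s1 s2 s3 s4 s5 s6
    decide

theorem mem_GammaTwoPow {n : ℕ} {A : SL(2, ℤ_[2])} :
    A ∈ GammaTwoPow n ↔ ∀ i j, (2 : ℤ_[2]) ^ n ∣ A i j - (1 : Matrix (Fin 2) (Fin 2) ℤ_[2]) i j := by
  unfold GammaTwoPow
  rw [MonoidHom.mem_ker, Matrix.SpecialLinearGroup.ext_iff]
  refine forall_congr' fun i => forall_congr' fun j => ?_
  have h2 : ((2 : ℕ) : ℤ_[2]) = 2 := by norm_num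
  rw [← Ideal.mem_span_singleton, ← h2, ← PadicInt.ker_toZModPow, RingHom.mem_ker, map_sub,
    sub_eq_zero]
  have h3 : PadicInt.toZModPow (p := 2) n ((1 : Matrix (Fin 2) (Fin 2) ℤ_[2]) i j) =
      (1 : Matrix (Fin 2) (Fin 2) (ZMod (2 ^ n))) i j := by
    by_cases h : i = j <;> simp [Matrix.one_apply, h]
  rw [h3]
  rfl

theorem GammaTwoPow_anti {m n : ℕ} (h : m ≤ n) : GammaTwoPow n ≤ GammaTwoPow m := by
  intro A hA
  rw [mem_GammaTwoPow] at *
  exact fun i j => (pow_dvd_pow _ h).trans (hA i j)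

theorem GammaTwoPow_two_le : GammaTwoPow 2 ≤ Gamma1Four := by
  intro A hA
  rw [mem_GammaTwoPow] at hA
  have h1 := hA 0 0
  have h2 := hA 1 0
  norm_num at h1 h2
  exact ⟨h1, h2⟩

end HS

namespace Mp

/-- The topology of `G`: the sets `g · {(k, 1) : k ∈ Γ(2ⁿ)}`, for `n ≥ 2`, form a basis of open
neighbourhoods of `g`. (For `n ≥ 2` the set `{(k, 1) : k ∈ Γ(2ⁿ)}` is a subgroup of `K₁(4)`.) -/
instance : TopologicalSpace Mp where
  IsOpen U := ∀ g ∈ U, ∃ n : ℕ, ∀ k ∈ GammaTwoPow n, g * ⟨inclSL k, 1⟩ ∈ U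
  isOpen_univ _ _ := ⟨0, fun _ _ => trivial⟩
  isOpen_inter U V hU hV g hg := by
    obtain ⟨n, hn⟩ := hU g hg.1
    obtain ⟨m, hm⟩ := hV g hg.2
    exact ⟨max n m, fun k hk => ⟨hn k (HS.GammaTwoPow_anti (le_max_left _ _) hk),
      hm k (HS.GammaTwoPow_anti (le_max_right _ _) hk)⟩⟩
  isOpen_sUnion S hS g hg := by
    obtain ⟨U, hU, hg⟩ := hg
    obtain ⟨n, hn⟩ := hS U hU g hg
    exact ⟨n, fun k hk => ⟨U, hU, hn k hk⟩⟩

/-- The projection `G → SL₂(ℚ₂)`. -/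
noncomputable def proj : Mp →* SL(2, ℚ_[2]) where
  toFun := mat
  map_one' := rfl
  map_mul' _ _ := rfl

/-- `K₀`, the full inverse image of `{A ∈ SL₂(ℤ₂) : c ∈ 4ℤ₂}`. -/
noncomputable def K0 : Subgroup Mp := (Gamma0Four.map inclSL).comap proj

/-- `K₁ = K₁(4) = {(A, 1) : A ∈ SL₂(ℤ₂), a ∈ 1 + 4ℤ₂, c ∈ 4ℤ₂}`. -/
noncomputable def K1 : Subgroup Mp where
  carrier := {g | g.mat ∈ Gamma1Four.map inclSL ∧ g.sgn = 1}
  mul_mem' := by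
    rintro ⟨_, _⟩ ⟨_, _⟩ ⟨⟨A, hA, rfl⟩, rfl⟩ ⟨⟨B, hB, rfl⟩, rfl⟩
    refine ⟨⟨A * B, mul_mem hA hB, map_mul _ _ _⟩, ?_⟩
    simp [mul_def, HS.cocycle_Gamma1 hA hB]
  one_mem' := ⟨one_mem _, rfl⟩
  inv_mem' := by
    rintro ⟨_, _⟩ ⟨⟨A, hA, rfl⟩, rfl⟩
    refine ⟨⟨A⁻¹, inv_mem hA, map_inv _ _⟩, ?_⟩
    simp only [inv_def]
    rw [← map_inv, HS.cocycle_Gamma1 (inv_mem hA) hA, one_mul]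

/-- The generator `-1` of `μ₂ ⊆ G`. -/
noncomputable def negOne : Mp := ⟨1, -1⟩

/-- `h(t)`, the lift of `diag(t, t⁻¹)`. -/
noncomputable def h (t : ℚ_[2]ˣ) : Mp :=
  ⟨⟨!![(t : ℚ_[2]), 0; 0, (↑t⁻¹ : ℚ_[2])], by simp [Matrix.det_fin_two]⟩, 1⟩

/-- `w(t)`, the lift of the matrix with rows `(0, t)` and `(-t⁻¹, 0)`. -/
noncomputable def w (t : ℚ_[2]ˣ) : Mp :=
  ⟨⟨!![0, (t : ℚ_[2]); -(↑t⁻¹ : ℚ_[2]), 0], by simp [Matrix.det_fin_two]⟩, 1⟩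

theorem cocycle_comm_of {a b : SL(2, ℚ_[2])} (h : a * b = b * a) : cocycle a b = cocycle b a := by
  unfold cocycle
  rw [h, HS.comm]
  ac_rfl

theorem mem_center_of {a : SL(2, ℚ_[2])} (ha : ∀ b, b * a = a * b) (e : ℤˣ) :
    (⟨a, e⟩ : Mp) ∈ Subgroup.center Mp := by
  rw [Subgroup.mem_center_iff]
  intro g
  simp only [mul_def]
  rw [cocycle_comm_of (ha _), ha, mul_comm g.sgn]

theorem negOne_mem_center : negOne ∈ Subgroup.center Mp := mem_center_of (by simp) _

theorem neg_one_mem_center (e : ℤˣ) : (⟨-1, e⟩ : Mp) ∈ Subgroup.center Mp :=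
  mem_center_of (by simp) e

theorem h_neg_one_mem_center : h (-1) ∈ Subgroup.center Mp := by
  have e : h (-1) = ⟨-1, 1⟩ := by
    unfold h
    congr 1
    ext i j
    fin_cases i <;> fin_cases j <;> simp
  rw [e]
  exact neg_one_mem_center 1

/-- `K₀ = M K₁` with `M` the centre of `G`. -/
theorem K0_decomp (k : K0) : ∃ m : Subgroup.center Mp, ∃ k₁ : K1, (k : Mp) = m * k₁ := by
  obtain ⟨⟨g, e⟩, A, hA, hg⟩ := k
  change inclSL A = g at hg
  subst hg
  have key : ∀ (z : SL(2, ℚ_[2])) (B : SL(2, ℤ_[2])), (∀ b, b * z = z * b) → B ∈ Gamma1Four →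
      inclSL A = z * inclSL B →
      ∃ m : Subgroup.center Mp, ∃ k₁ : K1, (⟨inclSL A, e⟩ : Mp) = m * k₁ := by
    intro z B hz hB h
    refine ⟨⟨⟨z, e * cocycle z (inclSL B)⟩, mem_center_of hz _⟩,
      ⟨⟨inclSL B, 1⟩, ⟨⟨B, hB, rfl⟩, rfl⟩⟩, ?_⟩
    simp only [mul_def]
    rw [mul_one, mul_assoc, HS.self_mul, mul_one, h]
  have hA' : (4 : ℤ_[2]) ∣ A 1 0 := hA
  have hodd : (4 : ℤ_[2]) ∣ A 0 0 - 1 ∨ (4 : ℤ_[2]) ∣ -A 0 0 - 1 := by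
    have hd := A.det_coe
    rw [Matrix.det_fin_two] at hd
    obtain ⟨c, hc⟩ := hA'
    have h1 : ¬ (2 : ℤ_[2]) ∣ A 0 0 := by
      rintro ⟨k, hk⟩
      exact HS.two_not_dvd_one ⟨k * A 1 1 - A 0 1 * (2 * c), by
        linear_combination -hd + A 1 1 * hk - A 0 1 * hc⟩
    obtain ⟨k, hk⟩ := (HS.parity _).resolve_left h1
    rcases HS.parity k with ⟨l, hl⟩ | ⟨l, hl⟩
    · exact Or.inl ⟨l, by rw [hk, hl]; ring⟩
    · exact Or.inr ⟨-l - 1, by linear_combination -hk - 2 * hl⟩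
  rcases hodd with h | h
  · exact key 1 A (by simp) ⟨h, hA'⟩ (one_mul _).symm
  · refine key (-1) (-A) (by simp) ⟨by simpa using h, by simpa using hA'⟩ ?_
    ext i j
    simp [HS.incl_apply]

theorem center_inf_K1 {m : Mp} (hm : m ∈ Subgroup.center Mp) (hk : m ∈ K1) : m = 1 := by
  obtain ⟨g, e⟩ := m
  obtain ⟨⟨A, hA, hg⟩, he⟩ := hk
  simp only at hg he
  subst hg he
  rw [Subgroup.mem_center_iff] at hm
  have hm' : inclSL A ∈ Subgroup.center SL(2, ℚ_[2]) := by
    rw [Subgroup.mem_center_iff]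
    exact fun b => congrArg mat (hm ⟨b, 1⟩)
  rw [Matrix.SpecialLinearGroup.mem_center_iff] at hm'
  obtain ⟨r, hr, hA'⟩ := hm'
  have e00 : (A 0 0 : ℚ_[2]) = r := by
    have := congrFun (congrFun hA' 0) 0
    simpa [HS.incl_apply] using this.symm
  have hr1 : r = 1 := by
    have h2 : r ^ 2 = 1 := by simpa using hr
    rcases sq_eq_one_iff.1 h2 with h | h
    · exact h
    · obtain ⟨k, hk⟩ := hA.1
      have h3 : A 0 0 = -1 := Subtype.ext (by rw [e00, h]; simp)
      refine absurd ⟨-k, mul_left_cancel₀ (a := (2 : ℤ_[2])) two_ne_zero ?_⟩ HS.two_not_dvd_one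
      linear_combination h3 - hk
  have : inclSL A = 1 := by
    apply Subtype.ext
    rw [← hA', hr1]; simp
  rw [this]; rfl

theorem central_unique {m m' : Subgroup.center Mp} {k k' : K1} (hh : (m : Mp) * k = m' * k') :
    m = m' := by
  have h1 : ((m'⁻¹ * m : Subgroup.center Mp) : Mp) = ((k' * k⁻¹ : K1) : Mp) := by
    push_cast
    rw [eq_mul_inv_iff_mul_eq, mul_assoc, hh, inv_mul_cancel_left]
  have h2 := center_inf_K1 (m'⁻¹ * m).2 (h1 ▸ (k' * k⁻¹).2)
  exact (inv_mul_eq_one.1 (Subtype.ext h2 : m'⁻¹ * m = 1)).symm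

theorem exists_centralPart : ∃ f : K0 → Subgroup.center Mp, ∀ k : K0, ∃ k₁ : K1, (k : Mp) = f k * k₁ :=
  Classical.skolem.1 K0_decomp

theorem central_mul {f : K0 → Subgroup.center Mp} (hf : ∀ k : K0, ∃ k₁ : K1, (k : Mp) = f k * k₁)
    (a b : K0) : f (a * b) = f a * f b := by
  obtain ⟨x, hx⟩ := hf a
  obtain ⟨y, hy⟩ := hf b
  obtain ⟨z, hz⟩ := hf (a * b)
  refine central_unique (k := z) (k' := x * y) ?_
  rw [← hz, Subgroup.coe_mul, hx, hy]
  push_cast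
  have := Subgroup.mem_center_iff.1 (f b).2 x
  simp only [mul_assoc]
  rw [← mul_assoc (x : Mp), this, mul_assoc]

/-- The projection of `K₀ = M × K₁` onto the centre `M`. -/
noncomputable def centralPart : K0 →* Subgroup.center Mp :=
  MonoidHom.mk' exists_centralPart.choose (central_mul exists_centralPart.choose_spec)

theorem centralPart_spec (k : K0) : ∃ k₁ : K1, (k : Mp) = centralPart k * k₁ :=
  exists_centralPart.choose_spec k

/-- The extension to `K₀ = M × K₁` of a character `γ` of the centre `M`, trivial on `K₁`. -/
noncomputable def extend (γ : Subgroup.center Mp →* ℂˣ) : K0 →* ℂˣ := γ.comp centralPart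

/-- `ζ = (1 + γ(h(-1))) / √2`. -/
noncomputable def zeta (γ : Subgroup.center Mp →* ℂˣ) : ℂ :=
  (1 + (γ ⟨h (-1), h_neg_one_mem_center⟩ : ℂ)) / (√2 : ℝ)

end Mp

/-! ### Hecke algebras and their modules -/

section Hecke

variable {G : Type} [Group G] (K : Subgroup G) (χ : K →* ℂˣ)

/-- The functions `f : G → ℂ` with `f(k g k') = χ(k)⁻¹ f(g) χ(k')⁻¹` for `k, k' ∈ K` that are
supported on finitely many cosets `gK`. If `K` is compact open and `χ` is smooth and unitary, these
are the locally constant compactly supported `f` with `f(k g k') = χ̄(k) f(g) χ̄(k')`. -/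
def heckeSubmodule : Submodule ℂ (G → ℂ) where
  carrier := {f | (∀ (k k' : K) (g : G),
      f (k * g * k') = ((χ k)⁻¹ : ℂˣ) * f g * ((χ k')⁻¹ : ℂˣ)) ∧
    ((fun g : G => (g : G ⧸ K)) '' Function.support f).Finite}
  add_mem' {f f'} hf hf' := by
    refine ⟨fun k k' g => ?_, (hf.2.union hf'.2).subset ?_⟩
    · simp only [Pi.add_apply, hf.1, hf'.1]; ring
    · rw [← Set.image_union]
      exact Set.image_mono (Function.support_add f f')
  zero_mem' := ⟨fun _ _ _ => by simp, by simp⟩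
  smul_mem' c f hf := by
    refine ⟨fun k k' g => ?_, hf.2.subset (Set.image_mono (Function.support_const_smul_subset c f))⟩
    simp only [Pi.smul_apply, smul_eq_mul, hf.1]; ring

/-- The Hecke algebra `H(G, K, χ)`. -/
abbrev HeckeAlgebra : Type := heckeSubmodule K χ

/-- The vectors on which `K` acts by `χ`. -/
def isotypic {V : Type*} [AddCommGroup V] [Module ℂ V] (ρ : Representation ℂ G V) :
    Submodule ℂ V where
  carrier := {v | ∀ k : K, ρ k v = (χ k : ℂ) • v}
  add_mem' {v w} hv hw k := by rw [map_add, hv k, hw k, smul_add]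
  zero_mem' k := by simp
  smul_mem' c v hv k := by rw [map_smul, hv k, smul_comm]

/-- The operator `π(f) v = ∫_G f(g) π(g) v dg` for the Haar measure with `vol(K) = 1`, on vectors
`v` on which `K` acts by `χ`: the integrand is right `K`-invariant, and the integral is the sum over
`G / K`. -/
noncomputable def heckeAct {V : Type*} [AddCommGroup V] [Module ℂ V] (ρ : Representation ℂ G V)
    (f : G → ℂ) (v : V) : V :=
  ∑ᶠ x : G ⧸ K, f x.out • ρ x.out v

/-- The convolution `(f₁ · f₂)(g₀) = ∫_G f₁(g) f₂(g⁻¹ g₀) dg` for the Haar measure with `vol(K) = 1`;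
the integrand is right `K`-invariant, and the integral is the sum over `G / K`. -/
noncomputable def heckeConv (f₁ f₂ : G → ℂ) (g₀ : G) : ℂ :=
  ∑ᶠ x : G ⧸ K, f₁ x.out * f₂ (x.out⁻¹ * g₀)

namespace HeckeAlgebra

variable {K χ}

instance : CoeFun (HeckeAlgebra K χ) fun _ => G → ℂ := ⟨Subtype.val⟩

@[ext] theorem ext {f f' : HeckeAlgebra K χ} (h : ∀ g, f g = f' g) : f = f' :=
  Subtype.ext (funext h)

theorem left (f : HeckeAlgebra K χ) (k : K) (g : G) : f (k * g) = ((χ k)⁻¹ : ℂˣ) * f g := by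
  simpa using f.2.1 k 1 g

theorem right (f : HeckeAlgebra K χ) (g : G) (k : K) : f (g * k) = f g * ((χ k)⁻¹ : ℂˣ) := by
  simpa using f.2.1 1 k g

theorem fin (f : HeckeAlgebra K χ) : {x : G ⧸ K | f x.out ≠ 0}.Finite :=
  f.2.2.subset fun x hx => ⟨x.out, hx, Quotient.out_eq' x⟩

theorem out_eq {M : Type*} {F : G → M} (hF : ∀ g (k : K), F (g * k) = F g) (g : G) :
    F (g : G ⧸ K).out = F g := by
  obtain ⟨k, hk⟩ := QuotientGroup.mk_out_eq_mul K g
  rw [hk, hF]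

theorem finsum_left {M : Type*} [AddCommMonoid M] {F : G → M}
    (hF : ∀ g (k : K), F (g * k) = F g) (a : G) :
    ∑ᶠ x : G ⧸ K, F (a * x.out) = ∑ᶠ x : G ⧸ K, F x.out := by
  rw [← finsum_comp_equiv (MulAction.toPerm a) (f := fun x : G ⧸ K => F x.out)]
  refine finsum_congr fun x => ?_
  have : (MulAction.toPerm a x : G ⧸ K) = ((a * x.out : G) : G ⧸ K) := by
    conv_lhs => rw [← QuotientGroup.out_eq' x]
    rfl
  simp only [this]
  rw [out_eq hF]

theorem conv_mem (f₁ f₂ : HeckeAlgebra K χ) : heckeConv K f₁ f₂ ∈ heckeSubmodule K χ := by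
  have hr : ∀ (g : G) (k : K), heckeConv K f₁ f₂ (g * k) =
      heckeConv K f₁ f₂ g * ((χ k)⁻¹ : ℂˣ) := by
    intro g k
    unfold heckeConv
    rw [mul_comm, ← smul_eq_mul (((χ k)⁻¹ : ℂˣ) : ℂ), smul_finsum]
    refine finsum_congr fun x => ?_
    rw [← mul_assoc _ g, right, smul_eq_mul]; ring
  have hl : ∀ (g : G) (k : K), heckeConv K f₁ f₂ (k * g) =
      ((χ k)⁻¹ : ℂˣ) * heckeConv K f₁ f₂ g := by
    intro g k
    unfold heckeConv
    rw [← finsum_left (F := fun x => f₁ x * f₂ (x⁻¹ * (k * g))) ?_ (k : G),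
      ← smul_eq_mul (((χ k)⁻¹ : ℂˣ) : ℂ), smul_finsum]
    · refine finsum_congr fun x => ?_
      rw [left, smul_eq_mul, mul_inv_rev]
      simp [mul_assoc]
    · intro x l
      rw [right, mul_inv_rev, ← Subgroup.coe_inv, mul_assoc (f₁ x), mul_assoc ((l⁻¹ : K) : G), left]
      simp
  refine ⟨fun k k' g => by rw [hr, hl], ?_⟩
  refine (f₁.fin.biUnion fun x _ => (f₂.2.2.image fun y => x.out • y)).subset ?_
  rintro _ ⟨g, hg, rfl⟩
  have : ∃ x : G ⧸ K, f₁ x.out * f₂ (x.out⁻¹ * g) ≠ 0 := by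
    by_contra h
    push Not at h
    exact hg (by simp only [heckeConv, h, finsum_zero])
  obtain ⟨x, hx⟩ := this
  refine Set.mem_biUnion (left_ne_zero_of_mul hx) ⟨_, ⟨_, right_ne_zero_of_mul hx, rfl⟩, ?_⟩
  simp only
  rw [MulAction.Quotient.smul_mk, smul_eq_mul, mul_inv_cancel_left]

noncomputable instance : Mul (HeckeAlgebra K χ) := ⟨fun f₁ f₂ => ⟨heckeConv K f₁ f₂, conv_mem f₁ f₂⟩⟩

theorem mul_apply (f₁ f₂ : HeckeAlgebra K χ) (g : G) :
    (f₁ * f₂) g = ∑ᶠ x : G ⧸ K, f₁ x.out * f₂ (x.out⁻¹ * g) := rfl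

open scoped Classical in
theorem one_mem : (fun g => if h : g ∈ K then (((χ ⟨g, h⟩)⁻¹ : ℂˣ) : ℂ) else 0) ∈
    heckeSubmodule K χ := by
  refine ⟨fun k k' g => ?_, (Set.finite_singleton ((1 : G) : G ⧸ K)).subset ?_⟩
  · simp only
    by_cases h : g ∈ K
    · rw [dif_pos h, dif_pos (mul_mem (mul_mem k.2 h) k'.2)]
      have : (⟨k * g * k', mul_mem (mul_mem k.2 h) k'.2⟩ : K) = k * ⟨g, h⟩ * k' := rfl
      rw [this]
      simp only [map_mul, mul_inv, Units.val_mul]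
    · rw [dif_neg h, dif_neg, mul_zero, zero_mul]
      rwa [K.mul_mem_cancel_right k'.2, K.mul_mem_cancel_left k.2]
  · rintro _ ⟨g, hg, rfl⟩
    have h : g ∈ K := by
      by_contra h
      exact hg (dif_neg h)
    exact (QuotientGroup.eq.2 (by simpa using h)).symm

open scoped Classical in
/-- The unit: the function `χ⁻¹` on `K`, extended by zero. -/
noncomputable instance : One (HeckeAlgebra K χ) := ⟨⟨_, one_mem⟩⟩

theorem one_apply_mem (k : K) : (1 : HeckeAlgebra K χ) (k : G) = ((χ k)⁻¹ : ℂˣ) := dif_pos k.2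

theorem one_apply_notMem {g : G} (h : g ∉ K) : (1 : HeckeAlgebra K χ) g = 0 := dif_neg h

section Act

variable {V : Type*} [AddCommGroup V] [Module ℂ V] {ρ : Representation ℂ G V}

theorem act_inv (f : HeckeAlgebra K χ) {v : V} (hv : v ∈ isotypic K χ ρ) (g : G) (k : K) :
    f (g * k) • ρ (g * k) v = f g • ρ g v := by
  rw [right, map_mul, Module.End.mul_apply, hv k, map_smul, smul_smul, mul_assoc]
  simp

theorem act_fin (f : HeckeAlgebra K χ) (v : V) :
    (Function.support fun x : G ⧸ K => f x.out • ρ x.out v).Finite :=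
  f.fin.subset fun x hx h => hx (by simp [h])

theorem rho_act (f : HeckeAlgebra K χ) {v : V} (hv : v ∈ isotypic K χ ρ) (x : G) :
    ρ x (heckeAct K ρ f v) = ∑ᶠ y : G ⧸ K, f (x⁻¹ * y.out) • ρ y.out v := by
  unfold heckeAct
  rw [map_finsum (ρ x) (act_fin f v), ← finsum_left (F := fun y => f (x⁻¹ * y) • ρ y v) ?_ x]
  · refine finsum_congr fun y => ?_
    rw [map_smul, inv_mul_cancel_left, map_mul, Module.End.mul_apply]
  · intro g k
    rw [← mul_assoc, right, map_mul, Module.End.mul_apply, hv k, map_smul, smul_smul, mul_assoc]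
    simp

theorem act_mem (f : HeckeAlgebra K χ) {v : V} (hv : v ∈ isotypic K χ ρ) :
    heckeAct K ρ f v ∈ isotypic K χ ρ := by
  intro k
  rw [rho_act f hv]
  unfold heckeAct
  rw [smul_finsum]
  refine finsum_congr fun y => ?_
  rw [← Subgroup.coe_inv, left, smul_smul, map_inv, inv_inv]

theorem act_mul (f₁ f₂ : HeckeAlgebra K χ) {v : V} (hv : v ∈ isotypic K χ ρ) :
    heckeAct K ρ (f₁ * f₂ : HeckeAlgebra K χ) v = heckeAct K ρ f₁ (heckeAct K ρ f₂ v) := by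
  classical
  let S := f₁.fin.toFinset
  have hS : ∀ x : G ⧸ K, f₁ x.out ≠ 0 → x ∈ S := fun x hx => by simpa [S] using hx
  let T := S.biUnion fun x => (f₂.2.2.image fun y => x.out • y).toFinset
  have hT : ∀ x ∈ S, ∀ y : G ⧸ K, f₂ (x.out⁻¹ * y.out) ≠ 0 → y ∈ T := by
    intro x hx y hy
    simp only [T, Finset.mem_biUnion, Set.Finite.mem_toFinset]
    refine ⟨x, hx, _, ⟨_, hy, rfl⟩, ?_⟩
    simp only
    rw [MulAction.Quotient.smul_mk, smul_eq_mul, mul_inv_cancel_left, QuotientGroup.out_eq']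
  have h1 : ∀ g : G, (f₁ * f₂) g = ∑ x ∈ S, f₁ x.out * f₂ (x.out⁻¹ * g) := fun g =>
    finsum_eq_sum_of_support_subset _ fun x hx => hS x (left_ne_zero_of_mul hx)
  have h2 : heckeAct K ρ f₁ (heckeAct K ρ f₂ v) =
      ∑ x ∈ S, f₁ x.out • ∑ y ∈ T, f₂ (x.out⁻¹ * y.out) • ρ y.out v := by
    rw [heckeAct, finsum_eq_sum_of_support_subset (s := S) _ fun x hx => hS x fun h => hx (by simp [h])]
    refine Finset.sum_congr rfl fun x hx => ?_
    rw [rho_act f₂ hv, finsum_eq_sum_of_support_subset (s := T) _ fun y hy =>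
      hT x hx y fun h => hy (by simp [h])]
  have h3 : heckeAct K ρ (f₁ * f₂ : HeckeAlgebra K χ) v =
      ∑ y ∈ T, (f₁ * f₂) y.out • ρ y.out v := by
    refine finsum_eq_sum_of_support_subset _ fun y hy => ?_
    by_contra hyT
    refine hy ?_
    simp only
    rw [h1, Finset.sum_eq_zero, zero_smul]
    intro x hx
    by_contra h
    exact hyT (hT x hx y (right_ne_zero_of_mul h))
  rw [h2, h3]
  simp_rw [h1, Finset.sum_smul, Finset.smul_sum, smul_smul]
  exact Finset.sum_comm

theorem act_one {v : V} (hv : v ∈ isotypic K χ ρ) :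
    heckeAct K ρ (1 : HeckeAlgebra K χ) v = v := by
  unfold heckeAct
  rw [finsum_eq_single _ ((1 : G) : G ⧸ K), out_eq (F := fun g => (1 : HeckeAlgebra K χ) g • ρ g v)
    (act_inv 1 hv)]
  · have := one_apply_mem (χ := χ) 1
    simp at this
    simp [this]
  · intro x hx
    rw [one_apply_notMem, zero_smul]
    intro h
    refine hx ?_
    rw [← QuotientGroup.out_eq' x]
    exact (QuotientGroup.eq.2 (by simpa using h)).symm

theorem act_add_left (f₁ f₂ : HeckeAlgebra K χ) (v : V) :
    heckeAct K ρ (f₁ + f₂ : HeckeAlgebra K χ) v = heckeAct K ρ f₁ v + heckeAct K ρ f₂ v := by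
  unfold heckeAct
  rw [← finsum_add_distrib (act_fin f₁ v) (act_fin f₂ v)]
  refine finsum_congr fun x => ?_
  rw [← add_smul]; rfl

theorem act_add_right (f : HeckeAlgebra K χ) (v w : V) :
    heckeAct K ρ f (v + w) = heckeAct K ρ f v + heckeAct K ρ f w := by
  unfold heckeAct
  rw [← finsum_add_distrib (act_fin f v) (act_fin f w)]
  simp only [map_add, smul_add]

theorem act_smul_left (c : ℂ) (f : HeckeAlgebra K χ) (v : V) :
    heckeAct K ρ (c • f : HeckeAlgebra K χ) v = c • heckeAct K ρ f v := by
  unfold heckeAct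
  rw [smul_finsum]
  refine finsum_congr fun x => ?_
  rw [smul_smul]; rfl

theorem act_smul_right (c : ℂ) (f : HeckeAlgebra K χ) (v : V) :
    heckeAct K ρ f (c • v) = c • heckeAct K ρ f v := by
  unfold heckeAct
  rw [smul_finsum]
  refine finsum_congr fun x => ?_
  rw [map_smul, smul_comm]

end Act

/-- Left translation of functions on `G`. -/
def leftReg : Representation ℂ G (G → ℂ) where
  toFun g :=
    { toFun := fun φ y => φ (g⁻¹ * y)
      map_add' := fun _ _ => rfl
      map_smul' := fun _ _ => rfl }
  map_one' := by ext; simp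
  map_mul' g h := by ext; simp [mul_assoc]

theorem mem_isotypic (f : HeckeAlgebra K χ) : (f : G → ℂ) ∈ isotypic K χ (leftReg (G := G)) := by
  intro k
  funext y
  change f ((k : G)⁻¹ * y) = (χ k : ℂ) * f y
  rw [← Subgroup.coe_inv, left, map_inv, inv_inv]

theorem coe_mul (f₁ f₂ : HeckeAlgebra K χ) :
    ((f₁ * f₂ : HeckeAlgebra K χ) : G → ℂ) = heckeAct K (leftReg (G := G)) f₁ f₂ := by
  funext g
  unfold heckeAct
  have := map_finsum (Pi.evalAddMonoidHom (fun _ : G => ℂ) g)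
    (act_fin (ρ := leftReg (G := G)) f₁ (f₂ : G → ℂ))
  simp only [Pi.evalAddMonoidHom_apply] at this
  rw [this, mul_apply]
  rfl

noncomputable instance : Ring (HeckeAlgebra K χ) :=
  { (inferInstance : AddCommGroup (HeckeAlgebra K χ)) with
    mul := (· * ·)
    one := 1
    mul_assoc := fun a b c => Subtype.ext (by
      rw [coe_mul, act_mul a b (mem_isotypic c), ← coe_mul, ← coe_mul])
    one_mul := fun a => Subtype.ext (by rw [coe_mul, act_one (mem_isotypic a)])
    mul_one := fun a => by
      ext g
      rw [mul_apply, finsum_eq_single _ (g : G ⧸ K),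
        out_eq (F := fun x => a x * (1 : HeckeAlgebra K χ) (x⁻¹ * g))]
      · have := one_apply_mem (χ := χ) 1
        simp at this
        simp [this]
      · intro x k
        rw [right, mul_inv_rev, ← Subgroup.coe_inv, mul_assoc (a x), mul_assoc ((k⁻¹ : K) : G), left]
        simp
      · intro x hx
        rw [one_apply_notMem, mul_zero]
        intro h
        refine hx ?_
        rw [← QuotientGroup.out_eq' x]
        exact QuotientGroup.eq.2 h
    left_distrib := fun a b c => Subtype.ext (by
      rw [coe_mul, Submodule.coe_add, act_add_right, ← coe_mul, ← coe_mul]; rfl)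
    right_distrib := fun a b c => Subtype.ext (by
      rw [coe_mul, act_add_left, ← coe_mul, ← coe_mul]; rfl)
    zero_mul := fun a => Subtype.ext (by
      have := act_smul_left (ρ := leftReg (G := G)) 0 (0 : HeckeAlgebra K χ) (a : G → ℂ)
      rw [zero_smul, zero_smul] at this
      rw [coe_mul, this]; rfl)
    mul_zero := fun a => Subtype.ext (by
      have := act_smul_right (ρ := leftReg (G := G)) 0 a (0 : G → ℂ)
      rw [zero_smul, zero_smul] at this
      rw [coe_mul]; exact this) }

noncomputable instance : Algebra ℂ (HeckeAlgebra K χ) :=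
  Algebra.ofModule
    (fun c a b => Subtype.ext (by
      rw [coe_mul, act_smul_left, ← coe_mul]; rfl))
    (fun c a b => Subtype.ext (by
      rw [coe_mul, Submodule.coe_smul, act_smul_right, ← coe_mul]; rfl))

/-- `V^χ` is a left module over the Hecke algebra. -/
noncomputable instance {V : Type*} [AddCommGroup V] [Module ℂ V] (ρ : Representation ℂ G V) :
    Module (HeckeAlgebra K χ) (isotypic K χ ρ) where
  smul f v := ⟨heckeAct K ρ f v, act_mem f v.2⟩
  one_smul v := Subtype.ext (act_one v.2)
  mul_smul f₁ f₂ v := Subtype.ext (act_mul f₁ f₂ v.2)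
  smul_zero f := Subtype.ext (by
    have := act_smul_right (ρ := ρ) 0 f 0
    rw [zero_smul, zero_smul] at this
    exact this)
  smul_add f v w := Subtype.ext (act_add_right f (v : V) w)
  add_smul f₁ f₂ v := Subtype.ext (act_add_left f₁ f₂ (v : V))
  zero_smul v := Subtype.ext (by
    have := act_smul_left (ρ := ρ) 0 (0 : HeckeAlgebra K χ) (v : V)
    rw [zero_smul, zero_smul] at this
    exact this)

theorem coe_smul {V : Type*} [AddCommGroup V] [Module ℂ V] (ρ : Representation ℂ G V)
    (f : HeckeAlgebra K χ) (v : isotypic K χ ρ) :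
    ((f • v : isotypic K χ ρ) : V) = heckeAct K ρ f v := rfl

instance {V : Type*} [AddCommGroup V] [Module ℂ V] (ρ : Representation ℂ G V) :
    IsScalarTower ℂ (HeckeAlgebra K χ) (isotypic K χ ρ) where
  smul_assoc c f v := Subtype.ext (act_smul_left c f (v : V))




end HeckeAlgebra

/-! ### Categories of representations -/

/-- The finite dimensional left modules over a `ℂ`-algebra. -/
def finDimModule (H : Type) [Ring H] [Algebra ℂ H] : ObjectProperty (ModuleCat.{0} H) :=
  fun M => letI := Module.compHom M (algebraMap ℂ H); FiniteDimensional ℂ M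

/-- The category `R(H)` of finite dimensional left `H`-modules. -/
abbrev FinDimModuleCat (H : Type) [Ring H] [Algebra ℂ H] : Type 1 :=
  (finDimModule H).FullSubcategory

/-- Restriction of finite dimensional modules along an isomorphism of algebras. -/
noncomputable def restrictFinDim {H H' : Type} [Ring H] [Algebra ℂ H] [Ring H'] [Algebra ℂ H']
    (Φ : H ≃ₐ[ℂ] H') : FinDimModuleCat H' ⥤ FinDimModuleCat H :=
  (finDimModule H).lift
    ((finDimModule H').ι ⋙ ModuleCat.restrictScalars (Φ : H →+* H'))
    (by
      intro M
      have h : algebraMap ℂ H' = (Φ : H →+* H').comp (algebraMap ℂ H) :=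
        RingHom.ext fun c => (Φ.commutes c).symm
      have := M.property
      change @Module.Finite ℂ M.obj _ _ (Module.compHom M.obj (algebraMap ℂ H')) at this
      rw [h] at this
      exact this)

variable [TopologicalSpace G]

/-- The admissible smooth representations of `G` that are generated by the vectors on which `K` acts
by `χ`. -/
structure IsGeneratedAdmissible (V : Rep.{0} ℂ G) : Prop where
  /-- Every vector has an open stabilizer. -/
  smooth : ∀ v : V, IsOpen {g : G | V.ρ g v = v}
  /-- The vectors fixed by an open subgroup form a finite dimensional space. -/
  admissible : ∀ U : Subgroup G, IsOpen (U : Set G) →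
    FiniteDimensional ℂ (isotypic U (1 : U →* ℂˣ) V.ρ)
  /-- The translates of `V^χ` span `V`. -/
  generated : Submodule.span ℂ {w : V | ∃ g : G, ∃ v ∈ isotypic K χ V.ρ, w = V.ρ g v} = ⊤

/-- The category of admissible smooth representations of `G` generated by `V^χ`. -/
abbrev AdmissibleCat : Type 1 :=
  ObjectProperty.FullSubcategory (C := Rep.{0} ℂ G) (IsGeneratedAdmissible K χ)

variable {K χ}

/-- The map `V^χ → W^χ` induced by a morphism `V → W`. -/
noncomputable def isotypicMap {V W : Rep.{0} ℂ G} (f : V ⟶ W) :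
    isotypic K χ V.ρ →ₗ[HeckeAlgebra K χ] isotypic K χ W.ρ where
  toFun v := ⟨f.hom v, fun k => by
    rw [← Rep.hom_comm_apply, v.2 k]; exact map_smul f.hom.toLinearMap _ _⟩
  map_add' v w := Subtype.ext (map_add f.hom.toLinearMap _ _)
  map_smul' h v := Subtype.ext (by
    change f.hom (heckeAct K V.ρ h v) = heckeAct K W.ρ h (f.hom v)
    unfold heckeAct
    have := map_finsum f.hom.toLinearMap (HeckeAlgebra.act_fin (ρ := V.ρ) h (v : V))
    refine this.trans (finsum_congr fun x => ?_)
    rw [map_smul]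
    exact congrArg _ (Rep.hom_comm_apply f _ _))

/-- The functor `V ↦ V^χ`, for a character `χ` of `K` with open kernel. -/
noncomputable def isotypicFunctor (hχ : IsOpen (χ.ker.map K.subtype : Set G)) :
    AdmissibleCat K χ ⥤ FinDimModuleCat (HeckeAlgebra K χ) where
  obj V := ⟨ModuleCat.of _ (isotypic K χ V.obj.ρ), by
    have h1 := V.property.admissible _ hχ
    have h2 : isotypic K χ V.obj.ρ ≤
        isotypic (χ.ker.map K.subtype) (1 : (χ.ker.map K.subtype : Subgroup G) →* ℂˣ) V.obj.ρ := by
      rintro v hv ⟨_, k, hk, rfl⟩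
      have hk' : χ k = 1 := hk
      have := hv k
      rw [hk'] at this
      simpa using this
    have h3 : FiniteDimensional ℂ (isotypic K χ V.obj.ρ) :=
      FiniteDimensional.of_injective (Submodule.inclusion h2) (Submodule.inclusion_injective h2)
    have h4 : Module.compHom (isotypic K χ V.obj.ρ) (algebraMap ℂ (HeckeAlgebra K χ)) =
        (inferInstance : Module ℂ (isotypic K χ V.obj.ρ)) := by
      ext c v
      exact congrArg Subtype.val (algebraMap_smul (HeckeAlgebra K χ) c v)
    change @Module.Finite ℂ (isotypic K χ V.obj.ρ) _ _
      (Module.compHom (isotypic K χ V.obj.ρ) (algebraMap ℂ (HeckeAlgebra K χ)))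
    rw [h4]
    exact h3⟩
  map f := ObjectProperty.homMk (ModuleCat.ofHom (isotypicMap f.hom))
  map_id V := rfl
  map_comp f g := rfl

end Hecke

/-! ### The Hecke algebra `H(γ)` -/

namespace Mp

theorem K1_le_K0 : K1 ≤ K0 := by
  rintro g ⟨⟨A, hA, h⟩, -⟩
  exact ⟨A, hA.2, h⟩

theorem centralPart_K1 {k : K0} (hk : (k : Mp) ∈ K1) : centralPart k = 1 := by
  obtain ⟨k₁, h⟩ := centralPart_spec k
  exact (central_unique (m := 1) (m' := centralPart k) (k := ⟨k, hk⟩) (k' := k₁) (by simpa using h)).symm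

theorem isOpen_ker_extend (γ : Subgroup.center Mp →* ℂˣ) :
    IsOpen ((extend γ).ker.map K0.subtype : Set Mp) := by
  rintro _ ⟨g, hg, rfl⟩
  refine ⟨2, fun k hk => ?_⟩
  have h1 : (⟨inclSL k, 1⟩ : Mp) ∈ K1 := ⟨⟨k, HS.GammaTwoPow_two_le hk, rfl⟩, rfl⟩
  refine ⟨g * ⟨_, K1_le_K0 h1⟩, mul_mem hg ?_, rfl⟩
  change γ (centralPart _) = 1
  rw [centralPart_K1 h1, map_one]

/-- `H(γ)`. -/
abbrev H (γ : Subgroup.center Mp →* ℂˣ) : Type := HeckeAlgebra K0 (extend γ)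

/-- `R(G, γ)`. -/
abbrev R (γ : Subgroup.center Mp →* ℂˣ) : Type 1 := AdmissibleCat K0 (extend γ)

/-- The functor `V ↦ V^γ` from `R(G, γ)` to `R(H(γ))`. -/
noncomputable def A (γ : Subgroup.center Mp →* ℂˣ) : R γ ⥤ FinDimModuleCat (H γ) :=
  isotypicFunctor (isOpen_ker_extend γ)

end Mp

/-! ### The Iwahori–Hecke algebra of `PGL₂(ℚ₂)` -/

namespace PGLTwo

/-- The quotient topology on `PGL₂(ℚ₂)`. -/
noncomputable instance : TopologicalSpace PGL(2, ℚ_[2]) :=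
  TopologicalSpace.coinduced (Matrix.ProjGenLinGroup.mk : GL (Fin 2) ℚ_[2] → PGL(2, ℚ_[2]))
    inferInstance

/-- The matrices in `GL₂(ℤ₂)` that are upper triangular modulo `2`. -/
noncomputable def iwahoriGL : Subgroup (GL (Fin 2) ℤ_[2]) where
  carrier := {A | (2 : ℤ_[2]) ∣ A 1 0}
  mul_mem' {A B} hA hB := by
    simp only [Set.mem_ofPred_eq, Matrix.GeneralLinearGroup.coe_mul, Matrix.mul_apply,
      Fin.sum_univ_two] at *
    exact dvd_add (hA.mul_right _) (hB.mul_left _)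
  one_mem' := by simp
  inv_mem' {A} hA := by
    change (2 : ℤ_[2]) ∣ (A⁻¹ : GL (Fin 2) ℤ_[2]) 1 0
    have hA' : (2 : ℤ_[2]) ∣ A 1 0 := hA
    rw [Matrix.coe_units_inv, Matrix.inv_def, Matrix.adjugate_fin_two]
    simpa using hA'.mul_left (Ring.inverse A.val.det)

/-- The Iwahori subgroup `I` of `PGL₂(ℚ₂)`. -/
noncomputable def iwahori : Subgroup PGL(2, ℚ_[2]) :=
  (iwahoriGL.map (Matrix.GeneralLinearGroup.map PadicInt.Coe.ringHom)).map Matrix.ProjGenLinGroup.mk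

theorem isOpen_iwahori : IsOpen (iwahori : Set PGL(2, ℚ_[2])) := by
  rw [isOpen_coinduced]
  change IsOpen ((iwahori.comap Matrix.ProjGenLinGroup.mk : Subgroup (GL (Fin 2) ℚ_[2])) :
    Set (GL (Fin 2) ℚ_[2]))
  let U : Set (GL (Fin 2) ℚ_[2]) := {g | ∀ i j, ‖g i j - (1 : Matrix (Fin 2) (Fin 2) ℚ_[2]) i j‖ < 1}
  have hU : IsOpen U := by
    simp only [U, Set.ofPred_forall]
    refine isOpen_iInter_of_finite fun i => isOpen_iInter_of_finite fun j => ?_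
    refine isOpen_lt ?_ continuous_const
    have : Continuous fun g : GL (Fin 2) ℚ_[2] => (g : Matrix (Fin 2) (Fin 2) ℚ_[2]) i j :=
      (continuous_id.matrix_elem i j).comp Units.continuous_val
    exact (this.sub continuous_const).norm
  refine Subgroup.isOpen_of_mem_nhds _ (g := 1) (Filter.mem_of_superset (hU.mem_nhds ?_) ?_)
  · intro i j; simp
  intro g hg
  have hd : ∀ i j, ∃ t : ℤ_[2], g i j = (1 : Matrix (Fin 2) (Fin 2) ℤ_[2]) i j + 2 * t := by
    intro i j
    have h := hg i j
    obtain ⟨t, ht⟩ := (PadicInt.norm_lt_one_iff_dvd (p := 2) ⟨_, h.le⟩).1 h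
    refine ⟨t, ?_⟩
    have h2 := congrArg Subtype.val ht
    have h1 : ((1 : Matrix (Fin 2) (Fin 2) ℤ_[2]) i j : ℚ_[2]) =
        (1 : Matrix (Fin 2) (Fin 2) ℚ_[2]) i j := by
      by_cases h : i = j <;> simp [Matrix.one_apply, h]
    rw [h1, ← sub_eq_iff_eq_add']
    exact h2.trans (by push_cast; rfl)
  choose t ht using hd
  let B : Matrix (Fin 2) (Fin 2) ℤ_[2] := fun i j =>
    (1 : Matrix (Fin 2) (Fin 2) ℤ_[2]) i j + 2 * t i j
  have hdet : IsUnit B.det := by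
    rw [PadicInt.isUnit_iff]
    refine le_antisymm (PadicInt.norm_le_one _) (not_lt.1 fun h => ?_)
    rw [PadicInt.norm_lt_one_iff_dvd, Matrix.det_fin_two] at h
    obtain ⟨k, hk⟩ := h
    simp only [B, Matrix.one_apply] at hk
    simp at hk
    exact HS.two_not_dvd_one ⟨k - t 0 0 - t 1 1 - 2 * t 0 0 * t 1 1 + 2 * t 0 1 * t 1 0, by
      linear_combination hk⟩
  refine ⟨g, ⟨Matrix.GeneralLinearGroup.mk'' B hdet, ?_, ?_⟩, rfl⟩
  · change (2 : ℤ_[2]) ∣ B 1 0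
    simp [B]
  · ext i j
    exact (ht i j).symm

theorem isOpen_ker_one :
    IsOpen ((1 : iwahori →* ℂˣ).ker.map iwahori.subtype : Set PGL(2, ℚ_[2])) := by
  have : (1 : iwahori →* ℂˣ).ker.map iwahori.subtype = iwahori := by
    ext g
    simp
  rw [this]
  exact isOpen_iwahori

/-- The Iwahori–Hecke algebra `H'`. -/
abbrev H : Type := HeckeAlgebra iwahori 1

/-- `R(G', I)`. -/
abbrev R : Type 1 := AdmissibleCat iwahori 1

/-- The functor `V ↦ V^I` from `R(G', I)` to `R(H')`. -/
noncomputable def A : R ⥤ FinDimModuleCat H := isotypicFunctor isOpen_ker_one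

/-- The class of the matrix with rows `(0, 1)` and `(1, 0)`. -/
noncomputable def w : PGL(2, ℚ_[2]) :=
  Matrix.ProjGenLinGroup.mk (Matrix.GeneralLinearGroup.mkOfDetNeZero !![0, 1; 1, 0] (by simp))

/-- The class of the matrix with rows `(0, 1)` and `(2, 0)`. -/
noncomputable def u : PGL(2, ℚ_[2]) :=
  Matrix.ProjGenLinGroup.mk (Matrix.GeneralLinearGroup.mkOfDetNeZero !![0, 1; 2, 0] (by simp))

end PGLTwo

/-- `f` is supported on the double coset `K g K` and takes the value `c` at `g`. -/
def HeckeAlgebra.IsDoubleCoset {G : Type} [Group G] {K : Subgroup G} {χ : K →* ℂˣ}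
    (f : HeckeAlgebra K χ) (g : G) (c : ℂ) : Prop :=
  (∀ x, f x ≠ 0 → x ∈ DoubleCoset.doubleCoset g (K : Set G) K) ∧ f g = c

/-!
The metaplectic side `(Mp, K₀, γ)` and the linear side `(PGL₂(ℚ₂), I, 1)` are treated at the same
time, as instances of a pair `(K, χ)` in a group with the structure of `SL₂(ℚ₂)`, the structure
`IwahoriDatum`. It comes with a diagonal element `t`, a Weyl element `w` and unipotent elements
`n b`, `n' b`; conjugation by `t` contracts the `n' b` by a factor `q`, which is `2` for the linear
group and `4` for the double cover. Let `u = t w`, and let `V^χ` be the space of vectors on which `K`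
acts by `χ`.

**The Hecke algebra.** Since the orbits of `K` on translates of `V^χ` are finite up to `χ`, averaging
gives a projection `e_χ` in every representation generated by `V^χ`. The averaged translates
`[g] = e_χ g e_χ` span the Hecke algebra, `[g]` is supported on `K g K`, and `[g] = 0` if `k g = g k'`
for some `k`, `k'` in `K` with `χ k ≠ χ k'` (`bracket_eq_zero`). For the double cover this happens on
all double cosets except those of `tᵐ` and `tᵐ w`, because `γ(h(-1))² = γ((-1, -1)₂) = -1`
(`Mp.exists_ne_of_norm_c`, `Mp.exists_ne_of_norm_b`); for the linear group there are no other double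
cosets. Suitable multiples of `[w]` and `[u]` satisfy `T² = T + 2` and `U² = 1`. On the metaplectic
side the square of `[w]` is a combination of `[1]`, `[n'(-1)]`, `[n'(-2)]`, `[n'(-3)]`, where
`n'(-2)` lies in a double coset that carries no functions and `n'(-1)`, `n'(-3)` lie in that of `w`.
By these relations the alternating words in `T` and `U` are invertible, hence nonzero, and they are
multiples of the averaged translates at distinct double cosets. So both Hecke algebras are identified
with the algebra `QuadraticHecke` that these two relations present (`IwahoriDatum.exists_algEquiv`),
and composition of the two isomorphisms gives `Φ`.

**The equivalences.** The functor `V ↦ V^χ` is an equivalence (`isEquivalence_isotypicFunctor`)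
provided that

* a nonzero subrepresentation of a representation generated by `V^χ` meets `V^χ` (`TypeProperty`);
* a representation generated by a finite dimensional `V^χ` is smooth and admissible.

It is full, because a Hecke linear map `V^χ → W^χ` generates a subrepresentation of `V × W`, which is
the graph of a map by the first point; and a module `M` is realized in the span of the right
translates of the functions `x ↦ [x] m` on the group, for `m` in `M`.

For admissibility, let `m` be given. By the Cartan decomposition the vectors fixed by the congruence
subgroup `U m` are obtained from the averages of `tⁱ J V^χ` over `U m`, where `J` is a maximal
compact subgroup, and these averages no longer grow when `i` is large
(`IwahoriDatum.finiteDimensional_range_projU`).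

**The type property.** Let `P` be a subrepresentation that does not meet `V^χ`. By the Iwasawa
decomposition a vector of `P` can be moved into the span of the spaces `n c t⁻ⁱ J V^χ` with `c`
integral and `i ≤ m`, that is, into a horoball of the tree. It is shown that the
contributions of the deepest vertices can be pushed one layer up, until only `J V^χ` is left, where
the claim is a property of representations of a finite group (`IwahoriDatum.eq_bot_of_elimination`).
A single vertex is isolated by translating it to the base point and applying a combination of
unipotent elements that kills the other vertices. If `q = 2`, the operator is `1 - n 1`
(`IwahoriDatum.typeProperty_of_q_eq_two`). If `q = 4`, the conjugate of `n 1` by `n' 2` is `n (-1)` up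
to a central element on which `χ` is `±i`, and besides `e_χ` its conjugate by `n' 2` is needed; the
corresponding components are eliminated in a second step
(`IwahoriDatum.typeProperty_of_q_eq_four`).
-/

/-! ### Averaging over the orbits of a group -/

namespace LocalShimura

section Average

variable {K : Type*} [Group K] {V W : Type*} [AddCommGroup V] [Module ℂ V]
  [AddCommGroup W] [Module ℂ W]
variable (τ : Representation ℂ K V) (σ : Representation ℂ K W)

/-- The stabilizer of a vector. -/
def fixer (v : V) : Subgroup K where
  carrier := {k | τ k v = v}
  mul_mem' {a b} ha hb := by
    simp only [Set.mem_ofPred_eq, map_mul, Module.End.mul_apply] at *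
    rw [hb, ha]
  one_mem' := by simp
  inv_mem' {a} ha := by
    simp only [Set.mem_ofPred_eq] at *
    conv_lhs => rw [← ha]
    rw [← Module.End.mul_apply, ← map_mul]
    simp

theorem mem_fixer {v : V} {k : K} : k ∈ fixer τ v ↔ τ k v = v := Iff.rfl

/-- The mean value of the `K`-orbit of `v`; it is meaningful if the orbit is finite. -/
noncomputable def average (v : V) : V :=
  ((fixer τ v).index : ℂ)⁻¹ • ∑ᶠ x : K ⧸ fixer τ v, τ x.out v

variable {τ σ}

theorem apply_out {L : Subgroup K} {v : V} (h : L ≤ fixer τ v) (k : K) :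
    τ (k : K ⧸ L).out v = τ k v := by
  obtain ⟨l, hl⟩ := QuotientGroup.mk_out_eq_mul L k
  rw [hl, map_mul, Module.End.mul_apply, h l.2]

/-- The average may be computed with any smaller subgroup of finite index. -/
theorem average_eq {L : Subgroup K} [hL : L.FiniteIndex] {v : V} (h : L ≤ fixer τ v) :
    average τ v = (L.index : ℂ)⁻¹ • ∑ᶠ x : K ⧸ L, τ x.out v := by
  have hF : (fixer τ v).FiniteIndex := Subgroup.finiteIndex_of_le h
  set F := fixer τ v with hFdef
  have hfin : Finite (K ⧸ L) := inferInstance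
  have hfin1 : Finite (K ⧸ F) := inferInstance
  let e := Subgroup.quotientEquivProdOfLE h
  have hfin2 : Finite ((K ⧸ F) × (F ⧸ L.subgroupOf F)) := Finite.of_equiv _ e
  have hne : Nonempty (K ⧸ F) := ⟨(1 : K)⟩
  have hfin3 : Finite (F ⧸ L.subgroupOf F) := Finite.of_injective
    (fun y => (((1 : K) : K ⧸ F), y)) (fun a b hab => (Prod.mk.inj hab).2)
  cases nonempty_fintype (K ⧸ L)
  cases nonempty_fintype (K ⧸ F)
  cases nonempty_fintype (F ⧸ L.subgroupOf F)
  have hfst : ∀ x : K ⧸ L, τ x.out v = τ (e x).1.out v := by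
    intro x
    induction x using QuotientGroup.induction_on with
    | H k =>
      rw [apply_out h]
      change _ = τ (k : K ⧸ F).out v
      rw [apply_out (hFdef.le)]
  have hsum : ∑ᶠ x : K ⧸ L, τ x.out v =
      (Fintype.card (F ⧸ L.subgroupOf F) : ℂ) • ∑ᶠ x : K ⧸ F, τ x.out v := by
    rw [finsum_eq_sum_of_fintype, finsum_eq_sum_of_fintype,
      Fintype.sum_equiv e _ (fun p => τ p.1.out v) hfst, Fintype.sum_prod_type, Finset.smul_sum]
    refine Finset.sum_congr rfl fun x _ => ?_
    change ∑ _ : F ⧸ L.subgroupOf F, τ x.out v = _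
    rw [Finset.sum_const, Finset.card_univ, Nat.cast_smul_eq_nsmul]
  have hidx : (L.index : ℂ) = F.index * Fintype.card (F ⧸ L.subgroupOf F) := by
    rw [← Subgroup.relIndex_mul_index h, mul_comm]
    push_cast
    rw [Subgroup.relIndex, Subgroup.index, Subgroup.index, Nat.card_eq_fintype_card,
      Nat.card_eq_fintype_card]
  have hc : (Fintype.card (F ⧸ L.subgroupOf F) : ℂ) ≠ 0 := by
    have := Fintype.card_pos_iff.2 (⟨((1 : F) : F ⧸ L.subgroupOf F)⟩ : Nonempty _)
    exact_mod_cast this.ne'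
  rw [average, hsum, smul_smul, hidx, mul_inv, mul_assoc, inv_mul_cancel₀ hc, mul_one]

theorem average_add {v w : V} [(fixer τ v).FiniteIndex] [(fixer τ w).FiniteIndex] :
    average τ (v + w) = average τ v + average τ w := by
  let L := fixer τ v ⊓ fixer τ w
  have hL : L ≤ fixer τ (v + w) := fun k hk => by
    rw [mem_fixer, map_add, hk.1, hk.2]
  rw [average_eq hL, average_eq (L := L) inf_le_left, average_eq (L := L) inf_le_right,
    ← smul_add, ← finsum_add_distrib (Set.toFinite _) (Set.toFinite _)]
  simp only [map_add]

theorem average_smul {v : V} [(fixer τ v).FiniteIndex] (c : ℂ) :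
    average τ (c • v) = c • average τ v := by
  have hL : fixer τ v ≤ fixer τ (c • v) := fun k hk => by
    rw [mem_fixer, map_smul, hk]
  rw [average_eq hL, average, smul_comm c, smul_finsum c]
  simp only [map_smul]

theorem average_of_fixed {v : V} (h : ∀ k, τ k v = v) : average τ v = v := by
  have hL : (⊤ : Subgroup K) ≤ fixer τ v := fun k _ => h k
  rw [average_eq hL]
  have : Unique (K ⧸ (⊤ : Subgroup K)) :=
    { default := ((1 : K) : K ⧸ (⊤ : Subgroup K))
      uniq := fun a => by
        induction a using QuotientGroup.induction_on with
        | H a => exact QuotientGroup.eq.2 trivial }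
  rw [finsum_unique, h]
  simp

theorem apply_average {v : V} [(fixer τ v).FiniteIndex] (k : K) :
    τ k (average τ v) = average τ v := by
  unfold average
  rw [map_smul, map_finsum _ (Set.toFinite _),
    ← finsum_comp_equiv (MulAction.toPerm k) (f := fun x : K ⧸ fixer τ v => τ x.out v)]
  congr 1
  refine finsum_congr fun x => ?_
  rw [← Module.End.mul_apply, ← map_mul]
  induction x using QuotientGroup.induction_on with
  | H a =>
    rw [map_mul, Module.End.mul_apply, apply_out le_rfl]
    change _ = τ ((k * a : K) : K ⧸ fixer τ v).out v
    rw [apply_out le_rfl, map_mul, Module.End.mul_apply]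

theorem average_apply {v : V} [(fixer τ v).FiniteIndex] (k : K) :
    average τ (τ k v) = average τ v := by
  let L := (fixer τ v).normalCore
  have h1 : L ≤ fixer τ v := Subgroup.normalCore_le _
  have h2 : L ≤ fixer τ (τ k v) := by
    intro l hl
    have := h1 (Subgroup.Normal.conj_mem inferInstance l hl k⁻¹)
    rw [mem_fixer, map_mul, map_mul, inv_inv, Module.End.mul_apply, Module.End.mul_apply] at this
    rw [mem_fixer]
    conv_rhs => rw [← this]
    rw [← Module.End.mul_apply, ← map_mul]
    simp
  rw [average_eq h2, average_eq h1,
    ← finsum_comp_equiv (Equiv.mulRight (k : K ⧸ L)) (f := fun x : K ⧸ L => τ x.out v)]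
  congr 1
  refine finsum_congr fun x => ?_
  induction x using QuotientGroup.induction_on with
  | H a =>
    rw [apply_out h2]
    change _ = τ ((a * k : K) : K ⧸ L).out v
    rw [apply_out h1, map_mul, Module.End.mul_apply]

theorem average_mem {v : V} {P : Submodule ℂ V} (h : ∀ k, τ k v ∈ P) : average τ v ∈ P := by
  unfold average
  exact P.smul_mem _ (finsum_induction (· ∈ P) P.zero_mem (fun _ _ => P.add_mem) fun x => h _)

theorem map_average (f : V →ₗ[ℂ] W) {v : V} [(fixer τ v).FiniteIndex]
    (hf : ∀ k, f (τ k v) = σ k (f v)) : f (average τ v) = average σ (f v) := by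
  have hL : fixer τ v ≤ fixer σ (f v) := fun k hk => by
    rw [mem_fixer, ← hf, hk]
  rw [average_eq hL, average, map_smul, map_finsum _ (Set.toFinite _)]
  simp only [hf]

theorem apply_average_of_invariant (f : V →ₗ[ℂ] W) {v : V} [(fixer τ v).FiniteIndex]
    (hf : ∀ k, f (τ k v) = f v) : f (average τ v) = f v := by
  rw [map_average (σ := (1 : Representation ℂ K W)) f fun k => by rw [hf]; rfl]
  exact average_of_fixed fun k => rfl

end Average

section Twist

variable {G : Type} [Group G] {V W : Type*} [AddCommGroup V] [Module ℂ V]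
  [AddCommGroup W] [Module ℂ W] (K : Subgroup G) (χ : K →* ℂˣ)

/-- The representation `χ⁻¹ ⊗ ρ` of `K`. -/
def twist (ρ : Representation ℂ G V) : Representation ℂ K V where
  toFun k := (((χ k)⁻¹ : ℂˣ) : ℂ) • ρ k
  map_one' := by simp
  map_mul' a b := by
    ext v
    simp [smul_smul, mul_comm]

/-- All orbits of `K` on the twist of `ρ` by `χ⁻¹` are finite. -/
def LocallyFinite (ρ : Representation ℂ G V) : Prop :=
  ∀ v, (fixer (twist K χ ρ) v).FiniteIndex

variable {K χ} {ρ : Representation ℂ G V} {σ : Representation ℂ G W}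

theorem twist_apply (k : K) (v : V) : twist K χ ρ k v = (((χ k)⁻¹ : ℂˣ) : ℂ) • ρ k v := rfl

theorem twist_apply_eq_iff {k : K} {v : V} : twist K χ ρ k v = v ↔ ρ k v = (χ k : ℂ) • v := by
  rw [twist_apply]
  constructor
  · intro h
    conv_rhs => rw [← h]
    simp [smul_smul]
  · intro h
    simp [h, smul_smul]

theorem mem_isotypic_iff {v : V} : v ∈ isotypic K χ ρ ↔ ∀ k : K, ρ k v = (χ k : ℂ) • v := Iff.rfl

/-- The projection of a locally finite representation onto the vectors on which `K` acts by `χ`. -/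
noncomputable def isoProj (h : LocallyFinite K χ ρ) : V →ₗ[ℂ] V where
  toFun := average (twist K χ ρ)
  map_add' v w := by
    have := h v
    have := h w
    exact average_add
  map_smul' c v := by
    have := h v
    exact average_smul c

variable (h : LocallyFinite K χ ρ)

theorem isoProj_mem (v : V) : isoProj h v ∈ isotypic K χ ρ := by
  have := h v
  intro k
  exact twist_apply_eq_iff.1 (apply_average k)

theorem isoProj_of_mem {v : V} (hv : v ∈ isotypic K χ ρ) : isoProj h v = v :=
  average_of_fixed fun k => twist_apply_eq_iff.2 (hv k)

theorem isoProj_apply (k : K) (v : V) : isoProj h (ρ k v) = (χ k : ℂ) • isoProj h v := by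
  have := h v
  have h1 : average (twist K χ ρ) (twist K χ ρ k v) = average (twist K χ ρ) v := average_apply k
  rw [twist_apply] at h1
  have h2 := (isoProj h).map_smul (((χ k)⁻¹ : ℂˣ) : ℂ) (ρ k v)
  have h3 : (((χ k)⁻¹ : ℂˣ) : ℂ) • isoProj h (ρ k v) = isoProj h v := h2.symm.trans h1
  rw [← h3, smul_smul]
  simp

theorem isoProj_mem_of {v : V} {P : Submodule ℂ V} (hP : ∀ k : K, ρ k v ∈ P) :
    isoProj h v ∈ P :=
  average_mem fun k => P.smul_mem _ (hP k)

theorem map_isoProj (h' : LocallyFinite K χ σ) (f : V →ₗ[ℂ] W)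
    (hf : ∀ (k : K) v, f (ρ k v) = σ k (f v)) (v : V) :
    f (isoProj h v) = isoProj h' (f v) := by
  have := h v
  exact map_average f fun k => by rw [twist_apply, twist_apply, map_smul, hf]

/-- An element of the group algebra that acts as `χ` demands on `ρ g v` may be moved through the
projection. -/
theorem isoProj_of_commute (f : V →ₗ[ℂ] V) (hf : ∀ (k : K) v, ∃ k' : K, χ k' = χ k ∧
    f (ρ k v) = ρ k' (f v)) (hf' : ∀ v ∈ isotypic K χ ρ, f v ∈ isotypic K χ ρ) (v : V) :
    isoProj h (f v) = f (isoProj h v) := by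
  have hv := h v
  rw [← isoProj_of_mem h (hf' _ (isoProj_mem h v))]
  change isoProj h (f v) = (isoProj h ∘ₗ f) (average (twist K χ ρ) v)
  have key : ∀ k : K, (isoProj h ∘ₗ f) (twist K χ ρ k v) = (isoProj h ∘ₗ f) v := by
    intro k
    obtain ⟨k', h1, h2⟩ := hf k v
    rw [twist_apply, map_smul, LinearMap.comp_apply, h2, isoProj_apply, h1, smul_smul]
    simp
  exact (apply_average_of_invariant _ key).symm

end Twist

end LocalShimura

/-! ### The Hecke algebra and averaged translates -/

namespace LocalShimura

section Generated

variable {G : Type} [Group G] (C : Subgroup G) (θ : C →* ℂˣ) (K : Subgroup G) (χ : K →* ℂˣ)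

/-- The elements of `C` that act by `θ` on `ρ g v` for every vector `v` on which `K` acts by `χ`. -/
def compat (g : G) : Subgroup C where
  carrier := {c | ∃ h : g⁻¹ * c * g ∈ K, χ ⟨_, h⟩ = θ c}
  mul_mem' {a b} := by
    rintro ⟨ha, ha'⟩ ⟨hb, hb'⟩
    have e : g⁻¹ * ↑(a * b) * g = (g⁻¹ * a * g) * (g⁻¹ * b * g) := by
      push_cast; group
    refine ⟨e ▸ mul_mem ha hb, ?_⟩
    rw [map_mul, ← ha', ← hb', ← map_mul]
    exact congrArg χ (Subtype.ext e)
  one_mem' := ⟨by simp, by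
    rw [map_one, ← map_one χ]
    exact congrArg χ (Subtype.ext (by simp))⟩
  inv_mem' {a} := by
    rintro ⟨ha, ha'⟩
    have e : g⁻¹ * ↑a⁻¹ * g = (g⁻¹ * a * g)⁻¹ := by push_cast; group
    refine ⟨e ▸ inv_mem ha, ?_⟩
    rw [map_inv, ← ha', ← map_inv]
    exact congrArg χ (Subtype.ext e)

/-- The condition that `θ`-twisted `C`-orbits are finite on representations generated by `V^χ`. -/
def OrbitFinite : Prop := ∀ g, (compat C θ K χ g).FiniteIndex

/-- The translates of `V^χ` span `V`. -/
def Generated {V : Type*} [AddCommGroup V] [Module ℂ V] (ρ : Representation ℂ G V) : Prop :=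
  Submodule.span ℂ {w : V | ∃ g : G, ∃ v ∈ isotypic K χ ρ, w = ρ g v} = ⊤

variable {C θ K χ} {V : Type*} [AddCommGroup V] [Module ℂ V] {ρ : Representation ℂ G V}

theorem compat_le {v : V} (hv : v ∈ isotypic K χ ρ) (g : G) :
    compat C θ K χ g ≤ fixer (twist C θ ρ) (ρ g v) := by
  rintro c ⟨h, h'⟩
  rw [mem_fixer, twist_apply_eq_iff, ← h', ← map_smul, ← mem_isotypic_iff.1 hv ⟨_, h⟩,
    ← Module.End.mul_apply, ← Module.End.mul_apply, ← map_mul, ← map_mul]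
  congr 2
  simp only
  group

theorem Generated.locallyFinite (hρ : Generated K χ ρ) (hC : OrbitFinite C θ K χ) :
    LocallyFinite C θ ρ := by
  intro v
  have hv : v ∈ Submodule.span ℂ {w : V | ∃ g : G, ∃ v ∈ isotypic K χ ρ, w = ρ g v} :=
    hρ ▸ Submodule.mem_top
  induction hv using Submodule.span_induction with
  | mem w hw =>
    obtain ⟨g, v, hv, rfl⟩ := hw
    have := hC g
    exact Subgroup.finiteIndex_of_le (compat_le hv g)
  | zero =>
    refine Subgroup.finiteIndex_of_le (H := ⊤) fun k _ => ?_
    rw [mem_fixer, map_zero]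
  | add v w _ _ hv hw =>
    refine Subgroup.finiteIndex_of_le
      (H := fixer (twist C θ ρ) v ⊓ fixer (twist C θ ρ) w) fun k hk => ?_
    rw [mem_fixer, map_add, hk.1, hk.2]
  | smul c v _ hv =>
    refine Subgroup.finiteIndex_of_le (H := fixer (twist C θ ρ) v) fun k hk => ?_
    rw [mem_fixer, map_smul, hk]

theorem Generated.induction (hρ : Generated K χ ρ) {P : Submodule ℂ V}
    (h : ∀ g, ∀ v ∈ isotypic K χ ρ, ρ g v ∈ P) (v : V) : v ∈ P := by
  have hv : v ∈ Submodule.span ℂ {w : V | ∃ g : G, ∃ v ∈ isotypic K χ ρ, w = ρ g v} :=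
    hρ ▸ Submodule.mem_top
  refine Submodule.span_le.2 ?_ hv
  rintro _ ⟨g, v, hv, rfl⟩
  exact h g v hv

end Generated

section Regular

variable {G : Type} [Group G] (K : Subgroup G) (χ : K →* ℂˣ)

/-- The functions `f` with `f(g k) = f(g) χ(k)⁻¹` that are supported on finitely many cosets `gK`. -/
def regular : Submodule ℂ (G → ℂ) where
  carrier := {f | (∀ (g : G) (k : K), f (g * k) = f g * ((χ k)⁻¹ : ℂˣ)) ∧
    ((fun g : G => (g : G ⧸ K)) '' Function.support f).Finite}
  add_mem' {f f'} hf hf' := by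
    refine ⟨fun g k => ?_, (hf.2.union hf'.2).subset ?_⟩
    · simp only [Pi.add_apply, hf.1, hf'.1]; ring
    · rw [← Set.image_union]
      exact Set.image_mono (Function.support_add f f')
  zero_mem' := ⟨fun _ _ => by simp, by simp⟩
  smul_mem' c f hf := by
    refine ⟨fun g k => ?_, hf.2.subset (Set.image_mono (Function.support_const_smul_subset c f))⟩
    simp only [Pi.smul_apply, smul_eq_mul, hf.1]; ring

variable {K χ}

theorem hecke_le_regular : heckeSubmodule K χ ≤ regular K χ := fun f hf =>
  ⟨fun g k => by simpa using hf.1 1 k g, hf.2⟩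

theorem leftReg_mem {f : G → ℂ} (hf : f ∈ regular K χ) (x : G) :
    HeckeAlgebra.leftReg x f ∈ regular K χ := by
  refine ⟨fun g k => ?_, (hf.2.image fun y => x • y).subset ?_⟩
  · change f (x⁻¹ * (g * k)) = f (x⁻¹ * g) * _
    rw [← mul_assoc, hf.1]
  · rintro _ ⟨g, hg, rfl⟩
    refine ⟨_, ⟨x⁻¹ * g, hg, rfl⟩, ?_⟩
    simp only
    rw [MulAction.Quotient.smul_mk, smul_eq_mul, mul_inv_cancel_left]

variable (K χ) in
/-- Left translation on `regular K χ`. -/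
def regRep : Representation ℂ G (regular K χ) :=
  (HeckeAlgebra.leftReg (G := G)).subrepresentation _ fun g _ hf => leftReg_mem hf g

theorem regRep_apply (x : G) (f : regular K χ) (y : G) :
    (regRep K χ x f : G → ℂ) y = (f : G → ℂ) (x⁻¹ * y) := rfl

variable (K χ) in
/-- The translate by `g` of the unit of the Hecke algebra: it is supported on `gK`. -/
noncomputable def translate (g : G) : regular K χ :=
  regRep K χ g ⟨(1 : HeckeAlgebra K χ).1, hecke_le_regular (1 : HeckeAlgebra K χ).2⟩

theorem translate_apply (g y : G) :
    (translate K χ g : G → ℂ) y = (1 : HeckeAlgebra K χ) (g⁻¹ * y) := rfl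

theorem regRep_translate (x g : G) : regRep K χ x (translate K χ g) = translate K χ (x * g) := by
  unfold translate
  rw [map_mul, Module.End.mul_apply]

theorem isotypic_regRep_iff {f : regular K χ} :
    f ∈ isotypic K χ (regRep K χ) ↔ (f : G → ℂ) ∈ heckeSubmodule K χ := by
  constructor
  · intro hf
    refine ⟨fun k k' g => ?_, f.2.2⟩
    have := congrFun (congrArg Subtype.val (hf k⁻¹)) g
    rw [regRep_apply] at this
    push_cast at this
    rw [inv_inv] at this
    rw [f.2.1, this]
    simp
  · intro hf
    have := HeckeAlgebra.mem_isotypic (⟨f, hf⟩ : HeckeAlgebra K χ)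
    exact fun k => Subtype.ext (this k)

theorem translate_one_mem : translate K χ 1 ∈ isotypic K χ (regRep K χ) := by
  rw [isotypic_regRep_iff]
  have : (translate K χ 1 : G → ℂ) = (1 : HeckeAlgebra K χ).1 := by
    funext y
    rw [translate_apply]; simp
  rw [this]
  exact (1 : HeckeAlgebra K χ).2

theorem translate_mul_right (g : G) (k : K) :
    translate K χ (g * k) = (χ k : ℂ) • translate K χ g := by
  rw [← mul_one (k : G), ← mul_assoc, mul_assoc, ← regRep_translate, ← regRep_translate,
    translate_one_mem k, map_smul, regRep_translate, mul_one]

section Act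

variable {V : Type*} [AddCommGroup V] [Module ℂ V] {ρ : Representation ℂ G V}

theorem regular_fin (f : regular K χ) (v : V) :
    (Function.support fun x : G ⧸ K => (f : G → ℂ) x.out • ρ x.out v).Finite :=
  f.2.2.subset fun x hx => ⟨x.out, fun h => hx (by simp [h]), Quotient.out_eq' x⟩

variable (K ρ) in
/-- The operator `f ↦ π(f) v` on functions `f` in `regular K χ`. -/
noncomputable def regularAct (v : V) : regular K χ →ₗ[ℂ] V where
  toFun f := heckeAct K ρ f v
  map_add' f f' := by
    unfold heckeAct
    rw [← finsum_add_distrib (regular_fin f v) (regular_fin f' v)]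
    refine finsum_congr fun x => ?_
    rw [← add_smul]; rfl
  map_smul' c f := by
    unfold heckeAct
    rw [RingHom.id_apply, smul_finsum]
    refine finsum_congr fun x => ?_
    rw [smul_smul]; rfl

theorem regularAct_apply (v : V) (f : regular K χ) : regularAct K ρ v f = heckeAct K ρ f v := rfl

theorem regularAct_regRep {v : V} (hv : v ∈ isotypic K χ ρ) (x : G) (f : regular K χ) :
    regularAct K ρ v (regRep K χ x f) = ρ x (regularAct K ρ v f) := by
  rw [regularAct_apply, regularAct_apply]
  unfold heckeAct
  rw [map_finsum (ρ x) (regular_fin f v), ← HeckeAlgebra.finsum_left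
    (F := fun y => (regRep K χ x f : G → ℂ) y • ρ y v) ?_ x]
  · refine finsum_congr fun y => ?_
    rw [map_smul, regRep_apply, inv_mul_cancel_left, map_mul, Module.End.mul_apply]
  · intro g k
    simp only [regRep_apply]
    rw [← mul_assoc, f.2.1, map_mul, Module.End.mul_apply, hv k, map_smul, smul_smul, mul_assoc]
    simp

theorem regularAct_translate {v : V} (hv : v ∈ isotypic K χ ρ) (g : G) :
    regularAct K ρ v (translate K χ g) = ρ g v := by
  unfold translate
  rw [regularAct_regRep hv, regularAct_apply]
  congr 1
  exact HeckeAlgebra.act_one hv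

end Act

/-- A function in `regular K χ` is the sum of its values times translates of the unit. -/
theorem heckeAct_regRep (f : regular K χ) :
    heckeAct K (regRep K χ) f (translate K χ 1) = f := by
  apply Subtype.ext
  funext g
  change (LinearMap.proj g ∘ₗ (regular K χ).subtype : regular K χ →ₗ[ℂ] ℂ) _ = _
  unfold heckeAct
  rw [map_finsum _ (regular_fin f (translate K χ 1))]
  have hF : ∀ (y : G) (k : K), (LinearMap.proj g ∘ₗ (regular K χ).subtype : regular K χ →ₗ[ℂ] ℂ)
      ((f : G → ℂ) (y * k) • regRep K χ (y * k) (translate K χ 1)) =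
      (LinearMap.proj g ∘ₗ (regular K χ).subtype : regular K χ →ₗ[ℂ] ℂ)
      ((f : G → ℂ) y • regRep K χ y (translate K χ 1)) := by
    intro y k
    rw [f.2.1, map_mul, Module.End.mul_apply, translate_one_mem k, map_smul (regRep K χ y), smul_smul,
      mul_assoc]
    simp
  rw [finsum_eq_single _ (g : G ⧸ K), HeckeAlgebra.out_eq (F := fun y =>
    (LinearMap.proj g ∘ₗ (regular K χ).subtype : regular K χ →ₗ[ℂ] ℂ)
      ((f : G → ℂ) y • regRep K χ y (translate K χ 1))) hF]
  · change (f : G → ℂ) g * (translate K χ 1 : G → ℂ) (g⁻¹ * g) = _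
    rw [translate_apply]
    have := HeckeAlgebra.one_apply_mem (χ := χ) 1
    simp at this
    simp [this]
  · intro x hx
    change (f : G → ℂ) x.out * (translate K χ 1 : G → ℂ) (x.out⁻¹ * g) = 0
    rw [translate_apply, HeckeAlgebra.one_apply_notMem, mul_zero]
    intro h
    refine hx ?_
    rw [← QuotientGroup.out_eq' x]
    exact QuotientGroup.eq.2 (by simpa using h)

theorem regular_mem_span (f : regular K χ) :
    f ∈ Submodule.span ℂ (Set.range (translate K χ)) := by
  rw [← heckeAct_regRep f]
  unfold heckeAct
  refine finsum_induction (· ∈ Submodule.span ℂ (Set.range (translate K χ)))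
    (Submodule.zero_mem _) (fun _ _ => Submodule.add_mem _) fun x => Submodule.smul_mem _ _ ?_
  rw [regRep_translate]
  exact Submodule.subset_span ⟨_, rfl⟩

theorem generated_regRep : Generated K χ (regRep K χ) := by
  refine Submodule.eq_top_iff'.2 fun f => Submodule.span_mono ?_ (regular_mem_span f)
  rintro _ ⟨g, rfl⟩
  exact ⟨g, _, translate_one_mem, by rw [regRep_translate, mul_one]⟩

variable (h : OrbitFinite K χ K χ)

/-- The projection of `regular K χ` onto the Hecke algebra. -/
noncomputable def heckeProj : regular K χ →ₗ[ℂ] HeckeAlgebra K χ where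
  toFun f := ⟨isoProj (generated_regRep.locallyFinite h) f,
    isotypic_regRep_iff.1 (isoProj_mem _ _)⟩
  map_add' a b := Subtype.ext
    (congrArg (fun f : regular K χ => (f : G → ℂ)) (map_add (isoProj (generated_regRep.locallyFinite h)) a b))
  map_smul' c a := Subtype.ext
    (congrArg (fun f : regular K χ => (f : G → ℂ)) (map_smul (isoProj (generated_regRep.locallyFinite h)) c a))

variable (K χ) in
/-- The inclusion of the Hecke algebra into `regular K χ`. -/
def heckeIncl : HeckeAlgebra K χ →ₗ[ℂ] regular K χ := Submodule.inclusion hecke_le_regular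

theorem heckeIncl_injective : Function.Injective (heckeIncl K χ) := Submodule.inclusion_injective _

theorem heckeIncl_mem (f : HeckeAlgebra K χ) : heckeIncl K χ f ∈ isotypic K χ (regRep K χ) :=
  isotypic_regRep_iff.2 f.2

theorem heckeIncl_proj (f : regular K χ) :
    heckeIncl K χ (heckeProj h f) = isoProj (generated_regRep.locallyFinite h) f := rfl

theorem heckeProj_incl (f : HeckeAlgebra K χ) : heckeProj h (heckeIncl K χ f) = f := by
  apply heckeIncl_injective
  rw [heckeIncl_proj, isoProj_of_mem _ (heckeIncl_mem f)]

theorem heckeProj_regRep (k : K) (f : regular K χ) :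
    heckeProj h (regRep K χ k f) = (χ k : ℂ) • heckeProj h f := by
  apply heckeIncl_injective
  rw [map_smul, heckeIncl_proj, heckeIncl_proj, isoProj_apply]

/-- The averaged translate `e_χ g e_χ`, an element of the Hecke algebra supported on `K g K`. -/
noncomputable def bracket (g : G) : HeckeAlgebra K χ := heckeProj h (translate K χ g)

theorem bracket_mul_left (k : K) (g : G) : bracket h (k * g) = (χ k : ℂ) • bracket h g := by
  rw [bracket, bracket, ← regRep_translate, heckeProj_regRep]

theorem bracket_mul_right (g : G) (k : K) : bracket h (g * k) = (χ k : ℂ) • bracket h g := by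
  rw [bracket, bracket, translate_mul_right, map_smul]

theorem bracket_eq_zero {g : G} {k k' : K} (e : k * g = g * k') (hk : χ k ≠ χ k') :
    bracket h g = 0 := by
  have h1 := bracket_mul_left h k g
  rw [e, bracket_mul_right] at h1
  have h2 : ((χ k' : ℂ) - χ k) • bracket h g = 0 := by rw [sub_smul, h1, sub_self]
  exact (smul_eq_zero.1 h2).resolve_left fun h => hk (Units.ext (sub_eq_zero.1 h).symm)

theorem bracket_support {g y : G} (hy : bracket h g y ≠ 0) :
    y ∈ DoubleCoset.doubleCoset g (K : Set G) K := by
  by_contra hn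
  refine hy ?_
  let P : Submodule ℂ (regular K χ) := LinearMap.ker
    (LinearMap.proj y ∘ₗ (regular K χ).subtype : regular K χ →ₗ[ℂ] ℂ)
  refine isoProj_mem_of (generated_regRep.locallyFinite h) (P := P) fun k => ?_
  change (regRep K χ k (translate K χ g) : G → ℂ) y = 0
  rw [regRep_translate, translate_apply]
  refine HeckeAlgebra.one_apply_notMem fun hm => hn ?_
  rw [DoubleCoset.mem_doubleCoset]
  exact ⟨k, k.2, _, hm, by group⟩

section Act

variable {V : Type*} [AddCommGroup V] [Module ℂ V] {ρ : Representation ℂ G V}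

/-- The averaged translate `e_χ g e_χ` acts on `V^χ` as `e_χ g`. -/
theorem heckeAct_bracket (hρ : LocallyFinite K χ ρ) {v : V} (hv : v ∈ isotypic K χ ρ) (g : G) :
    heckeAct K ρ (bracket h g) v = isoProj hρ (ρ g v) := by
  change regularAct K ρ v (isoProj (generated_regRep.locallyFinite h) (translate K χ g)) = _
  rw [map_isoProj _ hρ _ fun k f => regularAct_regRep hv k f, regularAct_translate hv]

end Act

theorem heckeIncl_mul (f₁ f₂ : HeckeAlgebra K χ) :
    heckeIncl K χ (f₁ * f₂) = heckeAct K (regRep K χ) f₁ (heckeIncl K χ f₂) := by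
  apply Subtype.ext
  change ((f₁ * f₂ : HeckeAlgebra K χ) : G → ℂ) = _
  rw [HeckeAlgebra.coe_mul]
  have := map_finsum (regular K χ).subtype (regular_fin (ρ := regRep K χ)
    (heckeIncl K χ f₁) (heckeIncl K χ f₂))
  exact this.symm

theorem bracket_mul (g : G) (f : HeckeAlgebra K χ) :
    bracket h g * f = heckeProj h (regRep K χ g (heckeIncl K χ f)) := by
  apply heckeIncl_injective
  rw [heckeIncl_mul, heckeAct_bracket h (generated_regRep.locallyFinite h)
    (heckeIncl_mem f)]
  rfl

theorem span_bracket : Submodule.span ℂ (Set.range (bracket h)) = ⊤ := by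
  rw [Submodule.eq_top_iff']
  intro f
  rw [← heckeProj_incl h f]
  have h2 := Submodule.mem_map_of_mem (f := heckeProj h) (regular_mem_span (heckeIncl K χ f))
  rw [Submodule.map_span, ← Set.range_comp] at h2
  exact h2

/-- `[x] [g]` is the mean value of `χ(k)⁻¹ [x k g]` over `k ∈ K`. -/
theorem bracket_mul_bracket (x g : G) : bracket h x * bracket h g =
    ((compat K χ K χ g).index : ℂ)⁻¹ • ∑ᶠ k : K ⧸ compat K χ K χ g,
      (((χ k.out)⁻¹ : ℂˣ) : ℂ) • bracket h (x * k.out * g) := by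
  have hg := h g
  have e1 : heckeIncl K χ (bracket h g) =
      ((compat K χ K χ g).index : ℂ)⁻¹ • ∑ᶠ k : K ⧸ compat K χ K χ g,
      (((χ k.out)⁻¹ : ℂˣ) : ℂ) • translate K χ (k.out * g) := by
    have h1 : compat K χ K χ g ≤ fixer (twist K χ (regRep K χ)) (translate K χ g) := by
      have := compat_le (C := K) (θ := χ) (translate_one_mem (K := K) (χ := χ)) g
      rwa [regRep_translate, mul_one] at this
    rw [bracket, heckeIncl_proj]
    refine (average_eq h1).trans ?_
    simp only [twist_apply, regRep_translate]
  rw [bracket_mul, e1, map_smul, map_smul, map_finsum _ (Set.toFinite _),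
    map_finsum _ (Set.toFinite _)]
  simp only [map_smul, regRep_translate, ← mul_assoc]
  rfl

/-- Products of averaged translates multiply whenever `K` is the product of a part that may be
moved to the left of `g` and a part that may be moved to the right of `x`. -/
theorem bracket_mul_of_decomp {g x : G}
    (hd : ∀ k : K, ∃ k₁ k₂ : K, k = k₁ * k₂ ∧ k₁⁻¹ ∈ compat K χ K χ g⁻¹ ∧ k₂ ∈ compat K χ K χ x) :
    bracket h g * bracket h x = bracket h (g * x) := by
  have hx := h x
  rw [bracket_mul_bracket]
  have key : ∀ k : K, (((χ k)⁻¹ : ℂˣ) : ℂ) • bracket h (g * k * x) = bracket h (g * x) := by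
    intro k
    obtain ⟨k₁, k₂, rfl, h1, h2⟩ := hd k
    obtain ⟨h1, h1'⟩ := inv_mem h1
    obtain ⟨h2, h2'⟩ := h2
    simp only [inv_inv] at h1 h1'
    have e : g * ↑(k₁ * k₂) * x = (⟨_, h1⟩ : K) * (g * x) * (⟨_, h2⟩ : K) := by
      push_cast
      group
    rw [e, bracket_mul_right, bracket_mul_left, h1', h2', smul_smul, smul_smul, map_mul]
    simp [mul_comm]
  simp only [key]
  cases nonempty_fintype (K ⧸ compat K χ K χ x)
  have h0 := hx.index_ne_zero
  rw [finsum_eq_sum_of_fintype, Finset.sum_const, ← Nat.cast_smul_eq_nsmul ℂ, smul_smul,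
    Finset.card_univ, ← Nat.card_eq_fintype_card, ← Subgroup.index,
    inv_mul_cancel₀ (by exact_mod_cast h0), one_smul]

end Regular

end LocalShimura

/-! ### Modules of the Hecke algebra and representations generated by `V^χ` -/

namespace LocalShimura

section Extension

variable {G : Type} [Group G] (K : Subgroup G) (χ : K →* ℂˣ)

/-- In a representation generated by `V^χ`, every nonzero subrepresentation meets `V^χ`. -/
def TypeProperty : Prop :=
  ∀ (V : Type) [AddCommGroup V] [Module ℂ V] (ρ : Representation ℂ G V), Generated K χ ρ →
    ∀ P : Submodule ℂ V, (∀ g, ∀ v ∈ P, ρ g v ∈ P) → (∀ v ∈ P, v ∈ isotypic K χ ρ → v = 0) → P = ⊥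

variable {K χ} {V W : Type} [AddCommGroup V] [Module ℂ V] [AddCommGroup W] [Module ℂ W]
  {ρ : Representation ℂ G V} {σ : Representation ℂ G W}

/-- The projection of a locally finite representation onto the subspace `V^χ`. -/
noncomputable def isoProj' (h : LocallyFinite K χ ρ) : V →ₗ[ℂ] isotypic K χ ρ :=
  (isoProj h).codRestrict _ (isoProj_mem h)

theorem bracket_smul (h : OrbitFinite K χ K χ) (hρ : LocallyFinite K χ ρ) (g : G)
    (v : isotypic K χ ρ) : bracket h g • v = isoProj' hρ (ρ g v) :=
  Subtype.ext (heckeAct_bracket h hρ v.2 g)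

/-- The graph of the extension to `V` of a linear map `V^χ → W^χ`. -/
def extensionGraph (φ : isotypic K χ ρ →ₗ[HeckeAlgebra K χ] isotypic K χ σ) :
    Submodule ℂ (V × W) :=
  Submodule.span ℂ {p | ∃ (g : G) (v : isotypic K χ ρ), p = (ρ g v, σ g (φ v))}

theorem extensionGraph_stable (φ : isotypic K χ ρ →ₗ[HeckeAlgebra K χ] isotypic K χ σ) (g : G)
    {p : V × W} (hp : p ∈ extensionGraph φ) : (ρ g p.1, σ g p.2) ∈ extensionGraph φ := by
  have h1 : extensionGraph φ ≤ (extensionGraph φ).comap ((ρ g).prodMap (σ g)) := by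
    refine Submodule.span_le.2 ?_
    rintro _ ⟨x, v, rfl⟩
    refine Submodule.subset_span ⟨g * x, v, ?_⟩
    simp [map_mul]
  exact h1 hp

theorem extensionGraph_proj (h : OrbitFinite K χ K χ) (hρ : LocallyFinite K χ ρ)
    (hσ : LocallyFinite K χ σ) (φ : isotypic K χ ρ →ₗ[HeckeAlgebra K χ] isotypic K χ σ)
    {p : V × W} (hp : p ∈ extensionGraph φ) : φ (isoProj' hρ p.1) = isoProj' hσ p.2 := by
  have h1 : extensionGraph φ ≤ LinearMap.ker
      ((φ.restrictScalars ℂ) ∘ₗ isoProj' hρ ∘ₗ LinearMap.fst ℂ V W -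
        isoProj' hσ ∘ₗ LinearMap.snd ℂ V W) := by
    refine Submodule.span_le.2 ?_
    rintro _ ⟨x, v, rfl⟩
    change φ (isoProj' hρ (ρ x v)) - isoProj' hσ (σ x (φ v)) = 0
    rw [← bracket_smul h hρ, ← bracket_smul h hσ, map_smul, sub_self]
  exact sub_eq_zero.1 (h1 hp)

/-- A module homomorphism `V^χ → W^χ` extends to an intertwining map `V → W`. -/
theorem exists_extension (h : OrbitFinite K χ K χ) (ht : TypeProperty K χ) (hρ : Generated K χ ρ)
    (hσ : Generated K χ σ) (φ : isotypic K χ ρ →ₗ[HeckeAlgebra K χ] isotypic K χ σ) :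
    ∃ f : ρ.IntertwiningMap σ, ∀ v : isotypic K χ ρ, f v = φ v := by
  have lρ := hρ.locallyFinite h
  have lσ := hσ.locallyFinite h
  have hker : ∀ w : W, ((0 : V), w) ∈ extensionGraph φ → w = 0 := by
    have := ht W σ hσ ((extensionGraph φ).comap (LinearMap.inr ℂ V W)) (fun g w hw => by
      have := extensionGraph_stable φ g hw
      simpa using this) (fun w hw hw' => by
      have := extensionGraph_proj h lρ lσ φ hw
      have h1 : isoProj lσ w = 0 := by
        change φ (isoProj' lρ 0) = isoProj' lσ w at this
        rw [map_zero, map_zero] at this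
        exact congrArg Subtype.val this.symm
      rwa [isoProj_of_mem lσ hw'] at h1)
    intro w hw
    have h1 : w ∈ (extensionGraph φ).comap (LinearMap.inr ℂ V W) := hw
    rw [this] at h1
    exact h1
  let p : extensionGraph φ →ₗ[ℂ] V := LinearMap.fst ℂ V W ∘ₗ (extensionGraph φ).subtype
  have hp : Function.Bijective p := by
    constructor
    · rw [← LinearMap.ker_eq_bot, LinearMap.ker_eq_bot']
      rintro ⟨⟨v, w⟩, hm⟩ h0
      change v = 0 at h0
      subst h0
      have := hker w hm
      subst this
      rfl
    · intro v
      refine hρ.induction (P := LinearMap.range p) (fun g v hv => ?_) v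
      exact ⟨⟨(ρ g v, σ g (φ ⟨v, hv⟩)), Submodule.subset_span ⟨g, ⟨v, hv⟩, rfl⟩⟩, rfl⟩
  let e := LinearEquiv.ofBijective p hp
  let f : V →ₗ[ℂ] W := LinearMap.snd ℂ V W ∘ₗ (extensionGraph φ).subtype ∘ₗ e.symm.toLinearMap
  have hf : ∀ q : extensionGraph φ, f q.1.1 = q.1.2 := by
    intro q
    have : e.symm q.1.1 = q := e.symm_apply_apply q
    change (e.symm q.1.1).1.2 = _
    rw [this]
  refine ⟨LinearMap.intertwiningMap_of_isIntertwiningMap ρ σ f fun g v => ?_, fun v => ?_⟩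
  · have h1 := extensionGraph_stable φ g (e.symm v).2
    have h2 := hf ⟨_, h1⟩
    have h3 : (e.symm v).1.1 = v := e.apply_symm_apply v
    simp only [h3] at h2
    exact h2
  · have h1 : ((v : V), (φ v : W)) ∈ extensionGraph φ :=
      Submodule.subset_span ⟨1, v, by simp⟩
    exact hf ⟨_, h1⟩

end Extension

section Induced

variable {G : Type} [Group G] {K : Subgroup G} {χ : K →* ℂˣ} (h : OrbitFinite K χ K χ)
variable (M : Type) [AddCommGroup M] [Module ℂ M] [Module (HeckeAlgebra K χ) M]
  [IsScalarTower ℂ (HeckeAlgebra K χ) M]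

/-- Right translation of `M`-valued functions on `G`. -/
def rightReg : Representation ℂ G (G → M) where
  toFun g :=
    { toFun := fun F x => F (x * g)
      map_add' := fun _ _ => rfl
      map_smul' := fun _ _ => rfl }
  map_one' := by ext; simp
  map_mul' g h := by ext; simp [mul_assoc]

/-- The function `x ↦ [x] m`, the matrix coefficient `x ↦ e_χ x m` of a vector
`m` on which `K` acts by `χ`. -/
noncomputable def coeffFun : M →ₗ[ℂ] (G → M) where
  toFun m x := bracket h x • m
  map_add' m m' := by funext x; exact smul_add _ _ _
  map_smul' c m := by funext x; exact smul_comm _ _ _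

/-- The span of the right translates of the functions `x ↦ [x] m`. -/
noncomputable def inducedSpace : Submodule ℂ (G → M) :=
  Submodule.span ℂ {F | ∃ (g : G) (m : M), F = rightReg M g (coeffFun h M m)}

theorem rightReg_mem (g : G) {F : G → M} (hF : F ∈ inducedSpace h M) :
    rightReg M g F ∈ inducedSpace h M := by
  refine Submodule.span_induction (p := fun F _ => rightReg M g F ∈ inducedSpace h M)
    ?_ ?_ ?_ ?_ hF
  · rintro F ⟨x, m, rfl⟩
    have e : rightReg M g (rightReg M x (coeffFun h M m)) = rightReg M (g * x) (coeffFun h M m) :=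
      funext fun y => congrArg (coeffFun h M m) (mul_assoc y g x)
    rw [e]
    exact Submodule.subset_span ⟨_, _, rfl⟩
  · rw [map_zero]
    exact Submodule.zero_mem _
  · intro F F' _ _ h1 h2
    rw [map_add]
    exact Submodule.add_mem _ h1 h2
  · intro c F _ h1
    rw [map_smul]
    exact Submodule.smul_mem _ c h1

/-- The representation generated by a Hecke module `M`, realized on `M`-valued functions on `G`. -/
noncomputable def inducedRep : Representation ℂ G (inducedSpace h M) :=
  (rightReg M).subrepresentation _ fun g _ hF => rightReg_mem h M g hF

/-- The embedding of `M` into the representation it generates. -/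
noncomputable def coeffVec : M →ₗ[ℂ] inducedSpace h M :=
  (coeffFun h M).codRestrict _ fun m => Submodule.subset_span ⟨1, m, by simp⟩

variable {M}

theorem inducedRep_coeffVec (g : G) (m : M) (x : G) :
    (inducedRep h M g (coeffVec h M m) : G → M) x = bracket h (x * g) • m := rfl

theorem coeffVec_mem (m : M) : coeffVec h M m ∈ isotypic K χ (inducedRep h M) := by
  intro k
  apply Subtype.ext
  funext x
  rw [inducedRep_coeffVec, bracket_mul_right, smul_assoc]
  rfl

theorem coeffVec_injective : Function.Injective (coeffVec h M) := by
  intro m m' e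
  have h1 : (bracket h 1 : HeckeAlgebra K χ) = 1 := by
    rw [bracket, ← heckeProj_incl h 1]
    congr 1
    apply Subtype.ext
    funext y
    rw [translate_apply]
    simp
    rfl
  have h2 := congrFun (congrArg Subtype.val e) 1
  change bracket h 1 • m = bracket h 1 • m' at h2
  rwa [h1, one_smul, one_smul] at h2

theorem span_coeffVec : Submodule.span ℂ
    {F | ∃ (g : G) (m : M), F = inducedRep h M g (coeffVec h M m)} = ⊤ := by
  have h1 := Submodule.span_span_coe_preimage (R := ℂ)
    (s := {F : G → M | ∃ (g : G) (m : M), F = rightReg M g (coeffFun h M m)})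
  refine Eq.trans ?_ h1
  congr 1
  ext F
  constructor
  · rintro ⟨g, m, rfl⟩
    exact ⟨g, m, rfl⟩
  · rintro ⟨g, m, e⟩
    exact ⟨g, m, Subtype.ext e⟩

theorem generated_inducedRep : Generated K χ (inducedRep h M) := by
  refine Submodule.eq_top_iff'.2 fun F => ?_
  have hF : F ∈ Submodule.span ℂ {F | ∃ (g : G) (m : M), F = inducedRep h M g (coeffVec h M m)} :=
    span_coeffVec h (M := M) ▸ Submodule.mem_top
  refine Submodule.span_mono ?_ hF
  rintro _ ⟨g, m, rfl⟩
  exact ⟨g, _, coeffVec_mem h m, rfl⟩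

theorem isoProj_coeffVec (g : G) (m : M) :
    isoProj ((generated_inducedRep h (M := M)).locallyFinite h) (inducedRep h M g (coeffVec h M m)) =
      coeffVec h M (bracket h g • m) := by
  have hg := h g
  have h1 := average_eq (compat_le (C := K) (θ := χ) (coeffVec_mem h m) g)
  refine h1.trans (Subtype.ext (funext fun x => ?_))
  let ev : inducedSpace h M →ₗ[ℂ] M := LinearMap.proj x ∘ₗ (inducedSpace h M).subtype
  have hev : ∀ F : inducedSpace h M, (F : G → M) x = ev F := fun _ => rfl
  rw [hev]
  change _ = bracket h x • bracket h g • m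
  rw [smul_smul, bracket_mul_bracket]
  let act : HeckeAlgebra K χ →ₗ[ℂ] M :=
    { toFun := fun f => f • m
      map_add' := fun _ _ => add_smul _ _ _
      map_smul' := fun c f => smul_assoc c f m }
  change _ = act _
  rw [map_smul, map_smul, map_finsum _ (Set.toFinite _), map_finsum _ (Set.toFinite _)]
  congr 1
  refine finsum_congr fun k => ?_
  rw [map_smul, twist_apply, map_smul, ← Module.End.mul_apply, ← map_mul, mul_assoc]
  rfl

theorem exists_coeffVec {F : inducedSpace h M} (hF : F ∈ isotypic K χ (inducedRep h M)) :
    ∃ m, coeffVec h M m = F := by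
  let e := isoProj ((generated_inducedRep h (M := M)).locallyFinite h)
  have h1 : (⊤ : Submodule ℂ (inducedSpace h M)) ≤ (LinearMap.range (coeffVec h M)).comap e := by
    rw [← span_coeffVec h]
    refine Submodule.span_le.2 ?_
    rintro _ ⟨g, m, rfl⟩
    exact ⟨_, (isoProj_coeffVec h g m).symm⟩
  obtain ⟨m, hm⟩ := h1 (Submodule.mem_top (x := F))
  exact ⟨m, hm.trans (isoProj_of_mem _ hF)⟩

/-- A Hecke module `M` is recovered as the vectors of type `χ` in the representation it generates. -/
noncomputable def inducedEquiv : M ≃ₗ[HeckeAlgebra K χ] isotypic K χ (inducedRep h M) :=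
  LinearEquiv.ofBijective
    { toFun := fun m => ⟨coeffVec h M m, coeffVec_mem h m⟩
      map_add' := fun m m' => Subtype.ext (map_add _ m m')
      map_smul' := fun f m => by
        have hf : f ∈ Submodule.span ℂ (Set.range (bracket h)) :=
          span_bracket h ▸ Submodule.mem_top
        rw [RingHom.id_apply]
        induction hf using Submodule.span_induction with
        | mem f hf =>
          obtain ⟨g, rfl⟩ := hf
          rw [bracket_smul h ((generated_inducedRep h).locallyFinite h)]
          exact Subtype.ext (isoProj_coeffVec h g m).symm
        | zero => rw [zero_smul, zero_smul]; exact Subtype.ext (map_zero _)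
        | add f f' _ _ hf hf' =>
          rw [add_smul, add_smul, ← hf, ← hf']
          exact Subtype.ext (map_add _ _ _)
        | smul c f _ hf =>
          rw [smul_assoc, smul_assoc, ← hf]
          exact Subtype.ext (map_smul _ _ _) }
    ⟨fun m m' e => coeffVec_injective h (congrArg Subtype.val e), fun F => by
      obtain ⟨m, hm⟩ := exists_coeffVec h F.2
      exact ⟨m, Subtype.ext hm⟩⟩

end Induced

section Equivalence

variable {G : Type} [Group G] [TopologicalSpace G] {K : Subgroup G} {χ : K →* ℂˣ}

/-- `V ↦ V^χ` is an equivalence if `(K, χ)` has the type property and every representation generated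
by a finite dimensional `V^χ` is smooth and admissible. -/
theorem isEquivalence_isotypicFunctor (hχ : IsOpen (χ.ker.map K.subtype : Set G))
    (h : OrbitFinite K χ K χ) (ht : TypeProperty K χ)
    (hs : ∀ (V : Type) [AddCommGroup V] [Module ℂ V] (ρ : Representation ℂ G V), Generated K χ ρ →
      ∀ v, IsOpen {g : G | ρ g v = v})
    (ha : ∀ (V : Type) [AddCommGroup V] [Module ℂ V] (ρ : Representation ℂ G V), Generated K χ ρ →
      FiniteDimensional ℂ (isotypic K χ ρ) → ∀ U : Subgroup G, IsOpen (U : Set G) →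
      FiniteDimensional ℂ (isotypic U (1 : U →* ℂˣ) ρ)) :
    (isotypicFunctor hχ).IsEquivalence where
  faithful := ⟨by
    intro V W f g e
    apply ObjectProperty.hom_ext
    apply Rep.hom_ext
    have h1 : ∀ v ∈ isotypic K χ V.obj.ρ, f.hom.hom v = g.hom.hom v := by
      intro v hv
      have h2 := congrArg (fun F => (ModuleCat.Hom.hom F.hom) (⟨v, hv⟩ : isotypic K χ V.obj.ρ)) e
      exact congrArg Subtype.val h2
    ext v
    have h3 := Generated.induction V.property.generated
      (P := LinearMap.ker (f.hom.hom.toLinearMap - g.hom.hom.toLinearMap)) (fun x v hv => by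
        change f.hom.hom (V.obj.ρ x v) - g.hom.hom (V.obj.ρ x v) = 0
        rw [Rep.hom_comm_apply, Rep.hom_comm_apply, h1 v hv, sub_self]) v
    exact sub_eq_zero.1 h3⟩
  full := ⟨by
    intro V W F
    obtain ⟨f, hf⟩ := exists_extension h ht V.property.generated W.property.generated
      (ModuleCat.Hom.hom F.hom)
    refine ⟨ObjectProperty.homMk (Rep.ofHom f), ?_⟩
    apply ObjectProperty.hom_ext
    ext v
    exact Subtype.ext (hf v)⟩
  essSurj := ⟨by
    intro M
    let : Module ℂ M.obj := Module.compHom M.obj (algebraMap ℂ (HeckeAlgebra K χ))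
    have : IsScalarTower ℂ (HeckeAlgebra K χ) M.obj := ⟨fun c f m => by
      rw [Algebra.smul_def, mul_smul]; rfl⟩
    have : FiniteDimensional ℂ M.obj := M.property
    let e := inducedEquiv h (M := M.obj)
    have hfin : FiniteDimensional ℂ (isotypic K χ (inducedRep h M.obj)) :=
      (e.restrictScalars ℂ).finiteDimensional
    refine ⟨⟨Rep.of (inducedRep h M.obj), ?_, ?_, ?_⟩, ⟨ObjectProperty.isoMk _ ?_⟩⟩
    · exact hs _ _ (generated_inducedRep h)
    · exact ha _ _ (generated_inducedRep h) hfin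
    · exact generated_inducedRep h
    · exact (LinearEquiv.toModuleIso e).symm⟩

end Equivalence

end LocalShimura

/-! ### Groups with an Iwahori-like pair `(K, χ)` -/

namespace LocalShimura

/-- The structure of `SL₂` or `PGL₂` over `ℚ₂`, or of a cover of such a group, relative to a
character `χ` of an Iwahori-like subgroup `K`: the unipotent elements `n b` (upper triangular) and
`n' b` (lower triangular), a diagonal element `t` such that conjugation by `t` contracts the lower
triangular ones, and conjugation by `t⁻¹` the upper triangular ones, by `q = 2` or `q = 4`, the Weyl element `w`, a maximal compact subgroup `J`, and a decreasing sequence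
`U` of normal subgroups of finite index of `J`, which will be a basis of neighbourhoods of `1`. -/
structure IwahoriDatum {G : Type} [Group G] (K : Subgroup G) (χ : K →* ℂˣ) where
  /-- The factor by which conjugation by `t⁻¹` contracts the upper triangular unipotent elements. -/
  q : ℕ
  hq : q = 2 ∨ q = 4
  /-- The maximal compact subgroup. -/
  J : Subgroup G
  /-- The congruence subgroups. -/
  U : ℕ → Subgroup G
  /-- The upper triangular unipotent elements. -/
  n : ℚ_[2] → G
  /-- The lower triangular unipotent elements. -/
  n' : ℚ_[2] → G
  /-- The diagonal element. -/
  t : G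
  /-- The Weyl element. -/
  w : G
  K_le : K ≤ J
  U_le : U 0 ≤ K
  χ_U : ∀ k : K, (k : G) ∈ U 0 → χ k = 1
  U_anti : Antitone U
  U_normal : ∀ m, ∀ j ∈ J, ∀ x ∈ U m, j * x * j⁻¹ ∈ U m
  U_index : ∀ m, (U m).relIndex J ≠ 0
  U_conj : ∀ (g : G) m, ∃ m', ∀ x ∈ U m', g * x * g⁻¹ ∈ U m
  n_add : ∀ a b, n (a + b) = n a * n b
  n'_add : ∀ a b, n' (a + b) = n' a * n' b
  n_mem : ∀ b, ‖b‖ ≤ 1 → n b ∈ K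
  χ_n : ∀ b (h : ‖b‖ ≤ 1), χ ⟨n b, n_mem b h⟩ = 1
  n_mem_U : ∀ b, ‖b‖ ≤ ‖(q : ℚ_[2])‖ → n b ∈ U 0
  n'_mem : ∀ b, ‖b‖ ≤ 1 → n' b ∈ J
  n'_mem_U : ∀ b, ‖b‖ ≤ ‖(q : ℚ_[2])‖ → n' b ∈ U 0
  n'_small : ∀ m, ∃ m', ∀ i ≥ m', ∀ b, ‖b‖ ≤ 1 → n' (q ^ i * b) ∈ U m
  t_n : ∀ b, t⁻¹ * n b * t = n (q * b)
  t_n' : ∀ b, t * n' b * t⁻¹ = n' (q * b)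
  w_mem : w ∈ J
  w_n : ∀ b, w * n b * w⁻¹ = n' (-b)
  w_t : w * t = t⁻¹ * w
  w_sq_mem : w * w ∈ K
  w_sq_comm : ∀ g, w * w * g = g * (w * w)
  u_conj : ∀ k : K, ∃ k' : K, t * w * k = k' * (t * w) ∧ χ k' = χ k
  K_decomp : ∀ k : K, ∃ z : K, ∃ b l, (∀ g, z * g = g * (z : G)) ∧ ‖b‖ ≤ 1 ∧
    (∀ m : ℕ, t ^ m * l * (t ^ m)⁻¹ ∈ U 0) ∧ (k : G) = z * n b * l
  kappa : ∀ c, c ≠ 0 → n' c⁻¹ * n 1 * n' (-c⁻¹) = n c * n' (-(c ^ 2)⁻¹) * n (-c)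
  iwasawa : ∀ g, ∃ b, ∃ m : ℤ, ∃ j ∈ J, g = n b * t ^ m * j
  cartan : ∀ g, ∃ j ∈ J, ∃ m : ℕ, ∃ j' ∈ J, g = j * t ^ m * j'
  bruhat : ∀ g, (∃ k k' : K, ∃ m : ℤ, g = k * t ^ m * k' ∨ g = k * (t ^ m * w) * k') ∨
    ∃ k k' : K, k * g = g * k' ∧ χ k ≠ χ k'
  disjoint : ∀ (m m' : ℤ) (ε ε' : Bool) (k k' : K),
    k * (t ^ m * if ε then w else 1) * k' = t ^ m' * (if ε' then w else 1) → m = m' ∧ ε = ε'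
  n'_notMem : ∀ j : ℕ, 0 < j → j < q → n' j ∉ K

namespace IwahoriDatum

variable {G : Type} [Group G] {K : Subgroup G} {χ : K →* ℂˣ} (D : IwahoriDatum K χ)

include D

theorem n_zero : D.n 0 = 1 := by
  have := D.n_add 0 0
  rwa [add_zero, eq_comm, mul_eq_left] at this

theorem n_neg (b : ℚ_[2]) : D.n (-b) = (D.n b)⁻¹ := by
  rw [eq_comm, inv_eq_iff_mul_eq_one, ← D.n_add, add_neg_cancel, n_zero]

theorem n'_zero : D.n' 0 = 1 := by
  have := D.n'_add 0 0
  rwa [add_zero, eq_comm, mul_eq_left] at this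

theorem n'_neg (b : ℚ_[2]) : D.n' (-b) = (D.n' b)⁻¹ := by
  rw [eq_comm, inv_eq_iff_mul_eq_one, ← D.n'_add, add_neg_cancel, n'_zero]

theorem n_natCast (j : ℕ) : D.n j = D.n 1 ^ j := by
  induction j with
  | zero => rw [Nat.cast_zero, n_zero, pow_zero]
  | succ j ih => rw [Nat.cast_succ, D.n_add, ih, pow_succ]

theorem q_pos : 0 < D.q := by rcases D.hq with h | h <;> omega

theorem q_cast_ne : (D.q : ℂ) ≠ 0 := by exact_mod_cast D.q_pos.ne'

theorem U_le_zero (m : ℕ) : D.U m ≤ D.U 0 := D.U_anti (Nat.zero_le m)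

theorem U_le_J (m : ℕ) : D.U m ≤ D.J := (D.U_le_zero m).trans (D.U_le.trans D.K_le)

theorem U_conj' (m : ℕ) {j x : G} (hj : j ∈ D.J) (hx : x ∈ D.U m) : j⁻¹ * x * j ∈ D.U m := by
  have := D.U_normal m j⁻¹ (inv_mem hj) x hx
  rwa [inv_inv] at this

theorem t_pow_n' (m : ℕ) (b : ℚ_[2]) :
    D.t ^ m * D.n' b = D.n' (D.q ^ m * b) * D.t ^ m := by
  induction m generalizing b with
  | zero => simp
  | succ m ih =>
    rw [pow_succ, mul_assoc, show D.t * D.n' b = D.n' (D.q * b) * D.t by rw [← D.t_n']; group,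
      ← mul_assoc, ih, mul_assoc, pow_succ]
    congr 2
    ring

theorem n_t_pow (m : ℕ) (b : ℚ_[2]) :
    D.n b * D.t ^ m = D.t ^ m * D.n (D.q ^ m * b) := by
  induction m generalizing b with
  | zero => simp
  | succ m ih =>
    rw [pow_succ, ← mul_assoc, ih, mul_assoc, mul_assoc,
      show D.n (D.q ^ m * b) * D.t = D.t * D.n (D.q * (D.q ^ m * b)) by rw [← D.t_n]; group]
    congr 3
    ring

theorem orbitFinite_of_le {C : Subgroup G} {θ : C →* ℂˣ} (hC : C ≤ D.J)
    (hθ : ∀ c : C, (c : G) ∈ D.U 0 → θ c = 1) : OrbitFinite C θ K χ := by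
  intro g
  obtain ⟨m, hm⟩ := D.U_conj g⁻¹ 0
  have h1 : (D.U m).relIndex C ≠ 0 := fun h0 =>
    D.U_index m (Subgroup.relIndex_eq_zero_of_le_right hC h0)
  have h2 : ((D.U m).subgroupOf C).FiniteIndex := ⟨h1⟩
  refine Subgroup.finiteIndex_of_le (H := (D.U m).subgroupOf C) fun c hc => ?_
  have h3 := hm _ (Subgroup.mem_subgroupOf.1 hc)
  rw [inv_inv] at h3
  exact ⟨D.U_le h3, by
    rw [D.χ_U _ h3, hθ c (D.U_le_zero m (Subgroup.mem_subgroupOf.1 hc))]⟩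

theorem orbitFinite : OrbitFinite K χ K χ := D.orbitFinite_of_le D.K_le D.χ_U

theorem orbitFinite_U (m : ℕ) : OrbitFinite (D.U m) 1 K χ :=
  D.orbitFinite_of_le (D.U_le_J m) fun _ _ => rfl

end IwahoriDatum
end LocalShimura

/-! ### Representations generated by `V^χ`: invariants of congruence subgroups -/

namespace LocalShimura
namespace IwahoriDatum

variable {G : Type} [Group G] {K : Subgroup G} {χ : K →* ℂˣ} (D : IwahoriDatum K χ)
  {V : Type} [AddCommGroup V] [Module ℂ V] {ρ : Representation ℂ G V}

omit D in
theorem apply_central (hρ : Generated K χ ρ) {z : K} (hz : ∀ g, z * g = g * (z : G)) (v : V) :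
    ρ z v = (χ z : ℂ) • v := by
  have h1 := hρ.induction (P := LinearMap.ker (ρ z - (χ z : ℂ) • LinearMap.id))
    (fun g v hv => ?_) v
  · exact sub_eq_zero.1 h1
  change ρ z (ρ g v) - (χ z : ℂ) • ρ g v = 0
  rw [← Module.End.mul_apply, ← map_mul, hz, map_mul, Module.End.mul_apply,
    mem_isotypic_iff.1 hv z, map_smul, sub_self]

include D

/-- The projection onto the vectors fixed by `U m`. -/
noncomputable def projU (hρ : Generated K χ ρ) (m : ℕ) : V →ₗ[ℂ] V :=
  isoProj (hρ.locallyFinite (D.orbitFinite_U m))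

/-- The projection onto `V^χ`. -/
noncomputable def projK (hρ : Generated K χ ρ) : V →ₗ[ℂ] V :=
  isoProj (hρ.locallyFinite D.orbitFinite)

variable (hρ : Generated K χ ρ)

theorem projU_fixed (m : ℕ) {x : G} (hx : x ∈ D.U m) (v : V) :
    ρ x (D.projU hρ m v) = D.projU hρ m v := by
  have := isoProj_mem (hρ.locallyFinite (D.orbitFinite_U m)) v ⟨x, hx⟩
  rwa [MonoidHom.one_apply, Units.val_one, one_smul] at this

theorem projU_apply (m : ℕ) {x : G} (hx : x ∈ D.U m) (v : V) :
    D.projU hρ m (ρ x v) = D.projU hρ m v := by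
  have := isoProj_apply (hρ.locallyFinite (D.orbitFinite_U m)) ⟨x, hx⟩ v
  rwa [MonoidHom.one_apply, Units.val_one, one_smul] at this

theorem projU_of_fixed (m : ℕ) {v : V} (hv : ∀ x ∈ D.U m, ρ x v = v) : D.projU hρ m v = v :=
  isoProj_of_mem _ fun x => by simpa using hv x x.2

theorem projU_comm (m : ℕ) {j : G} (hj : j ∈ D.J) (v : V) :
    D.projU hρ m (ρ j v) = ρ j (D.projU hρ m v) := by
  refine isoProj_of_commute _ (ρ j) (fun k v => ⟨⟨j * (k : G) * j⁻¹, D.U_normal m j hj k k.2⟩, rfl, ?_⟩)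
    (fun v hv k => ?_) v
  · rw [← Module.End.mul_apply, ← map_mul, ← Module.End.mul_apply, ← map_mul]
    congr 2; simp
  · have h1 := hv ⟨j⁻¹ * k * j, D.U_conj' m hj k.2⟩
    simp only [MonoidHom.one_apply, Units.val_one, one_smul] at h1 ⊢
    conv_rhs => rw [← h1]
    rw [← Module.End.mul_apply, ← map_mul, ← Module.End.mul_apply, ← map_mul]
    congr 2; group

theorem fixed_of_mem {v : V} (hv : v ∈ isotypic K χ ρ) {x : G} (hx : x ∈ D.U 0) : ρ x v = v := by
  have := hv ⟨x, D.U_le hx⟩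
  rwa [D.χ_U _ hx, Units.val_one, one_smul] at this

theorem fixed_J {v : V} (hv : ∀ x ∈ D.U 0, ρ x v = v) {j : G} (hj : j ∈ D.J) :
    ∀ x ∈ D.U 0, ρ x (ρ j v) = ρ j v := by
  intro x hx
  have h1 := hv _ (D.U_conj' 0 hj hx)
  conv_rhs => rw [← h1]
  rw [← Module.End.mul_apply, ← map_mul, ← Module.End.mul_apply, ← map_mul]
  congr 2; group

omit D in
/-- Every `2`-adic integer is congruent to a natural number modulo `2 ^ k`. -/
theorem exists_nat_approx (k : ℕ) {b : ℚ_[2]} (hb : ‖b‖ ≤ 1) :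
    ∃ i : ℕ, i < 2 ^ k ∧ ∃ c : ℚ_[2], ‖c‖ ≤ 1 ∧ b = i + 2 ^ k * c := by
  let x : ℤ_[2] := ⟨b, hb⟩
  obtain ⟨c, hc⟩ := Ideal.mem_span_singleton.1 (PadicInt.appr_spec k x)
  refine ⟨x.appr k, PadicInt.appr_lt x k, c, c.2, ?_⟩
  have := congrArg (fun y : ℤ_[2] => (y : ℚ_[2])) hc
  push_cast at this
  have h2 : ((2 : ℤ_[2]) : ℚ_[2]) = 2 := rfl
  rw [h2] at this
  linear_combination this

omit D in
theorem norm_natCast_le (j : ℕ) : ‖(j : ℚ_[2])‖ ≤ 1 := by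
  simpa using Padic.norm_int_le_one (p := 2) j

theorem exists_q : ∃ k, 0 < k ∧ D.q = 2 ^ k := by
  rcases D.hq with h | h
  · exact ⟨1, one_pos, h⟩
  · exact ⟨2, two_pos, h⟩

theorem norm_q_mul_le {b : ℚ_[2]} (hb : ‖b‖ ≤ 1) : ‖(D.q : ℚ_[2]) * b‖ ≤ ‖(D.q : ℚ_[2])‖ := by
  rw [norm_mul]
  exact mul_le_of_le_one_right (norm_nonneg _) hb

include hρ in
/-- A vector fixed by `U 0` and by `n 1` has type `χ`. -/
theorem mem_isotypic {v : V} (hv : ∀ x ∈ D.U 0, ρ x v = v) (h1 : ρ (D.n 1) v = v) :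
    v ∈ isotypic K χ ρ := by
  intro k
  obtain ⟨z, b, l, hz, hb, hl, hk⟩ := D.K_decomp k
  have hl0 : l ∈ D.U 0 := by simpa using hl 0
  have hnat : ∀ i : ℕ, ρ (D.n i) v = v := by
    intro i
    rw [D.n_natCast]
    induction i with
    | zero => simp
    | succ i ih => rw [pow_succ, map_mul, Module.End.mul_apply, h1, ih]
  have hn : ρ (D.n b) v = v := by
    obtain ⟨s, -, hs⟩ := D.exists_q
    obtain ⟨i, -, c, hc, rfl⟩ := exists_nat_approx s hb
    rw [D.n_add, map_mul, Module.End.mul_apply, hv _ (D.n_mem_U _ ?_), hnat]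
    have := D.norm_q_mul_le hc
    rw [hs] at this ⊢
    push_cast at this ⊢
    exact this
  have hχ : χ k = χ z := by
    have : k = z * ⟨D.n b, D.n_mem b hb⟩ * ⟨l, D.U_le hl0⟩ := Subtype.ext hk
    rw [this, map_mul, map_mul, D.χ_n b hb, D.χ_U ⟨l, _⟩ hl0, mul_one, mul_one]
  rw [hχ, hk, map_mul, map_mul, Module.End.mul_apply, Module.End.mul_apply, hv _ hl0, hn,
    apply_central hρ hz]

/-- On vectors fixed by `U 0`, the projection onto `V^χ` averages over `n 0, …, n (q - 1)`. -/
theorem projK_eq {v : V} (hv : ∀ x ∈ D.U 0, ρ x v = v) :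
    D.projK hρ v = (D.q : ℂ)⁻¹ • ∑ j ∈ Finset.range D.q, ρ (D.n j) v := by
  have hJ : ∀ j : ℕ, D.n j ∈ K := fun j => D.n_mem _ (norm_natCast_le j)
  have h1 : ∑ j ∈ Finset.range D.q, ρ (D.n j) v ∈ isotypic K χ ρ := by
    refine D.mem_isotypic hρ (fun x hx => ?_) ?_
    · rw [map_sum]
      exact Finset.sum_congr rfl fun j _ => D.fixed_J hv (D.K_le (hJ j)) x hx
    · have h2 : ∀ j : ℕ, ρ (D.n 1) (ρ (D.n j) v) = ρ (D.n ((j + 1 : ℕ) : ℚ_[2])) v := by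
        intro j
        rw [← Module.End.mul_apply, ← map_mul, ← D.n_add, add_comm, Nat.cast_succ]
      have h3 := Finset.sum_range_succ (fun j : ℕ => ρ (D.n j) v) D.q
      rw [Finset.sum_range_succ', Nat.cast_zero, D.n_zero, map_one, Module.End.one_apply,
        hv _ (D.n_mem_U _ le_rfl), add_left_inj] at h3
      rw [map_sum, ← h3]
      exact Finset.sum_congr rfl fun j _ => h2 j
  have h2 := isoProj_of_mem (hρ.locallyFinite D.orbitFinite) h1
  rw [map_sum] at h2
  have h3 : ∀ j ∈ Finset.range D.q, isoProj (hρ.locallyFinite D.orbitFinite) (ρ (D.n j) v) =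
      D.projK hρ v := by
    intro j _
    have := isoProj_apply (hρ.locallyFinite D.orbitFinite) ⟨_, hJ j⟩ v
    rwa [D.χ_n _ (norm_natCast_le j), Units.val_one, one_smul] at this
  rw [Finset.sum_congr rfl h3, Finset.sum_const, Finset.card_range] at h2
  rw [← h2, ← Nat.cast_smul_eq_nsmul ℂ, inv_smul_smul₀ D.q_cast_ne]

theorem projK_projU (v : V) : D.projK hρ (D.projU hρ 0 v) = D.projK hρ v := by
  have h1 := hρ.locallyFinite (D.orbitFinite_U 0) v
  refine apply_average_of_invariant (D.projK hρ) fun k => ?_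
  have h2 := isoProj_apply (hρ.locallyFinite D.orbitFinite) ⟨k, D.U_le k.2⟩ v
  rw [D.χ_U _ k.2, Units.val_one, one_smul] at h2
  rw [twist_apply, MonoidHom.one_apply, inv_one, Units.val_one, one_smul]
  exact h2

theorem projK_mem (v : V) : D.projK hρ v ∈ isotypic K χ ρ := isoProj_mem _ v

theorem projK_of_mem {v : V} (hv : v ∈ isotypic K χ ρ) : D.projK hρ v = v := isoProj_of_mem _ hv

theorem projK_apply (k : K) (v : V) : D.projK hρ (ρ k v) = (χ k : ℂ) • D.projK hρ v :=
  isoProj_apply _ k v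

/-- The element `u = t w` preserves `V^χ`. -/
theorem u_mem {v : V} (hv : v ∈ isotypic K χ ρ) : ρ (D.t * D.w) v ∈ isotypic K χ ρ := by
  have key : ∀ k : K, ∃ k' : K, k * (D.t * D.w) = D.t * D.w * k' ∧ χ k' = χ k := by
    intro k
    obtain ⟨k', h1, h2⟩ := D.u_conj k
    refine ⟨k', ?_, h2⟩
    have hu : D.t * D.w * (D.t * D.w) = D.w * D.w := by
      rw [← mul_assoc, mul_assoc D.t, D.w_t]; group
    have h3 : k * (D.t * D.w) * (D.t * D.w) = D.t * D.w * k' * (D.t * D.w) := by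
      rw [mul_assoc _ (k' : G), ← h1, mul_assoc, hu, ← D.w_sq_comm, ← hu, mul_assoc]
    exact mul_right_cancel h3
  intro k
  obtain ⟨k', h1, h2⟩ := key k
  rw [← Module.End.mul_apply, ← map_mul, h1, map_mul, Module.End.mul_apply, hv k', map_smul, h2]

/-- The `J`-subrepresentation generated by `V^χ`. -/
def spanJ (ρ : Representation ℂ G V) : Submodule ℂ V :=
  Submodule.span ℂ {w | ∃ j ∈ D.J, ∃ v ∈ isotypic K χ ρ, w = ρ j v}

omit hρ

theorem mem_spanJ {v : V} (hv : v ∈ isotypic K χ ρ) : v ∈ D.spanJ ρ :=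
  Submodule.subset_span ⟨1, one_mem _, v, hv, by simp⟩

theorem spanJ_stable {j : G} (hj : j ∈ D.J) {v : V} (hv : v ∈ D.spanJ ρ) : ρ j v ∈ D.spanJ ρ := by
  have h1 : D.spanJ ρ ≤ (D.spanJ ρ).comap (ρ j) := by
    refine Submodule.span_le.2 ?_
    rintro _ ⟨i, hi, v, hv, rfl⟩
    refine Submodule.subset_span ⟨j * i, mul_mem hj hi, v, hv, ?_⟩
    rw [map_mul, Module.End.mul_apply]
  exact h1 hv

theorem spanJ_fixed {v : V} (hv : v ∈ D.spanJ ρ) {x : G} (hx : x ∈ D.U 0) : ρ x v = v := by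
  have h1 : D.spanJ ρ ≤ LinearMap.ker (ρ x - LinearMap.id) := by
    refine Submodule.span_le.2 ?_
    rintro _ ⟨i, hi, v, hv, rfl⟩
    exact sub_eq_zero.2 (D.fixed_J (fun x hx => D.fixed_of_mem hv hx) hi x hx)
  exact sub_eq_zero.1 (h1 hv)

end IwahoriDatum
end LocalShimura

/-! ### Smoothness and admissibility of representations generated by `V^χ` -/

namespace LocalShimura
namespace IwahoriDatum

variable {G : Type} [Group G] {K : Subgroup G} {χ : K →* ℂˣ} (D : IwahoriDatum K χ)
  {V : Type} [AddCommGroup V] [Module ℂ V] {ρ : Representation ℂ G V}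

include D

theorem exists_U_le_fixer (hρ : Generated K χ ρ) (v : V) : ∃ m, D.U m ≤ fixer ρ v := by
  let P : Submodule ℂ V :=
    { carrier := {v | ∃ m, D.U m ≤ fixer ρ v}
      add_mem' := by
        rintro v v' ⟨m, hm⟩ ⟨m', hm'⟩
        refine ⟨max m m', fun x hx => ?_⟩
        rw [mem_fixer, map_add, hm (D.U_anti (le_max_left _ _) hx),
          hm' (D.U_anti (le_max_right _ _) hx)]
      zero_mem' := ⟨0, fun x _ => map_zero _⟩
      smul_mem' := by
        rintro c v ⟨m, hm⟩
        exact ⟨m, fun x hx => by rw [mem_fixer, map_smul, hm hx]⟩ }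
  refine hρ.induction (P := P) (fun g v hv => ?_) v
  obtain ⟨m, hm⟩ := D.U_conj g⁻¹ 0
  refine ⟨m, fun x hx => ?_⟩
  have h1 := D.fixed_of_mem hv (hm x hx)
  rw [mem_fixer]
  conv_rhs => rw [← h1]
  rw [← Module.End.mul_apply, ← map_mul, ← Module.End.mul_apply, ← map_mul]
  congr 2; group

theorem isOpen_fixer [TopologicalSpace G]
    (hO : ∀ S : Subgroup G, IsOpen (S : Set G) ↔ ∃ m, D.U m ≤ S) (hρ : Generated K χ ρ) (v : V) :
    IsOpen {g : G | ρ g v = v} :=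
  (hO (fixer ρ v)).2 (D.exists_U_le_fixer hρ v)

/-- The `J`-translates of a finite dimensional space of `U m`-invariants span a finite dimensional
space. -/
theorem finiteDimensional_span_J {N : Submodule ℂ V} [FiniteDimensional ℂ N] {m : ℕ}
    (hN : ∀ x ∈ D.U m, ∀ v ∈ N, ρ x v = v) :
    FiniteDimensional ℂ (Submodule.span ℂ {w | ∃ j ∈ D.J, ∃ v ∈ N, w = ρ j v}) := by
  have h1 : ((D.U m).subgroupOf D.J).FiniteIndex := ⟨D.U_index m⟩
  refine Submodule.finiteDimensional_of_le
    (S₂ := ⨆ x : D.J ⧸ (D.U m).subgroupOf D.J, N.map (ρ (x.out : G))) ?_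
  refine Submodule.span_le.2 ?_
  rintro _ ⟨j, hj, v, hv, rfl⟩
  refine Submodule.mem_iSup_of_mem (((⟨j, hj⟩ : D.J) : D.J ⧸ (D.U m).subgroupOf D.J)) ?_
  obtain ⟨l, hl⟩ := QuotientGroup.mk_out_eq_mul ((D.U m).subgroupOf D.J) (⟨j, hj⟩ : D.J)
  rw [hl]
  refine ⟨v, hv, ?_⟩
  push_cast
  rw [map_mul, Module.End.mul_apply, hN _ (Subgroup.mem_subgroupOf.1 l.2) v hv]

/-- For large `i`, averaging over `U m` absorbs the lower triangular elements to the right of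
`t ^ i`; a vector `v` of the span of `J V^χ` may therefore be replaced by an element of `w V^χ`, and
`t w` preserves `V^χ`. -/
theorem projU_t_pow (hρ : Generated K χ ρ) (m : ℕ) : ∃ m₀, ∀ i ≥ m₀, ∀ v ∈ D.spanJ ρ,
    ∃ v' ∈ D.spanJ ρ, D.projU hρ m (ρ (D.t ^ (i + 1)) v) = D.projU hρ m (ρ (D.t ^ i) v') := by
  obtain ⟨m₀, hm₀⟩ := D.n'_small m
  refine ⟨m₀, fun i hi v hv => ⟨ρ (D.t * D.w) (D.projK hρ (ρ D.w⁻¹ v)),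
    D.mem_spanJ (D.u_mem (D.projK_mem hρ _)), ?_⟩⟩
  rw [← Module.End.mul_apply (ρ _) (ρ _), ← map_mul, ← mul_assoc, ← pow_succ,
    D.projK_eq hρ (D.fixed_J (fun x hx => D.spanJ_fixed hv hx) (inv_mem D.w_mem)), map_smul,
    map_sum, map_smul, map_sum]
  have h1 : ∀ j ∈ Finset.range D.q, D.projU hρ m (ρ (D.t ^ (i + 1) * D.w)
      (ρ (D.n j) (ρ D.w⁻¹ v))) = D.projU hρ m (ρ (D.t ^ (i + 1)) v) := by
    intro j _
    rw [← Module.End.mul_apply (ρ _) (ρ _), ← map_mul, ← Module.End.mul_apply (ρ _) (ρ _),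
      ← map_mul, show D.t ^ (i + 1) * D.w * D.n j * D.w⁻¹ = D.t ^ (i + 1) * (D.w * D.n j * D.w⁻¹) by group,
      D.w_n, D.t_pow_n', map_mul, Module.End.mul_apply, D.projU_apply]
    exact hm₀ _ (by omega) _ (by rw [norm_neg]; exact norm_natCast_le j)
  rw [Finset.sum_congr rfl h1, Finset.sum_const, Finset.card_range, ← Nat.cast_smul_eq_nsmul ℂ,
    inv_smul_smul₀ D.q_cast_ne]

/-- The invariants of a congruence subgroup are finite dimensional. By the Cartan decomposition they
are spanned by the `J`-translates of the averages of `tⁱ J V^χ` over `U m`, and for large `i` the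
averages of `tⁱ⁺¹ J V^χ` are contained in those of `tⁱ J V^χ`. -/
theorem finiteDimensional_range_projU (hρ : Generated K χ ρ)
    [FiniteDimensional ℂ (isotypic K χ ρ)] (m : ℕ) :
    FiniteDimensional ℂ (LinearMap.range (D.projU hρ m)) := by
  have hW : FiniteDimensional ℂ (D.spanJ ρ) :=
    D.finiteDimensional_span_J (N := isotypic K χ ρ) (m := 0)
      fun x hx v hv => D.fixed_of_mem hv hx
  obtain ⟨m₀, hm₀⟩ := D.projU_t_pow hρ m
  let N : Submodule ℂ V := ⨆ i : Fin (m₀ + 1),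
    (D.spanJ ρ).map (D.projU hρ m ∘ₗ ρ (D.t ^ (i : ℕ)))
  have hN : ∀ i : ℕ, ∀ v ∈ D.spanJ ρ, D.projU hρ m (ρ (D.t ^ i) v) ∈ N := by
    intro i
    induction i with
    | zero => exact fun v hv => Submodule.mem_iSup_of_mem (0 : Fin (m₀ + 1)) ⟨v, hv, rfl⟩
    | succ i ih =>
      intro v hv
      by_cases hi : i + 1 < m₀ + 1
      · exact Submodule.mem_iSup_of_mem (⟨i + 1, hi⟩ : Fin (m₀ + 1)) ⟨v, hv, rfl⟩
      · obtain ⟨v', hv', h⟩ := hm₀ i (by omega) v hv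
        rw [h]
        exact ih v' hv'
  have hfix : ∀ x ∈ D.U m, ∀ v ∈ N, ρ x v = v := by
    intro x hx v hv
    have h1 : N ≤ LinearMap.ker (ρ x - LinearMap.id) := by
      refine iSup_le fun i => ?_
      rintro _ ⟨v, _, rfl⟩
      exact sub_eq_zero.2 (D.projU_fixed hρ m hx _)
    exact sub_eq_zero.1 (h1 hv)
  have hfin := D.finiteDimensional_span_J hfix
  refine Submodule.finiteDimensional_of_le (S₂ := Submodule.span ℂ
    {w | ∃ j ∈ D.J, ∃ v ∈ N, w = ρ j v}) ?_
  rintro _ ⟨v, rfl⟩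
  refine hρ.induction (P := (Submodule.span ℂ {w | ∃ j ∈ D.J, ∃ v ∈ N, w = ρ j v}).comap
    (D.projU hρ m)) (fun g v hv => ?_) v
  obtain ⟨j, hj, i, j', hj', rfl⟩ := D.cartan g
  refine Submodule.subset_span ⟨j, hj, _, hN i _ (D.spanJ_stable hj' (D.mem_spanJ hv)), ?_⟩
  rw [map_mul, map_mul, Module.End.mul_apply, Module.End.mul_apply, D.projU_comm hρ m hj]

theorem finiteDimensional_invariants [TopologicalSpace G]
    (hO : ∀ S : Subgroup G, IsOpen (S : Set G) ↔ ∃ m, D.U m ≤ S) (hρ : Generated K χ ρ)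
    (hfin : FiniteDimensional ℂ (isotypic K χ ρ)) (S : Subgroup G) (hS : IsOpen (S : Set G)) :
    FiniteDimensional ℂ (isotypic S (1 : S →* ℂˣ) ρ) := by
  obtain ⟨m, hm⟩ := (hO S).1 hS
  have := D.finiteDimensional_range_projU hρ m
  refine Submodule.finiteDimensional_of_le (S₂ := LinearMap.range (D.projU hρ m)) fun v hv => ?_
  refine ⟨v, D.projU_of_fixed hρ m fun x hx => ?_⟩
  have := hv ⟨x, hm hx⟩
  rwa [MonoidHom.one_apply, Units.val_one, one_smul] at this

end IwahoriDatum
end LocalShimura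

/-! ### Subrepresentations meet `V^χ` -/

namespace LocalShimura
namespace IwahoriDatum

variable {G : Type} [Group G] {K : Subgroup G} {χ : K →* ℂˣ} (D : IwahoriDatum K χ)
  {V : Type} [AddCommGroup V] [Module ℂ V] {ρ : Representation ℂ G V}

include D

/-- A `J`-stable subspace of the span of `J V^χ` that does not meet `V^χ` vanishes: by averaging over
the finite quotient `J / U 0` it is the image of an equivariant projection, which kills `V^χ`. -/
theorem eq_bot_of_le_spanJ {N : Submodule ℂ V} (hNW : N ≤ D.spanJ ρ)
    (hN : ∀ j ∈ D.J, ∀ v ∈ N, ρ j v ∈ N) (h0 : ∀ v ∈ N, v ∈ isotypic K χ ρ → v = 0) : N = ⊥ := by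
  let W := D.spanJ ρ
  let σ : Representation ℂ D.J V := ρ.comp D.J.subtype
  let σW : Representation ℂ D.J W := σ.subrepresentation W fun j _ hv => D.spanJ_stable j.2 hv
  obtain ⟨p, hp⟩ := LinearMap.exists_leftInverse_of_injective N.subtype N.ker_subtype
  let f : W →ₗ[ℂ] V := N.subtype ∘ₗ p ∘ₗ W.subtype
  have hf : ∀ v (hv : v ∈ N), f ⟨v, hNW hv⟩ = v := fun v hv =>
    congrArg Subtype.val (LinearMap.congr_fun hp ⟨v, hv⟩)
  let τ := Representation.linHom σW σ
  have hτ : ∀ (j : D.J) (F : W →ₗ[ℂ] V) (v : W), τ j F v = ρ j (F (σW j⁻¹ v)) := fun _ _ _ => rfl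
  have hfin : (fixer τ f).FiniteIndex := by
    have : ((D.U 0).subgroupOf D.J).FiniteIndex := ⟨D.U_index 0⟩
    refine Subgroup.finiteIndex_of_le (H := (D.U 0).subgroupOf D.J) fun l hl => ?_
    have hl' : (l : G) ∈ D.U 0 := Subgroup.mem_subgroupOf.1 hl
    refine LinearMap.ext fun v => ?_
    have h1 : σW l⁻¹ v = v := Subtype.ext (D.spanJ_fixed v.2 (inv_mem hl'))
    rw [hτ, h1]
    exact D.spanJ_fixed (hNW (p v).2) hl'
  let F := average τ f
  have hFN : ∀ v, F v ∈ N := by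
    intro v
    have h1 : F ∈ (⨅ v, N.comap (LinearMap.applyₗ v) : Submodule ℂ (W →ₗ[ℂ] V)) := by
      refine average_mem fun j => (Submodule.mem_iInf _).2 fun v => ?_
      exact hN j j.2 _ (p _).2
    exact (Submodule.mem_iInf _).1 h1 v
  have hFJ : ∀ (j : D.J) v, F (σW j v) = ρ j (F v) := by
    intro j v
    have h1 : τ j F = F := apply_average j
    conv_lhs => rw [← h1]
    rw [hτ, ← Module.End.mul_apply (σW _), ← map_mul, inv_mul_cancel, map_one, Module.End.one_apply]
  have hF1 : ∀ v (hv : v ∈ N), F ⟨v, hNW hv⟩ = v := by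
    intro v hv
    have h1 : ∀ j, LinearMap.applyₗ (R := ℂ) (⟨v, hNW hv⟩ : W) (τ j f) =
        LinearMap.applyₗ (R := ℂ) (⟨v, hNW hv⟩ : W) f := by
      intro j
      change τ j f _ = f _
      rw [hτ, hf v hv]
      have h2 : σW j⁻¹ ⟨v, hNW hv⟩ = ⟨ρ (j⁻¹ : D.J) v, hNW (hN _ (j⁻¹).2 v hv)⟩ := rfl
      rw [h2, hf _ (hN _ (j⁻¹).2 v hv), ← Module.End.mul_apply, ← map_mul]
      simp
    exact (apply_average_of_invariant (LinearMap.applyₗ (R := ℂ) (⟨v, hNW hv⟩ : W)) h1).trans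
      (hf v hv)
  have hF0 : ∀ v (hv : v ∈ isotypic K χ ρ), F ⟨v, D.mem_spanJ hv⟩ = 0 := by
    intro v hv
    refine h0 _ (hFN _) fun k => ?_
    have h1 := hFJ ⟨k, D.K_le k.2⟩ ⟨v, D.mem_spanJ hv⟩
    have h2 : σW ⟨k, D.K_le k.2⟩ ⟨v, D.mem_spanJ hv⟩ = (χ k : ℂ) • ⟨v, D.mem_spanJ hv⟩ :=
      Subtype.ext (hv k)
    rw [h2, map_smul] at h1
    exact h1.symm
  have hF : ∀ v (hv : v ∈ W), F ⟨v, hv⟩ = 0 := by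
    intro v hv
    have h1 : W ≤ (LinearMap.ker F).map W.subtype := by
      refine Submodule.span_le.2 ?_
      rintro _ ⟨j, hj, v, hv, rfl⟩
      refine ⟨σW ⟨j, hj⟩ ⟨v, D.mem_spanJ hv⟩, ?_, rfl⟩
      change F _ = 0
      rw [hFJ, hF0 v hv, map_zero]
    obtain ⟨x, hx, rfl⟩ := h1 hv
    exact hx
  refine (Submodule.eq_bot_iff _).2 fun v hv => ?_
  rw [← hF1 v hv, hF]

/-- A vector of the span of `J V^χ` vanishes if all its `J`-translates project to `0` in `V^χ`. -/
theorem eq_zero_of_projK (hρ : Generated K χ ρ) {v : V} (hv : v ∈ D.spanJ ρ)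
    (h : ∀ j ∈ D.J, D.projK hρ (ρ j v) = 0) : v = 0 := by
  let N : Submodule ℂ V :=
    { carrier := {v | v ∈ D.spanJ ρ ∧ ∀ j ∈ D.J, D.projK hρ (ρ j v) = 0}
      add_mem' := fun ha hb => ⟨Submodule.add_mem _ ha.1 hb.1, fun j hj => by
        rw [map_add, map_add, ha.2 j hj, hb.2 j hj, add_zero]⟩
      zero_mem' := ⟨Submodule.zero_mem _, fun j _ => by rw [map_zero, map_zero]⟩
      smul_mem' := fun c a ha => ⟨Submodule.smul_mem _ c ha.1, fun j hj => by
        rw [map_smul, map_smul, ha.2 j hj, smul_zero]⟩ }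
  have h1 : N = ⊥ := by
    refine D.eq_bot_of_le_spanJ (fun v hv => hv.1)
      (fun j hj v hv => ⟨D.spanJ_stable hj hv.1, fun i hi => ?_⟩) fun v hv hv' => ?_
    · rw [← Module.End.mul_apply (ρ i), ← map_mul]
      exact hv.2 _ (mul_mem hi hj)
    · have := hv.2 1 (one_mem _)
      rwa [map_one, Module.End.one_apply, D.projK_of_mem hρ hv'] at this
  have h2 : v ∈ N := ⟨hv, h⟩
  rwa [h1] at h2

end IwahoriDatum
end LocalShimura

/-! ### Elimination along horoballs -/

namespace LocalShimura

theorem apply_mul {G V : Type*} [Group G] [AddCommGroup V] [Module ℂ V] (ρ : Representation ℂ G V)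
    (x y : G) (v : V) : ρ (x * y) v = ρ x (ρ y v) := by
  rw [map_mul, Module.End.mul_apply]

theorem apply_inv_apply {G V : Type*} [Group G] [AddCommGroup V] [Module ℂ V]
    (ρ : Representation ℂ G V) (x : G) (v : V) : ρ x⁻¹ (ρ x v) = v := by
  rw [← apply_mul, inv_mul_cancel, map_one, Module.End.one_apply]

theorem norm_lt_natCast_int {e : ℕ} {a : ℤ} (h0 : a ≠ 0) (h : |a| < 2 ^ e) :
    ‖(2 : ℚ_[2]) ^ e‖ < ‖(a : ℚ_[2])‖ := by
  by_contra hn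
  rw [not_lt] at hn
  have h2 : ‖(2 : ℚ_[2]) ^ e‖ = ((2 : ℕ) : ℝ) ^ (-e : ℤ) := by
    have := Padic.norm_p_pow (p := 2) e
    exact_mod_cast this
  rw [h2, Padic.norm_int_le_pow_iff_dvd] at hn
  have := Int.le_of_dvd (abs_pos.2 h0) ((dvd_abs _ _).2 hn)
  push_cast at this
  omega

namespace IwahoriDatum

variable {G : Type} [Group G] {K : Subgroup G} {χ : K →* ℂˣ} (D : IwahoriDatum K χ)
  {V : Type} [AddCommGroup V] [Module ℂ V] {ρ : Representation ℂ G V}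

include D

theorem q_ne : (D.q : ℚ_[2]) ≠ 0 := by exact_mod_cast D.q_pos.ne'

theorem t_pow_n (m : ℕ) (b : ℚ_[2]) : D.t ^ m * D.n b = D.n (b / D.q ^ m) * D.t ^ m := by
  rw [D.n_t_pow, mul_div_cancel₀ _ (pow_ne_zero m D.q_ne)]

theorem t_pow_inv_n (m : ℕ) (b : ℚ_[2]) :
    (D.t ^ m)⁻¹ * D.n b = D.n (D.q ^ m * b) * (D.t ^ m)⁻¹ := by
  rw [inv_mul_eq_iff_eq_mul, ← mul_assoc, ← D.n_t_pow]; group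

/-- The span of `n c t⁻ⁱ J V^χ` for `i ≤ m` and integral `c`: the vertices of the tree at depth at
most `m` below the base point. -/
def horoball (ρ : Representation ℂ G V) (m : ℕ) : Submodule ℂ V :=
  Submodule.span ℂ {v | ∃ i ≤ m, ∃ c : ℚ_[2], ‖c‖ ≤ 1 ∧ ∃ w ∈ D.spanJ ρ,
    v = ρ (D.n c) (ρ (D.t ^ i)⁻¹ w)}

theorem horoball_mono {m m' : ℕ} (h : m ≤ m') : D.horoball ρ m ≤ D.horoball ρ m' := by
  refine Submodule.span_mono ?_
  rintro _ ⟨i, hi, h⟩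
  exact ⟨i, hi.trans ‹_›, h⟩

/-- The contributions of the vertices other than the base point that are at most as deep. -/
def low (ρ : Representation ℂ G V) : Submodule ℂ V :=
  Submodule.span ℂ {y | ∃ (c : ℚ_[2]) (j : ℕ), (1 ≤ j ∨ j = 0 ∧ 1 < ‖c‖) ∧ ∃ w ∈ D.spanJ ρ,
    y = ρ (D.n c) (ρ (D.t ^ j) w)}

/-- The variant of `low` in which the vertices at the same depth as the base point contribute only
translates of `Z`. -/
def lowOf (ρ : Representation ℂ G V) (Z : Submodule ℂ V) : Submodule ℂ V :=
  Submodule.span ℂ {y | ∃ c : ℚ_[2], (∃ j : ℕ, 1 ≤ j ∧ ∃ w ∈ D.spanJ ρ,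
    y = ρ (D.n c) (ρ (D.t ^ j) w)) ∨ 2 < ‖c‖ ∧ ∃ z ∈ Z, y = ρ (D.n c) z}

/-- Every vector is moved into a horoball by `t⁻ᴺ` for large `N`: by the Iwasawa decomposition it is
enough to treat the translates `n b tᵐ j v`, and `t⁻ᴺ` makes `b` integral. -/
theorem exists_mem_horoball (hρ : Generated K χ ρ) (v : V) :
    ∃ N₀ : ℕ, ∀ N ≥ N₀, ∃ m, ρ (D.t ^ N)⁻¹ v ∈ D.horoball ρ m := by
  let P : Submodule ℂ V :=
    { carrier := {v | ∃ N₀ : ℕ, ∀ N ≥ N₀, ∃ m, ρ (D.t ^ N)⁻¹ v ∈ D.horoball ρ m}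
      add_mem' := by
        rintro v v' ⟨N₀, h⟩ ⟨N₀', h'⟩
        refine ⟨max N₀ N₀', fun N hN => ?_⟩
        obtain ⟨m, hm⟩ := h N (le_of_max_le_left hN)
        obtain ⟨m', hm'⟩ := h' N (le_of_max_le_right hN)
        refine ⟨max m m', ?_⟩
        rw [map_add]
        exact Submodule.add_mem _ (D.horoball_mono (le_max_left _ _) hm)
          (D.horoball_mono (le_max_right _ _) hm')
      zero_mem' := ⟨0, fun _ _ => ⟨0, by rw [map_zero]; exact Submodule.zero_mem _⟩⟩
      smul_mem' := by
        rintro c v ⟨N₀, h⟩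
        refine ⟨N₀, fun N hN => ?_⟩
        obtain ⟨m, hm⟩ := h N hN
        exact ⟨m, by rw [map_smul]; exact Submodule.smul_mem _ c hm⟩ }
  refine hρ.induction (P := P) (fun g v hv => ?_) v
  obtain ⟨b, m, j, hj, rfl⟩ := D.iwasawa g
  obtain ⟨N₁, hN₁⟩ : ∃ N₁ : ℕ, ∀ N ≥ N₁, ‖(D.q : ℚ_[2]) ^ N * b‖ ≤ 1 := by
    have hlt : ‖(D.q : ℚ_[2])‖ < 1 := by
      obtain ⟨k, hk, hq⟩ := D.exists_q
      rw [hq, Nat.cast_pow, norm_pow]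
      exact pow_lt_one₀ (norm_nonneg _) Padic.norm_p_lt_one hk.ne'
    have h1 := (tendsto_pow_atTop_nhds_zero_of_lt_one (norm_nonneg _) hlt).mul_const ‖b‖
    rw [zero_mul] at h1
    obtain ⟨N₁, h⟩ := Filter.eventually_atTop.1 (h1.eventually (ge_mem_nhds zero_lt_one))
    exact ⟨N₁, fun N hN => by rw [norm_mul, norm_pow]; exact h N hN⟩
  refine ⟨max N₁ m.toNat, fun N hN => ⟨N - m.toNat + (-m).toNat, ?_⟩⟩
  have hN1 := hN₁ N (le_of_max_le_left hN)
  have hN2 := le_of_max_le_right hN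
  refine Submodule.subset_span ⟨N - m.toNat + (-m).toNat, le_rfl, _, hN1, ρ j v,
    D.spanJ_stable hj (D.mem_spanJ hv), ?_⟩
  rw [← apply_mul, ← apply_mul, ← apply_mul]
  congr 2
  rw [← mul_assoc, ← mul_assoc, D.t_pow_inv_n]
  congr 1
  rw [mul_assoc]
  congr 1
  rw [inv_mul_eq_iff_eq_mul, ← zpow_natCast, ← zpow_natCast, ← zpow_neg, ← zpow_add]
  congr 1
  omega

/-- The deepest layer of the horoball is indexed by the residues modulo `q ^ (m + 1)`. -/
theorem exists_horoball_succ (m : ℕ) {p : V} (hp : p ∈ D.horoball ρ (m + 1)) :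
    ∃ w : ℕ → V, (∀ i, w i ∈ D.spanJ ρ) ∧
      p - ∑ i ∈ Finset.range (D.q ^ (m + 1)), ρ (D.n i) (ρ (D.t ^ (m + 1))⁻¹ (w i)) ∈
        D.horoball ρ m := by
  induction hp using Submodule.span_induction with
  | mem p hp =>
    obtain ⟨i, hi, c, hc, w, hw, rfl⟩ := hp
    rcases Nat.lt_or_ge i (m + 1) with h | h
    · refine ⟨0, fun _ => Submodule.zero_mem _, ?_⟩
      rw [Finset.sum_eq_zero fun _ _ => by simp, sub_zero]
      exact Submodule.subset_span ⟨i, by omega, c, hc, w, hw, rfl⟩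
    · obtain rfl : i = m + 1 := by omega
      obtain ⟨k, hk, hq⟩ := D.exists_q
      obtain ⟨r, hr, c', hc', rfl⟩ := exists_nat_approx (k * (m + 1)) hc
      have hQ : D.q ^ (m + 1) = 2 ^ (k * (m + 1)) := by rw [hq, pow_mul]
      have hQ' : (D.q : ℚ_[2]) ^ (m + 1) = 2 ^ (k * (m + 1)) := by exact_mod_cast congrArg Nat.cast hQ
      refine ⟨Pi.single r (ρ (D.n c') w), fun i => ?_, ?_⟩
      · by_cases h : i = r
        · subst h
          rw [Pi.single_eq_same]
          exact D.spanJ_stable (D.K_le (D.n_mem _ hc')) hw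
        · rw [Pi.single_eq_of_ne h]
          exact Submodule.zero_mem _
      · rw [Finset.sum_eq_single r (fun i _ hi => by rw [Pi.single_eq_of_ne hi]; simp)
          (fun h => absurd (Finset.mem_range.2 (hQ ▸ hr)) h), Pi.single_eq_same,
          ← apply_mul _ _ (D.n c'), D.t_pow_inv_n, hQ', apply_mul, ← apply_mul _ (D.n r), ← D.n_add,
          sub_self]
        exact Submodule.zero_mem _
  | zero => exact ⟨0, fun _ => Submodule.zero_mem _, by simp⟩
  | add p p' _ _ h h' =>
    obtain ⟨w, hw, h⟩ := h
    obtain ⟨w', hw', h'⟩ := h'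
    refine ⟨w + w', fun i => Submodule.add_mem _ (hw i) (hw' i), ?_⟩
    have := Submodule.add_mem _ h h'
    simp only [Pi.add_apply, map_add, Finset.sum_add_distrib]
    rwa [sub_add_sub_comm] at this
  | smul c p _ h =>
    obtain ⟨w, hw, h⟩ := h
    refine ⟨c • w, fun i => Submodule.smul_mem _ c (hw i), ?_⟩
    have := Submodule.smul_mem _ c h
    simp only [Pi.smul_apply, map_smul, ← Finset.smul_sum]
    rwa [smul_sub] at this

/-- Moving the vertex `n i t⁻ᵐ⁻¹` to the base point moves the shallower layers into `low`. -/
theorem translate_horoball (m i : ℕ) {x : V} (hx : x ∈ D.horoball ρ m) :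
    ρ (D.t ^ (m + 1) * D.n (-i)) x ∈ Submodule.span ℂ {y | ∃ c : ℚ_[2], ∃ j : ℕ, 1 ≤ j ∧
      ∃ w ∈ D.spanJ ρ, y = ρ (D.n c) (ρ (D.t ^ j) w)} := by
  have h1 : D.horoball ρ m ≤ (Submodule.span ℂ {y | ∃ c : ℚ_[2], ∃ j : ℕ, 1 ≤ j ∧
      ∃ w ∈ D.spanJ ρ, y = ρ (D.n c) (ρ (D.t ^ j) w)}).comap (ρ (D.t ^ (m + 1) * D.n (-i))) := by
    refine Submodule.span_le.2 ?_
    rintro _ ⟨k, hk, c, hc, w, hw, rfl⟩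
    refine Submodule.subset_span ⟨(-i + c) / D.q ^ (m + 1), m + 1 - k, by omega, w, hw, ?_⟩
    rw [← apply_mul, ← apply_mul, ← apply_mul]
    congr 2
    rw [mul_assoc, mul_assoc, ← mul_assoc (D.n (-i)), ← D.n_add, ← mul_assoc, D.t_pow_n, mul_assoc,
      pow_sub _ (by omega)]
  exact h1 hx

theorem translate_layer (m i k : ℕ) (w : V) :
    ρ (D.t ^ (m + 1) * D.n (-i)) (ρ (D.n k) (ρ (D.t ^ (m + 1))⁻¹ w)) =
      ρ (D.n ((k - i) / D.q ^ (m + 1))) w := by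
  rw [← apply_mul, ← apply_mul]
  congr 2
  rw [mul_assoc, mul_assoc, ← mul_assoc (D.n (-i)), ← D.n_add, ← mul_assoc, D.t_pow_n, mul_assoc,
    mul_inv_cancel, mul_one, neg_add_eq_sub]

/-- Elimination of the deepest layer: if the component at the base point of an element of `P`
always lies in `t J V^χ + Z`, and if then the component in `Z` can be removed as well, then `P` does
not meet any horoball. -/
theorem eq_bot_of_elimination (hρ : Generated K χ ρ) {P Z : Submodule ℂ V}
    (hP : ∀ g, ∀ v ∈ P, ρ g v ∈ P) (h0 : ∀ v ∈ P, v ∈ isotypic K χ ρ → v = 0)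
    (h1 : ∀ w ∈ D.spanJ ρ, ∀ y ∈ D.low ρ, w + y ∈ P →
      ∃ w' ∈ D.spanJ ρ, ∃ z ∈ Z, w = ρ D.t w' + z)
    (hZ : ∀ z ∈ Z, ρ (D.n 2⁻¹) z ∈ Z)
    (h2 : ∀ z ∈ Z, ∀ y ∈ D.lowOf ρ Z, z + y ∈ P → z = 0) : P = ⊥ := by
  have key : ∀ m, ∀ p ∈ P, p ∈ D.horoball ρ m → p = 0 := by
    intro m
    induction m with
    | zero =>
      intro p hp hp'
      have h3 : D.horoball ρ 0 ≤ D.spanJ ρ := by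
        refine Submodule.span_le.2 ?_
        rintro _ ⟨i, hi, c, hc, w, hw, rfl⟩
        obtain rfl : i = 0 := by omega
        rw [pow_zero, inv_one, map_one]
        exact D.spanJ_stable (D.K_le (D.n_mem _ hc)) hw
      have h4 : P ⊓ D.spanJ ρ = ⊥ := D.eq_bot_of_le_spanJ inf_le_right
        (fun j hj v hv => ⟨hP j v hv.1, D.spanJ_stable hj hv.2⟩) fun v hv => h0 v hv.1
      have h5 : p ∈ P ⊓ D.spanJ ρ := ⟨hp, h3 hp'⟩
      rwa [h4] at h5
    | succ m ih =>
      intro p hp hp'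
      refine ih p hp ?_
      obtain ⟨w, hw, hx⟩ := D.exists_horoball_succ m hp'
      obtain ⟨s, hs, hq⟩ := D.exists_q
      obtain ⟨e, he⟩ : ∃ e, s * (m + 1) = e + 1 := ⟨s * (m + 1) - 1, by
        have := Nat.mul_pos hs (Nat.succ_pos m); simp only [Nat.succ_eq_add_one] at this; omega⟩
      have hQ : D.q ^ (m + 1) = 2 ^ e + 2 ^ e := by rw [hq, ← pow_mul, he, pow_succ]; ring
      have hQ' : (D.q : ℚ_[2]) ^ (m + 1) = 2 ^ e * 2 := by
        have : ((D.q ^ (m + 1) : ℕ) : ℚ_[2]) = ((2 ^ e + 2 ^ e : ℕ) : ℚ_[2]) := congrArg Nat.cast hQ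
        push_cast at this
        rw [this]; ring
      have h2n : ‖(2 : ℚ_[2])‖ = 2⁻¹ := by simpa using Padic.norm_p (p := 2)
      -- distinct residues of the deepest layer are not congruent modulo `q ^ (m + 1)`
      have hsep : ∀ (E i k : ℕ), i < 2 ^ E → k < 2 ^ E → k ≠ i →
          ‖(2 : ℚ_[2]) ^ E‖ < ‖(k - i : ℚ_[2])‖ := by
        intro E i k hi hk hki
        have := norm_lt_natCast_int (e := E) (a := (k : ℤ) - i) (by omega) (by
          rw [abs_lt]
          have hi' : (i : ℤ) < 2 ^ E := by exact_mod_cast hi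
          have hk' : (k : ℤ) < 2 ^ E := by exact_mod_cast hk
          constructor <;> omega)
        push_cast at this
        exact this
      -- The group element `g` moves the vertex `i` of the deepest layer to the base point, and all
      -- other vertices to vertices that contribute to `low`.
      have hs1 : ∀ i ∈ Finset.range (D.q ^ (m + 1)), ∃ w' ∈ D.spanJ ρ, ∃ z ∈ Z,
          w i = ρ D.t w' + z := by
        intro i hi
        let g := D.t ^ (m + 1) * D.n (-i)
        refine h1 (w i) (hw i) (ρ g p - w i) ?_ (by rw [add_sub_cancel]; exact hP g p hp)
        have e1 : ρ g p - w i = ρ g (p - ∑ k ∈ Finset.range (D.q ^ (m + 1)),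
            ρ (D.n k) (ρ (D.t ^ (m + 1))⁻¹ (w k))) + ∑ k ∈ (Finset.range (D.q ^ (m + 1))).erase i,
            ρ (D.n ((k - i) / D.q ^ (m + 1))) (w k) := by
          have e2 := Finset.add_sum_erase _ (fun k : ℕ => ρ g (ρ (D.n k)
            (ρ (D.t ^ (m + 1))⁻¹ (w k)))) hi
          simp only [g, D.translate_layer, sub_self, zero_div, D.n_zero, map_one,
            Module.End.one_apply] at e2
          rw [map_sub, map_sum]
          simp only [g, D.translate_layer]
          rw [← e2]; abel
        rw [e1]
        refine Submodule.add_mem _ (Submodule.span_mono ?_ (D.translate_horoball m i hx))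
          (Submodule.sum_mem _ fun k hk => Submodule.subset_span ⟨(k - i) / D.q ^ (m + 1), 0,
            Or.inr ⟨rfl, ?_⟩, w k, hw k, by simp⟩)
        · rintro _ ⟨c, j, hj, w, hw, rfl⟩
          exact ⟨c, j, Or.inl hj, w, hw, rfl⟩
        · rw [Finset.mem_erase, Finset.mem_range, hQ, ← mul_two, ← pow_succ] at hk
          rw [Finset.mem_range, hQ, ← mul_two, ← pow_succ] at hi
          have := hsep (e + 1) i k hi hk.2 hk.1
          rw [norm_div, hQ', ← pow_succ]
          exact (one_lt_div (norm_pos_iff.2 (pow_ne_zero _ two_ne_zero))).2 this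
      choose! w' hw' z hz hwz using hs1
      -- The parts `t w' i` belong to the layer above, so only the `z i` remain in the deepest layer.
      have hx2 : p - ∑ i ∈ Finset.range (D.q ^ (m + 1)),
          ρ (D.n i) (ρ (D.t ^ (m + 1))⁻¹ (z i)) ∈ D.horoball ρ m := by
        have e1 : p - ∑ i ∈ Finset.range (D.q ^ (m + 1)),
            ρ (D.n i) (ρ (D.t ^ (m + 1))⁻¹ (z i)) = (p - ∑ i ∈ Finset.range (D.q ^ (m + 1)),
            ρ (D.n i) (ρ (D.t ^ (m + 1))⁻¹ (w i))) + ∑ i ∈ Finset.range (D.q ^ (m + 1)),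
            ρ (D.n i) (ρ (D.t ^ m)⁻¹ (w' i)) := by
          have e2 : ∀ i ∈ Finset.range (D.q ^ (m + 1)),
              ρ (D.n i) (ρ (D.t ^ (m + 1))⁻¹ (w i)) = ρ (D.n i) (ρ (D.t ^ m)⁻¹ (w' i)) +
                ρ (D.n i) (ρ (D.t ^ (m + 1))⁻¹ (z i)) := by
            intro i hi
            rw [hwz i hi, map_add, map_add, ← apply_mul _ _ D.t,
              show (D.t ^ (m + 1))⁻¹ * D.t = (D.t ^ m)⁻¹ by rw [pow_succ']; group]
          rw [Finset.sum_congr rfl e2, Finset.sum_add_distrib]; abel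
        rw [e1]
        exact Submodule.add_mem _ hx (Submodule.sum_mem _ fun i hi =>
          Submodule.subset_span ⟨m, le_rfl, i, norm_natCast_le i, w' i, hw' i hi, rfl⟩)
      -- Since `n (1/2)` preserves `Z`, the contributions of the vertices `i` and `2 ^ e + i` combine.
      -- The remaining vertices are far enough apart for `lowOf`.
      let z' : ℕ → V := fun i => z i + ρ (D.n 2⁻¹) (z (2 ^ e + i))
      have hz' : ∀ i ∈ Finset.range (2 ^ e), z' i ∈ Z := by
        intro i hi
        rw [Finset.mem_range] at hi
        exact Submodule.add_mem _ (hz i (Finset.mem_range.2 (by omega)))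
          (hZ _ (hz _ (Finset.mem_range.2 (by omega))))
      have hsum : ∑ i ∈ Finset.range (D.q ^ (m + 1)), ρ (D.n i) (ρ (D.t ^ (m + 1))⁻¹ (z i)) =
          ∑ i ∈ Finset.range (2 ^ e), ρ (D.n i) (ρ (D.t ^ (m + 1))⁻¹ (z' i)) := by
        rw [hQ, Finset.sum_range_add, ← Finset.sum_add_distrib]
        refine Finset.sum_congr rfl fun i _ => ?_
        rw [map_add, map_add, add_right_inj, ← apply_mul _ _ (D.n 2⁻¹), D.t_pow_inv_n, hQ',
          apply_mul, ← apply_mul _ (D.n i), ← D.n_add, mul_assoc, mul_inv_cancel₀ two_ne_zero,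
          mul_one]
        push_cast
        rw [add_comm]
      rw [hsum] at hx2
      have hz0 : ∀ i ∈ Finset.range (2 ^ e), z' i = 0 := by
        intro i hi
        let g := D.t ^ (m + 1) * D.n (-i)
        refine h2 (z' i) (hz' i hi) (ρ g p - z' i) ?_ (by rw [add_sub_cancel]; exact hP g p hp)
        have e1 : ρ g p - z' i = ρ g (p - ∑ k ∈ Finset.range (2 ^ e),
            ρ (D.n k) (ρ (D.t ^ (m + 1))⁻¹ (z' k))) + ∑ k ∈ (Finset.range (2 ^ e)).erase i,
            ρ (D.n ((k - i) / D.q ^ (m + 1))) (z' k) := by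
          have e2 := Finset.add_sum_erase _ (fun k : ℕ => ρ g (ρ (D.n k)
            (ρ (D.t ^ (m + 1))⁻¹ (z' k)))) hi
          simp only [g, D.translate_layer, sub_self, zero_div, D.n_zero, map_one,
            Module.End.one_apply] at e2
          rw [map_sub, map_sum]
          simp only [g, D.translate_layer]
          rw [← e2]; abel
        rw [e1]
        refine Submodule.add_mem _ (Submodule.span_mono ?_ (D.translate_horoball m i hx2))
          (Submodule.sum_mem _ fun k hk => Submodule.subset_span ⟨_, Or.inr ⟨?_, z' k,
            hz' k (Finset.mem_of_mem_erase hk), rfl⟩⟩)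
        · rintro _ ⟨c, j, hj, w, hw, rfl⟩
          exact ⟨c, Or.inl ⟨j, hj, w, hw, rfl⟩⟩
        · rw [Finset.mem_erase, Finset.mem_range] at hk
          have := hsep e i k (Finset.mem_range.1 hi) hk.2 hk.1
          rw [norm_div, hQ', norm_mul, h2n, lt_div_iff₀ (mul_pos (norm_pos_iff.2
            (pow_ne_zero _ two_ne_zero)) (by norm_num))]
          linarith
      rw [Finset.sum_eq_zero fun i hi => by rw [hz0 i hi, map_zero, map_zero], sub_zero] at hx2
      exact hx2
  refine (Submodule.eq_bot_iff _).2 fun p hp => ?_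
  obtain ⟨N, hN⟩ := D.exists_mem_horoball hρ p
  obtain ⟨m, hm⟩ := hN N le_rfl
  have h3 := key m _ (hP _ p hp) hm
  have h4 := apply_inv_apply ρ (D.t ^ N)⁻¹ p
  rwa [h3, map_zero, eq_comm] at h4

end IwahoriDatum
end LocalShimura

/-! ### The type property -/

namespace LocalShimura

theorem exists_two_mul {a : ℚ_[2]} (ha : ‖a‖ < 1) : ∃ b : ℚ_[2], ‖b‖ ≤ 1 ∧ a = 2 * b := by
  obtain ⟨b, hb⟩ := (PadicInt.norm_lt_one_iff_dvd (⟨a, ha.le⟩ : ℤ_[2])).1 ha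
  refine ⟨b, b.2, ?_⟩
  have := congrArg (fun y : ℤ_[2] => (y : ℚ_[2])) hb
  push_cast at this
  exact this

namespace IwahoriDatum

variable {G : Type} [Group G] {K : Subgroup G} {χ : K →* ℂˣ} (D : IwahoriDatum K χ)
  {V : Type} [AddCommGroup V] [Module ℂ V] {ρ : Representation ℂ G V}

include D

/-- The operator `∑ a j • n j`, for `0 ≤ j < q`. -/
noncomputable def unipSum (ρ : Representation ℂ G V) (a : ℕ → ℂ) : V →ₗ[ℂ] V :=
  ∑ j ∈ Finset.range D.q, a j • ρ (D.n j)

theorem unipSum_apply (a : ℕ → ℂ) (v : V) :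
    D.unipSum ρ a v = ∑ j ∈ Finset.range D.q, a j • ρ (D.n j) v := by
  simp [unipSum]

theorem n_natCast_fixed {v : V} (hv : ρ (D.n 1) v = v) (j : ℕ) : ρ (D.n j) v = v := by
  rw [D.n_natCast]
  induction j with
  | zero => simp
  | succ j ih => rw [pow_succ, apply_mul, hv, ih]

theorem n_n_apply (a b : ℚ_[2]) (v : V) : ρ (D.n a) (ρ (D.n b) v) = ρ (D.n (a + b)) v := by
  rw [D.n_add, apply_mul]

theorem unipSum_of_fixed {a : ℕ → ℂ} (ha : ∑ j ∈ Finset.range D.q, a j = 0) {v : V}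
    (hv : ρ (D.n 1) v = v) : D.unipSum ρ a v = 0 := by
  rw [unipSum_apply, Finset.sum_congr rfl fun j _ => by rw [D.n_natCast_fixed hv],
    ← Finset.sum_smul, ha, zero_smul]

theorem unipSum_mem {a : ℕ → ℂ} {P : Submodule ℂ V} (hP : ∀ j ∈ D.J, ∀ v ∈ P, ρ j v ∈ P) {v : V}
    (hv : v ∈ P) : D.unipSum ρ a v ∈ P := by
  rw [unipSum_apply]
  exact Submodule.sum_mem _ fun j _ => Submodule.smul_mem _ _
    (hP _ (D.K_le (D.n_mem _ (norm_natCast_le j))) v hv)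

theorem projU_unipSum (hρ : Generated K χ ρ) (a : ℕ → ℂ) (v : V) :
    D.projU hρ 0 (D.unipSum ρ a v) = D.unipSum ρ a (D.projU hρ 0 v) := by
  rw [unipSum_apply, unipSum_apply, map_sum]
  exact Finset.sum_congr rfl fun j _ => by
    rw [map_smul, D.projU_comm hρ 0 (D.K_le (D.n_mem _ (norm_natCast_le j)))]

/-- `n 1` fixes `n c tʲ J V^χ` for `j ≥ 1`. -/
theorem n_one_fixed_of_pos {c : ℚ_[2]} {j : ℕ} (hj : 1 ≤ j) {w : V} (hw : w ∈ D.spanJ ρ) :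
    ρ (D.n 1) (ρ (D.n c) (ρ (D.t ^ j) w)) = ρ (D.n c) (ρ (D.t ^ j) w) := by
  rw [← apply_mul, ← D.n_add, add_comm, D.n_add, apply_mul, ← apply_mul _ (D.n 1), D.n_t_pow,
    apply_mul, D.spanJ_fixed hw]
  refine D.n_mem_U _ ?_
  obtain ⟨i, rfl⟩ := Nat.exists_eq_add_of_le' hj
  rw [mul_one, pow_succ']
  refine D.norm_q_mul_le ?_
  rw [← Nat.cast_pow]
  exact norm_natCast_le _

/-- `n' c⁻¹ n 1 n' (-c⁻¹)` fixes `n c J V^χ` if `c` is not integral. -/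
theorem n_one_fixed_of_large {c : ℚ_[2]} (hc : 1 < ‖c‖) {w : V} (hw : w ∈ D.spanJ ρ) :
    ρ (D.n 1) (ρ (D.n' (-c⁻¹)) (ρ (D.n c) w)) = ρ (D.n' (-c⁻¹)) (ρ (D.n c) w) := by
  have hc0 : c ≠ 0 := norm_pos_iff.1 (one_pos.trans hc)
  have h1 : ‖-(c ^ 2)⁻¹‖ ≤ ‖(D.q : ℚ_[2])‖ := by
    obtain ⟨b, hb, h⟩ := exists_two_mul (a := c⁻¹) (by rw [norm_inv]; exact inv_lt_one_of_one_lt₀ hc)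
    rw [norm_neg, ← inv_pow, h, mul_pow, norm_mul]
    have h2 : ‖(2 : ℚ_[2]) ^ 2‖ ≤ ‖(D.q : ℚ_[2])‖ := by
      rcases D.hq with h | h <;> rw [h, norm_pow]
      · have := Padic.norm_p (p := 2)
        push_cast at this ⊢
        rw [this]; norm_num
      · rw [← norm_pow]; norm_num
    refine (mul_le_of_le_one_right (norm_nonneg _) ?_).trans h2
    rw [norm_pow]
    exact pow_le_one₀ (norm_nonneg _) hb
  have h2 : D.n 1 * D.n' (-c⁻¹) * D.n c = D.n' (-c⁻¹) * (D.n c * D.n' (-(c ^ 2)⁻¹)) := by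
    have := D.kappa c hc0
    rw [D.n_neg, eq_mul_inv_iff_mul_eq] at this
    rw [← this, D.n'_neg]; group
  rw [← apply_mul, ← apply_mul, h2, apply_mul, apply_mul, D.spanJ_fixed hw (D.n'_mem_U _ h1)]

/-- The first elimination step: for suitable `r = ∑ a j n j`, the operators `e_χ k r` with `k` in `J`
annihilate `low`, so that the component at the base point of an element of `P` is killed by `r`. -/
theorem unipSum_eq_zero (hρ : Generated K χ ρ) {a : ℕ → ℂ}
    (ha : ∑ j ∈ Finset.range D.q, a j = 0)
    (hr : ∀ v, (∀ x ∈ D.U 0, ρ x v = v) → ∀ b : ℚ_[2], ‖b‖ ≤ 1 →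
      D.unipSum ρ a (ρ (D.n' (2 * b)) v) = ρ (D.n' (2 * b)) (D.unipSum ρ a v))
    {P : Submodule ℂ V} (hP : ∀ g, ∀ v ∈ P, ρ g v ∈ P) (h0 : ∀ v ∈ P, v ∈ isotypic K χ ρ → v = 0)
    {w y : V} (hw : w ∈ D.spanJ ρ) (hy : y ∈ D.low ρ) (hwy : w + y ∈ P) : D.unipSum ρ a w = 0 := by
  have key : ∀ k ∈ D.J, D.projK hρ (ρ k (D.unipSum ρ a y)) = 0 := by
    intro k hk
    have h1 : D.low ρ ≤ LinearMap.ker (D.projK hρ ∘ₗ ρ k ∘ₗ D.unipSum ρ a) := by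
      refine Submodule.span_le.2 ?_
      rintro _ ⟨c, j, hj, w, hw, rfl⟩
      change D.projK hρ (ρ k (D.unipSum ρ a _)) = 0
      rcases hj with hj | ⟨rfl, hc⟩
      · rw [D.unipSum_of_fixed ha (D.n_one_fixed_of_pos hj hw), map_zero, map_zero]
      · rw [pow_zero, map_one, Module.End.one_apply, ← D.projK_projU, D.projU_comm hρ 0 hk,
          D.projU_unipSum]
        obtain ⟨b, hb, h⟩ := exists_two_mul (a := -c⁻¹)
          (by rw [norm_neg, norm_inv]; exact inv_lt_one_of_one_lt₀ hc)
        have h2 := D.unipSum_of_fixed ha (D.n_one_fixed_of_large hc hw)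
        have h3 := congrArg (D.projU hρ 0) h2
        have hJ : D.n' (2 * b) ∈ D.J := D.n'_mem _ (by
          rw [← h, norm_neg, norm_inv]; exact inv_le_one_of_one_le₀ hc.le)
        rw [map_zero, D.projU_unipSum, h, D.projU_comm hρ 0 hJ,
          hr _ (fun x hx => D.projU_fixed hρ 0 hx _) b hb] at h3
        have h4 := congrArg (ρ (D.n' (2 * b))⁻¹) h3
        rw [apply_inv_apply, map_zero] at h4
        rw [h4, map_zero, map_zero]
    exact h1 hy
  refine D.eq_zero_of_projK hρ (D.unipSum_mem (fun j hj v hv => D.spanJ_stable hj hv) hw)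
    fun k hk => ?_
  have h1 : D.projK hρ (ρ k (D.unipSum ρ a (w + y))) = 0 := by
    refine h0 _ (isoProj_mem_of _ fun k => hP _ _ (hP _ _ ?_)) (D.projK_mem hρ _)
    exact D.unipSum_mem (fun j _ v hv => hP j v hv) hwy
  rwa [map_add, map_add, map_add, key k hk, add_zero] at h1

theorem exists_t_apply {v : V} (hv : v ∈ isotypic K χ ρ) : ∃ w ∈ D.spanJ ρ, v = ρ D.t w := by
  have h1 : ρ (D.w * D.w)⁻¹ v ∈ isotypic K χ ρ := by
    have := hv ⟨D.w * D.w, D.w_sq_mem⟩⁻¹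
    rw [show ρ (D.w * D.w)⁻¹ v = _ from this]
    exact Submodule.smul_mem _ _ hv
  refine ⟨ρ D.w (ρ (D.t * D.w) (ρ (D.w * D.w)⁻¹ v)),
    D.spanJ_stable D.w_mem (D.mem_spanJ (D.u_mem h1)), ?_⟩
  rw [← apply_mul, ← apply_mul, ← apply_mul]
  have : D.t * D.w * (D.t * D.w) * (D.w * D.w)⁻¹ = 1 := by
    rw [← mul_assoc, mul_assoc D.t, D.w_t]; group
  rw [this, map_one, Module.End.one_apply]

/-- If `q = 2`, then `n' (2 b)` lies in `U 0` for integral `b`, and `1 - e_χ` can be used for the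
elimination. -/
theorem typeProperty_of_q_eq_two (hq : D.q = 2) : TypeProperty K χ := by
  intro V _ _ ρ hρ P hP h0
  refine D.eq_bot_of_elimination (Z := ⊥) hρ hP h0 (fun w hw y hy hwy => ?_) (fun z hz => ?_)
    fun z hz _ _ _ => hz
  · let a : ℕ → ℂ := fun j => if j = 0 then 1 else -1
    have hr := D.unipSum_eq_zero hρ (a := a) (by simp [hq, Finset.sum_range_succ, a]) (by
      intro v hv b hb
      have hm : D.n' (2 * b) ∈ D.U 0 := D.n'_mem_U _ (by
        have := D.norm_q_mul_le hb
        rwa [hq] at this ⊢)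
      rw [hv _ hm, unipSum_apply, map_sum]
      exact Finset.sum_congr rfl fun j _ => by
        rw [map_smul, D.fixed_J hv (D.K_le (D.n_mem _ (norm_natCast_le j))) _ hm])
      hP h0 hw hy hwy
    rw [unipSum_apply, hq, Finset.sum_range_succ, Finset.sum_range_one] at hr
    simp only [a, if_true, one_ne_zero, if_false, Nat.cast_zero, Nat.cast_one, D.n_zero, map_one,
      Module.End.one_apply, one_smul, neg_smul] at hr
    have hv := D.mem_isotypic hρ (fun x hx => D.spanJ_fixed hw hx) (add_neg_eq_zero.1 hr).symm
    obtain ⟨w', hw', h⟩ := D.exists_t_apply hv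
    exact ⟨w', hw', 0, Submodule.zero_mem _, by rw [add_zero, h]⟩
  · rw [(Submodule.mem_bot ℂ).1 hz, map_zero]
    exact Submodule.zero_mem _

/-- If `q = 4`, then `s = n' 2` normalizes the group generated by `U 0` and `n 1` up to a central
element `z` on which `χ` takes the value `±i`, and the elimination uses the sum of `e_χ` and
`s e_χ s⁻¹`. -/
theorem typeProperty_of_q_eq_four (hq : D.q = 4) {z : K} (hz : ∀ g, z * g = g * (z : G))
    (hχ : (χ z : ℂ) ^ 2 = -1) {l : G} (hl : l ∈ D.U 0)
    (hs : D.n' 2 * D.n 1 = z * D.n (-1) * l * D.n' 2) {k : K}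
    (hk : D.n 2⁻¹ * D.n' 2 = D.n' 2 * k * (D.t * D.w)) : TypeProperty K χ := by
  intro V _ _ ρ hρ P hP h0
  set s := D.n' 2 with hsdef
  set ι : ℂ := (χ z : ℂ) with hι
  have hsJ : s ∈ D.J := D.n'_mem _ (by simpa using norm_natCast_le 2)
  have hι0 : ι ≠ 0 := by rintro h; rw [h] at hχ; norm_num at hχ
  have hι1 : ι ≠ 1 := by rintro h; rw [h] at hχ; norm_num at hχ
  have hzv : ∀ v, ρ z v = ι • v := fun v => apply_central hρ hz v
  have hn4 : ∀ v, (∀ x ∈ D.U 0, ρ x v = v) → ρ (D.n 4) v = v := fun v hv =>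
    hv _ (D.n_mem_U _ (by rw [hq]; simp))
  have hfix : ∀ v, (∀ x ∈ D.U 0, ρ x v = v) → ∀ c : ℚ_[2], ‖c‖ ≤ 1 →
      ∀ x ∈ D.U 0, ρ x (ρ (D.n c) v) = ρ (D.n c) v := fun v hv c hc =>
    D.fixed_J hv (D.K_le (D.n_mem _ hc))
  have h1n : ‖(1 : ℚ_[2])‖ ≤ 1 := norm_one.le
  have h2n : ‖(2 : ℚ_[2])‖ ≤ 1 := by simpa using norm_natCast_le 2
  have h3n : ‖(3 : ℚ_[2])‖ ≤ 1 := by simpa using norm_natCast_le 3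
  -- the commutation relations between `s` and the `n j` on the vectors fixed by `U 0`
  have hs1 : ∀ v, (∀ x ∈ D.U 0, ρ x v = v) → ρ s (ρ (D.n 1) v) = ι • ρ (D.n 3) (ρ s v) := by
    intro v hv
    rw [← apply_mul, hs, apply_mul, apply_mul, apply_mul, D.fixed_J hv hsJ l hl, hzv]
    conv_lhs => rw [← hn4 _ (D.fixed_J hv hsJ), ← apply_mul, ← D.n_add]
    norm_num
  have hs2 : ∀ v, (∀ x ∈ D.U 0, ρ x v = v) → ρ s (ρ (D.n 2) v) = -ρ (D.n 2) (ρ s v) := by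
    intro v hv
    have e : ρ (D.n 3) (ρ (D.n 3) (ρ s v)) = ρ (D.n 2) (ρ s v) := by
      conv_rhs => rw [← hn4 _ (D.fixed_J hv hsJ)]
      rw [D.n_n_apply, D.n_n_apply]
      norm_num
    rw [show (2 : ℚ_[2]) = 1 + 1 by norm_num, D.n_add, apply_mul, hs1 _ (hfix v hv 1 h1n),
      hs1 v hv, map_smul, e, smul_smul, ← sq, hχ, neg_one_smul, ← D.n_add]
    norm_num
  have hs3 : ∀ v, (∀ x ∈ D.U 0, ρ x v = v) → ρ s (ρ (D.n 3) v) = -(ι • ρ (D.n 1) (ρ s v)) := by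
    intro v hv
    have e : ρ (D.n 3) (ρ (D.n 2) (ρ s v)) = ρ (D.n 1) (ρ s v) := by
      conv_rhs => rw [← hn4 _ (D.fixed_J hv hsJ)]
      rw [D.n_n_apply, D.n_n_apply]
      norm_num
    rw [show (3 : ℚ_[2]) = 1 + 2 by norm_num, D.n_add, apply_mul, hs1 _ (hfix v hv 2 h2n),
      hs2 v hv, map_neg, e, smul_neg]
  -- the operator `1 - π₁ - s π₁ s⁻¹`, where `π₁` is the average of the `n j`
  let a : ℕ → ℂ
    | 0 => 1 / 2
    | 1 => -(1 - ι) / 4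
    | 2 => 0
    | _ => -(1 + ι) / 4
  have hr : ∀ v, D.unipSum ρ a v = (1 / 2 : ℂ) • v + (-(1 - ι) / 4) • ρ (D.n 1) v +
      (-(1 + ι) / 4) • ρ (D.n 3) v := by
    intro v
    rw [unipSum_apply, hq]
    simp [Finset.sum_range_succ, a, D.n_zero]
  have hrs : ∀ v, (∀ x ∈ D.U 0, ρ x v = v) → D.unipSum ρ a (ρ s v) = ρ s (D.unipSum ρ a v) := by
    intro v hv
    rw [hr, hr, map_add, map_add, map_smul, map_smul, map_smul, hs1 v hv, hs3 v hv]
    linear_combination (norm := module) (-1 / 4 : ℂ) • (hχ • (ρ (D.n 3) (ρ s v))) +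
      (-1 / 4 : ℂ) • (hχ • (ρ (D.n 1) (ρ s v)))
  have hru : ∀ v, (∀ x ∈ D.U 0, ρ x v = v) → ∀ x ∈ D.U 0, ρ x (D.unipSum ρ a v) =
      D.unipSum ρ a v := by
    intro v hv x hx
    rw [hr, map_add, map_add, map_smul, map_smul, map_smul, hv x hx, hfix v hv 1 h1n x hx,
      hfix v hv 3 h3n x hx]
  -- conjugation by `s` gives `e_χ s⁻¹ n (-1) = χ(z)⁻¹ e_χ s⁻¹`
  have hsK : ∀ y, ρ (D.n 1) y = y → D.projK hρ (ρ s⁻¹ y) = 0 := by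
    intro y hy
    have e1 : s⁻¹ * (z : G) * D.n (-1) = D.n 1 * (s⁻¹ * l⁻¹ * s) * s⁻¹ := by
      have : (z : G) * D.n (-1) = s * D.n 1 * s⁻¹ * l⁻¹ := by rw [hs]; group
      rw [mul_assoc, this]; group
    have e2 : ρ (D.n (-1)) y = y := by
      rw [D.n_neg]
      conv_lhs => rw [← hy]
      rw [apply_inv_apply]
    have e3 : s⁻¹ * l⁻¹ * s ∈ D.U 0 := D.U_conj' 0 hsJ (inv_mem hl)
    have e4 : D.projK hρ (ρ (s⁻¹ * (z : G) * D.n (-1)) y) =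
        D.projK hρ (ρ (D.n 1 * (s⁻¹ * l⁻¹ * s) * s⁻¹) y) := by rw [e1]
    rw [apply_mul, apply_mul, e2, hzv, map_smul, map_smul, apply_mul, apply_mul] at e4
    rw [D.projK_apply hρ ⟨D.n 1, D.n_mem 1 h1n⟩, D.χ_n 1 h1n, Units.val_one, one_smul,
      D.projK_apply hρ ⟨s⁻¹ * l⁻¹ * s, D.U_le e3⟩, D.χ_U _ e3, Units.val_one,
      one_smul] at e4
    have e5 : (ι - 1) • D.projK hρ (ρ s⁻¹ y) = 0 := by rw [sub_smul, e4, one_smul, sub_self]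
    exact (smul_eq_zero.1 e5).resolve_left (sub_ne_zero.2 hι1)
  -- elimination with `Z = s V^χ`
  refine D.eq_bot_of_elimination (Z := (isotypic K χ ρ).map (ρ s)) hρ hP h0
    (fun w hw y hy hwy => ?_) ?_ ?_
  · have hr0 := D.unipSum_eq_zero hρ (a := a) (by
        rw [hq]; simp only [Finset.sum_range_succ, Finset.sum_range_zero, a]; ring)
      (fun v hv b hb => ?_) hP h0 hw hy hwy
    · have hv : ∀ x ∈ D.U 0, ρ x w = w := fun x hx => D.spanJ_fixed hw hx
      obtain ⟨w', hw', h⟩ := D.exists_t_apply (D.projK_mem hρ w)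
      rw [D.projK_eq hρ hv, hq] at h
      simp only [Finset.sum_range_succ, Finset.sum_range_zero, Nat.cast_zero, Nat.cast_one,
        Nat.cast_ofNat, D.n_zero, map_one, Module.End.one_apply, zero_add] at h
      -- the component of `w` in the eigenspace of `n 1` for `ι`; it is equal to `s e_χ s⁻¹ w`
      let y' : V := (1 / 4 : ℂ) • (w - ι • ρ (D.n 1) w - ρ (D.n 2) w + ι • ρ (D.n 3) w)
      have hy' : ∀ x ∈ D.U 0, ρ x (ρ s⁻¹ y') = ρ s⁻¹ y' := by
        refine D.fixed_J (fun x hx => ?_) (inv_mem hsJ)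
        simp only [y', map_smul, map_add, map_sub, hv x hx, hfix w hv 1 h1n x hx,
          hfix w hv 2 h2n x hx, hfix w hv 3 h3n x hx]
      have hss : ρ s (ρ s⁻¹ y') = y' := by
        rw [← apply_mul, mul_inv_cancel, map_one, Module.End.one_apply]
      refine ⟨w', hw', y', ⟨ρ s⁻¹ y', D.mem_isotypic hρ hy' ?_, hss⟩, ?_⟩
      · -- `n 1` acts on `y'` by `ι`, and hence trivially on `s⁻¹ y'`
        have e1 : ρ (D.n 1) y' = ι • y' := by
          have h2 : ρ (D.n 1) (ρ (D.n 1) w) = ρ (D.n 2) w := by rw [D.n_n_apply]; norm_num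
          have h3 : ρ (D.n 1) (ρ (D.n 2) w) = ρ (D.n 3) w := by rw [D.n_n_apply]; norm_num
          have h4 : ρ (D.n 1) (ρ (D.n 3) w) = w := by
            rw [D.n_n_apply, show (1 + 3 : ℚ_[2]) = 4 by norm_num, hn4 w hv]
          simp only [y', map_smul, map_add, map_sub, h2, h3, h4]
          linear_combination (norm := module) (1 / 4 : ℂ) • (hχ • (ρ (D.n 1) w - ρ (D.n 3) w))
        have e3 : ρ (D.n 3) y' = (ι * ι * ι) • y' := by
          rw [show (3 : ℚ_[2]) = 1 + (1 + 1) by norm_num, ← D.n_n_apply, ← D.n_n_apply, e1,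
            map_smul, map_smul, e1, map_smul, e1, smul_smul, smul_smul, mul_assoc]
        have e4 := hs1 _ hy'
        rw [hss, e3, smul_smul, show ι * (ι * ι * ι) = 1 by linear_combination (ι ^ 2 - 1) * hχ,
          one_smul] at e4
        rw [← apply_inv_apply ρ s (ρ (D.n 1) (ρ s⁻¹ y')), e4]
      · rw [← h]
        rw [hr] at hr0
        linear_combination (norm := module) hr0
    · obtain ⟨i, hi, c, hc, rfl⟩ := exists_nat_approx 1 hb
      have hm : D.n' (4 * c) ∈ D.U 0 := D.n'_mem_U _ (by
        have := D.norm_q_mul_le hc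
        rwa [hq] at this ⊢)
      rw [show (2 * (i + 2 ^ 1 * c) : ℚ_[2]) = 2 * i + 4 * c by ring, D.n'_add, apply_mul,
        apply_mul, hv _ hm, hru v hv _ hm]
      interval_cases i
      · simp [D.n'_zero]
      · rw [Nat.cast_one, mul_one]
        exact hrs v hv
  · -- `n (1/2)` preserves `Z`, because `n (1/2) s` lies in `s K u` and `u` preserves `V^χ`
    rintro _ ⟨v, hv, rfl⟩
    refine ⟨ρ k (ρ (D.t * D.w) v), ?_, ?_⟩
    · rw [D.u_mem hv k]
      exact Submodule.smul_mem _ _ (D.u_mem hv)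
    · rw [← apply_mul, ← apply_mul, ← apply_mul, hk]
  · -- `e_χ s⁻¹` kills `lowOf` and is inverse to `s` on `Z`
    rintro _ ⟨v, hv, rfl⟩ y hy hyP
    have key : D.lowOf ρ ((isotypic K χ ρ).map (ρ s)) ≤ LinearMap.ker (D.projK hρ ∘ₗ ρ s⁻¹) := by
      refine Submodule.span_le.2 ?_
      rintro _ ⟨c, ⟨j, hj, w, hw, rfl⟩ | ⟨hc, _, ⟨v, hv, rfl⟩, rfl⟩⟩
      · exact hsK _ (D.n_one_fixed_of_pos hj hw)
      · change D.projK hρ (ρ s⁻¹ (ρ (D.n c) (ρ s v))) = 0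
        have hm : D.n' (-c⁻¹) ∈ D.U 0 := by
          have hc0 : 0 < ‖c‖ := two_pos.trans hc
          obtain ⟨b, -, h⟩ := exists_two_mul (a := -c⁻¹) (by
            rw [norm_neg, norm_inv]; exact inv_lt_one_of_one_lt₀ (by linarith))
          obtain ⟨b', hb', rfl⟩ := exists_two_mul (a := b) (by
            have h2 := congrArg norm h
            have h3 : ‖(2 : ℚ_[2])‖ = 2⁻¹ := by simpa using Padic.norm_p (p := 2)
            rw [norm_neg, norm_inv, norm_mul, h3] at h2
            have : ‖c‖⁻¹ < 2⁻¹ := inv_strictAnti₀ two_pos hc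
            linarith)
          rw [h, ← mul_assoc]
          refine D.n'_mem_U _ ?_
          have := D.norm_q_mul_le hb'
          rw [hq] at this ⊢
          norm_num at this ⊢
          exact this
        have e1 := hsK _ (D.n_one_fixed_of_large (by linarith)
          (D.spanJ_stable hsJ (D.mem_spanJ hv)))
        rw [← apply_mul, hsdef, ← D.n'_neg, ← D.n'_add, add_comm, D.n'_add, apply_mul,
          D.projK_apply hρ ⟨_, D.U_le hm⟩, D.χ_U _ hm, Units.val_one, one_smul, D.n'_neg] at e1
        exact e1
    have h1 : D.projK hρ (ρ s⁻¹ (ρ s v + y)) = 0 :=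
      h0 _ (isoProj_mem_of _ fun k => hP _ _ (hP _ _ hyP)) (D.projK_mem hρ _)
    rw [map_add, map_add, apply_inv_apply, D.projK_of_mem hρ hv,
      show D.projK hρ (ρ s⁻¹ y) = 0 from key hy, add_zero] at h1
    rw [h1, map_zero]

end IwahoriDatum
end LocalShimura

/-! ### The algebra with the relations `T² = T + 2` and `U² = 1` -/

namespace LocalShimura

/-- The quadratic relations between the generators `T` (`false`) and `U` (`true`). -/
inductive QuadraticRel : FreeAlgebra ℂ Bool → FreeAlgebra ℂ Bool → Prop
  | quad : QuadraticRel (FreeAlgebra.ι ℂ false * FreeAlgebra.ι ℂ false) (FreeAlgebra.ι ℂ false + 2)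
  | invol : QuadraticRel (FreeAlgebra.ι ℂ true * FreeAlgebra.ι ℂ true) 1

/-- The algebra generated by `T` and `U` with `T² = T + 2` and `U² = 1`. -/
abbrev QuadraticHecke : Type := RingQuot QuadraticRel

namespace QuadraticHecke

/-- The generator `T`. -/
noncomputable def T : QuadraticHecke := RingQuot.mkAlgHom ℂ QuadraticRel (FreeAlgebra.ι ℂ false)

/-- The generator `U`. -/
noncomputable def U : QuadraticHecke := RingQuot.mkAlgHom ℂ QuadraticRel (FreeAlgebra.ι ℂ true)

theorem T_mul_T : T * T = T + 2 := by
  have := RingQuot.mkAlgHom_rel ℂ QuadraticRel.quad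
  rwa [map_mul, map_add, map_ofNat] at this

theorem U_mul_U : U * U = 1 := by
  have := RingQuot.mkAlgHom_rel ℂ QuadraticRel.invol
  rwa [map_mul, map_one] at this

/-- Elements of an algebra that satisfy the relations define a homomorphism. -/
noncomputable def lift {R : Type} [Ring R] [Algebra ℂ R] (t u : R) (ht : t * t = t + 2)
    (hu : u * u = 1) : QuadraticHecke →ₐ[ℂ] R :=
  RingQuot.liftAlgHom ℂ ⟨FreeAlgebra.lift ℂ fun b => if b then u else t, by
    rintro _ _ (_ | _)
    · simp only [map_mul, map_add, FreeAlgebra.lift_ι_apply, map_ofNat]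
      simpa using ht
    · simp only [map_mul, FreeAlgebra.lift_ι_apply, map_one]
      simpa using hu⟩

section Lift

variable {R : Type} [Ring R] [Algebra ℂ R] {t u : R} (ht : t * t = t + 2) (hu : u * u = 1)

theorem lift_T : lift t u ht hu T = t := by
  simp [lift, T]

theorem lift_U : lift t u ht hu U = u := by
  simp [lift, U]

end Lift

/-- The alternating words in two elements `t` and `u` of an algebra; the booleans tell whether there
is an additional `u` on the left and an additional `t` on the right of a power of `t u`. -/
def word {R : Type} [Monoid R] (t u : R) (i : Bool × Bool × ℕ) : R :=
  (if i.1 then u else 1) * ((t * u) ^ i.2.2 * if i.2.1 then t else 1)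

theorem map_word {R : Type} [Ring R] [Algebra ℂ R] (f : QuadraticHecke →ₐ[ℂ] R)
    (i : Bool × Bool × ℕ) : f (word T U i) = word (f T) (f U) i := by
  obtain ⟨a, b, m⟩ := i
  cases a <;> cases b <;> simp [word]

/-- The words span, because their span is stable under left multiplication by `T` and by `U`:
repeated letters are removed by the quadratic relations. -/
theorem span_word : Submodule.span ℂ (Set.range (word T U)) = ⊤ := by
  let S := Submodule.span ℂ (Set.range (word T U))
  have h1 : (1 : QuadraticHecke) ∈ S :=
    Submodule.subset_span ⟨(false, false, 0), by simp [word]⟩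
  have hU : ∀ x ∈ S, U * x ∈ S := by
    intro x hx
    have h : S ≤ S.comap (LinearMap.mulLeft ℂ U) := by
      refine Submodule.span_le.2 ?_
      rintro _ ⟨⟨a, b, m⟩, rfl⟩
      refine Submodule.subset_span ⟨(!a, b, m), ?_⟩
      cases a
      · simp [word]
      · simp [word, ← mul_assoc, U_mul_U]
    exact h hx
  have hT : ∀ x ∈ S, T * x ∈ S := by
    intro x hx
    have h : S ≤ S.comap (LinearMap.mulLeft ℂ T) := by
      refine Submodule.span_le.2 ?_
      rintro _ ⟨⟨a, b, m⟩, rfl⟩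
      cases a
      · cases m with
        | zero =>
          cases b
          · exact Submodule.subset_span ⟨(false, true, 0), by simp [word]⟩
          · have e : (LinearMap.mulLeft ℂ T) (word T U (false, true, 0)) =
                word T U (false, true, 0) + (2 : ℂ) • word T U (false, false, 0) := by
              simp only [word, LinearMap.mulLeft_apply, Bool.false_eq_true, if_false, if_true,
                pow_zero, one_mul, T_mul_T]
              rw [Algebra.smul_def, map_ofNat, mul_one]
            rw [SetLike.mem_coe, Submodule.mem_comap, e]
            exact Submodule.add_mem _ (Submodule.subset_span ⟨_, rfl⟩)
              (Submodule.smul_mem _ _ (Submodule.subset_span ⟨_, rfl⟩))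
        | succ m =>
          have e : (LinearMap.mulLeft ℂ T) (word T U (false, b, m + 1)) =
              word T U (false, b, m + 1) + (2 : ℂ) • word T U (true, b, m) := by
            simp only [word, LinearMap.mulLeft_apply, Bool.false_eq_true, if_false, if_true,
              one_mul, pow_succ']
            have h3 : T * (T * U) = T * U + 2 * U := by rw [← mul_assoc, T_mul_T, add_mul]
            rw [← mul_assoc, ← mul_assoc, h3, Algebra.smul_def, map_ofNat, add_mul, add_mul,
              mul_assoc 2, mul_assoc 2, mul_assoc U]
          rw [SetLike.mem_coe, Submodule.mem_comap, e]
          exact Submodule.add_mem _ (Submodule.subset_span ⟨_, rfl⟩)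
            (Submodule.smul_mem _ _ (Submodule.subset_span ⟨_, rfl⟩))
      · refine Submodule.subset_span ⟨(false, b, m + 1), ?_⟩
        simp [word, pow_succ', mul_assoc]
    exact h hx
  have h2 : ∀ x : FreeAlgebra ℂ Bool, ∀ y ∈ S, RingQuot.mkAlgHom ℂ QuadraticRel x * y ∈ S := by
    intro x
    induction x using FreeAlgebra.induction with
    | grade0 c =>
      intro y hy
      rw [AlgHom.commutes, ← Algebra.smul_def]
      exact Submodule.smul_mem _ c hy
    | grade1 b =>
      intro y hy
      cases b
      · exact hT y hy
      · exact hU y hy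
    | mul a b ha hb =>
      intro y hy
      rw [map_mul, mul_assoc]
      exact ha _ (hb y hy)
    | add a b ha hb =>
      intro y hy
      rw [map_add, add_mul]
      exact Submodule.add_mem _ (ha y hy) (hb y hy)
  refine Submodule.eq_top_iff'.2 fun x => ?_
  obtain ⟨x, rfl⟩ := RingQuot.mkAlgHom_surjective ℂ QuadraticRel x
  have := h2 x 1 h1
  rwa [mul_one] at this

/-- If the alternating words in `t` and `u` form a basis, then the relations are a presentation. -/
theorem lift_bijective {R : Type} [Ring R] [Algebra ℂ R] {t u : R} (ht : t * t = t + 2)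
    (hu : u * u = 1) (hli : LinearIndependent ℂ (word t u))
    (hs : Submodule.span ℂ (Set.range (word t u)) = ⊤) :
    Function.Bijective (lift t u ht hu) := by
  have hw : ∀ i, lift t u ht hu (word T U i) = word t u i := fun i => by
    rw [map_word, lift_T, lift_U]
  have hw' : ∀ c : Bool × Bool × ℕ →₀ ℂ, lift t u ht hu (c.sum fun i a => a • word T U i) =
      c.sum fun i a => a • word t u i := fun c => by
    rw [map_finsuppSum]
    exact Finsupp.sum_congr fun i _ => by rw [map_smul, hw]
  constructor
  · rw [injective_iff_map_eq_zero]
    intro x hx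
    have h1 : x ∈ Submodule.span ℂ (Set.range (word T U)) := span_word ▸ Submodule.mem_top
    obtain ⟨c, rfl⟩ := (Finsupp.mem_span_range_iff_exists_finsupp).1 h1
    rw [hw'] at hx
    have h3 := linearIndependent_iff.1 hli c hx
    rw [h3, Finsupp.sum_zero_index]
  · intro y
    have h1 : y ∈ Submodule.span ℂ (Set.range (word t u)) := hs ▸ Submodule.mem_top
    obtain ⟨c, rfl⟩ := (Finsupp.mem_span_range_iff_exists_finsupp).1 h1
    exact ⟨_, hw' c⟩

end QuadraticHecke
end LocalShimura

/-! ### The Hecke algebra of `(K, χ)` -/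

namespace LocalShimura
namespace IwahoriDatum

variable {G : Type} [Group G] {K : Subgroup G} {χ : K →* ℂˣ} (D : IwahoriDatum K χ)

include D

/-- The averaged translate `e_χ g e_χ` in the Hecke algebra. -/
noncomputable def br (g : G) : HeckeAlgebra K χ := bracket D.orbitFinite g

/-- The element `u = t w` that normalizes `(K, χ)`. -/
def u : G := D.t * D.w

theorem u_mul_u : D.u * D.u = D.w * D.w := by
  unfold u
  rw [← mul_assoc, mul_assoc D.t, D.w_t]; group

theorem u_conj' (k : K) : ∃ k' : K, k * D.u = D.u * k' ∧ χ k' = χ k := by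
  obtain ⟨k', h1, h2⟩ := D.u_conj k
  change D.u * k = k' * D.u at h1
  refine ⟨k', ?_, h2⟩
  have h3 : k * D.u * D.u = D.u * k' * D.u := by
    rw [mul_assoc _ (k' : G), ← h1, mul_assoc, u_mul_u, ← D.w_sq_comm, ← u_mul_u, mul_assoc]
  exact mul_right_cancel h3

theorem br_mul_u (x : G) : D.br x * D.br D.u = D.br (x * D.u) := by
  refine bracket_mul_of_decomp D.orbitFinite fun k => ⟨1, k, (one_mul k).symm, ?_, ?_⟩
  · rw [inv_one]; exact one_mem _
  · obtain ⟨k', h, h'⟩ := D.u_conj' k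
    have e : D.u⁻¹ * k * D.u = k' := by rw [mul_assoc, h]; group
    exact ⟨e ▸ k'.2, by rw [← h']; exact congrArg χ (Subtype.ext e)⟩

theorem u_mul_br (x : G) : D.br D.u * D.br x = D.br (D.u * x) := by
  refine bracket_mul_of_decomp D.orbitFinite fun k => ⟨k, 1, (mul_one k).symm, ?_, one_mem _⟩
  obtain ⟨k', h, h'⟩ := D.u_conj k⁻¹
  change D.u * _ = k' * D.u at h
  have e : D.u⁻¹⁻¹ * ((k⁻¹ : K) : G) * D.u⁻¹ = k' := by rw [inv_inv, h]; group
  exact ⟨e ▸ k'.2, by rw [← h']; exact congrArg χ (Subtype.ext e)⟩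

/-- `t⁻ⁱ` contracts the upper triangular part of `K`, which makes `[t⁻ⁱ] [x] = [t⁻ⁱ x]` if `x⁻¹`
contracts the remaining part. -/
theorem t_pow_mul_br (i : ℕ) {x : G}
    (hx : ∀ l, (∀ m : ℕ, D.t ^ m * l * (D.t ^ m)⁻¹ ∈ D.U 0) → x⁻¹ * l * x ∈ D.U 0) :
    D.br (D.t ^ i)⁻¹ * D.br x = D.br ((D.t ^ i)⁻¹ * x) := by
  refine bracket_mul_of_decomp D.orbitFinite fun k => ?_
  obtain ⟨z, b, l, hz, hb, hl, hk⟩ := D.K_decomp k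
  have hl0 : l ∈ D.U 0 := by simpa using hl 0
  refine ⟨z * ⟨D.n b, D.n_mem b hb⟩, ⟨l, D.U_le hl0⟩, Subtype.ext hk, ?_, ?_⟩
  · have hc : ‖-((D.q : ℚ_[2]) ^ i * b)‖ ≤ 1 := by
      rw [norm_neg, norm_mul, norm_pow]
      exact mul_le_one₀ (pow_le_one₀ (norm_nonneg _) (norm_natCast_le _)) (norm_nonneg _) hb
    have e : (D.t ^ i)⁻¹⁻¹⁻¹ * (((z * ⟨D.n b, D.n_mem b hb⟩)⁻¹ : K) : G) * (D.t ^ i)⁻¹⁻¹ =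
        ((⟨D.n (-(D.q ^ i * b)), D.n_mem _ hc⟩ * z⁻¹ : K) : G) := by
      push_cast
      simp only [inv_inv]
      rw [mul_inv_rev, ← mul_assoc, ← D.n_neg, D.t_pow_inv_n, mul_assoc, mul_assoc]
      have h1 : (D.t ^ i)⁻¹ * ((z : G)⁻¹ * D.t ^ i) = (z : G)⁻¹ := by
        rw [inv_mul_eq_iff_eq_mul, inv_mul_eq_iff_eq_mul, ← mul_assoc, hz, mul_assoc,
          mul_inv_cancel, mul_one]
      rw [h1, mul_neg]
    refine ⟨e ▸ (_ : K).2, (congrArg χ (Subtype.ext e)).trans ?_⟩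
    rw [map_mul, D.χ_n _ hc, one_mul, map_inv, map_inv, map_mul, D.χ_n _ hb, mul_one]
  · have h1 := hx l hl
    exact ⟨D.U_le h1, by rw [D.χ_U _ h1, D.χ_U _ hl0]⟩

theorem br_t_pow (m : ℕ) : D.br (D.t ^ 1)⁻¹ * D.br (D.t ^ m)⁻¹ = D.br (D.t ^ (m + 1))⁻¹ := by
  rw [D.t_pow_mul_br 1 fun l hl => by rw [inv_inv]; exact hl m, ← mul_inv_rev, ← pow_add]

theorem br_t_pow_w (m : ℕ) : D.br (D.t ^ m)⁻¹ * D.br D.w = D.br ((D.t ^ m)⁻¹ * D.w) :=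
  D.t_pow_mul_br m fun l hl => D.U_conj' 0 D.w_mem (by simpa using hl 0)

theorem br_w_sq (g : G) : ∃ c : ℂ, D.br (g * (D.w * D.w)) = c • D.br g :=
  ⟨_, bracket_mul_right D.orbitFinite g ⟨_, D.w_sq_mem⟩⟩

theorem br_one : D.br 1 = 1 := by
  unfold br
  rw [bracket, ← heckeProj_incl D.orbitFinite 1]
  congr 1
  apply Subtype.ext
  funext y
  rw [translate_apply, inv_one, one_mul]
  rfl

theorem w_t_pow_inv (m : ℕ) : D.w * (D.t ^ m)⁻¹ = D.t ^ m * D.w := by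
  induction m with
  | zero => simp
  | succ m ih =>
    have h1 : D.w * D.t⁻¹ = D.t * D.w := by
      have := D.w_t
      rw [mul_inv_eq_iff_eq_mul, mul_assoc, this]; group
    rw [pow_succ', mul_inv_rev, ← mul_assoc, ih, mul_assoc, h1, ← mul_assoc, ← pow_succ, pow_succ']

/-- The representatives of the double cosets on which the alternating words in the generators of the
Hecke algebra are supported. -/
def rep (i : Bool × Bool × ℕ) : G :=
  D.t ^ (if i.1 then (i.2.2 : ℤ) + 1 else -i.2.2) * if xor i.1 i.2.1 then D.w else 1

variable {a b : ℂ}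

/-- Every word in the two generators is a multiple of a single averaged translate. -/
theorem word_eq (i : Bool × Bool × ℕ) : ∃ c : ℂ,
    QuadraticHecke.word (a • D.br D.w) (b • D.br D.u) i = c • D.br (D.rep i) := by
  have hpow : ∀ m : ℕ, ∃ c : ℂ, ((a • D.br D.w) * (b • D.br D.u)) ^ m = c • D.br (D.t ^ m)⁻¹ := by
    intro m
    induction m with
    | zero => exact ⟨1, by rw [pow_zero, pow_zero, inv_one, br_one, one_smul]⟩
    | succ m ih =>
      obtain ⟨c, hc⟩ := ih
      obtain ⟨c', hc'⟩ := D.br_w_sq (D.t ^ 1)⁻¹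
      refine ⟨b * (a * (c' * c)), ?_⟩
      have h1 : D.w * D.u = (D.t ^ 1)⁻¹ * (D.w * D.w) := by
        unfold u
        rw [← mul_assoc, D.w_t, pow_one, mul_assoc]
      rw [pow_succ', hc, smul_mul_smul_comm, D.br_mul_u, h1, hc', smul_smul, smul_mul_smul_comm,
        D.br_t_pow]
      congr 1; ring
  have hpow' : ∀ (m : ℕ) (e : Bool), ∃ c : ℂ, ((a • D.br D.w) * (b • D.br D.u)) ^ m *
      (if e then a • D.br D.w else 1) = c • D.br ((D.t ^ m)⁻¹ * if e then D.w else 1) := by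
    intro m e
    obtain ⟨c, hc⟩ := hpow m
    cases e
    · exact ⟨c, by simpa using hc⟩
    · refine ⟨c * a, ?_⟩
      rw [if_pos rfl, if_pos rfl, hc, smul_mul_smul_comm, D.br_t_pow_w]
  obtain ⟨d, e, m⟩ := i
  obtain ⟨c, hc⟩ := hpow' m e
  unfold QuadraticHecke.word rep
  dsimp only
  rw [hc]
  cases d
  · refine ⟨c, ?_⟩
    simp
  · have h1 : D.u * (D.t ^ m)⁻¹ = D.t ^ ((m : ℤ) + 1) * D.w := by
      unfold u
      rw [mul_assoc, D.w_t_pow_inv, ← mul_assoc, ← pow_succ', zpow_add_one, zpow_natCast, ← pow_succ]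
    rw [if_pos rfl, if_pos rfl, smul_mul_smul_comm, D.u_mul_br, ← mul_assoc, h1]
    cases e
    · exact ⟨b * c, by simp⟩
    · obtain ⟨c', hc'⟩ := D.br_w_sq (D.t ^ ((m : ℤ) + 1))
      refine ⟨b * c * c', ?_⟩
      rw [if_pos rfl, mul_assoc, hc', smul_smul]
      simp

theorem rep_injective {i j : Bool × Bool × ℕ} {k k' : K} (h : k * D.rep i * k' = D.rep j) :
    i = j := by
  obtain ⟨d, e, m⟩ := i
  obtain ⟨d', e', m'⟩ := j
  obtain ⟨h1, h2⟩ := D.disjoint _ _ _ _ k k' h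
  simp only at h1 h2
  cases d <;> cases d' <;> cases e <;> cases e' <;> simp at h1 h2 ⊢ <;> omega

omit D in
theorem one_ne_zero_hecke : (1 : HeckeAlgebra K χ) ≠ 0 := by
  intro h
  have h1 : (1 : HeckeAlgebra K χ) (1 : K) = (0 : HeckeAlgebra K χ) (1 : K) := by rw [h]
  rw [HeckeAlgebra.one_apply_mem, map_one, inv_one, Units.val_one] at h1
  exact one_ne_zero h1

section Presentation

variable (hT : (a • D.br D.w) * (a • D.br D.w) = a • D.br D.w + 2)
  (hU : (b • D.br D.u) * (b • D.br D.u) = 1)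

include hT hU

theorem isUnit_word (i : Bool × Bool × ℕ) :
    IsUnit (QuadraticHecke.word (a • D.br D.w) (b • D.br D.u) i) := by
  have h1 : IsUnit (b • D.br D.u) := ⟨⟨_, _, hU, hU⟩, rfl⟩
  have h2 : IsUnit (a • D.br D.w) := by
    have e : (a • D.br D.w) * ((2⁻¹ : ℂ) • (a • D.br D.w - 1)) = 1 ∧
        ((2⁻¹ : ℂ) • (a • D.br D.w - 1)) * (a • D.br D.w) = 1 := by
      have h3 : (2⁻¹ : ℂ) • (2 : HeckeAlgebra K χ) = 1 := by
        rw [Algebra.smul_def, ← map_ofNat (algebraMap ℂ (HeckeAlgebra K χ)) 2, ← map_mul,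
          inv_mul_cancel₀ two_ne_zero, map_one]
      generalize a • D.br D.w = X at hT ⊢
      rw [mul_smul_comm, smul_mul_assoc, mul_sub, sub_mul, hT, mul_one, one_mul, add_sub_cancel_left]
      exact ⟨h3, h3⟩
    exact ⟨⟨_, _, e.1, e.2⟩, rfl⟩
  obtain ⟨d, e, m⟩ := i
  unfold QuadraticHecke.word
  refine IsUnit.mul ?_ (((h2.mul h1).pow m).mul ?_)
  · split_ifs
    exacts [h1, isUnit_one]
  · split_ifs
    exacts [h2, isUnit_one]

theorem word_ne_zero (i : Bool × Bool × ℕ) :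
    QuadraticHecke.word (a • D.br D.w) (b • D.br D.u) i ≠ 0 := by
  have : Nontrivial (HeckeAlgebra K χ) := ⟨1, 0, one_ne_zero_hecke⟩
  exact (D.isUnit_word hT hU i).ne_zero

/-- The alternating words are nonzero, being units, and are supported on distinct double cosets. -/
theorem linearIndependent_word :
    LinearIndependent ℂ (QuadraticHecke.word (a • D.br D.w) (b • D.br D.u)) := by
  have h1 : ∀ i, ∃ y, QuadraticHecke.word (a • D.br D.w) (b • D.br D.u) i y ≠ 0 := by
    intro i
    by_contra hn
    push Not at hn
    exact D.word_ne_zero hT hU i (Subtype.ext (funext hn))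
  choose y hy using h1
  have h2 : ∀ i y, QuadraticHecke.word (a • D.br D.w) (b • D.br D.u) i y ≠ 0 →
      ∃ k k' : K, k * D.rep i * k' = y := by
    intro i y h
    obtain ⟨c, hc⟩ := D.word_eq (a := a) (b := b) i
    rw [hc] at h
    have h3 : D.br (D.rep i) y ≠ 0 := fun h0 => h (by
      change c • D.br (D.rep i) y = 0
      rw [h0, smul_zero])
    obtain ⟨k, hk, k', hk', e⟩ := DoubleCoset.mem_doubleCoset.1 (bracket_support _ h3)
    exact ⟨⟨k, hk⟩, ⟨k', hk'⟩, e.symm⟩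
  have h3 : ∀ i j, QuadraticHecke.word (a • D.br D.w) (b • D.br D.u) i (y j) ≠ 0 → i = j := by
    intro i j h
    obtain ⟨k, k', e⟩ := h2 i _ h
    obtain ⟨k₁, k₁', e₁⟩ := h2 j _ (hy j)
    refine D.rep_injective (k := k₁⁻¹ * k) (k' := k' * k₁'⁻¹) ?_
    rw [← e] at e₁
    push_cast
    rw [show (k₁ : G)⁻¹ * k * D.rep i * (k' * (k₁' : G)⁻¹) =
      (k₁ : G)⁻¹ * (k * D.rep i * k') * (k₁' : G)⁻¹ by group, ← e₁]
    group
  rw [linearIndependent_iff']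
  intro s g hg i hi
  have h4 := congrArg (LinearMap.proj (y i) ∘ₗ (heckeSubmodule K χ).subtype) hg
  rw [map_sum, map_zero, Finset.sum_eq_single i] at h4
  · rw [map_smul] at h4
    exact (smul_eq_zero.1 h4).resolve_right (hy i)
  · intro j _ hj
    rw [map_smul]
    by_contra hn
    exact hj (h3 j i (right_ne_zero_of_smul hn))
  · exact fun h => absurd hi h

/-- The words span the Hecke algebra: averaged translates span it, and those that are not attached
to the double cosets of the `rep i` vanish. -/
theorem span_word : Submodule.span ℂ
    (Set.range (QuadraticHecke.word (a • D.br D.w) (b • D.br D.u))) = ⊤ := by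
  let S := Submodule.span ℂ (Set.range (QuadraticHecke.word (a • D.br D.w) (b • D.br D.u)))
  have h1 : ∀ i, D.br (D.rep i) ∈ S := by
    intro i
    obtain ⟨c, hc⟩ := D.word_eq (a := a) (b := b) i
    have h0 : c ≠ 0 := by
      rintro rfl
      exact D.word_ne_zero hT hU i (by rw [hc, zero_smul])
    rw [← inv_smul_smul₀ h0 (D.br (D.rep i)), ← hc]
    exact Submodule.smul_mem _ _ (Submodule.subset_span ⟨i, rfl⟩)
  have h2 : ∀ (m : ℤ) (e : Bool), D.br (D.t ^ m * if e then D.w else 1) ∈ S := by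
    intro m e
    rcases le_or_gt m 0 with hm | hm
    · have := h1 (false, e, m.natAbs)
      unfold rep at this
      dsimp only at this
      rwa [if_neg Bool.false_ne_true, Bool.false_xor, Int.natCast_natAbs, abs_of_nonpos hm,
        neg_neg] at this
    · have := h1 (true, !e, (m - 1).natAbs)
      unfold rep at this
      dsimp only at this
      rwa [if_pos rfl, Bool.true_xor, Bool.not_not, Int.natCast_natAbs,
        abs_of_nonneg (by omega), sub_add_cancel] at this
  refine (Submodule.eq_top_iff'.2 fun f => ?_ : S = ⊤)
  have hf : f ∈ Submodule.span ℂ (Set.range (bracket D.orbitFinite)) :=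
    span_bracket D.orbitFinite ▸ Submodule.mem_top
  refine Submodule.span_le.2 ?_ hf
  rintro _ ⟨g, rfl⟩
  rcases D.bruhat g with ⟨k, k', m, rfl | rfl⟩ | ⟨k, k', e, hk⟩
  · rw [bracket_mul_right, bracket_mul_left]
    have := h2 m false
    rw [if_neg Bool.false_ne_true, mul_one] at this
    exact Submodule.smul_mem _ _ (Submodule.smul_mem _ _ this)
  · rw [bracket_mul_right, bracket_mul_left]
    exact Submodule.smul_mem _ _ (Submodule.smul_mem _ _ (h2 m true))
  · rw [bracket_eq_zero D.orbitFinite e hk]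
    exact Submodule.zero_mem _

/-- The Hecke algebra is presented by the quadratic relations. -/
theorem exists_algEquiv : ∃ e : QuadraticHecke ≃ₐ[ℂ] HeckeAlgebra K χ,
    e QuadraticHecke.T = a • D.br D.w ∧ e QuadraticHecke.U = b • D.br D.u :=
  ⟨AlgEquiv.ofBijective _ (QuadraticHecke.lift_bijective hT hU (D.linearIndependent_word hT hU)
    (D.span_word hT hU)), QuadraticHecke.lift_T hT hU, QuadraticHecke.lift_U hT hU⟩

end Presentation

theorem br_u_sq : D.br D.u * D.br D.u = (χ ⟨D.w * D.w, D.w_sq_mem⟩ : ℂ) • 1 := by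
  rw [D.br_mul_u, u_mul_u, ← D.br_one]
  have := bracket_mul_left D.orbitFinite ⟨D.w * D.w, D.w_sq_mem⟩ 1
  rwa [mul_one] at this

theorem heckeIncl_br_w : heckeIncl K χ (D.br D.w) =
    (D.q : ℂ)⁻¹ • ∑ j ∈ Finset.range D.q, translate K χ (D.n j * D.w) := by
  have h1 : ∀ x ∈ D.U 0, regRep K χ x (translate K χ D.w) = translate K χ D.w := by
    have := D.fixed_J (fun x hx => D.fixed_of_mem (translate_one_mem (K := K) (χ := χ)) hx) D.w_mem
    rwa [regRep_translate, mul_one] at this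
  have h2 := D.projK_eq generated_regRep h1
  simp only [regRep_translate] at h2
  exact h2

theorem w_mul_n_mul_w (j : ℚ_[2]) : D.w * D.n j * D.w = D.n' (-j) * (D.w * D.w) := by
  rw [← D.w_n]; group

theorem br_w_mul_br_w : D.br D.w * D.br D.w = ((χ ⟨D.w * D.w, D.w_sq_mem⟩ : ℂ) * (D.q : ℂ)⁻¹) •
    ∑ j ∈ Finset.range D.q, D.br (D.n' (-j)) := by
  have h1 : D.br D.w * D.br D.w = heckeProj D.orbitFinite
      (regRep K χ D.w (heckeIncl K χ (D.br D.w))) := bracket_mul _ _ _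
  have h2 : ∀ j : ℚ_[2], heckeProj D.orbitFinite (regRep K χ D.w (translate K χ (D.n j * D.w))) =
      (χ ⟨D.w * D.w, D.w_sq_mem⟩ : ℂ) • D.br (D.n' (-j)) := by
    intro j
    rw [regRep_translate, ← mul_assoc, w_mul_n_mul_w]
    exact bracket_mul_right D.orbitFinite _ ⟨_, D.w_sq_mem⟩
  rw [h1, heckeIncl_br_w, map_smul, map_smul, map_sum, map_sum,
    Finset.sum_congr rfl fun (j : ℕ) _ => h2 j, ← Finset.smul_sum, smul_smul, mul_comm (D.q : ℂ)⁻¹]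

theorem br_w_apply : D.br D.w D.w = (D.q : ℂ)⁻¹ := by
  have h1 : D.br D.w D.w = (heckeIncl K χ (D.br D.w) : G → ℂ) D.w := rfl
  have h2 : (LinearMap.proj D.w ∘ₗ (regular K χ).subtype : regular K χ →ₗ[ℂ] ℂ)
      (heckeIncl K χ (D.br D.w)) = (D.q : ℂ)⁻¹ := by
    rw [heckeIncl_br_w, map_smul, map_sum, Finset.sum_eq_single 0]
    · change (D.q : ℂ)⁻¹ • (translate K χ _ : G → ℂ) D.w = _
      rw [translate_apply, Nat.cast_zero, D.n_zero, one_mul, inv_mul_cancel]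
      have := HeckeAlgebra.one_apply_mem (χ := χ) (1 : K)
      rw [map_one, inv_one, Units.val_one] at this
      rw [show (1 : HeckeAlgebra K χ) (1 : G) = 1 from this, smul_eq_mul, mul_one]
    · intro j hj hj0
      change (translate K χ _ : G → ℂ) D.w = 0
      rw [translate_apply]
      refine HeckeAlgebra.one_apply_notMem fun hm => ?_
      refine D.n'_notMem j (Nat.pos_of_ne_zero hj0) (Finset.mem_range.1 hj) ?_
      have e : (D.w * D.w)⁻¹ * (D.n' j * (D.w * D.w)) = (D.n j * D.w)⁻¹ * D.w := by
        have := D.w_n (-j)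
        rw [neg_neg] at this
        rw [← this, D.n_neg]; group
      rw [← D.w_sq_comm, inv_mul_cancel_left] at e
      rwa [e]
    · intro h
      exact absurd (Finset.mem_range.2 D.q_pos) h
  exact h1.trans h2

theorem br_u_apply : D.br D.u D.u = 1 := by
  have h1 : translate K χ D.u ∈ isotypic K χ (regRep K χ) := by
    have := D.u_mem (translate_one_mem (K := K) (χ := χ))
    rwa [regRep_translate, mul_one] at this
  have h2 : heckeIncl K χ (D.br D.u) = translate K χ D.u :=
    isoProj_of_mem (generated_regRep.locallyFinite D.orbitFinite) h1
  have h3 : D.br D.u D.u = (translate K χ D.u : G → ℂ) D.u :=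
    congrFun (congrArg Subtype.val h2) D.u
  have h4 := HeckeAlgebra.one_apply_mem (χ := χ) (1 : K)
  rw [map_one, inv_one, Units.val_one] at h4
  rw [h3, translate_apply, inv_mul_cancel]
  exact h4

theorem isDoubleCoset_smul_br {g : G} (c d : ℂ) (h : c * D.br g g = d) :
    (c • D.br g).IsDoubleCoset g d := by
  refine ⟨fun x hx => bracket_support D.orbitFinite (g := g) fun h0 => hx ?_, h⟩
  change c * D.br g x = 0
  rw [show D.br g x = 0 from h0, mul_zero]

end IwahoriDatum
end LocalShimura

/-! ### Matrices in `PGL₂(ℚ₂)` -/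

namespace LocalShimura

theorem norm_two : ‖(2 : ℚ_[2])‖ = 2⁻¹ := by simpa using Padic.norm_p (p := 2)

theorem norm_two_zpow (m : ℤ) : ‖(2 : ℚ_[2]) ^ m‖ = 2 ^ (-m) := by
  rw [norm_zpow, norm_two, inv_zpow']

theorem two_zpow_ne (m : ℤ) : (2 : ℚ_[2]) ^ m ≠ 0 := zpow_ne_zero _ two_ne_zero

theorem eq_of_norm_two_zpow {m m' : ℤ} (h : ‖(2 : ℚ_[2]) ^ m‖ = ‖(2 : ℚ_[2]) ^ m'‖) : m = m' := by
  rw [norm_two_zpow, norm_two_zpow] at h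
  have := zpow_right_injective₀ (a := (2 : ℝ)) (by norm_num) (by norm_num) h
  omega

theorem exists_zpow_mul {a : ℚ_[2]} (ha : a ≠ 0) : ∃ (m : ℤ) (u : ℚ_[2]), ‖u‖ = 1 ∧ a = 2 ^ m * u := by
  refine ⟨a.valuation, a / 2 ^ a.valuation, ?_, by field_simp [two_zpow_ne]⟩
  rw [norm_div, norm_two_zpow, Padic.norm_eq_zpow_neg_valuation ha]
  exact div_self (by positivity)

theorem exists_padicInt {a : ℚ_[2]} (ha : ‖a‖ ≤ 1) : ∃ x : ℤ_[2], (x : ℚ_[2]) = a := ⟨⟨a, ha⟩, rfl⟩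

theorem norm_div_le_one {a b : ℚ_[2]} (hb : b ≠ 0) (h : ‖a‖ ≤ ‖b‖) : ‖a / b‖ ≤ 1 := by
  rw [norm_div]; exact (div_le_one (norm_pos_iff.2 hb)).2 h

theorem norm_div_lt_one {a b : ℚ_[2]} (h : ‖a‖ < ‖b‖) : ‖a / b‖ < 1 := by
  rw [norm_div]; exact (div_lt_one ((norm_nonneg a).trans_lt h)).2 h

theorem norm_mul_le_one {a b : ℚ_[2]} (ha : ‖a‖ ≤ 1) (hb : ‖b‖ ≤ 1) : ‖a * b‖ ≤ 1 := by
  rw [norm_mul]; exact mul_le_one₀ ha (norm_nonneg _) hb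

theorem norm_mul_lt_one {a b : ℚ_[2]} (ha : ‖a‖ ≤ 1) (hb : ‖b‖ < 1) : ‖a * b‖ < 1 := by
  rw [norm_mul]; exact mul_lt_one_of_nonneg_of_lt_one_right ha (norm_nonneg _) hb

theorem norm_sub_eq_of_lt {a b : ℚ_[2]} (h : ‖b‖ < ‖a‖) : ‖a - b‖ = ‖a‖ := by
  rw [sub_eq_add_neg, Padic.add_eq_max_of_ne (by rw [norm_neg]; exact h.ne'), norm_neg,
    max_eq_left h.le]

theorem exists_pow_norm_mul_le_one (x : ℚ_[2]) : ∃ M : ℕ, ‖2 ^ M * x‖ ≤ 1 := by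
  obtain ⟨M, hM⟩ := pow_unbounded_of_one_lt ‖x‖ (one_lt_two (α := ℝ))
  refine ⟨M, ?_⟩
  rw [norm_mul, norm_pow, norm_two, inv_pow, inv_mul_le_iff₀ (by positivity), mul_one]
  exact hM.le

end LocalShimura

namespace PGLTwo

open Matrix LocalShimura

/-- The class in `PGL₂(ℚ₂)` of the matrix with rows `(a, b)` and `(c, d)`. -/
noncomputable def mat (a b c d : ℚ_[2]) (h : a * d - b * c ≠ 0) : PGL(2, ℚ_[2]) :=
  ProjGenLinGroup.mk (GeneralLinearGroup.mkOfDetNeZero !![a, b; c, d]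
    (by rwa [det_fin_two_of]))

theorem exists_mat (g : PGL(2, ℚ_[2])) : ∃ a b c d h, g = mat a b c d h := by
  obtain ⟨A, rfl⟩ := ProjGenLinGroup.mk_surjective g
  refine ⟨A 0 0, A 0 1, A 1 0, A 1 1, ?_, ?_⟩
  · rw [← det_fin_two]; exact A.det_ne_zero
  · refine congrArg _ (Units.ext ?_)
    exact eta_fin_two _

theorem mat_mul {a b c d a' b' c' d' : ℚ_[2]} (h : a * d - b * c ≠ 0) (h' : a' * d' - b' * c' ≠ 0) :
    mat a b c d h * mat a' b' c' d' h' = mat (a * a' + b * c') (a * b' + b * d')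
      (c * a' + d * c') (c * b' + d * d') (by
        have := mul_ne_zero h h'
        contrapose! this
        linear_combination this) := by
  unfold mat
  rw [← map_mul]
  refine congrArg _ (Units.ext ?_)
  exact mul_fin_two _ _ _ _ _ _ _ _

theorem mkOfDetNeZero_mul_scalar (A : Matrix (Fin 2) (Fin 2) ℚ_[2]) (h : A.det ≠ 0) (u : ℚ_[2]ˣ)
    (i j : Fin 2) : ((GeneralLinearGroup.mkOfDetNeZero A h * .scalar (Fin 2) u :
      GL (Fin 2) ℚ_[2]) : Matrix (Fin 2) (Fin 2) ℚ_[2]) i j = A i j * u := by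
  rw [Units.val_mul, GeneralLinearGroup.coe_scalar]
  change (A * Matrix.scalar (Fin 2) (u : ℚ_[2])) i j = _
  simp [Matrix.scalar_apply]

theorem mat_eq {a b c d a' b' c' d' : ℚ_[2]} {h : a * d - b * c ≠ 0} {h' : a' * d' - b' * c' ≠ 0}
    (u : ℚ_[2]) (hu : u ≠ 0) (ha : a = u * a') (hb : b = u * b') (hc : c = u * c')
    (hd : d = u * d') : mat a b c d h = mat a' b' c' d' h' := by
  unfold mat
  rw [eq_comm, ProjGenLinGroup.mk_eq_mk_iff]
  refine ⟨Units.mk0 u hu, Units.ext ?_⟩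
  ext i j
  rw [mkOfDetNeZero_mul_scalar]
  change _ = !![a, b; c, d] i j
  fin_cases i <;> fin_cases j <;> simp [*, mul_comm]

theorem eq_of_mat_eq {a b c d a' b' c' d' : ℚ_[2]} {h : a * d - b * c ≠ 0}
    {h' : a' * d' - b' * c' ≠ 0} (e : mat a b c d h = mat a' b' c' d' h') :
    ∃ u ≠ 0, a' = a * u ∧ b' = b * u ∧ c' = c * u ∧ d' = d * u := by
  unfold mat at e
  rw [ProjGenLinGroup.mk_eq_mk_iff] at e
  obtain ⟨u, hu⟩ := e
  have key : ∀ i j, !![a', b'; c', d'] i j = !![a, b; c, d] i j * u := fun i j => by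
    rw [← mkOfDetNeZero_mul_scalar _ (by rwa [det_fin_two_of]), hu]; rfl
  exact ⟨u, u.ne_zero, key 0 0, key 0 1, key 1 0, key 1 1⟩

/-- The homomorphism `GL₂(ℤ₂) → PGL₂(ℚ₂)`. -/
noncomputable def fromInt : GL (Fin 2) ℤ_[2] →* PGL(2, ℚ_[2]) :=
  ProjGenLinGroup.mk.comp (GeneralLinearGroup.map PadicInt.Coe.ringHom)

theorem fromInt_eq (A : GL (Fin 2) ℤ_[2]) : ∃ h,
    fromInt A = mat (A 0 0 : ℚ_[2]) (A 0 1) (A 1 0) (A 1 1) h := by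
  have hd := (GeneralLinearGroup.map PadicInt.Coe.ringHom A).det_ne_zero
  rw [det_fin_two] at hd
  refine ⟨hd, congrArg ProjGenLinGroup.mk (Units.ext ?_)⟩
  exact eta_fin_two _

theorem norm_det_eq_one (A : GL (Fin 2) ℤ_[2]) :
    ‖(A 0 0 : ℚ_[2]) * A 1 1 - A 0 1 * A 1 0‖ = 1 := by
  have := PadicInt.isUnit_iff.1 (isUnits_det_units A)
  rw [det_fin_two] at this
  exact this

theorem exists_fromInt {a b c d : ℚ_[2]} {h : a * d - b * c ≠ 0} (ha : ‖a‖ ≤ 1) (hb : ‖b‖ ≤ 1)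
    (hc : ‖c‖ ≤ 1) (hd : ‖d‖ ≤ 1) (hD : ‖a * d - b * c‖ = 1) : ∃ A : GL (Fin 2) ℤ_[2],
    (A 0 0 : ℚ_[2]) = a ∧ (A 0 1 : ℚ_[2]) = b ∧ (A 1 0 : ℚ_[2]) = c ∧ (A 1 1 : ℚ_[2]) = d ∧
    mat a b c d h = fromInt A := by
  obtain ⟨a, rfl⟩ := exists_padicInt ha
  obtain ⟨b, rfl⟩ := exists_padicInt hb
  obtain ⟨c, rfl⟩ := exists_padicInt hc
  obtain ⟨d, rfl⟩ := exists_padicInt hd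
  have hu : IsUnit (!![a, b; c, d]).det := by
    rw [PadicInt.isUnit_iff, det_fin_two_of]
    exact hD
  refine ⟨GeneralLinearGroup.mk'' _ hu, rfl, rfl, rfl, rfl, ?_⟩
  exact (fromInt_eq (GeneralLinearGroup.mk'' _ hu)).2.symm

/-- The image of `GL₂(ℤ₂)`. -/
noncomputable def maxCompact : Subgroup PGL(2, ℚ_[2]) := fromInt.range

/-- The image of the principal congruence subgroup of level `2ᵐ⁺¹`. -/
noncomputable def congr (m : ℕ) : Subgroup PGL(2, ℚ_[2]) :=
  (GeneralLinearGroup.map (n := Fin 2) (PadicInt.toZModPow (p := 2) (m + 1))).ker.map fromInt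

theorem mat_mem_maxCompact {a b c d : ℚ_[2]} {h : a * d - b * c ≠ 0} (ha : ‖a‖ ≤ 1) (hb : ‖b‖ ≤ 1)
    (hc : ‖c‖ ≤ 1) (hd : ‖d‖ ≤ 1) (hD : ‖a * d - b * c‖ = 1) : mat a b c d h ∈ maxCompact := by
  obtain ⟨A, -, -, -, -, hA⟩ := exists_fromInt (h := h) ha hb hc hd hD
  exact ⟨A, hA.symm⟩

theorem mat_mem_iwahori {a b c d : ℚ_[2]} {h : a * d - b * c ≠ 0} (ha : ‖a‖ ≤ 1) (hb : ‖b‖ ≤ 1)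
    (hc : ‖c‖ < 1) (hd : ‖d‖ ≤ 1) (hD : ‖a * d - b * c‖ = 1) : mat a b c d h ∈ iwahori := by
  obtain ⟨A, -, -, h3, -, hA⟩ := exists_fromInt (h := h) ha hb hc.le hd hD
  refine ⟨_, ⟨A, ?_, rfl⟩, hA.symm⟩
  change (2 : ℤ_[2]) ∣ A 1 0
  have := (PadicInt.norm_lt_one_iff_dvd (p := 2) (A 1 0)).1 (by rw [PadicInt.norm_def, h3]; exact hc)
  exact_mod_cast this

theorem exists_of_mem_iwahori {g : PGL(2, ℚ_[2])} (hg : g ∈ iwahori) : ∃ a b c d h,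
    g = mat a b c d h ∧ ‖a‖ = 1 ∧ ‖b‖ ≤ 1 ∧ ‖c‖ < 1 ∧ ‖d‖ = 1 := by
  obtain ⟨_, ⟨A, hA, rfl⟩, rfl⟩ := hg
  obtain ⟨h, e⟩ := fromInt_eq A
  have hc : ‖(A 1 0 : ℚ_[2])‖ < 1 := by
    rw [← PadicInt.norm_def, PadicInt.norm_lt_one_iff_dvd]
    exact_mod_cast hA
  have hD := norm_det_eq_one A
  have hbc : ‖(A 0 1 : ℚ_[2]) * A 1 0‖ < 1 := norm_mul_lt_one (PadicInt.norm_le_one _) hc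
  have had : ‖(A 0 0 : ℚ_[2]) * A 1 1‖ = 1 := by
    rw [← sub_add_cancel ((A 0 0 : ℚ_[2]) * A 1 1) (A 0 1 * A 1 0),
      Padic.add_eq_max_of_ne (by rw [hD]; exact hbc.ne'), hD, max_eq_left hbc.le]
  have ha : ‖(A 0 0 : ℚ_[2])‖ ≤ 1 := PadicInt.norm_le_one _
  have hd : ‖(A 1 1 : ℚ_[2])‖ ≤ 1 := PadicInt.norm_le_one _
  rw [norm_mul] at had
  refine ⟨_, _, _, _, h, e, ?_, PadicInt.norm_le_one _, hc, ?_⟩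
  · nlinarith [norm_nonneg (A 0 0 : ℚ_[2]), norm_nonneg (A 1 1 : ℚ_[2])]
  · nlinarith [norm_nonneg (A 0 0 : ℚ_[2]), norm_nonneg (A 1 1 : ℚ_[2])]

theorem dvd_iff_norm (k : ℕ) (x : ℤ_[2]) :
    PadicInt.toZModPow (p := 2) k x = 0 ↔ ‖(x : ℚ_[2])‖ ≤ ‖(2 : ℚ_[2]) ^ k‖ := by
  rw [← RingHom.mem_ker, PadicInt.ker_toZModPow, ← PadicInt.norm_le_pow_iff_mem_span_pow,
    PadicInt.norm_def, norm_pow, norm_two, _root_.zpow_neg, inv_pow]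
  simp

theorem mem_congr_iff {m : ℕ} {A : GL (Fin 2) ℤ_[2]} :
    A ∈ (GeneralLinearGroup.map (n := Fin 2) (PadicInt.toZModPow (p := 2) (m + 1))).ker ↔
      ‖(A 0 0 : ℚ_[2]) - 1‖ ≤ ‖(2 : ℚ_[2]) ^ (m + 1)‖ ∧ ‖(A 0 1 : ℚ_[2])‖ ≤ ‖(2 : ℚ_[2]) ^ (m + 1)‖ ∧
      ‖(A 1 0 : ℚ_[2])‖ ≤ ‖(2 : ℚ_[2]) ^ (m + 1)‖ ∧ ‖(A 1 1 : ℚ_[2]) - 1‖ ≤ ‖(2 : ℚ_[2]) ^ (m + 1)‖ := by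
  have e : ∀ x : ℤ_[2], (x : ℚ_[2]) - 1 = ((x - 1 : ℤ_[2]) : ℚ_[2]) := fun x => by push_cast; rfl
  rw [e, e, ← dvd_iff_norm, ← dvd_iff_norm, ← dvd_iff_norm, ← dvd_iff_norm, map_sub, map_sub, map_one,
    sub_eq_zero, sub_eq_zero, MonoidHom.mem_ker]
  constructor
  · intro h
    have h1 := fun i j => congrArg (fun B : GL (Fin 2) (ZMod (2 ^ (m + 1))) => B i j) h
    exact ⟨h1 0 0, h1 0 1, h1 1 0, h1 1 1⟩
  · rintro ⟨h1, h2, h3, h4⟩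
    refine Units.ext ?_
    ext i j
    fin_cases i <;> fin_cases j
    exacts [h1, h2, h3, h4]

theorem norm_le_one_of_sub {a : ℚ_[2]} {k : ℕ} (h : ‖a - 1‖ ≤ ‖(2 : ℚ_[2]) ^ (k + 1)‖) : ‖a‖ = 1 := by
  have h1 : ‖a - 1‖ < ‖(1 : ℚ_[2])‖ := by
    refine h.trans_lt ?_
    rw [norm_pow, norm_two, norm_one]
    exact pow_lt_one₀ (by norm_num) (by norm_num) (by omega)
  have := Padic.add_eq_max_of_ne h1.ne
  rwa [sub_add_cancel, max_eq_right h1.le, norm_one] at this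

theorem two_pow_succ_lt (k : ℕ) : ‖(2 : ℚ_[2]) ^ (k + 1)‖ < 1 := by
  rw [norm_pow, norm_two]
  exact pow_lt_one₀ (by norm_num) (by norm_num) (by omega)

theorem mat_mem_congr {m : ℕ} {a b c d : ℚ_[2]} {h : a * d - b * c ≠ 0}
    (ha : ‖a - 1‖ ≤ ‖(2 : ℚ_[2]) ^ (m + 1)‖) (hb : ‖b‖ ≤ ‖(2 : ℚ_[2]) ^ (m + 1)‖)
    (hc : ‖c‖ ≤ ‖(2 : ℚ_[2]) ^ (m + 1)‖) (hd : ‖d - 1‖ ≤ ‖(2 : ℚ_[2]) ^ (m + 1)‖) :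
    mat a b c d h ∈ congr m := by
  have h1 := two_pow_succ_lt m
  have hbc : ‖b * c‖ < 1 := norm_mul_lt_one (hb.trans h1.le) (hc.trans_lt h1)
  have had : ‖a * d‖ = 1 := by
    rw [norm_mul, norm_le_one_of_sub ha, norm_le_one_of_sub hd, one_mul]
  obtain ⟨A, rfl, rfl, rfl, rfl, hA⟩ := exists_fromInt (h := h) (norm_le_one_of_sub ha).le
    (hb.trans h1.le) (hc.trans h1.le) (norm_le_one_of_sub hd).le
    (by rw [norm_sub_eq_of_lt (by rwa [had]), had])
  exact ⟨A, mem_congr_iff.2 ⟨ha, hb, hc, hd⟩, hA.symm⟩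

theorem exists_of_mem_congr {m : ℕ} {g : PGL(2, ℚ_[2])} (hg : g ∈ congr m) : ∃ a b c d h,
    g = mat a b c d h ∧ ‖a - 1‖ ≤ ‖(2 : ℚ_[2]) ^ (m + 1)‖ ∧ ‖b‖ ≤ ‖(2 : ℚ_[2]) ^ (m + 1)‖ ∧
    ‖c‖ ≤ ‖(2 : ℚ_[2]) ^ (m + 1)‖ ∧ ‖d - 1‖ ≤ ‖(2 : ℚ_[2]) ^ (m + 1)‖ := by
  obtain ⟨A, hA, rfl⟩ := hg
  obtain ⟨h, e⟩ := fromInt_eq A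
  exact ⟨_, _, _, _, h, e, mem_congr_iff.1 hA⟩

theorem congr_antitone : Antitone congr := by
  intro m m' hm g hg
  obtain ⟨a, b, c, d, h, rfl, h1, h2, h3, h4⟩ := exists_of_mem_congr hg
  have : ‖(2 : ℚ_[2]) ^ (m' + 1)‖ ≤ ‖(2 : ℚ_[2]) ^ (m + 1)‖ := by
    rw [norm_pow, norm_pow, norm_two]
    exact pow_le_pow_of_le_one (by norm_num) (by norm_num) (by omega)
  exact mat_mem_congr (h1.trans this) (h2.trans this) (h3.trans this) (h4.trans this)

theorem congr_normal (m : ℕ) : ∀ j ∈ maxCompact, ∀ x ∈ congr m, j * x * j⁻¹ ∈ congr m := by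
  rintro _ ⟨A, rfl⟩ _ ⟨B, hB, rfl⟩
  rw [← map_mul, ← map_inv, ← map_mul]
  exact ⟨_, (MonoidHom.normal_ker _).conj_mem _ hB A, rfl⟩

theorem relIndex_congr (m : ℕ) : (congr m).relIndex maxCompact ≠ 0 := by
  unfold maxCompact congr
  rw [MonoidHom.range_eq_map, Subgroup.relIndex_map_map, top_sup_eq, Subgroup.relIndex_top_right]
  have h1 : ((GeneralLinearGroup.map (n := Fin 2) (PadicInt.toZModPow (p := 2) (m + 1))).ker).FiniteIndex :=
    have : Finite (GL (Fin 2) (ZMod (2 ^ (m + 1)))) := inferInstance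
    inferInstance
  exact (Subgroup.finiteIndex_of_le (le_sup_left (b := fromInt.ker))).index_ne_zero

theorem congr_zero_le : congr 0 ≤ iwahori := by
  intro g hg
  obtain ⟨a, b, c, d, h, rfl, h1, h2, h3, h4⟩ := exists_of_mem_congr hg
  have h5 := two_pow_succ_lt 0
  have ha := norm_le_one_of_sub h1
  have hd := norm_le_one_of_sub h4
  refine mat_mem_iwahori ha.le (h2.trans h5.le) (h3.trans_lt h5) hd.le ?_
  have had : ‖a * d‖ = 1 := by rw [norm_mul, ha, hd, one_mul]
  rw [norm_sub_eq_of_lt (by rw [had]; exact norm_mul_lt_one (h2.trans h5.le) (h3.trans_lt h5)), had]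

theorem iwahori_le : iwahori ≤ maxCompact := by
  rintro _ ⟨_, ⟨A, -, rfl⟩, rfl⟩
  exact ⟨A, rfl⟩

end PGLTwo

/-! ### The Iwahori subgroup of `PGL₂(ℚ₂)` -/

namespace PGLTwo

open Matrix LocalShimura

/-- The upper triangular unipotent elements. -/
noncomputable def upper (b : ℚ_[2]) : PGL(2, ℚ_[2]) := mat 1 b 0 1 (by simp)

/-- The lower triangular unipotent elements. -/
noncomputable def lower (b : ℚ_[2]) : PGL(2, ℚ_[2]) := mat 1 0 b 1 (by simp)

/-- The classes of the matrices `diag(1, x)`. -/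
noncomputable def torus : ℚ_[2]ˣ →* PGL(2, ℚ_[2]) :=
  MonoidHom.mk' (fun x => mat 1 0 0 x (by simp)) fun x y => by
    rw [mat_mul]
    exact mat_eq 1 one_ne_zero (by simp) (by simp) (by simp) (by simp)

theorem torus_apply (x : ℚ_[2]ˣ) : torus x = mat 1 0 0 x (by simp) := rfl

/-- The class of `diag(1, 2)`. -/
noncomputable def t : PGL(2, ℚ_[2]) := torus (Units.mk0 2 two_ne_zero)

theorem t_zpow (m : ℤ) : t ^ m = mat 1 0 0 (2 ^ m) (by simp [two_zpow_ne]) := by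
  unfold t
  rw [← map_zpow, torus_apply]
  exact mat_eq 1 one_ne_zero (by simp) (by simp) (by simp) (by simp)

/-- The class of the matrix with rows `(0, 1)` and `(-1, 0)`. It lies in the coset `w I`, and
conjugation by it inverts the parameter of unipotent elements as in the double cover of `SL₂`. -/
noncomputable def weyl : PGL(2, ℚ_[2]) := mat 0 1 (-1) 0 (by simp)

theorem weyl_eq : weyl = mat 0 1 (-1) 0 (by simp) := rfl

theorem t_eq : t = mat 1 0 0 2 (by simp) := rfl

theorem one_eq : (1 : PGL(2, ℚ_[2])) = mat 1 0 0 1 (by simp) := (map_one torus).symm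

theorem mat_inv {a b c d : ℚ_[2]} (h : a * d - b * c ≠ 0) :
    (mat a b c d h)⁻¹ = mat d (-b) (-c) a (by convert h using 1; ring) := by
  rw [inv_eq_iff_mul_eq_one, mat_mul, one_eq]
  exact mat_eq _ h (by ring) (by ring) (by ring) (by ring)

theorem weyl_mul_weyl : weyl * weyl = 1 := by
  rw [weyl_eq, mat_mul, one_eq]
  exact mat_eq (-1) (by simp) (by simp) (by simp) (by simp) (by simp)

theorem weyl_mem_maxCompact : weyl ∈ maxCompact := by
  rw [weyl_eq]
  exact mat_mem_maxCompact (by simp) (by simp) (by simp) (by simp) (by simp)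

theorem upper_mem {b : ℚ_[2]} (hb : ‖b‖ ≤ 1) : upper b ∈ iwahori :=
  mat_mem_iwahori (by simp) hb (by simp) (by simp) (by simp)

theorem lower_mem {b : ℚ_[2]} (hb : ‖b‖ < 1) : lower b ∈ iwahori :=
  mat_mem_iwahori (by simp) (by simp) hb (by simp) (by simp)

theorem lower_mem_maxCompact {b : ℚ_[2]} (hb : ‖b‖ ≤ 1) : lower b ∈ maxCompact :=
  mat_mem_maxCompact (by simp) (by simp) hb (by simp) (by simp)

theorem torus_mem {x : ℚ_[2]ˣ} (hx : ‖(x : ℚ_[2])‖ = 1) : torus x ∈ iwahori := by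
  rw [torus_apply]
  exact mat_mem_iwahori (by simp) (by simp) (by simp) hx.le (by simp [hx])

theorem lower_mem_congr {m : ℕ} {b : ℚ_[2]} (hb : ‖b‖ ≤ ‖(2 : ℚ_[2]) ^ (m + 1)‖) :
    lower b ∈ congr m :=
  mat_mem_congr (by simp) (by simp) hb (by simp)

theorem upper_mem_congr {m : ℕ} {b : ℚ_[2]} (hb : ‖b‖ ≤ ‖(2 : ℚ_[2]) ^ (m + 1)‖) :
    upper b ∈ congr m :=
  mat_mem_congr (by simp) hb (by simp) (by simp)

theorem diag_eq {a d : ℚ_[2]} (h : a * d - 0 * 0 ≠ 0) : ∃ (m : ℤ) (k : PGL(2, ℚ_[2])), k ∈ iwahori ∧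
    mat a 0 0 d h = t ^ m * k ∧ (‖d‖ ≤ ‖a‖ → 0 ≤ m) := by
  have ha : a ≠ 0 := by rintro rfl; simp at h
  have hd : d ≠ 0 := by rintro rfl; simp at h
  obtain ⟨m, x, hx, e⟩ := exists_zpow_mul (div_ne_zero hd ha)
  have hx0 : x ≠ 0 := norm_ne_zero_iff.1 (by rw [hx]; exact one_ne_zero)
  refine ⟨m, torus (Units.mk0 x hx0), torus_mem hx, ?_, fun hda => ?_⟩
  · rw [t_zpow, torus_apply, mat_mul]
    refine mat_eq a ha (by simp) (by simp) (by simp) ?_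
    simp only [Units.val_mk0, mul_zero, zero_add]
    rw [← e]; field_simp
  · have h1 := norm_div_le_one ha hda
    rw [e, norm_mul, hx, mul_one, norm_two_zpow] at h1
    by_contra hm
    have := one_lt_zpow₀ (a := (2 : ℝ)) (by norm_num) (n := -m) (by omega)
    linarith

theorem antidiag_eq {b c : ℚ_[2]} (h : 0 * 0 - b * c ≠ 0) : ∃ (m : ℤ) (k : PGL(2, ℚ_[2])),
    k ∈ iwahori ∧ mat 0 b c 0 h = t ^ m * weyl * k := by
  have hb : b ≠ 0 := by rintro rfl; simp at h
  have hc : c ≠ 0 := by rintro rfl; simp at h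
  obtain ⟨m, x, hx, e⟩ := exists_zpow_mul (div_ne_zero hc hb)
  have hx0 : x ≠ 0 := norm_ne_zero_iff.1 (by rw [hx]; exact one_ne_zero)
  refine ⟨m, mat (-x) 0 0 1 (by simpa using hx0),
    mat_mem_iwahori (by simp [hx]) (by simp) (by simp) (by simp) (by simp [hx]), ?_⟩
  rw [t_zpow, weyl_eq, mat_mul, mat_mul]
  refine mat_eq b hb (by simp) (by simp) ?_ (by simp)
  have : c = b * (2 ^ m * x) := by rw [← e]; field_simp
  simpa using this

section Pivot

variable {a b c d : ℚ_[2]} (h : a * d - b * c ≠ 0)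

theorem pivot_a (ha : a ≠ 0) : mat a b c d h =
    lower (c / a) * mat a 0 0 ((a * d - b * c) / a) (by simp [ha, h]) * upper (b / a) := by
  unfold lower upper
  rw [mat_mul, mat_mul]
  exact mat_eq 1 one_ne_zero (by simp) (by field_simp; ring) (by field_simp; ring)
    (by field_simp; ring)

theorem pivot_d (hd : d ≠ 0) : mat a b c d h =
    upper (b / d) * mat ((a * d - b * c) / d) 0 0 d (by simp [hd, h]) * lower (c / d) := by
  unfold lower upper
  rw [mat_mul, mat_mul]
  exact mat_eq 1 one_ne_zero (by field_simp; ring) (by field_simp; ring) (by field_simp; ring)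
    (by simp)

theorem pivot_c (hc : c ≠ 0) : mat a b c d h =
    upper (a / c) * mat 0 (-(a * d - b * c) / c) c 0 (by field_simp; simp [h]) *
      upper (d / c) := by
  unfold upper
  rw [mat_mul, mat_mul]
  exact mat_eq 1 one_ne_zero (by field_simp; ring) (by field_simp; ring) (by simp)
    (by field_simp; ring)

theorem pivot_b (hb : b ≠ 0) : mat a b c d h =
    lower (d / b) * mat 0 b (-(a * d - b * c) / b) 0 (by field_simp; simp [h]) *
      lower (a / b) := by
  unfold lower
  rw [mat_mul, mat_mul]
  exact mat_eq 1 one_ne_zero (by field_simp; ring) (by simp) (by field_simp; ring)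
    (by field_simp; ring)

end Pivot

theorem iwasawa (g : PGL(2, ℚ_[2])) : ∃ b, ∃ m : ℤ, ∃ j ∈ maxCompact, g = upper b * t ^ m * j := by
  have key : ∀ a b c d h, ‖c‖ ≤ ‖d‖ → ∃ x, ∃ m : ℤ, ∃ j ∈ maxCompact,
      mat a b c d h = upper x * t ^ m * j := by
    intro a b c d h hcd
    have hd : d ≠ 0 := by
      rintro rfl
      have : c = 0 := by simpa using hcd
      simp [this] at h
    obtain ⟨m, k, hk, e, -⟩ := diag_eq (a := (a * d - b * c) / d) (d := d) (by simp [hd, h])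
    refine ⟨b / d, m, k * lower (c / d), mul_mem (iwahori_le hk)
      (lower_mem_maxCompact (norm_div_le_one hd hcd)), ?_⟩
    rw [pivot_d h hd, e]
    group
  obtain ⟨a, b, c, d, h, rfl⟩ := exists_mat g
  rcases le_total ‖c‖ ‖d‖ with hcd | hcd
  · exact key _ _ _ _ h hcd
  · obtain ⟨x, m, j, hj, e⟩ := key (-b) a (-d) c (by contrapose! h; linear_combination h)
      (by simpa using hcd)
    refine ⟨x, m, j * weyl, mul_mem hj weyl_mem_maxCompact, ?_⟩
    rw [← mul_assoc, ← e, weyl_eq, mat_mul]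
    exact mat_eq (-1) (by simp) (by simp) (by simp) (by simp) (by simp)

/-- If the upper left entry is the largest one, the other entries of its row and column are removed
by integral unipotents; multiplication by `weyl` on either side moves the largest entry there. -/
theorem cartan (g : PGL(2, ℚ_[2])) : ∃ j ∈ maxCompact, ∃ m : ℕ, ∃ j' ∈ maxCompact,
    g = j * t ^ m * j' := by
  have key : ∀ a b c d h, ‖b‖ ≤ ‖a‖ → ‖c‖ ≤ ‖a‖ → ‖d‖ ≤ ‖a‖ → ∃ j ∈ maxCompact, ∃ m : ℕ,
      ∃ j' ∈ maxCompact, mat a b c d h = j * t ^ m * j' := by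
    intro a b c d h hb hc hd
    have ha : a ≠ 0 := by
      rintro rfl
      have : b = 0 := by simpa using hb
      simp [this] at h
    have hD : ‖(a * d - b * c) / a‖ ≤ ‖a‖ := by
      rw [show (a * d - b * c) / a = d - (b / a) * c by field_simp]
      rw [sub_eq_add_neg]
      refine (Padic.nonarchimedean _ _).trans (max_le hd ?_)
      rw [norm_neg, norm_mul]
      exact (mul_le_of_le_one_left (norm_nonneg _) (norm_div_le_one ha hb)).trans hc
    obtain ⟨m, k, hk, e, hm⟩ := diag_eq (a := a) (d := (a * d - b * c) / a) (by simp [ha, h])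
    obtain ⟨m, rfl⟩ := Int.eq_ofNat_of_zero_le (hm hD)
    rw [zpow_natCast] at e
    refine ⟨lower (c / a), lower_mem_maxCompact (norm_div_le_one ha hc), m, k * upper (b / a),
      iwahori_le (mul_mem hk (upper_mem (norm_div_le_one ha hb))), ?_⟩
    rw [pivot_a h ha, e]
    group
  have hl : ∀ g, (∃ j ∈ maxCompact, ∃ m : ℕ, ∃ j' ∈ maxCompact, weyl * g = j * t ^ m * j') →
      ∃ j ∈ maxCompact, ∃ m : ℕ, ∃ j' ∈ maxCompact, g = j * t ^ m * j' := by
    rintro g ⟨j, hj, m, j', hj', e⟩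
    refine ⟨weyl * j, mul_mem weyl_mem_maxCompact hj, m, j', hj', ?_⟩
    rw [mul_assoc weyl, mul_assoc weyl, ← e, ← mul_assoc, weyl_mul_weyl, one_mul]
  have hr : ∀ g, (∃ j ∈ maxCompact, ∃ m : ℕ, ∃ j' ∈ maxCompact, g * weyl = j * t ^ m * j') →
      ∃ j ∈ maxCompact, ∃ m : ℕ, ∃ j' ∈ maxCompact, g = j * t ^ m * j' := by
    rintro g ⟨j, hj, m, j', hj', e⟩
    refine ⟨j, hj, m, j' * weyl, mul_mem hj' weyl_mem_maxCompact, ?_⟩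
    rw [← mul_assoc, ← e, mul_assoc, weyl_mul_weyl, mul_one]
  have el : ∀ a b c d h, weyl * mat a b c d h =
      mat c d (-a) (-b) (by contrapose! h; linear_combination h) := by
    intro a b c d h
    rw [weyl_eq, mat_mul]
    exact mat_eq 1 one_ne_zero (by simp) (by simp) (by simp) (by simp)
  have er : ∀ a b c d h, mat a b c d h * weyl =
      mat (-b) a (-d) c (by contrapose! h; linear_combination h) := by
    intro a b c d h
    rw [weyl_eq, mat_mul]
    exact mat_eq 1 one_ne_zero (by simp) (by simp) (by simp) (by simp)
  obtain ⟨a, b, c, d, h, rfl⟩ := exists_mat g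
  have hmax : (‖b‖ ≤ ‖a‖ ∧ ‖c‖ ≤ ‖a‖ ∧ ‖d‖ ≤ ‖a‖) ∨ (‖a‖ ≤ ‖b‖ ∧ ‖c‖ ≤ ‖b‖ ∧ ‖d‖ ≤ ‖b‖) ∨
      (‖a‖ ≤ ‖c‖ ∧ ‖b‖ ≤ ‖c‖ ∧ ‖d‖ ≤ ‖c‖) ∨ (‖a‖ ≤ ‖d‖ ∧ ‖b‖ ≤ ‖d‖ ∧ ‖c‖ ≤ ‖d‖) := by grind
  rcases hmax with ⟨h1, h2, h3⟩ | ⟨h1, h2, h3⟩ | ⟨h1, h2, h3⟩ | ⟨h1, h2, h3⟩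
  · exact key _ _ _ _ h h1 h2 h3
  · refine hr _ ?_
    rw [er]
    exact key _ _ _ _ _ (by simpa using h1) (by simpa using h3) (by simpa using h2)
  · refine hl _ ?_
    rw [el]
    exact key _ _ _ _ _ (by simpa using h3) (by simpa using h1) (by simpa using h2)
  · refine hl _ (hr _ ?_)
    rw [el, er]
    exact key _ _ _ _ _ (by simpa using h3) (by simpa using h2) (by simpa using h1)

/-- The pivot is the lower left entry if it is as large as the diagonal entries, the upper right
entry if it is larger than the diagonal entries, and the larger diagonal entry otherwise. -/
theorem bruhat (g : PGL(2, ℚ_[2])) : ∃ k k' : iwahori, ∃ m : ℤ, g = k * t ^ m * k' ∨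
    g = k * (t ^ m * weyl) * k' := by
  have diag : ∀ a d (h : a * d - 0 * 0 ≠ 0) (x y : PGL(2, ℚ_[2])), x ∈ iwahori → y ∈ iwahori →
      ∃ k k' : iwahori, ∃ m : ℤ, x * mat a 0 0 d h * y = k * t ^ m * k' ∨
        x * mat a 0 0 d h * y = k * (t ^ m * weyl) * k' := by
    intro a d h x y hx hy
    obtain ⟨m, k, hk, e, -⟩ := diag_eq h
    exact ⟨⟨x, hx⟩, ⟨_, mul_mem hk hy⟩, m, Or.inl (by rw [e]; group)⟩
  have antidiag : ∀ b c (h : 0 * 0 - b * c ≠ 0) (x y : PGL(2, ℚ_[2])), x ∈ iwahori → y ∈ iwahori →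
      ∃ k k' : iwahori, ∃ m : ℤ, x * mat 0 b c 0 h * y = k * t ^ m * k' ∨
        x * mat 0 b c 0 h * y = k * (t ^ m * weyl) * k' := by
    intro a d h x y hx hy
    obtain ⟨m, k, hk, e⟩ := antidiag_eq h
    exact ⟨⟨x, hx⟩, ⟨_, mul_mem hk hy⟩, m, Or.inr (by rw [e]; group)⟩
  obtain ⟨a, b, c, d, h, rfl⟩ := exists_mat g
  by_cases hc : ‖a‖ ≤ ‖c‖ ∧ ‖d‖ ≤ ‖c‖
  · have hc0 : c ≠ 0 := by
      rintro rfl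
      have : a = 0 := by simpa using hc.1
      simp [this] at h
    rw [pivot_c h hc0]
    exact antidiag _ _ _ _ _ (upper_mem (norm_div_le_one hc0 hc.1))
      (upper_mem (norm_div_le_one hc0 hc.2))
  by_cases hb : ‖a‖ < ‖b‖ ∧ ‖d‖ < ‖b‖
  · rw [pivot_b h (norm_pos_iff.1 ((norm_nonneg _).trans_lt hb.1))]
    exact antidiag _ _ _ _ _ (lower_mem (norm_div_lt_one hb.2)) (lower_mem (norm_div_lt_one hb.1))
  by_cases had : ‖d‖ ≤ ‖a‖
  · have hca : ‖c‖ < ‖a‖ := by grind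
    have hba : ‖b‖ ≤ ‖a‖ := by grind
    have ha : a ≠ 0 := norm_pos_iff.1 ((norm_nonneg _).trans_lt hca)
    rw [pivot_a h ha]
    exact diag _ _ _ _ _ (lower_mem (norm_div_lt_one hca)) (upper_mem (norm_div_le_one ha hba))
  · have hcd : ‖c‖ < ‖d‖ := by grind
    have hbd : ‖b‖ ≤ ‖d‖ := by grind
    have hd : d ≠ 0 := norm_pos_iff.1 ((norm_nonneg _).trans_lt hcd)
    rw [pivot_d h hd]
    exact diag _ _ _ _ _ (upper_mem (norm_div_le_one hd hbd)) (lower_mem (norm_div_lt_one hcd))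

/-- The double cosets of `tᵐ` and `tᵐ w` are distinct, as comparison of the absolute values of the
entries shows. -/
theorem disjoint (m m' : ℤ) (ε ε' : Bool) (k k' : iwahori)
    (e : k * (t ^ m * if ε then weyl else 1) * k' = t ^ m' * (if ε' then weyl else 1)) :
    m = m' ∧ ε = ε' := by
  have e' := eq_mul_inv_of_mul_eq e
  obtain ⟨a, b, c, d, h, hk, ha, hb, hc, hd⟩ := exists_of_mem_iwahori k.2
  obtain ⟨a', b', c', d', h', hk', ha', hb', hc', hd'⟩ := exists_of_mem_iwahori (inv_mem k'.2)
  rw [hk, hk', t_zpow, t_zpow, weyl_eq, one_eq] at e'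
  rcases ε with _ | _ <;> rcases ε' with _ | _ <;>
    simp only [if_true, Bool.false_eq_true, if_false, mat_mul] at e' <;>
    obtain ⟨u, hu, e1, e2, e3, e4⟩ := eq_of_mat_eq e' <;>
    ring_nf at e1 e2 e3 e4
  · have h1 : ‖u‖ = 1 := by
      have := congrArg norm e1
      rw [norm_mul, ha, ha', one_mul] at this
      exact this.symm
    have h4 := congrArg norm e4
    rw [norm_mul, norm_mul, norm_mul, hd, hd', h1] at h4
    exact ⟨eq_of_norm_two_zpow (by linarith), rfl⟩
  · exfalso
    have n1 := congrArg norm e1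
    have n2 := congrArg norm e2
    have n3 := congrArg norm e3
    have n4 := congrArg norm e4
    simp only [norm_neg, norm_mul, ha, ha', hd, hd', one_mul, mul_one] at n1 n2 n3 n4
    have p1 : ‖b‖ * ‖(2 : ℚ_[2]) ^ m‖ * ‖u‖ ≤ ‖(2 : ℚ_[2]) ^ m‖ * ‖u‖ := by
      rw [mul_assoc]; exact mul_le_of_le_one_left (by positivity) hb
    have p2 : ‖b'‖ * ‖(2 : ℚ_[2]) ^ m'‖ ≤ ‖(2 : ℚ_[2]) ^ m'‖ :=
      mul_le_of_le_one_left (norm_nonneg _) hb'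
    have p3 : ‖u‖ * ‖c‖ < 1 :=
      mul_lt_one_of_nonneg_of_lt_one_right (by linarith) (norm_nonneg _) hc
    linarith
  · exfalso
    have n1 := congrArg norm e1
    have n2 := congrArg norm e2
    have n3 := congrArg norm e3
    have n4 := congrArg norm e4
    simp only [norm_neg, norm_mul, ha, ha', hd, hd', one_mul, mul_one] at n1 n2 n3 n4
    have p1 : ‖b‖ * ‖(2 : ℚ_[2]) ^ m‖ * ‖u‖ ≤ ‖(2 : ℚ_[2]) ^ m‖ * ‖u‖ := by
      rw [mul_assoc]; exact mul_le_of_le_one_left (by positivity) hb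
    have p2 : ‖c'‖ * ‖(2 : ℚ_[2]) ^ m'‖ ≤ ‖(2 : ℚ_[2]) ^ m'‖ :=
      mul_le_of_le_one_left (norm_nonneg _) hc'.le
    have p3 : ‖u‖ * ‖c‖ < 1 :=
      mul_lt_one_of_nonneg_of_lt_one_right (by linarith) (norm_nonneg _) hc
    linarith
  · have h1 : ‖u‖ = 1 := by
      have := congrArg norm e2
      rw [norm_mul, ha, hd', one_mul] at this
      exact this.symm
    have h4 := congrArg norm e3
    rw [norm_neg, norm_neg, norm_mul, norm_mul, norm_mul, hd, ha', h1] at h4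
    exact ⟨eq_of_norm_two_zpow (by linarith), rfl⟩

end PGLTwo

/-! ### The equivalences for `PGL₂(ℚ₂)` -/

namespace PGLTwo

open Matrix LocalShimura

theorem upper_add (a b : ℚ_[2]) : upper (a + b) = upper a * upper b := by
  unfold upper
  rw [mat_mul]
  exact mat_eq 1 one_ne_zero (by ring) (by ring) (by ring) (by ring)

theorem lower_add (a b : ℚ_[2]) : lower (a + b) = lower a * lower b := by
  unfold lower
  rw [mat_mul]
  exact mat_eq 1 one_ne_zero (by ring) (by ring) (by ring) (by ring)

theorem t_upper (b : ℚ_[2]) : t⁻¹ * upper b * t = upper (2 * b) := by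
  rw [mul_assoc, inv_mul_eq_iff_eq_mul, t_eq]
  unfold upper
  rw [mat_mul, mat_mul]
  exact mat_eq 1 one_ne_zero (by ring) (by ring) (by ring) (by ring)

theorem t_lower (b : ℚ_[2]) : t * lower b * t⁻¹ = lower (2 * b) := by
  rw [mul_inv_eq_iff_eq_mul, t_eq]
  unfold lower
  rw [mat_mul, mat_mul]
  exact mat_eq 1 one_ne_zero (by ring) (by ring) (by ring) (by ring)

theorem weyl_upper (b : ℚ_[2]) : weyl * upper b * weyl⁻¹ = lower (-b) := by
  rw [mul_inv_eq_iff_eq_mul, weyl_eq]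
  unfold lower upper
  rw [mat_mul, mat_mul]
  exact mat_eq 1 one_ne_zero (by ring) (by ring) (by ring) (by ring)

theorem weyl_t : weyl * t = t⁻¹ * weyl := by
  rw [t_eq, mat_inv, weyl_eq, mat_mul, mat_mul]
  exact mat_eq 1 one_ne_zero (by ring) (by ring) (by ring) (by ring)

theorem u_conj (k : iwahori) : ∃ k' : iwahori, t * weyl * k = k' * (t * weyl) := by
  obtain ⟨a, b, c, d, h, hk, ha, hb, hc, hd⟩ := exists_of_mem_iwahori k.2
  obtain ⟨c', hc', hcc⟩ := exists_two_mul hc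
  refine ⟨⟨mat d (-c') (-(2 * b)) a (by
    clear hk; contrapose! h; rw [hcc]; linear_combination h), ?_⟩, ?_⟩
  · have h2 : ‖-(2 * b)‖ < 1 := by
      rw [norm_neg, mul_comm]; exact norm_mul_lt_one hb (by rw [norm_two]; norm_num)
    have hc2 : ‖-c'‖ ≤ 1 := by rwa [norm_neg]
    refine mat_mem_iwahori hd.le hc2 h2 ha.le ?_
    have had : ‖d * a‖ = 1 := by rw [norm_mul, hd, ha, one_mul]
    rw [norm_sub_eq_of_lt (by rw [had]; exact norm_mul_lt_one hc2 h2), had]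
  · rw [hk, weyl_eq, t_eq, mat_mul, mat_mul, mat_mul]
    exact mat_eq 1 one_ne_zero (by rw [hcc]; ring) (by ring) (by ring) (by ring)

theorem kappa (c : ℚ_[2]) (hc : c ≠ 0) :
    lower c⁻¹ * upper 1 * lower (-c⁻¹) = upper c * lower (-(c ^ 2)⁻¹) * upper (-c) := by
  unfold lower upper
  rw [mat_mul, mat_mul, mat_mul, mat_mul]
  exact mat_eq 1 one_ne_zero (by field_simp; ring) (by field_simp; ring) (by field_simp; ring)
    (by field_simp; ring)

theorem mat_mem_congr_of_smul {m : ℕ} {a b c d : ℚ_[2]} {h : a * d - b * c ≠ 0} {u : ℚ_[2]}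
    (hu : u ≠ 0) (ha : ‖a / u - 1‖ ≤ ‖(2 : ℚ_[2]) ^ (m + 1)‖) (hb : ‖b / u‖ ≤ ‖(2 : ℚ_[2]) ^ (m + 1)‖)
    (hc : ‖c / u‖ ≤ ‖(2 : ℚ_[2]) ^ (m + 1)‖) (hd : ‖d / u - 1‖ ≤ ‖(2 : ℚ_[2]) ^ (m + 1)‖) :
    mat a b c d h ∈ congr m := by
  have h' : a / u * (d / u) - b / u * (c / u) ≠ 0 := by
    rw [show a / u * (d / u) - b / u * (c / u) = (a * d - b * c) / u ^ 2 by field_simp]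
    exact div_ne_zero h (pow_ne_zero 2 hu)
  rw [mat_eq (h' := h') u hu (by field_simp) (by field_simp) (by field_simp) (by field_simp)]
  exact mat_mem_congr ha hb hc hd

/-- Conjugation by `g` is continuous: if `g` is scaled to an integral matrix, only its determinant
enters denominators. -/
theorem congr_conj (g : PGL(2, ℚ_[2])) (m : ℕ) : ∃ m', ∀ x ∈ congr m', g * x * g⁻¹ ∈ congr m := by
  have key : ∀ (a b c d : ℤ_[2]) (h : (a * d - b * c : ℚ_[2]) ≠ 0), ∃ m', ∀ x ∈ congr m',
      mat a b c d h * x * (mat a b c d h)⁻¹ ∈ congr m := by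
    intro a b c d h
    obtain ⟨M, hM⟩ := exists_pow_norm_mul_le_one (a * d - b * c : ℚ_[2])⁻¹
    refine ⟨m + M, fun x hx => ?_⟩
    obtain ⟨p, q, r, s, hx', rfl, h1, h2, h3, h4⟩ := exists_of_mem_congr hx
    have h20 : (2 : ℚ_[2]) ^ (m + M + 1) ≠ 0 := pow_ne_zero _ two_ne_zero
    have lift : ∀ y : ℚ_[2], ‖y‖ ≤ ‖(2 : ℚ_[2]) ^ (m + M + 1)‖ → ∃ z : ℤ_[2],
        y = 2 ^ (m + M + 1) * z :=
      fun y hy => ⟨⟨_, norm_div_le_one h20 hy⟩, (mul_div_cancel₀ _ h20).symm⟩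
    obtain ⟨p', hp⟩ := lift _ h1
    obtain ⟨q', rfl⟩ := lift _ h2
    obtain ⟨r', rfl⟩ := lift _ h3
    obtain ⟨s', hs⟩ := lift _ h4
    obtain rfl : p = 1 + 2 ^ (m + M + 1) * p' := by rw [← hp]; ring
    obtain rfl : s = 1 + 2 ^ (m + M + 1) * s' := by rw [← hs]; ring
    have small : ∀ y : ℚ_[2], (∃ z : ℤ_[2], y = 2 ^ (m + M + 1) * z / (a * d - b * c : ℚ_[2])) →
        ‖y‖ ≤ ‖(2 : ℚ_[2]) ^ (m + 1)‖ := by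
      rintro _ ⟨z, rfl⟩
      rw [show 2 ^ (m + M + 1) * z / (a * d - b * c : ℚ_[2]) =
        2 ^ (m + 1) * ((2 ^ M * (a * d - b * c : ℚ_[2])⁻¹) * z) by field_simp; ring, norm_mul]
      exact mul_le_of_le_one_right (norm_nonneg _) (norm_mul_le_one hM (PadicInt.norm_le_one z))
    rw [mat_inv, mat_mul, mat_mul]
    refine mat_mem_congr_of_smul h (small _ ⟨(a * p' + b * r') * d - (a * q' + b * s') * c, ?_⟩)
      (small _ ⟨-(a * p' + b * r') * b + (a * q' + b * s') * a, ?_⟩)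
      (small _ ⟨(c * p' + d * r') * d - (c * q' + d * s') * c, ?_⟩)
      (small _ ⟨-(c * p' + d * r') * b + (c * q' + d * s') * a, ?_⟩) <;>
    · push_cast
      try rw [div_sub_one h]
      congr 1
      ring
  obtain ⟨a, b, c, d, h, rfl⟩ := exists_mat g
  obtain ⟨N₁, h1⟩ := exists_pow_norm_mul_le_one a
  obtain ⟨N₂, h2⟩ := exists_pow_norm_mul_le_one b
  obtain ⟨N₃, h3⟩ := exists_pow_norm_mul_le_one c
  obtain ⟨N₄, h4⟩ := exists_pow_norm_mul_le_one d
  -- a common power of `2` clears the denominators of all four entries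
  have up : ∀ {i j : ℕ} {x : ℚ_[2]}, ‖2 ^ i * x‖ ≤ 1 → ‖2 ^ (j + i) * x‖ ≤ 1 := by
    intro i j x hx
    rw [pow_add, mul_assoc]
    exact norm_mul_le_one (by
      rw [norm_pow, norm_two]; exact pow_le_one₀ (by norm_num) (by norm_num)) hx
  obtain ⟨a', ha⟩ := exists_padicInt (up (j := N₂ + N₃ + N₄) h1)
  obtain ⟨b', hb⟩ := exists_padicInt (up (j := N₁ + N₃ + N₄) h2)
  obtain ⟨c', hc⟩ := exists_padicInt (up (j := N₁ + N₂ + N₄) h3)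
  obtain ⟨d', hd⟩ := exists_padicInt (up (j := N₁ + N₂ + N₃) h4)
  have h20 : (2 : ℚ_[2]) ^ (N₁ + N₂ + N₃ + N₄) ≠ 0 := pow_ne_zero _ two_ne_zero
  have h' : (a' * d' - b' * c' : ℚ_[2]) ≠ 0 := by
    rw [ha, hb, hc, hd]
    convert mul_ne_zero (pow_ne_zero 2 h20) h using 1
    ring
  rw [← mat_eq (h := h') _ h20 (by rw [ha]; ring) (by rw [hb]; ring) (by rw [hc]; ring)
    (by rw [hd])]
  exact key _ _ _ _ h'

theorem exists_mk (A : GL (Fin 2) ℚ_[2]) : ∃ h, ProjGenLinGroup.mk A = mat (A 0 0) (A 0 1) (A 1 0)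
    (A 1 1) h := by
  refine ⟨?_, ?_⟩
  · rw [← det_fin_two]; exact A.det_ne_zero
  · refine congrArg ProjGenLinGroup.mk (Units.ext ?_)
    exact eta_fin_two _

/-- For the implication from left to right, the preimage of an open set under the continuous map
`X ↦ 1 + 2X` from the integral matrices to `GL₂(ℚ₂)` is open. -/
theorem isOpen_iff (S : Subgroup PGL(2, ℚ_[2])) : IsOpen (S : Set PGL(2, ℚ_[2])) ↔
    ∃ m, congr m ≤ S := by
  rw [isOpen_coinduced]
  constructor
  · intro hS
    let B : (Fin 4 → ℤ_[2]) → Matrix (Fin 2) (Fin 2) ℚ_[2] := fun x =>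
      !![1 + 2 * x 0, 2 * x 1; 2 * x 2, 1 + 2 * x 3]
    have hB : Continuous B := by
      refine continuous_matrix fun i j => ?_
      fin_cases i <;> fin_cases j <;> simp [B] <;> fun_prop
    have n2 : ∀ x : ℤ_[2], ‖2 * (x : ℚ_[2])‖ < 1 := fun x => by
      rw [mul_comm]; exact norm_mul_lt_one (PadicInt.norm_le_one x) (by rw [norm_two]; norm_num)
    have hne : ∀ x, (B x).det ≠ 0 := by
      intro x
      have n1 : ∀ x : ℤ_[2], ‖1 + 2 * (x : ℚ_[2])‖ = 1 := fun x => by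
        rw [Padic.add_eq_max_of_ne (by rw [norm_one]; exact (n2 x).ne'), norm_one,
          max_eq_left (n2 x).le]
      rw [det_fin_two_of, ← norm_ne_zero_iff, norm_sub_eq_of_lt, norm_mul, n1, n1]
      · norm_num
      · rw [norm_mul (1 + _), n1, n1, one_mul]
        exact norm_mul_lt_one (n2 _).le (n2 _)
    let ψ : (Fin 4 → ℤ_[2]) → GL (Fin 2) ℚ_[2] := fun x =>
      GeneralLinearGroup.mkOfDetNeZero (B x) (hne x)
    have hψ : Continuous ψ := by
      rw [Units.continuous_iff]
      refine ⟨hB, ?_⟩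
      have : (fun x => ((ψ x)⁻¹ : GL (Fin 2) ℚ_[2]).val) =
          fun x => (B x).det⁻¹ • (B x).adjugate := by
        funext x
        rw [coe_units_inv, inv_def, Ring.inverse_eq_inv']
        rfl
      change Continuous fun x => ((ψ x)⁻¹ : GL (Fin 2) ℚ_[2]).val
      rw [this]
      exact (hB.matrix_det.inv₀ hne).smul hB.matrix_adjugate
    have h0 : ψ 0 = 1 := by
      refine Units.ext ?_
      change B 0 = 1
      simp [B, one_fin_two]
    obtain ⟨ε, hε, hball⟩ := Metric.isOpen_iff.1 (hS.preimage hψ) 0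
      (by change ProjGenLinGroup.mk (ψ 0) ∈ S; rw [h0, map_one]; exact one_mem S)
    obtain ⟨m, hm⟩ := exists_pow_lt_of_lt_one hε (by norm_num : (2⁻¹ : ℝ) < 1)
    refine ⟨m, fun g hg => ?_⟩
    obtain ⟨a, b, c, d, h, rfl, h1, h2, h3, h4⟩ := exists_of_mem_congr hg
    have lift : ∀ y : ℚ_[2], ‖y‖ ≤ ‖(2 : ℚ_[2]) ^ (m + 1)‖ → ∃ z : ℤ_[2], y = 2 * z ∧ ‖z‖ < ε := by
      intro y hy
      rw [pow_succ', norm_mul] at hy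
      have hy2 : ‖y / 2‖ ≤ ‖(2 : ℚ_[2]) ^ m‖ := by
        rw [norm_div]; exact (div_le_iff₀' (norm_pos_iff.2 two_ne_zero)).2 hy
      have hz : ‖(2 : ℚ_[2]) ^ m‖ = 2⁻¹ ^ m := by rw [norm_pow, norm_two]
      refine ⟨⟨y / 2, hy2.trans ?_⟩, (mul_div_cancel₀ _ two_ne_zero).symm, ?_⟩
      · rw [hz]; exact pow_le_one₀ (by norm_num) (by norm_num)
      · exact (hy2.trans_eq hz).trans_lt hm
    obtain ⟨x0, e0, l0⟩ := lift _ h1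
    obtain ⟨x1, e1, l1⟩ := lift _ h2
    obtain ⟨x2, e2, l2⟩ := lift _ h3
    obtain ⟨x3, e3, l3⟩ := lift _ h4
    have hx : (![x0, x1, x2, x3] : Fin 4 → ℤ_[2]) ∈ Metric.ball 0 ε := by
      rw [Metric.mem_ball, dist_pi_lt_iff hε]
      intro i
      rw [Pi.zero_apply, dist_zero_right]
      fin_cases i
      exacts [l0, l1, l2, l3]
    have := hball hx
    change ProjGenLinGroup.mk (ψ ![x0, x1, x2, x3]) ∈ S at this
    convert this
    refine Eq.trans ?_ (exists_mk _).2.symm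
    rw [sub_eq_iff_eq_add'] at e0 e3
    exact mat_eq 1 one_ne_zero (by rw [one_mul]; exact e0) (by rw [one_mul]; exact e1)
      (by rw [one_mul]; exact e2) (by rw [one_mul]; exact e3)
  · rintro ⟨m, hm⟩
    change IsOpen ((S.comap ProjGenLinGroup.mk : Subgroup (GL (Fin 2) ℚ_[2])) :
      Set (GL (Fin 2) ℚ_[2]))
    let V : Set (GL (Fin 2) ℚ_[2]) :=
      {g | ∀ i j, ‖g i j - (1 : Matrix (Fin 2) (Fin 2) ℚ_[2]) i j‖ < ‖(2 : ℚ_[2]) ^ (m + 1)‖}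
    have hV : IsOpen V := by
      simp only [V, Set.ofPred_forall]
      refine isOpen_iInter_of_finite fun i => isOpen_iInter_of_finite fun j => ?_
      refine isOpen_lt ?_ continuous_const
      have : Continuous fun g : GL (Fin 2) ℚ_[2] => (g : Matrix (Fin 2) (Fin 2) ℚ_[2]) i j :=
        (continuous_id.matrix_elem i j).comp Units.continuous_val
      exact (this.sub continuous_const).norm
    refine Subgroup.isOpen_of_mem_nhds _ (g := 1) (Filter.mem_of_superset (hV.mem_nhds ?_) ?_)
    · intro i j; simp
    · intro g hg
      refine hm ?_
      obtain ⟨h, e⟩ := exists_mk g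
      rw [e]
      have h00 := hg 0 0
      have h01 := hg 0 1
      have h10 := hg 1 0
      have h11 := hg 1 1
      simp only [one_apply_eq, one_apply_ne (show (0 : Fin 2) ≠ 1 by decide),
        one_apply_ne (show (1 : Fin 2) ≠ 0 by decide), sub_zero] at h00 h01 h10 h11
      exact mat_mem_congr h00.le h01.le h10.le h11.le

/-- An element of the Iwahori subgroup is the product of an integral upper unipotent and a lower
triangular element, and the latter stays in the subgroup `congr 0` when it is contracted by the
powers of `t`. -/
theorem iwahori_decomp (k : iwahori) : ∃ b l, ‖b‖ ≤ 1 ∧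
    (∀ m : ℕ, t ^ m * l * (t ^ m)⁻¹ ∈ congr 0) ∧ (k : PGL(2, ℚ_[2])) = upper b * l := by
  obtain ⟨a, b, c, d, h, hk, ha, hb, hc, hd⟩ := exists_of_mem_iwahori k.2
  have hd0 : d ≠ 0 := norm_ne_zero_iff.1 (by rw [hd]; exact one_ne_zero)
  have hdet : ‖a * d - b * c‖ = 1 := by
    have had : ‖a * d‖ = 1 := by rw [norm_mul, ha, hd, one_mul]
    rw [norm_sub_eq_of_lt (by rw [had]; exact norm_mul_lt_one hb hc), had]
  have unit : ∀ x : ℚ_[2], ‖x‖ = 1 → ‖x - 1‖ ≤ ‖(2 : ℚ_[2]) ^ (0 + 1)‖ := by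
    intro x hx
    obtain ⟨y, rfl⟩ := exists_padicInt hx.le
    rcases HS.parity y with ⟨z, rfl⟩ | ⟨z, hz⟩
    · rw [PadicInt.coe_mul, norm_mul] at hx
      have h2 : ‖((2 : ℤ_[2]) : ℚ_[2])‖ = 2⁻¹ := norm_two
      have hz : ‖(z : ℚ_[2])‖ ≤ 1 := PadicInt.norm_le_one z
      rw [h2] at hx
      linarith
    · have hz' : (y : ℚ_[2]) - 1 = 2 * z := by exact_mod_cast congrArg Subtype.val hz
      rw [hz', zero_add, pow_one, norm_mul]
      exact mul_le_of_le_one_right (norm_nonneg _) (PadicInt.norm_le_one z)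
  refine ⟨b / d, mat ((a * d - b * c) / d) 0 c d (by simpa [hd0] using h),
    norm_div_le_one hd0 (by rwa [hd]), fun m => ?_, ?_⟩
  · rw [← zpow_natCast, t_zpow, mat_inv, mat_mul, mat_mul]
    have h2 : (2 : ℚ_[2]) ^ (m : ℤ) ≠ 0 := two_zpow_ne _
    have hc2 : ‖2 ^ (m : ℤ) * c‖ ≤ ‖(2 : ℚ_[2]) ^ (0 + 1)‖ := by
      obtain ⟨c', hc', rfl⟩ := exists_two_mul hc
      rw [zero_add, pow_one, mul_left_comm, norm_mul]
      refine mul_le_of_le_one_right (norm_nonneg _) (norm_mul_le_one ?_ hc')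
      rw [norm_two_zpow, _root_.zpow_neg, zpow_natCast]
      exact inv_le_one_of_one_le₀ (one_le_pow₀ one_le_two)
    refine mat_mem_congr_of_smul h2 ?_ ?_ ?_ ?_
    · refine le_of_eq_of_le (congrArg norm ?_) (unit ((a * d - b * c) / d) (by
        rw [norm_div, hdet, hd, div_one]))
      field_simp
      ring
    · simp
    · refine le_of_eq_of_le (congrArg norm ?_) hc2
      field_simp
      ring
    · refine le_of_eq_of_le (congrArg norm ?_) (unit d hd)
      field_simp
      ring
  · rw [hk]
    unfold upper
    rw [mat_mul]
    exact mat_eq 1 one_ne_zero (by field_simp; ring) (by field_simp; ring) (by ring) (by ring)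

/-- `PGL₂(ℚ₂)` with the trivial character of its Iwahori subgroup. -/
noncomputable def datum : IwahoriDatum iwahori 1 where
  q := 2
  hq := Or.inl rfl
  J := maxCompact
  U := congr
  n := upper
  n' := lower
  t := t
  w := weyl
  K_le := iwahori_le
  U_le := congr_zero_le
  χ_U _ _ := rfl
  U_anti := congr_antitone
  U_normal := congr_normal
  U_index := relIndex_congr
  U_conj := congr_conj
  n_add := upper_add
  n'_add := lower_add
  n_mem _ := upper_mem
  χ_n _ _ := rfl
  n_mem_U b hb := upper_mem_congr (by simpa using hb)
  n'_mem _ := lower_mem_maxCompact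
  n'_mem_U b hb := lower_mem_congr (by simpa using hb)
  n'_small m := ⟨m + 1, fun i hi b hb => lower_mem_congr (by
    rw [norm_mul, Nat.cast_ofNat, norm_pow, norm_pow, norm_two]
    exact (mul_le_of_le_one_right (by positivity) hb).trans
      (pow_le_pow_of_le_one (by norm_num) (by norm_num) hi))⟩
  t_n b := by rw [t_upper, Nat.cast_ofNat]
  t_n' b := by rw [t_lower, Nat.cast_ofNat]
  w_mem := weyl_mem_maxCompact
  w_n := weyl_upper
  w_t := weyl_t
  w_sq_mem := by rw [weyl_mul_weyl]; exact one_mem _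
  w_sq_comm g := by rw [weyl_mul_weyl, one_mul, mul_one]
  u_conj k := (u_conj k).imp fun k' h => ⟨h, rfl⟩
  K_decomp k := by
    obtain ⟨b, l, hb, hl, e⟩ := iwahori_decomp k
    exact ⟨1, b, l, by simp, hb, hl, by simpa using e⟩
  kappa := kappa
  iwasawa := iwasawa
  cartan := cartan
  bruhat g := Or.inl (bruhat g)
  disjoint := disjoint
  n'_notMem j h1 h2 := by
    obtain rfl : j = 1 := by omega
    intro hm
    obtain ⟨a, b, c, d, h, e, ha, hb, hc, hd⟩ := exists_of_mem_iwahori hm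
    obtain ⟨u, hu, e1, -, e3, -⟩ := eq_of_mat_eq e
    rw [one_mul] at e1
    rw [e3, ← e1, norm_mul, ha, mul_one, Nat.cast_one, norm_one] at hc
    exact lt_irrefl _ hc

theorem isOpen_iff_datum (S : Subgroup PGL(2, ℚ_[2])) : IsOpen (S : Set PGL(2, ℚ_[2])) ↔
    ∃ m, datum.U m ≤ S := isOpen_iff S

theorem isEquivalence_A : A.IsEquivalence :=
  isEquivalence_isotypicFunctor isOpen_ker_one datum.orbitFinite
    (datum.typeProperty_of_q_eq_two rfl)
    (fun _ _ _ _ hρ => datum.isOpen_fixer isOpen_iff_datum hρ)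
    (fun _ _ _ _ => datum.finiteDimensional_invariants isOpen_iff_datum)

theorem br_eq_of_eq {g x : PGL(2, ℚ_[2])} (k k' : iwahori) (e : g = k * x * k') :
    datum.br g = datum.br x := by
  have h1 := bracket_mul_right datum.orbitFinite (k * x) k'
  have h2 := bracket_mul_left datum.orbitFinite k x
  rw [MonoidHom.one_apply, Units.val_one, one_smul] at h1 h2
  rw [e]
  exact h1.trans h2

/-- `weyl = w k`. -/
theorem weyl_eq_w_mul : ∃ k : iwahori, weyl = w * k ∧ t * weyl = u * k := by
  refine ⟨⟨mat (-1) 0 0 1 (by simp), mat_mem_iwahori (by simp) (by simp) (by simp) (by simp)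
    (by simp)⟩, ?_, ?_⟩
  · change _ = mat 0 1 1 0 (by simp) * mat (-1) 0 0 1 (by simp)
    rw [weyl_eq, mat_mul]
    exact mat_eq 1 one_ne_zero (by ring) (by ring) (by ring) (by ring)
  · change _ = mat 0 1 2 0 (by simp) * mat (-1) 0 0 1 (by simp)
    rw [weyl_eq, t_eq, mat_mul, mat_mul]
    exact mat_eq 1 one_ne_zero (by ring) (by ring) (by ring) (by ring)

theorem isDoubleCoset_of_mul {f : H} {g : PGL(2, ℚ_[2])} {k : iwahori} {d : ℂ}
    (h : f.IsDoubleCoset (g * k) d) : f.IsDoubleCoset g d := by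
  refine ⟨fun x hx => ?_, ?_⟩
  · obtain ⟨a, ha, b, hb, e⟩ := DoubleCoset.mem_doubleCoset.1 (h.1 x hx)
    exact DoubleCoset.mem_doubleCoset.2 ⟨a, ha, k * b, mul_mem k.2 hb, by rw [e]; group⟩
  · rw [← h.2, HeckeAlgebra.right]; simp

/-- The generators are `2 [w]` and `[u]`, where `[g]` denotes the averaged translate. The relation
`T² = T + 2` holds since `[w]² = 1 / 2 ([1] + [n'(-1)])` and `n'(-1) = n(-1) w n(-1)`. -/
theorem exists_algEquiv : ∃ e : QuadraticHecke ≃ₐ[ℂ] H,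
    (e QuadraticHecke.T).IsDoubleCoset w 1 ∧ (e QuadraticHecke.U).IsDoubleCoset u 1 := by
  have hT : ((2 : ℂ) • datum.br datum.w) * ((2 : ℂ) • datum.br datum.w) =
      (2 : ℂ) • datum.br datum.w + 2 := by
    rw [smul_mul_smul_comm, datum.br_w_mul_br_w]
    change _ • _ • ∑ j ∈ Finset.range 2, datum.br (lower (-(j : ℚ_[2]))) = _
    have e : lower (-1) = upper (-1) * weyl * upper (-1) := by
      rw [weyl_eq]
      unfold lower upper
      rw [mat_mul, mat_mul]
      exact mat_eq 1 one_ne_zero (by ring) (by ring) (by ring) (by ring)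
    rw [Finset.sum_range_succ, Finset.sum_range_one, Nat.cast_one, Nat.cast_zero,
      br_eq_of_eq (x := weyl) ⟨_, upper_mem (by simp)⟩ ⟨_, upper_mem (by simp)⟩ e, neg_zero,
      show lower 0 = 1 from datum.n'_zero, datum.br_one, smul_smul, MonoidHom.one_apply]
    have : (2 * 2 : ℂ) * (((1 : ℂˣ) : ℂ) * ((datum.q : ℕ) : ℂ)⁻¹) = 2 := by
      change (2 * 2 : ℂ) * (((1 : ℂˣ) : ℂ) * ((2 : ℕ) : ℂ)⁻¹) = 2
      norm_num
    rw [this, smul_add, add_comm]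
    congr 1
    rw [← Algebra.algebraMap_eq_smul_one, map_ofNat]
  have hU : ((1 : ℂ) • datum.br datum.u) * ((1 : ℂ) • datum.br datum.u) = 1 := by
    rw [one_smul, datum.br_u_sq, MonoidHom.one_apply, Units.val_one, one_smul]
  obtain ⟨e, eT, eU⟩ := datum.exists_algEquiv hT hU
  obtain ⟨k, hw, hu⟩ := weyl_eq_w_mul
  refine ⟨e, isDoubleCoset_of_mul (k := k) ?_, isDoubleCoset_of_mul (k := k) ?_⟩
  · rw [eT, ← hw]
    refine datum.isDoubleCoset_smul_br _ _ ?_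
    rw [datum.br_w_apply]
    change (2 : ℂ) * ((2 : ℕ) : ℂ)⁻¹ = 1
    norm_num
  · rw [eU, ← hu]
    exact datum.isDoubleCoset_smul_br _ _ (by rw [one_mul]; exact datum.br_u_apply)

end PGLTwo

/-! ### Restriction of modules along an isomorphism -/

namespace LocalShimura

theorem isEquivalence_restrictFinDim {H H' : Type} [Ring H] [Algebra ℂ H] [Ring H'] [Algebra ℂ H']
    (Φ : H ≃ₐ[ℂ] H') : (restrictFinDim Φ).IsEquivalence := by
  have h1 : (ModuleCat.restrictScalars.{0} (Φ : H →+* H')).IsEquivalence :=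
    ModuleCat.restrictScalars_isEquivalence_of_ringEquiv Φ.toRingEquiv
  exact
  { faithful := by unfold restrictFinDim; infer_instance
    full := by unfold restrictFinDim; infer_instance
    essSurj := ⟨fun M => by
      let N := (ModuleCat.restrictScalars.{0} (Φ : H →+* H')).obj
        ((ModuleCat.restrictScalars.{0} (Φ.symm : H' →+* H)).obj M.obj)
      let e : N ≃ₗ[H] M.obj :=
        { toFun := fun x => x
          invFun := fun x => x
          left_inv := fun _ => rfl
          right_inv := fun _ => rfl
          map_add' := fun _ _ => rfl
          map_smul' := fun h x => by
            change (Φ.symm (Φ h)) • (show M.obj from x) = h • (show M.obj from x)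
            rw [AlgEquiv.symm_apply_apply] }
      exact ⟨(restrictFinDim Φ.symm).obj M, ⟨ObjectProperty.isoMk _ e.toModuleIso⟩⟩⟩ }

/-- Three equivalences with a common source of modules give the correspondence. -/
theorem exists_equivalence {C D M N : Type 1} [Category.{0} C] [Category.{0} D] [Category.{0} M]
    [Category.{0} N] (F : C ⥤ M) (R : N ⥤ M) (E : D ⥤ N) [F.IsEquivalence] [R.IsEquivalence]
    [E.IsEquivalence] : ∃ S : C ≌ D, Nonempty (S.functor ⋙ E ⋙ R ≅ F) := by
  refine ⟨F.asEquivalence.trans (E ⋙ R).asEquivalence.symm, ⟨?_⟩⟩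
  exact Functor.isoWhiskerLeft F (E ⋙ R).asEquivalence.counitIso ≪≫ Functor.rightUnitor F

end LocalShimura

/-! ### Elements of the double cover -/

namespace Mp

open LocalShimura

theorem mat_mul (g k : Mp) : (g * k).mat = g.mat * k.mat := rfl

theorem mat_inv (g : Mp) : (g⁻¹).mat = g.mat⁻¹ := rfl

theorem inv_00 (A : SL(2, ℚ_[2])) : A⁻¹ 0 0 = A 1 1 := by
  rw [Matrix.SpecialLinearGroup.SL2_inv_expl]; rfl

theorem inv_01 (A : SL(2, ℚ_[2])) : A⁻¹ 0 1 = -A 0 1 := by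
  rw [Matrix.SpecialLinearGroup.SL2_inv_expl]; rfl

theorem inv_10 (A : SL(2, ℚ_[2])) : A⁻¹ 1 0 = -A 1 0 := by
  rw [Matrix.SpecialLinearGroup.SL2_inv_expl]; rfl

theorem inv_11 (A : SL(2, ℚ_[2])) : A⁻¹ 1 1 = A 0 0 := by
  rw [Matrix.SpecialLinearGroup.SL2_inv_expl]; rfl

theorem SL_ext {A B : SL(2, ℚ_[2])} (h00 : A 0 0 = B 0 0) (h01 : A 0 1 = B 0 1)
    (h10 : A 1 0 = B 1 0) (h11 : A 1 1 = B 1 1) : A = B := by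
  ext i j
  fin_cases i <;> fin_cases j
  exacts [h00, h01, h10, h11]

/-- The lift of the matrix with rows `(a, b)` and `(c, d)` with trivial component in `μ₂`. -/
noncomputable def lift (a b c d : ℚ_[2]) (h : a * d - b * c = 1) : Mp :=
  ⟨⟨!![a, b; c, d], by rwa [Matrix.det_fin_two_of]⟩, 1⟩

/-- The upper triangular unipotent elements. -/
noncomputable def upper (b : ℚ_[2]) : Mp := lift 1 b 0 1 (by ring)

/-- The lower triangular unipotent elements. -/
noncomputable def lower (b : ℚ_[2]) : Mp := lift 1 0 b 1 (by ring)

/-- `h(1/2)`. -/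
noncomputable def t : Mp := h (Units.mk0 2 two_ne_zero)⁻¹

section Entries

variable (b : ℚ_[2]) (x : ℚ_[2]ˣ)

theorem upper_00 : (upper b).mat 0 0 = 1 := rfl

theorem upper_01 : (upper b).mat 0 1 = b := rfl

theorem upper_10 : (upper b).mat 1 0 = 0 := rfl

theorem upper_11 : (upper b).mat 1 1 = 1 := rfl

theorem lower_00 : (lower b).mat 0 0 = 1 := rfl

theorem lower_01 : (lower b).mat 0 1 = 0 := rfl

theorem lower_10 : (lower b).mat 1 0 = b := rfl

theorem lower_11 : (lower b).mat 1 1 = 1 := rfl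

theorem h_00 : (h x).mat 0 0 = x := rfl

theorem h_01 : (h x).mat 0 1 = 0 := rfl

theorem h_10 : (h x).mat 1 0 = 0 := rfl

theorem h_11 : (h x).mat 1 1 = (x : ℚ_[2])⁻¹ := Units.val_inv_eq_inv_val x

theorem w_00 : (w x).mat 0 0 = 0 := rfl

theorem w_01 : (w x).mat 0 1 = x := rfl

theorem w_10 : (w x).mat 1 0 = -(x : ℚ_[2])⁻¹ := congrArg Neg.neg (Units.val_inv_eq_inv_val x)

theorem w_11 : (w x).mat 1 1 = 0 := rfl

/-- The homomorphism `x ↦ diag(x, x⁻¹)`. -/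
noncomputable def diagSL : ℚ_[2]ˣ →* SL(2, ℚ_[2]) :=
  MonoidHom.mk' (fun x => (h x).mat) fun x y => by
    refine SL_ext ?_ ?_ ?_ ?_ <;>
    simp [HS.mul_00, HS.mul_01, HS.mul_10, HS.mul_11, h_00, h_01, h_10, h_11, mul_comm]

theorem t_zpow_mat (m : ℤ) : (t ^ m).mat = (h (Units.mk0 2 two_ne_zero ^ (-m))).mat := by
  have h1 : (t ^ m).mat = proj t ^ m := map_zpow proj t m
  have h2 : proj t = diagSL (Units.mk0 2 two_ne_zero)⁻¹ := rfl
  rw [h1, h2, ← map_zpow, inv_zpow']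
  rfl

theorem t_zpow_00 (m : ℤ) : (t ^ m).mat 0 0 = 2 ^ (-m) := by
  rw [t_zpow_mat, h_00]; simp

theorem t_zpow_01 (m : ℤ) : (t ^ m).mat 0 1 = 0 := by
  rw [t_zpow_mat, h_01]

theorem t_zpow_10 (m : ℤ) : (t ^ m).mat 1 0 = 0 := by
  rw [t_zpow_mat, h_10]

theorem t_zpow_11 (m : ℤ) : (t ^ m).mat 1 1 = 2 ^ m := by
  rw [t_zpow_mat, h_11]; simp

end Entries

/-- Elements with the same image in `SL₂(ℚ₂)` agree up to the generator of `μ₂`. -/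
theorem eq_or_eq_negOne_mul {g k : Mp} (e : g.mat = k.mat) : g = k ∨ g = negOne * k := by
  have h1 : negOne * k = ⟨k.mat, -k.sgn⟩ := by
    change (⟨1 * k.mat, -1 * k.sgn * cocycle 1 k.mat⟩ : Mp) = _
    rw [HS.cocycle_one_left, one_mul, mul_one, neg_one_mul]
  rw [h1]
  rcases Int.units_eq_one_or g.sgn with h | h <;> rcases Int.units_eq_one_or k.sgn with h' | h'
  · exact Or.inl (Mp.ext e (h.trans h'.symm))
  · exact Or.inr (Mp.ext e (by rw [h, h']; rfl))
  · exact Or.inr (Mp.ext e (by rw [h, h']))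
  · exact Or.inl (Mp.ext e (h.trans h'.symm))

theorem negOne_mul_comm (g : Mp) : negOne * g = g * negOne :=
  (Subgroup.mem_center_iff.1 negOne_mem_center g).symm

theorem negOne_mul_negOne : negOne * negOne = 1 := by
  refine Mp.ext (one_mul _) ?_
  change -1 * -1 * cocycle 1 1 = 1
  rw [HS.cocycle_one_left]
  rfl

/-- Two homomorphisms from the `2`-divisible group `ℚ₂` to the double cover that agree in
`SL₂(ℚ₂)` are equal, since their values at `b` are the squares of those at `b / 2`. -/
theorem eq_of_mat_eq {f g : ℚ_[2] → Mp} (hf : ∀ a b, f (a + b) = f a * f b)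
    (hg : ∀ a b, g (a + b) = g a * g b) (e : ∀ b, (f b).mat = (g b).mat) (b : ℚ_[2]) :
    f b = g b := by
  rw [← add_halves b, hf, hg]
  rcases eq_or_eq_negOne_mul (e (b / 2)) with h | h
  · rw [h]
  · rw [h]
    nth_rw 1 [negOne_mul_comm]
    rw [mul_assoc, ← mul_assoc negOne, negOne_mul_negOne, one_mul]

theorem sgn_mul (g k : Mp) : (g * k).sgn = g.sgn * k.sgn * cocycle g.mat k.mat := rfl

theorem upper_add (a b : ℚ_[2]) : upper (a + b) = upper a * upper b := by
  refine Mp.ext ?_ ?_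
  · rw [mat_mul]
    refine SL_ext ?_ ?_ ?_ ?_ <;>
    simp [HS.mul_00, HS.mul_01, HS.mul_10, HS.mul_11, upper_00, upper_01, upper_10, upper_11,
      add_comm]
  · rw [sgn_mul]
    have hX : ∀ A : SL(2, ℚ_[2]), A 1 0 = 0 → A 1 1 = 1 → cocycleX A = 1 := fun A h1 h2 => by
      rw [HS.X_of_eq h1, h2]
    have hS : ∀ A : SL(2, ℚ_[2]), A 1 0 = 0 → cocycleS A = 1 := fun A h1 => by
      unfold cocycleS; rw [if_neg (by simp [h1])]
    unfold cocycle
    rw [hX _ (upper_10 a) (upper_11 a), hX _ (upper_10 b) (upper_11 b), hS _ (upper_10 a),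
      hS _ (upper_10 b), hX, hS, HS.of_sq ⟨1, by norm_num⟩]
    · rfl
    all_goals simp [HS.mul_10, HS.mul_11, upper_01, upper_10, upper_11]

theorem lower_add (a b : ℚ_[2]) : lower (a + b) = lower a * lower b := by
  have hm : (lower (a + b)).mat = (lower a).mat * (lower b).mat := by
    refine SL_ext ?_ ?_ ?_ ?_ <;>
    simp [HS.mul_00, HS.mul_01, HS.mul_10, HS.mul_11, lower_00, lower_01, lower_10, lower_11]
  refine Mp.ext hm ?_
  rw [sgn_mul]
  have hX0 : cocycleX (lower 0).mat = 1 := by rw [HS.X_of_eq (lower_10 0), lower_11]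
  have hX : ∀ c, c ≠ 0 → cocycleX (lower c).mat = c := fun c hc => by
    rw [HS.X_of_ne (by rwa [lower_10]), lower_10]
  have hS : ∀ c, cocycleS (lower c).mat = 1 := fun c => by
    unfold cocycleS
    rw [lower_11, HS.of_sq ⟨1, by norm_num⟩, ite_self]
  unfold cocycle
  rw [← hm, hS, hS, hS, mul_one, mul_one, mul_one]
  change 1 = 1 * 1 * _
  rw [one_mul, one_mul, eq_comm]
  by_cases ha : a = 0
  · rw [ha, hX0, zero_add]
    exact HS.of_sq ⟨cocycleX (lower b).mat, by ring⟩
  by_cases hb : b = 0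
  · rw [hb, hX0, add_zero, HS.comm]
    exact HS.of_sq ⟨cocycleX (lower a).mat, by ring⟩
  by_cases hab : a + b = 0
  · rw [hab, hX0, hX a ha, hX b hb, one_mul, one_mul, ← neg_eq_of_add_eq_zero_right hab]
    exact HS.neg_self a
  · rw [hX a ha, hX b hb, hX _ hab]
    exact HS.of_add ⟨a + b, by ring⟩

theorem upper_zero : upper 0 = 1 := by
  have := upper_add 0 0
  rwa [add_zero, eq_comm, mul_eq_left] at this

theorem upper_neg (b : ℚ_[2]) : upper (-b) = (upper b)⁻¹ := by
  rw [eq_comm, inv_eq_iff_mul_eq_one, ← upper_add, add_neg_cancel, upper_zero]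

theorem lower_zero : lower 0 = 1 := by
  have := lower_add 0 0
  rwa [add_zero, eq_comm, mul_eq_left] at this

theorem lower_neg (b : ℚ_[2]) : lower (-b) = (lower b)⁻¹ := by
  rw [eq_comm, inv_eq_iff_mul_eq_one, ← lower_add, add_neg_cancel, lower_zero]

theorem conj_add {f : ℚ_[2] → Mp} (hf : ∀ a b, f (a + b) = f a * f b) (g : Mp) (a b : ℚ_[2]) :
    g * f (a + b) * g⁻¹ = g * f a * g⁻¹ * (g * f b * g⁻¹) := by
  rw [hf]; group

theorem t_upper (b : ℚ_[2]) : t⁻¹ * upper b * t = upper (4 * b) := by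
  have := eq_of_mat_eq (f := fun b => t⁻¹ * upper b * (t⁻¹)⁻¹) (g := fun b => upper (4 * b))
    (conj_add upper_add t⁻¹) (fun a b => by rw [mul_add, upper_add]) (fun b => ?_) b
  · simpa using this
  · refine SL_ext ?_ ?_ ?_ ?_ <;>
    simp [HS.mul_00, HS.mul_01, HS.mul_10, HS.mul_11, upper_00, upper_01, upper_10, upper_11,
      mat_mul, mat_inv, inv_00, inv_01, inv_10, inv_11, t, h_00, h_01, h_10, h_11]
    ring

theorem t_lower (b : ℚ_[2]) : t * lower b * t⁻¹ = lower (4 * b) := by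
  refine eq_of_mat_eq (f := fun b => t * lower b * t⁻¹) (g := fun b => lower (4 * b))
    (conj_add lower_add t) (fun a b => by rw [mul_add, lower_add]) (fun b => ?_) b
  refine SL_ext ?_ ?_ ?_ ?_ <;>
  simp [HS.mul_00, HS.mul_01, HS.mul_10, HS.mul_11, lower_00, lower_01, lower_10, lower_11,
    mat_mul, mat_inv, inv_00, inv_01, inv_10, inv_11, t, h_00, h_01, h_10, h_11]
  ring

theorem w_upper (b : ℚ_[2]) : w 1 * upper b * (w 1)⁻¹ = lower (-b) := by
  refine eq_of_mat_eq (f := fun b => w 1 * upper b * (w 1)⁻¹) (g := fun b => lower (-b))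
    (conj_add upper_add _) (fun a b => by rw [neg_add, lower_add]) (fun b => ?_) b
  refine SL_ext ?_ ?_ ?_ ?_ <;>
  simp [HS.mul_00, HS.mul_01, HS.mul_10, HS.mul_11, lower_00, lower_01, lower_10, lower_11,
    mat_mul, mat_inv, inv_00, inv_01, inv_10, inv_11, w_00, w_01, w_10, w_11, upper_00, upper_01,
    upper_10, upper_11]

theorem w_lower (b : ℚ_[2]) : w 1 * lower b * (w 1)⁻¹ = upper (-b) := by
  refine eq_of_mat_eq (f := fun b => w 1 * lower b * (w 1)⁻¹) (g := fun b => upper (-b))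
    (conj_add lower_add _) (fun a b => by rw [neg_add, upper_add]) (fun b => ?_) b
  refine SL_ext ?_ ?_ ?_ ?_ <;>
  simp [HS.mul_00, HS.mul_01, HS.mul_10, HS.mul_11, lower_00, lower_01, lower_10, lower_11,
    mat_mul, mat_inv, inv_00, inv_01, inv_10, inv_11, w_00, w_01, w_10, w_11, upper_00, upper_01,
    upper_10, upper_11]

theorem kappa (c : ℚ_[2]) (hc : c ≠ 0) :
    lower c⁻¹ * upper 1 * lower (-c⁻¹) = upper c * lower (-(c ^ 2)⁻¹) * upper (-c) := by
  rw [lower_neg, upper_neg]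
  have := eq_of_mat_eq (f := fun b => lower c⁻¹ * upper b * (lower c⁻¹)⁻¹)
    (g := fun b => upper c * lower (-(c ^ 2)⁻¹ * b) * (upper c)⁻¹) (conj_add upper_add _)
    (conj_add (f := fun b => lower (-(c ^ 2)⁻¹ * b)) (fun a b => by rw [mul_add, lower_add]) _)
    (fun b => ?_) 1
  · simpa using this
  refine SL_ext ?_ ?_ ?_ ?_ <;>
  simp [HS.mul_00, HS.mul_01, HS.mul_10, HS.mul_11, lower_00, lower_01, lower_10, lower_11,
    mat_mul, mat_inv, inv_00, inv_01, inv_10, inv_11, upper_00, upper_01,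
    upper_10, upper_11] <;> field_simp <;> ring

theorem cocycleS_of_eq_zero {A : SL(2, ℚ_[2])} (h : A 1 0 * A 1 1 = 0) : cocycleS A = 1 := by
  unfold cocycleS
  rw [if_neg (by simp [h])]

theorem cocycleS_h (x : ℚ_[2]ˣ) : cocycleS (h x).mat = 1 :=
  cocycleS_of_eq_zero (by rw [h_10, zero_mul])

theorem cocycleS_w (x : ℚ_[2]ˣ) : cocycleS (w x).mat = 1 :=
  cocycleS_of_eq_zero (by rw [w_11, mul_zero])

theorem cocycleX_h (x : ℚ_[2]ˣ) : cocycleX (h x).mat = (x : ℚ_[2])⁻¹ := by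
  rw [HS.X_of_eq (h_10 x), h_11]

theorem cocycleX_w (x : ℚ_[2]ˣ) : cocycleX (w x).mat = -(x : ℚ_[2])⁻¹ := by
  rw [HS.X_of_ne (by rw [w_10]; simp), w_10]

theorem h_mul_w (x y : ℚ_[2]ˣ) : h x * w y =
    ⟨(w (x * y)).mat, hilbertSymbol (-(x * y : ℚ_[2])⁻¹ * (x : ℚ_[2])⁻¹)
      (-(x * y : ℚ_[2])⁻¹ * -(y : ℚ_[2])⁻¹)⟩ := by
  have hm : (h x).mat * (w y).mat = (w (x * y)).mat := by
    refine SL_ext ?_ ?_ ?_ ?_ <;>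
    simp [HS.mul_00, HS.mul_01, HS.mul_10, HS.mul_11, h_00, h_01, h_10, h_11, w_00, w_01, w_10,
      w_11, mul_comm]
  refine Mp.ext hm ?_
  rw [sgn_mul]
  unfold cocycle
  rw [hm, cocycleS_h, cocycleS_w, cocycleS_w, cocycleX_h, cocycleX_w, cocycleX_w]
  change 1 * 1 * _ = _
  simp

theorem w_mul_h (y x : ℚ_[2]ˣ) : w y * h x =
    ⟨(w (y * x⁻¹)).mat, hilbertSymbol (-(x * (y : ℚ_[2])⁻¹) * -(y : ℚ_[2])⁻¹)
      (-(x * (y : ℚ_[2])⁻¹) * (x : ℚ_[2])⁻¹)⟩ := by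
  have hm : (w y).mat * (h x).mat = (w (y * x⁻¹)).mat := by
    refine SL_ext ?_ ?_ ?_ ?_ <;>
    simp [HS.mul_00, HS.mul_01, HS.mul_10, HS.mul_11, h_00, h_01, h_10, h_11, w_00, w_01, w_10,
      w_11, mul_comm]
  refine Mp.ext hm ?_
  rw [sgn_mul]
  unfold cocycle
  rw [hm, cocycleS_h, cocycleS_w, cocycleS_w, cocycleX_h, cocycleX_w, cocycleX_w]
  change 1 * 1 * _ = _
  simp

theorem t_mul_w : t * w 1 = w (Units.mk0 2 two_ne_zero)⁻¹ := by
  unfold t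
  rw [h_mul_w]
  refine Mp.ext (by rw [mul_one]) (HS.eq_one_iff.2 ⟨1, 2, 2, by norm_num, ?_⟩)
  simp
  norm_num

theorem w_t : w 1 * t = t⁻¹ * w 1 := by
  rw [eq_inv_mul_iff_mul_eq, ← mul_assoc, t_mul_w]
  unfold t
  rw [w_mul_h]
  refine Mp.ext (by simp) (HS.eq_one_iff.2 ⟨1, 1, 0, by norm_num, ?_⟩)
  simp

theorem w_mul_w : w 1 * w 1 = h (-1) := by
  have hm : (w 1).mat * (w 1).mat = (h (-1)).mat := by
    refine SL_ext ?_ ?_ ?_ ?_ <;>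
    simp [HS.mul_00, HS.mul_01, HS.mul_10, HS.mul_11, h_00, h_01, h_10, h_11, w_00, w_01, w_10,
      w_11]
  refine Mp.ext hm ?_
  rw [sgn_mul]
  unfold cocycle
  rw [hm, cocycleS_h, cocycleS_w, cocycleX_h, cocycleX_w, HS.of_sq ⟨1, by simp⟩]
  rfl

theorem w_h (x : ℚ_[2]ˣ) : w 1 * h x * (w 1)⁻¹ = h x⁻¹ := by
  rw [mul_inv_eq_iff_eq_mul, w_mul_h, h_mul_w]
  refine Mp.ext (by simp) ?_
  have hx : (x : ℚ_[2]) ≠ 0 := x.ne_zero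
  simp only [Units.val_one, inv_one, mul_one, Units.val_inv_eq_inv_val, inv_inv, neg_mul_neg]
  rw [HS.comm, neg_mul, mul_inv_cancel₀ hx, ← HS.sq_mul hx]
  congr 1
  ring

theorem t_h (x : ℚ_[2]ˣ) : t * h x * t⁻¹ = h x := by
  rw [mul_inv_eq_iff_eq_mul]
  have hm : t.mat * (h x).mat = (h x).mat * t.mat := by
    refine SL_ext ?_ ?_ ?_ ?_ <;>
    simp [t, HS.mul_00, HS.mul_01, HS.mul_10, HS.mul_11, h_00, h_01, h_10, h_11, mul_comm]
  refine Mp.ext hm ?_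
  rw [sgn_mul, sgn_mul, cocycle_comm_of hm, mul_comm (Mp.sgn _)]

end Mp

/-! ### Compact subgroups of the double cover -/

namespace Mp

open LocalShimura

theorem two_pow_dvd_iff (k : ℕ) (x : ℤ_[2]) :
    (2 : ℤ_[2]) ^ k ∣ x ↔ ‖(x : ℚ_[2])‖ ≤ ‖(2 : ℚ_[2]) ^ k‖ := by
  rw [← PGLTwo.dvd_iff_norm, ← RingHom.mem_ker, PadicInt.ker_toZModPow, Ideal.mem_span_singleton]
  norm_num

theorem four_dvd_iff (x : ℤ_[2]) : (4 : ℤ_[2]) ∣ x ↔ ‖(x : ℚ_[2])‖ ≤ ‖(4 : ℚ_[2])‖ := by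
  have := two_pow_dvd_iff 2 x
  norm_num at this ⊢
  exact this

theorem norm_four : ‖(4 : ℚ_[2])‖ = 4⁻¹ := by
  rw [show (4 : ℚ_[2]) = 2 * 2 by norm_num, norm_mul, norm_two]; norm_num

theorem coe_sub_one (x : ℤ_[2]) : ((x - 1 : ℤ_[2]) : ℚ_[2]) = x - 1 := by push_cast; rfl

theorem exists_inclSL {A : SL(2, ℚ_[2])} (h00 : ‖A 0 0‖ ≤ 1) (h01 : ‖A 0 1‖ ≤ 1)
    (h10 : ‖A 1 0‖ ≤ 1) (h11 : ‖A 1 1‖ ≤ 1) : ∃ B : SL(2, ℤ_[2]), inclSL B = A := by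
  obtain ⟨a, ha⟩ := exists_padicInt h00
  obtain ⟨b, hb⟩ := exists_padicInt h01
  obtain ⟨c, hc⟩ := exists_padicInt h10
  obtain ⟨d, hd⟩ := exists_padicInt h11
  have hdet := HS.det_eq A
  rw [← ha, ← hb, ← hc, ← hd] at hdet
  refine ⟨⟨!![a, b; c, d], ?_⟩, SL_ext ha hb hc hd⟩
  rw [Matrix.det_fin_two_of]
  exact Subtype.ext (by push_cast; exact hdet)

/-- The inverse image of `SL₂(ℤ₂)`. -/
noncomputable def maxCompact : Subgroup Mp := inclSL.range.comap proj

/-- The inverse image of the principal congruence subgroup of level `2ᵐ⁺²`. -/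
noncomputable def fullCongr (m : ℕ) : Subgroup Mp := ((GammaTwoPow (m + 2)).map inclSL).comap proj

/-- The copy of the principal congruence subgroup of level `2ᵐ⁺²` inside `K₁`. -/
noncomputable def congr (m : ℕ) : Subgroup Mp := K1 ⊓ fullCongr m

theorem mem_maxCompact_iff {g : Mp} : g ∈ maxCompact ↔
    ‖g.mat 0 0‖ ≤ 1 ∧ ‖g.mat 0 1‖ ≤ 1 ∧ ‖g.mat 1 0‖ ≤ 1 ∧ ‖g.mat 1 1‖ ≤ 1 := by
  constructor
  · rintro ⟨B, hB⟩
    change inclSL B = g.mat at hB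
    rw [← hB]
    exact ⟨PadicInt.norm_le_one _, PadicInt.norm_le_one _, PadicInt.norm_le_one _,
      PadicInt.norm_le_one _⟩
  · rintro ⟨h1, h2, h3, h4⟩
    exact exists_inclSL h1 h2 h3 h4

theorem mem_K0_iff {g : Mp} : g ∈ K0 ↔
    ‖g.mat 0 0‖ ≤ 1 ∧ ‖g.mat 0 1‖ ≤ 1 ∧ ‖g.mat 1 0‖ ≤ ‖(4 : ℚ_[2])‖ ∧ ‖g.mat 1 1‖ ≤ 1 := by
  constructor
  · rintro ⟨B, hB, hg⟩
    change inclSL B = g.mat at hg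
    rw [← hg]
    exact ⟨PadicInt.norm_le_one _, PadicInt.norm_le_one _, (four_dvd_iff _).1 hB,
      PadicInt.norm_le_one _⟩
  · rintro ⟨h1, h2, h3, h4⟩
    obtain ⟨B, hB⟩ := exists_inclSL h1 h2 (h3.trans (by rw [norm_four]; norm_num)) h4
    refine ⟨B, (four_dvd_iff _).2 ?_, hB⟩
    rw [← HS.incl_apply, hB]; exact h3

theorem mem_K1_iff {g : Mp} : g ∈ K1 ↔ g.sgn = 1 ∧ ‖g.mat 0 0 - 1‖ ≤ ‖(4 : ℚ_[2])‖ ∧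
    ‖g.mat 0 1‖ ≤ 1 ∧ ‖g.mat 1 0‖ ≤ ‖(4 : ℚ_[2])‖ ∧ ‖g.mat 1 1‖ ≤ 1 := by
  constructor
  · rintro ⟨⟨B, hB, hg⟩, hs⟩
    rw [← hg]
    refine ⟨hs, ?_, PadicInt.norm_le_one _, (four_dvd_iff _).1 hB.2, PadicInt.norm_le_one _⟩
    have := (four_dvd_iff _).1 hB.1
    rwa [coe_sub_one] at this
  · rintro ⟨hs, h1, h2, h3, h4⟩
    have h1' : ‖g.mat 0 0‖ ≤ 1 := by
      rw [← sub_add_cancel (g.mat 0 0) 1]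
      refine (Padic.nonarchimedean _ _).trans (max_le (h1.trans ?_) (by simp))
      rw [norm_four]; norm_num
    obtain ⟨B, hB⟩ := exists_inclSL h1' h2 (h3.trans (by rw [norm_four]; norm_num)) h4
    rw [← hB] at h1 h3
    refine ⟨⟨B, ⟨(four_dvd_iff _).2 ?_, (four_dvd_iff _).2 h3⟩, hB⟩, hs⟩
    rw [coe_sub_one]; exact h1

theorem mem_fullCongr_iff {m : ℕ} {g : Mp} : g ∈ fullCongr m ↔
    ‖g.mat 0 0 - 1‖ ≤ ‖(2 : ℚ_[2]) ^ (m + 2)‖ ∧ ‖g.mat 0 1‖ ≤ ‖(2 : ℚ_[2]) ^ (m + 2)‖ ∧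
    ‖g.mat 1 0‖ ≤ ‖(2 : ℚ_[2]) ^ (m + 2)‖ ∧ ‖g.mat 1 1 - 1‖ ≤ ‖(2 : ℚ_[2]) ^ (m + 2)‖ := by
  have key : ∀ B : SL(2, ℤ_[2]), B ∈ GammaTwoPow (m + 2) ↔
      ‖inclSL B 0 0 - 1‖ ≤ ‖(2 : ℚ_[2]) ^ (m + 2)‖ ∧ ‖inclSL B 0 1‖ ≤ ‖(2 : ℚ_[2]) ^ (m + 2)‖ ∧
      ‖inclSL B 1 0‖ ≤ ‖(2 : ℚ_[2]) ^ (m + 2)‖ ∧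
      ‖inclSL B 1 1 - 1‖ ≤ ‖(2 : ℚ_[2]) ^ (m + 2)‖ := by
    intro B
    rw [HS.mem_GammaTwoPow, Fin.forall_fin_two, Fin.forall_fin_two, Fin.forall_fin_two]
    simp only [two_pow_dvd_iff, Matrix.one_apply_eq, Matrix.one_apply_ne zero_ne_one,
      Matrix.one_apply_ne one_ne_zero, sub_zero, coe_sub_one, HS.incl_apply]
    tauto
  constructor
  · rintro ⟨B, hB, hg⟩
    change inclSL B = g.mat at hg
    rw [← hg]
    exact (key B).1 hB
  · intro hg
    have h1 : ‖(2 : ℚ_[2]) ^ (m + 2)‖ ≤ 1 := (PGLTwo.two_pow_succ_lt (m + 1)).le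
    obtain ⟨B, hB⟩ := exists_inclSL (PGLTwo.norm_le_one_of_sub (k := m + 1) hg.1).le
      (hg.2.1.trans h1) (hg.2.2.1.trans h1) (PGLTwo.norm_le_one_of_sub (k := m + 1) hg.2.2.2).le
    rw [← hB] at hg
    exact ⟨B, (key B).2 hg, hB⟩

theorem two_pow_le_four (m : ℕ) : ‖(2 : ℚ_[2]) ^ (m + 2)‖ ≤ ‖(4 : ℚ_[2])‖ := by
  rw [pow_add, norm_mul, show (2 : ℚ_[2]) ^ 2 = 4 by norm_num]
  refine mul_le_of_le_one_left (norm_nonneg _) ?_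
  rw [norm_pow, norm_two]
  exact pow_le_one₀ (by norm_num) (by norm_num)

theorem mem_congr_iff {m : ℕ} {g : Mp} : g ∈ congr m ↔ g.sgn = 1 ∧
    ‖g.mat 0 0 - 1‖ ≤ ‖(2 : ℚ_[2]) ^ (m + 2)‖ ∧ ‖g.mat 0 1‖ ≤ ‖(2 : ℚ_[2]) ^ (m + 2)‖ ∧
    ‖g.mat 1 0‖ ≤ ‖(2 : ℚ_[2]) ^ (m + 2)‖ ∧ ‖g.mat 1 1 - 1‖ ≤ ‖(2 : ℚ_[2]) ^ (m + 2)‖ := by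
  rw [congr, Subgroup.mem_inf, mem_fullCongr_iff, mem_K1_iff]
  have h4 := two_pow_le_four m
  have h1 : ‖(2 : ℚ_[2]) ^ (m + 2)‖ ≤ 1 := (PGLTwo.two_pow_succ_lt (m + 1)).le
  constructor
  · rintro ⟨⟨hs, -⟩, h⟩
    exact ⟨hs, h⟩
  · rintro ⟨hs, h⟩
    exact ⟨⟨hs, h.1.trans h4, h.2.1.trans h1, h.2.2.1.trans h4,
      (PGLTwo.norm_le_one_of_sub (k := m + 1) h.2.2.2).le⟩, h⟩

theorem K1_ext {g k : Mp} (hg : g ∈ K1) (hk : k ∈ K1) (e : g.mat = k.mat) : g = k :=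
  Mp.ext e (hg.2.trans hk.2.symm)

theorem upper_mem_K1 {b : ℚ_[2]} (hb : ‖b‖ ≤ 1) : upper b ∈ K1 := by
  rw [mem_K1_iff, upper_00, upper_01, upper_10, upper_11]
  exact ⟨rfl, by simp, hb, by simp, by simp⟩

theorem lower_mem_K1 {b : ℚ_[2]} (hb : ‖b‖ ≤ ‖(4 : ℚ_[2])‖) : lower b ∈ K1 := by
  rw [mem_K1_iff, lower_00, lower_01, lower_10, lower_11]
  exact ⟨rfl, by simp, by simp, hb, by simp⟩

theorem upper_mem_congr {m : ℕ} {b : ℚ_[2]} (hb : ‖b‖ ≤ ‖(2 : ℚ_[2]) ^ (m + 2)‖) :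
    upper b ∈ congr m := by
  rw [mem_congr_iff, upper_00, upper_01, upper_10, upper_11]
  exact ⟨rfl, by simp, hb, by simp, by simp⟩

theorem lower_mem_congr {m : ℕ} {b : ℚ_[2]} (hb : ‖b‖ ≤ ‖(2 : ℚ_[2]) ^ (m + 2)‖) :
    lower b ∈ congr m := by
  rw [mem_congr_iff, lower_00, lower_01, lower_10, lower_11]
  exact ⟨rfl, by simp, by simp, hb, by simp⟩

theorem norm_inv_sub_one {x : ℚ_[2]} (hx : ‖x‖ = 1) : ‖x⁻¹ - 1‖ = ‖x - 1‖ := by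
  have hx0 : x ≠ 0 := norm_ne_zero_iff.1 (by rw [hx]; exact one_ne_zero)
  rw [show x⁻¹ - 1 = (1 - x) / x by field_simp, norm_div, hx, div_one, norm_sub_rev]

theorem h_mem_congr {m : ℕ} {x : ℚ_[2]ˣ} (hx : ‖(x : ℚ_[2]) - 1‖ ≤ ‖(2 : ℚ_[2]) ^ (m + 2)‖) :
    h x ∈ congr m := by
  rw [mem_congr_iff, h_00, h_01, h_10, h_11,
    norm_inv_sub_one (PGLTwo.norm_le_one_of_sub (k := m + 1) hx)]
  exact ⟨rfl, hx, by simp, by simp, hx⟩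

theorem h_inv_mem_congr {m : ℕ} {x : ℚ_[2]ˣ} (hx : ‖(x : ℚ_[2]) - 1‖ ≤ ‖(2 : ℚ_[2]) ^ (m + 2)‖) :
    h x⁻¹ ∈ congr m := by
  refine h_mem_congr ?_
  rwa [Units.val_inv_eq_inv_val, norm_inv_sub_one (PGLTwo.norm_le_one_of_sub (k := m + 1) hx)]

theorem congr_antitone : Antitone congr := by
  intro m m' hm g hg
  rw [mem_congr_iff] at hg ⊢
  have : ‖(2 : ℚ_[2]) ^ (m' + 2)‖ ≤ ‖(2 : ℚ_[2]) ^ (m + 2)‖ := by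
    rw [norm_pow, norm_pow, norm_two]
    exact pow_le_pow_of_le_one (by norm_num) (by norm_num) (by omega)
  exact ⟨hg.1, hg.2.1.trans this, hg.2.2.1.trans this, hg.2.2.2.1.trans this, hg.2.2.2.2.trans this⟩

/-- The triangular decomposition of an element of `K₁`. There are no signs, since all factors lie in
`K₁`. -/
theorem K1_triangular {g : Mp} (hg : g ∈ K1) : ∃ (y x : ℚ_[2]) (a : ℚ_[2]ˣ),
    g = upper y * h a * lower x ∧ ‖y‖ = ‖g.mat 0 1‖ ∧ ‖x‖ = ‖g.mat 1 0‖ ∧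
    ‖(a : ℚ_[2]) - 1‖ = ‖g.mat 1 1 - 1‖ ∧ ‖g.mat 1 1 - 1‖ ≤ ‖(4 : ℚ_[2])‖ := by
  have hginv := (mem_K1_iff.1 (inv_mem hg)).2.1
  rw [mat_inv, inv_00] at hginv
  have hd : ‖g.mat 1 1‖ = 1 :=
    PGLTwo.norm_le_one_of_sub (k := 1) (hginv.trans_eq (by norm_num))
  have hd0 : g.mat 1 1 ≠ 0 := norm_ne_zero_iff.1 (by rw [hd]; exact one_ne_zero)
  obtain ⟨-, -, h01, h10, -⟩ := mem_K1_iff.1 hg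
  refine ⟨g.mat 0 1 / g.mat 1 1, g.mat 1 0 / g.mat 1 1, (Units.mk0 _ hd0)⁻¹, ?_,
    by rw [norm_div, hd, div_one], by rw [norm_div, hd, div_one], ?_, hginv⟩
  · refine K1_ext hg (mul_mem (mul_mem (upper_mem_K1 (by rwa [norm_div, hd, div_one])) ?_)
      (lower_mem_K1 (by rwa [norm_div, hd, div_one]))) ?_
    · exact (h_inv_mem_congr (m := 0) (hginv.trans_eq (by norm_num))).1
    · have := HS.det_eq g.mat
      refine SL_ext ?_ ?_ ?_ ?_ <;>
      simp [HS.mul_00, HS.mul_01, HS.mul_10, HS.mul_11, h_00, h_01, h_10, h_11, mat_mul, upper_00,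
        upper_01, upper_10, upper_11, lower_00, lower_01, lower_10, lower_11] <;> field_simp
      linear_combination this
  · rw [Units.val_inv_eq_inv_val]
    exact norm_inv_sub_one hd

theorem conj_mem_of_triangular {g : Mp} {k : Mp} {S : Subgroup Mp} {y x : ℚ_[2]} {a : ℚ_[2]ˣ}
    (e : k = upper y * h a * lower x) (h1 : g * upper y * g⁻¹ ∈ S) (h2 : g * h a * g⁻¹ ∈ S)
    (h3 : g * lower x * g⁻¹ ∈ S) : g * k * g⁻¹ ∈ S := by
  have := mul_mem (mul_mem h1 h2) h3
  rw [e]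
  convert this using 1
  group

theorem w_conj_congr {m : ℕ} {k : Mp} (hk : k ∈ congr m) : w 1 * k * (w 1)⁻¹ ∈ congr m := by
  obtain ⟨y, x, a, e, hy, hx, ha, -⟩ := K1_triangular hk.1
  rw [mem_congr_iff] at hk
  refine conj_mem_of_triangular e ?_ ?_ ?_
  · rw [w_upper]; exact lower_mem_congr (by rw [norm_neg, hy]; exact hk.2.2.1)
  · rw [w_h]; exact h_inv_mem_congr (by rw [ha]; exact hk.2.2.2.2)
  · rw [w_lower]; exact upper_mem_congr (by rw [norm_neg, hx]; exact hk.2.2.2.1)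

theorem norm_four_inv_mul {x : ℚ_[2]} {k : ℕ} (hx : ‖x‖ ≤ ‖(2 : ℚ_[2]) ^ (k + 2)‖) :
    ‖4⁻¹ * x‖ ≤ ‖(2 : ℚ_[2]) ^ k‖ := by
  rw [norm_mul, norm_inv]
  rw [pow_add, norm_mul, show (2 : ℚ_[2]) ^ 2 = 4 by norm_num, mul_comm] at hx
  exact (inv_mul_le_iff₀ (norm_pos_iff.2 (by norm_num))).2 hx

theorem norm_four_mul_le (x : ℚ_[2]) : ‖4 * x‖ ≤ ‖x‖ := by
  rw [norm_mul, norm_four]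
  linarith [norm_nonneg x]

theorem t_conj_congr {m : ℕ} {k : Mp} (hk : k ∈ congr (m + 2)) : t * k * t⁻¹ ∈ congr m := by
  obtain ⟨y, x, a, e, hy, hx, ha, -⟩ := K1_triangular hk.1
  have hk' := mem_congr_iff.1 (congr_antitone (Nat.le_add_right m 2) hk)
  rw [mem_congr_iff] at hk
  refine conj_mem_of_triangular e ?_ ?_ ?_
  · have := t_upper (4⁻¹ * y)
    rw [mul_inv_cancel_left₀ (by norm_num)] at this
    rw [← this, show t * (t⁻¹ * upper (4⁻¹ * y) * t) * t⁻¹ = upper (4⁻¹ * y) by group]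
    exact upper_mem_congr (norm_four_inv_mul (by rw [hy]; exact hk.2.2.1))
  · rw [t_h]; exact h_mem_congr (by rw [ha]; exact hk'.2.2.2.2)
  · rw [t_lower]
    exact lower_mem_congr ((norm_four_mul_le x).trans (by rw [hx]; exact hk'.2.2.2.1))

end Mp

/-! ### Decompositions of the double cover -/

namespace Mp

open LocalShimura

theorem K0_le_maxCompact : K0 ≤ maxCompact := by
  intro g hg
  rw [mem_K0_iff] at hg
  rw [mem_maxCompact_iff]
  exact ⟨hg.1, hg.2.1, hg.2.2.1.trans (by rw [norm_four]; norm_num), hg.2.2.2⟩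

theorem congr_le_K1 (m : ℕ) : congr m ≤ K1 := inf_le_left

theorem fullCongr_conj {m : ℕ} {g k : Mp} (hg : g ∈ maxCompact) (hk : k ∈ fullCongr m) :
    g * k * g⁻¹ ∈ fullCongr m := by
  obtain ⟨A, hA⟩ := hg
  obtain ⟨B, hB, hk⟩ := hk
  refine ⟨A * B * A⁻¹, (MonoidHom.normal_ker _).conj_mem B hB A, ?_⟩
  rw [map_mul, map_mul, map_inv, hA, hk, map_mul, map_mul, map_inv]

theorem center_conj {z : Mp} (hz : z ∈ Subgroup.center Mp) (g k : Mp) :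
    z * g * k * (z * g)⁻¹ = g * k * g⁻¹ := by
  rw [mul_inv_eq_iff_eq_mul, ← mul_assoc, Subgroup.mem_center_iff.1 hz, mul_assoc z (g * k * g⁻¹),
    inv_mul_cancel_right, mul_assoc]

theorem K0_conj_congr {m : ℕ} {g k : Mp} (hg : g ∈ K0) (hk : k ∈ congr m) :
    g * k * g⁻¹ ∈ congr m := by
  refine Subgroup.mem_inf.2 ⟨?_, fullCongr_conj (K0_le_maxCompact hg) hk.2⟩
  obtain ⟨z, k₁, e⟩ := K0_decomp ⟨g, hg⟩
  rw [show g = z * k₁ from e, center_conj z.2]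
  exact mul_mem (mul_mem k₁.2 hk.1) (inv_mem k₁.2)

theorem h_neg_one_comm (g : Mp) : h (-1) * g = g * h (-1) :=
  (Subgroup.mem_center_iff.1 h_neg_one_mem_center g).symm

theorem h_neg_one_mem : h (-1) ∈ K0 := by
  rw [mem_K0_iff, h_00, h_01, h_10, h_11]
  simp

theorem w_mem_maxCompact : w 1 ∈ maxCompact := by
  rw [mem_maxCompact_iff, w_00, w_01, w_10, w_11]
  simp

theorem lower_mem_maxCompact {b : ℚ_[2]} (hb : ‖b‖ ≤ 1) : lower b ∈ maxCompact := by
  rw [mem_maxCompact_iff, lower_00, lower_01, lower_10, lower_11]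
  simp [hb]

theorem norm_eq_one_of_mul_sub {a b c d : ℚ_[2]} (h : a * d - b * c = 1) (ha : ‖a‖ ≤ 1) (hb : ‖b‖ ≤ 1)
    (hc : ‖c‖ ≤ 1) (hd : ‖d‖ < 1) : ‖c‖ = 1 := by
  by_contra hc1
  have h1 := norm_mul_lt_one ha hd
  have h2 := norm_mul_lt_one hb (lt_of_le_of_ne hc hc1)
  have h3 : ‖a * d - b * c‖ < 1 := by
    rw [sub_eq_add_neg]
    exact (Padic.nonarchimedean _ _).trans_lt (max_lt h1 (by rwa [norm_neg]))
  rw [h, norm_one] at h3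
  exact lt_irrefl _ h3

/-- One of the entries in the lower row is a unit, so the lower left entry can be removed from the
right by an integral lower unipotent element, if need be after multiplication by `w 1`. -/
theorem maxCompact_decomp {j : Mp} (hj : j ∈ maxCompact) : ∃ k ∈ K0, ∃ b : ℚ_[2], ‖b‖ ≤ 1 ∧
    (j = k * lower b ∨ j = k * lower b * (w 1)⁻¹) := by
  have key : ∀ j ∈ maxCompact, ‖j.mat 1 1‖ = 1 → ∃ k ∈ K0, ∃ b : ℚ_[2], ‖b‖ ≤ 1 ∧
      j = k * lower b := by
    intro j hj hd
    have hd0 : j.mat 1 1 ≠ 0 := norm_ne_zero_iff.1 (by rw [hd]; exact one_ne_zero)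
    have hj' := mem_maxCompact_iff.1 hj
    have hcd : ‖-(j.mat 1 0 / j.mat 1 1)‖ ≤ 1 := by
      rw [norm_neg]; exact norm_div_le_one hd0 (by rw [hd]; exact hj'.2.2.1)
    refine ⟨j * lower (-(j.mat 1 0 / j.mat 1 1)), ?_, j.mat 1 0 / j.mat 1 1,
      by rwa [norm_neg] at hcd, ?_⟩
    · have h1 := mem_maxCompact_iff.1 (mul_mem hj (lower_mem_maxCompact hcd))
      refine mem_K0_iff.2 ⟨h1.1, h1.2.1, ?_, h1.2.2.2⟩
      rw [mat_mul, HS.mul_10, lower_00, lower_10, mul_one, mul_neg, mul_div_cancel₀ _ hd0,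
        add_neg_cancel, norm_zero]
      exact norm_nonneg _
    · rw [lower_neg, inv_mul_cancel_right]
  have hj' := mem_maxCompact_iff.1 hj
  by_cases hd : ‖j.mat 1 1‖ = 1
  · obtain ⟨k, hk, b, hb, e⟩ := key j hj hd
    exact ⟨k, hk, b, hb, Or.inl e⟩
  · obtain ⟨k, hk, b, hb, e⟩ := key (j * w 1) (mul_mem hj w_mem_maxCompact) (by
      rw [mat_mul, HS.mul_11, w_01, w_11, mul_zero, add_zero, Units.val_one, mul_one]
      exact norm_eq_one_of_mul_sub (HS.det_eq j.mat) hj'.1 hj'.2.1 hj'.2.2.1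
        (lt_of_le_of_ne hj'.2.2.2 hd))
    exact ⟨k, hk, b, hb, Or.inr (by rw [← e, mul_inv_cancel_right])⟩

/-- Conjugation by `SL₂(ℤ₂)` preserves the lifts of the congruence subgroups: the group is generated
by `K₀` and `w`. -/
theorem congr_normal (m : ℕ) : ∀ j ∈ maxCompact, ∀ k ∈ congr m, j * k * j⁻¹ ∈ congr m := by
  intro j hj k hk
  have comp : ∀ {g g' k : Mp}, g * (g' * k * g'⁻¹) * g⁻¹ ∈ congr m →
      g * g' * k * (g * g')⁻¹ ∈ congr m := by
    intro g g' k hk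
    convert hk using 1
    group
  have hwinv : ∀ {k : Mp}, k ∈ congr m → (w 1)⁻¹ * k * (w 1)⁻¹⁻¹ ∈ congr m := by
    intro k hk
    have h1 : (w 1)⁻¹ = (h (-1))⁻¹ * w 1 := by rw [← w_mul_w]; group
    rw [h1, center_conj (inv_mem h_neg_one_mem_center)]
    exact w_conj_congr hk
  have hl : ∀ (b : ℚ_[2]) {k : Mp}, ‖b‖ ≤ 1 → k ∈ congr m → lower b * k * (lower b)⁻¹ ∈ congr m := by
    intro b k hb hk
    have e := w_upper (-b)
    rw [neg_neg] at e
    rw [← e]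
    refine comp (comp (w_conj_congr (K0_conj_congr ?_ (hwinv hk))))
    exact K1_le_K0 (upper_mem_K1 (by rwa [norm_neg]))
  obtain ⟨k₀, hk₀, b, hb, rfl | rfl⟩ := maxCompact_decomp hj
  · exact comp (K0_conj_congr hk₀ (hl b hb hk))
  · exact comp (comp (K0_conj_congr hk₀ (hl b hb (hwinv hk))))

section Entries

variable (b : ℚ_[2]) (m : ℤ) (g : Mp)

theorem upper_mul_00 : (upper b * g).mat 0 0 = g.mat 0 0 + b * g.mat 1 0 := by
  rw [mat_mul, HS.mul_00, upper_00, upper_01, one_mul]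

theorem upper_mul_01 : (upper b * g).mat 0 1 = g.mat 0 1 + b * g.mat 1 1 := by
  rw [mat_mul, HS.mul_01, upper_00, upper_01, one_mul]

theorem upper_mul_10 : (upper b * g).mat 1 0 = g.mat 1 0 := by
  rw [mat_mul, HS.mul_10, upper_10, upper_11, one_mul, zero_mul, zero_add]

theorem upper_mul_11 : (upper b * g).mat 1 1 = g.mat 1 1 := by
  rw [mat_mul, HS.mul_11, upper_10, upper_11, one_mul, zero_mul, zero_add]

theorem lower_mul_00 : (lower b * g).mat 0 0 = g.mat 0 0 := by
  rw [mat_mul, HS.mul_00, lower_00, lower_01, one_mul, zero_mul, add_zero]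

theorem lower_mul_01 : (lower b * g).mat 0 1 = g.mat 0 1 := by
  rw [mat_mul, HS.mul_01, lower_00, lower_01, one_mul, zero_mul, add_zero]

theorem lower_mul_10 : (lower b * g).mat 1 0 = b * g.mat 0 0 + g.mat 1 0 := by
  rw [mat_mul, HS.mul_10, lower_10, lower_11, one_mul]

theorem lower_mul_11 : (lower b * g).mat 1 1 = b * g.mat 0 1 + g.mat 1 1 := by
  rw [mat_mul, HS.mul_11, lower_10, lower_11, one_mul]

theorem t_inv_mul_00 : ((t ^ m)⁻¹ * g).mat 0 0 = 2 ^ m * g.mat 0 0 := by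
  rw [← zpow_neg, mat_mul, HS.mul_00, t_zpow_00, t_zpow_01, neg_neg, zero_mul, add_zero]

theorem t_inv_mul_01 : ((t ^ m)⁻¹ * g).mat 0 1 = 2 ^ m * g.mat 0 1 := by
  rw [← zpow_neg, mat_mul, HS.mul_01, t_zpow_00, t_zpow_01, neg_neg, zero_mul, add_zero]

theorem t_inv_mul_10 : ((t ^ m)⁻¹ * g).mat 1 0 = 2 ^ (-m) * g.mat 1 0 := by
  rw [← zpow_neg, mat_mul, HS.mul_10, t_zpow_10, t_zpow_11, zero_mul, zero_add]

theorem t_inv_mul_11 : ((t ^ m)⁻¹ * g).mat 1 1 = 2 ^ (-m) * g.mat 1 1 := by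
  rw [← zpow_neg, mat_mul, HS.mul_11, t_zpow_10, t_zpow_11, zero_mul, zero_add]

theorem w_inv_mul_00 : ((w 1)⁻¹ * g).mat 0 0 = -g.mat 1 0 := by
  rw [mat_mul, HS.mul_00, mat_inv, inv_00, inv_01, w_11, w_01]; simp

theorem w_inv_mul_01 : ((w 1)⁻¹ * g).mat 0 1 = -g.mat 1 1 := by
  rw [mat_mul, HS.mul_01, mat_inv, inv_00, inv_01, w_11, w_01]; simp

theorem w_inv_mul_10 : ((w 1)⁻¹ * g).mat 1 0 = g.mat 0 0 := by
  rw [mat_mul, HS.mul_10, mat_inv, inv_10, inv_11, w_00, w_10]; simp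

theorem w_inv_mul_11 : ((w 1)⁻¹ * g).mat 1 1 = g.mat 0 1 := by
  rw [mat_mul, HS.mul_11, mat_inv, inv_10, inv_11, w_00, w_10]; simp

theorem mul_w_10 : (g * w 1).mat 1 0 = -g.mat 1 1 := by
  rw [mat_mul, HS.mul_10, w_00, w_10]; simp

theorem mul_w_11 : (g * w 1).mat 1 1 = g.mat 1 0 := by
  rw [mat_mul, HS.mul_11, w_01, w_11]; simp

theorem mul_w_00 : (g * w 1).mat 0 0 = -g.mat 0 1 := by
  rw [mat_mul, HS.mul_00, w_00, w_10]; simp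

theorem mul_w_01 : (g * w 1).mat 0 1 = g.mat 0 0 := by
  rw [mat_mul, HS.mul_01, w_01, w_11]; simp

end Entries

theorem exists_norm_zpow {d : ℚ_[2]} (hd : d ≠ 0) : ∃ m : ℤ, ∀ x : ℚ_[2],
    ‖2 ^ m * x‖ = ‖d * x‖ ∧ ‖2 ^ (-m) * x‖ = ‖x / d‖ := by
  obtain ⟨m, u, hu, rfl⟩ := exists_zpow_mul hd
  refine ⟨m, fun x => ⟨?_, ?_⟩⟩
  · rw [norm_mul, norm_mul, norm_mul, hu, mul_one]
  · rw [norm_mul, norm_div, norm_mul, hu, mul_one, zpow_neg, norm_inv, inv_mul_eq_div]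

section Pivot

variable {g : Mp}

theorem pivot_a (h : g.mat 0 0 ≠ 0) : -(g.mat 1 0 / g.mat 0 0) * g.mat 0 0 + g.mat 1 0 = 0 ∧
    -(g.mat 1 0 / g.mat 0 0) * g.mat 0 1 + g.mat 1 1 = (g.mat 0 0)⁻¹ := by
  have := HS.det_eq g.mat
  constructor <;> field_simp
  · ring
  · linear_combination this

theorem pivot_b (h : g.mat 0 1 ≠ 0) : -(g.mat 1 1 / g.mat 0 1) * g.mat 0 0 + g.mat 1 0 =
    -(g.mat 0 1)⁻¹ ∧ -(g.mat 1 1 / g.mat 0 1) * g.mat 0 1 + g.mat 1 1 = 0 := by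
  have := HS.det_eq g.mat
  constructor <;> field_simp
  · linear_combination -this
  · ring

theorem pivot_c (h : g.mat 1 0 ≠ 0) : g.mat 0 0 + -(g.mat 0 0 / g.mat 1 0) * g.mat 1 0 = 0 ∧
    g.mat 0 1 + -(g.mat 0 0 / g.mat 1 0) * g.mat 1 1 = -(g.mat 1 0)⁻¹ := by
  have := HS.det_eq g.mat
  constructor <;> field_simp
  · ring
  · linear_combination -this

theorem pivot_d (h : g.mat 1 1 ≠ 0) : g.mat 0 0 + -(g.mat 0 1 / g.mat 1 1) * g.mat 1 0 =
    (g.mat 1 1)⁻¹ ∧ g.mat 0 1 + -(g.mat 0 1 / g.mat 1 1) * g.mat 1 1 = 0 := by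
  have := HS.det_eq g.mat
  constructor <;> field_simp
  · linear_combination this
  · ring

end Pivot

theorem iwasawa (g : Mp) : ∃ b, ∃ m : ℤ, ∃ j ∈ maxCompact, g = upper b * t ^ m * j := by
  have key : ∀ g : Mp, ‖g.mat 1 0‖ ≤ ‖g.mat 1 1‖ → ∃ b, ∃ m : ℤ, ∃ j ∈ maxCompact,
      g = upper b * t ^ m * j := by
    intro g hcd
    have hd : g.mat 1 1 ≠ 0 := by
      intro hd
      have hdet := HS.det_eq g.mat
      rw [hd, norm_zero, norm_le_zero_iff] at hcd
      simp [hd, hcd] at hdet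
    obtain ⟨m, hm⟩ := exists_norm_zpow hd
    refine ⟨g.mat 0 1 / g.mat 1 1, m, (t ^ m)⁻¹ * (upper (-(g.mat 0 1 / g.mat 1 1)) * g), ?_, ?_⟩
    · rw [mem_maxCompact_iff, t_inv_mul_00, t_inv_mul_01, t_inv_mul_10, t_inv_mul_11, upper_mul_00,
        upper_mul_01, upper_mul_10, upper_mul_11, (pivot_d hd).1, (pivot_d hd).2, (hm _).1, (hm _).1,
        (hm _).2, (hm _).2]
      exact ⟨by simp [hd], by simp, norm_div_le_one hd hcd, by simp [hd]⟩
    · rw [upper_neg]; group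
  rcases le_total ‖g.mat 1 0‖ ‖g.mat 1 1‖ with hcd | hcd
  · exact key g hcd
  · obtain ⟨b, m, j, hj, e⟩ := key (g * w 1) (by
      rwa [mul_w_10, mul_w_11, norm_neg])
    refine ⟨b, m, j * (w 1)⁻¹, mul_mem hj (inv_mem w_mem_maxCompact), ?_⟩
    rw [← mul_assoc, ← e, mul_inv_cancel_right]

/-- If the upper left entry is the largest one, the other entries of its row and column are removed
by integral unipotents; multiplication by `w 1` on either side moves the largest entry there. -/
theorem cartan (g : Mp) : ∃ j ∈ maxCompact, ∃ m : ℕ, ∃ j' ∈ maxCompact, g = j * t ^ m * j' := by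
  have key : ∀ g : Mp, ‖g.mat 0 1‖ ≤ ‖g.mat 0 0‖ → ‖g.mat 1 0‖ ≤ ‖g.mat 0 0‖ →
      ‖g.mat 1 1‖ ≤ ‖g.mat 0 0‖ → ∃ j ∈ maxCompact, ∃ m : ℕ, ∃ j' ∈ maxCompact,
      g = j * t ^ m * j' := by
    intro g hb hc hd
    have hdet := HS.det_eq g.mat
    have ha1 : 1 ≤ ‖g.mat 0 0‖ := by
      by_contra! h
      have h1 := norm_mul_lt_one h.le (hd.trans_lt h)
      have h2 := norm_mul_lt_one (hb.trans h.le) (hc.trans_lt h)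
      have h3 : ‖g.mat 0 0 * g.mat 1 1 - g.mat 0 1 * g.mat 1 0‖ < 1 := by
        rw [sub_eq_add_neg]
        exact (Padic.nonarchimedean _ _).trans_lt (max_lt h1 (by rwa [norm_neg]))
      rw [hdet, norm_one] at h3
      exact lt_irrefl _ h3
    have ha : g.mat 0 0 ≠ 0 := norm_pos_iff.1 (by linarith)
    obtain ⟨m, hm⟩ := exists_norm_zpow (inv_ne_zero ha)
    have hm0 : 0 ≤ m := by
      have h1 := (hm 1).1
      rw [mul_one, mul_one, norm_inv, norm_two_zpow] at h1
      by_contra! hlt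
      have h2 := one_lt_zpow₀ (a := (2 : ℝ)) (by norm_num) (n := -m) (by omega)
      rw [h1] at h2
      exact absurd (inv_le_one_of_one_le₀ ha1) (not_le.2 h2)
    obtain ⟨m, rfl⟩ := Int.eq_ofNat_of_zero_le hm0
    refine ⟨lower (g.mat 1 0 / g.mat 0 0), lower_mem_maxCompact (norm_div_le_one ha hc), m,
      (t ^ (m : ℤ))⁻¹ * (lower (-(g.mat 1 0 / g.mat 0 0)) * g), ?_, ?_⟩
    · rw [mem_maxCompact_iff, t_inv_mul_00, t_inv_mul_01, t_inv_mul_10, t_inv_mul_11, lower_mul_00,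
        lower_mul_01, lower_mul_10, lower_mul_11, (pivot_a ha).1, (pivot_a ha).2, (hm _).1, (hm _).1,
        (hm _).2, (hm _).2]
      refine ⟨by simp [ha], ?_, by simp, by simp [ha]⟩
      rw [inv_mul_eq_div]
      exact norm_div_le_one ha hb
    · rw [zpow_natCast, lower_neg]; group
  have hr : ∀ g, (∃ j ∈ maxCompact, ∃ m : ℕ, ∃ j' ∈ maxCompact, g * w 1 = j * t ^ m * j') →
      ∃ j ∈ maxCompact, ∃ m : ℕ, ∃ j' ∈ maxCompact, g = j * t ^ m * j' := by
    rintro g ⟨j, hj, m, j', hj', e⟩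
    refine ⟨j, hj, m, j' * (w 1)⁻¹, mul_mem hj' (inv_mem w_mem_maxCompact), ?_⟩
    rw [← mul_assoc, ← e, mul_inv_cancel_right]
  have hl : ∀ g, (∃ j ∈ maxCompact, ∃ m : ℕ, ∃ j' ∈ maxCompact, (w 1)⁻¹ * g = j * t ^ m * j') →
      ∃ j ∈ maxCompact, ∃ m : ℕ, ∃ j' ∈ maxCompact, g = j * t ^ m * j' := by
    rintro g ⟨j, hj, m, j', hj', e⟩
    refine ⟨w 1 * j, mul_mem w_mem_maxCompact hj, m, j', hj', ?_⟩
    rw [mul_assoc (w 1), mul_assoc (w 1), ← e, mul_inv_cancel_left]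
  have hmax : (‖g.mat 0 1‖ ≤ ‖g.mat 0 0‖ ∧ ‖g.mat 1 0‖ ≤ ‖g.mat 0 0‖ ∧ ‖g.mat 1 1‖ ≤ ‖g.mat 0 0‖) ∨
      (‖g.mat 0 0‖ ≤ ‖g.mat 0 1‖ ∧ ‖g.mat 1 0‖ ≤ ‖g.mat 0 1‖ ∧ ‖g.mat 1 1‖ ≤ ‖g.mat 0 1‖) ∨
      (‖g.mat 0 0‖ ≤ ‖g.mat 1 0‖ ∧ ‖g.mat 0 1‖ ≤ ‖g.mat 1 0‖ ∧ ‖g.mat 1 1‖ ≤ ‖g.mat 1 0‖) ∨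
      (‖g.mat 0 0‖ ≤ ‖g.mat 1 1‖ ∧ ‖g.mat 0 1‖ ≤ ‖g.mat 1 1‖ ∧ ‖g.mat 1 0‖ ≤ ‖g.mat 1 1‖) := by
    grind
  rcases hmax with ⟨h1, h2, h3⟩ | ⟨h1, h2, h3⟩ | ⟨h1, h2, h3⟩ | ⟨h1, h2, h3⟩
  · exact key g h1 h2 h3
  · refine hr _ (key _ ?_ ?_ ?_) <;> rw [mul_w_00]
    · rwa [mul_w_01, norm_neg]
    · rwa [mul_w_10, norm_neg, norm_neg]
    · rwa [mul_w_11, norm_neg]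
  · refine hl _ (key _ ?_ ?_ ?_) <;> rw [w_inv_mul_00]
    · rwa [w_inv_mul_01, norm_neg, norm_neg]
    · rwa [w_inv_mul_10, norm_neg]
    · rwa [w_inv_mul_11, norm_neg]
  · refine hl _ (hr _ (key _ ?_ ?_ ?_)) <;> rw [mul_w_00, w_inv_mul_01]
    · rwa [mul_w_01, w_inv_mul_00, norm_neg, neg_neg]
    · rwa [mul_w_10, w_inv_mul_11, norm_neg, neg_neg]
    · rwa [mul_w_11, w_inv_mul_10, neg_neg]

/-- The image of the double cover in `PGL₂(ℚ₂)`. -/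
noncomputable def toPGL : Mp →* PGL(2, ℚ_[2]) :=
  (Matrix.ProjGenLinGroup.mk.comp Matrix.SpecialLinearGroup.toGL).comp proj

theorem toPGL_eq (g : Mp) : toPGL g = PGLTwo.mat (g.mat 0 0) (g.mat 0 1) (g.mat 1 0) (g.mat 1 1)
    (by rw [HS.det_eq]; exact one_ne_zero) := by
  refine congrArg Matrix.ProjGenLinGroup.mk (Units.ext ?_)
  exact Matrix.eta_fin_two _

theorem toPGL_w : toPGL (w 1) = PGLTwo.weyl := by
  rw [toPGL_eq, PGLTwo.weyl_eq]
  exact PGLTwo.mat_eq 1 one_ne_zero (by rw [w_00, mul_zero]) (by rw [w_01]; simp)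
    (by rw [w_10]; simp) (by rw [w_11, mul_zero])

theorem toPGL_t_zpow (m : ℤ) : toPGL (t ^ m) = PGLTwo.t ^ (2 * m) := by
  rw [toPGL_eq, PGLTwo.t_zpow]
  refine PGLTwo.mat_eq (2 ^ (-m)) (two_zpow_ne _) (by rw [t_zpow_00, mul_one]) (by rw [t_zpow_01, mul_zero])
    (by rw [t_zpow_10, mul_zero]) ?_
  rw [t_zpow_11, ← zpow_add₀ two_ne_zero]
  congr 1
  ring

theorem toPGL_mem {k : Mp} (hk : k ∈ K0) : toPGL k ∈ PGLTwo.iwahori := by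
  rw [mem_K0_iff] at hk
  rw [toPGL_eq]
  exact PGLTwo.mat_mem_iwahori hk.1 hk.2.1 (hk.2.2.1.trans_lt (by rw [norm_four]; norm_num))
    hk.2.2.2 (by rw [HS.det_eq, norm_one])

/-- Distinct double cosets of `K₀` have distinct images in `PGL₂(ℚ₂)`. -/
theorem disjoint (m m' : ℤ) (ε ε' : Bool) (k k' : K0)
    (e : k * (t ^ m * if ε then w 1 else 1) * k' = t ^ m' * (if ε' then w 1 else 1)) :
    m = m' ∧ ε = ε' := by
  have h1 : ∀ ε : Bool, toPGL (if ε then w 1 else 1) = if ε then PGLTwo.weyl else 1 := by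
    rintro (_ | _)
    · exact map_one _
    · exact toPGL_w
  have := congrArg toPGL e
  rw [map_mul, map_mul, map_mul, map_mul, toPGL_t_zpow, toPGL_t_zpow, h1, h1] at this
  have := PGLTwo.disjoint _ _ _ _ ⟨_, toPGL_mem k.2⟩ ⟨_, toPGL_mem k'.2⟩ this
  exact ⟨by omega, this.2⟩

end Mp

/-! ### The character of `K₀` and the topology of the double cover -/

namespace Mp

open LocalShimura

/-- The Hilbert symbol `(-1, -1)` is nontrivial at `2`. -/
theorem hilbertSymbol_neg_one : hilbertSymbol (-1) (-1) = -1 := by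
  obtain ⟨z, hz⟩ := HS.isSq (u := -7) ⟨-1, by norm_num⟩
  have h7 : (-1 : ℚ_[2]) = (HS.rep 3 : ℤ) * (z / 7) ^ 2 := by
    rw [div_pow, hz]
    change (-1 : ℚ_[2]) = (7 : ℤ) * (((-(7 : ℤ_[2]) : ℤ_[2]) : ℚ_[2]) / 7 ^ 2)
    rw [PadicInt.coe_neg, show ((7 : ℤ_[2]) : ℚ_[2]) = 7 from rfl]
    norm_num
  have hz0 : z / 7 ≠ 0 := by
    intro h
    rw [h] at h7
    norm_num at h7
  rw [h7, HS.mul_sq hz0, HS.sq_mul hz0, HS.rep_eq, if_neg (by decide)]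

theorem h_neg_one_mul_self : h (-1) * h (-1) = negOne := by
  have hm : (h (-1)).mat * (h (-1)).mat = 1 := by
    refine SL_ext ?_ ?_ ?_ ?_ <;>
    simp [HS.mul_00, HS.mul_01, HS.mul_10, HS.mul_11, h_00, h_01, h_10, h_11]
  refine Mp.ext hm ?_
  rw [sgn_mul]
  unfold cocycle
  rw [hm, cocycleS_h, cocycleX_h, HS.X_one, HS.S_one]
  change 1 * 1 * _ = -1
  simp [hilbertSymbol_neg_one, inv_neg]

variable (γ : Subgroup.center Mp →* ℂˣ)

theorem extend_of_eq {k : K0} {z : Subgroup.center Mp} {k₁ : Mp} (hk : k₁ ∈ K1)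
    (e : (k : Mp) = z * k₁) : extend γ k = γ z := by
  obtain ⟨k₂, e'⟩ := centralPart_spec k
  exact congrArg γ (central_unique (k := k₂) (k' := ⟨k₁, hk⟩) (e'.symm.trans e))

theorem extend_K1 {k : K0} (hk : (k : Mp) ∈ K1) : extend γ k = 1 := by
  rw [extend_of_eq γ (z := 1) hk (one_mul _).symm, map_one]

variable {γ}

theorem gamma_h_sq (hγ : γ ⟨negOne, negOne_mem_center⟩ = -1) :
    γ ⟨h (-1), h_neg_one_mem_center⟩ ^ 2 = -1 := by
  rw [← map_pow, ← hγ]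
  congr 1
  exact Subtype.ext ((pow_two _).trans h_neg_one_mul_self)

/-- The elements of `K₀` with `a ≡ -1 mod 4` lie in `h(-1) K₁` up to `μ₂`, and `γ(h(-1))` is a
square root of `-1`. -/
theorem extend_sq (hγ : γ ⟨negOne, negOne_mem_center⟩ = -1) {k : K0}
    (hk : ‖(k : Mp).mat 0 0 + 1‖ ≤ ‖(4 : ℚ_[2])‖) : extend γ k ^ 2 = -1 := by
  have hk0 := mem_K0_iff.1 k.2
  let k₁ : Mp := ⟨-(k : Mp).mat, 1⟩
  have h1 : k₁ ∈ K1 := by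
    rw [mem_K1_iff]
    refine ⟨rfl, ?_, ?_, ?_, ?_⟩
    · change ‖-(k : Mp).mat 0 0 - 1‖ ≤ _
      rwa [← norm_neg, neg_sub, sub_neg_eq_add, add_comm]
    · change ‖-(k : Mp).mat 0 1‖ ≤ _
      rw [norm_neg]; exact hk0.2.1
    · change ‖-(k : Mp).mat 1 0‖ ≤ _
      rw [norm_neg]; exact hk0.2.2.1
    · change ‖-(k : Mp).mat 1 1‖ ≤ _
      rw [norm_neg]; exact hk0.2.2.2
  have hm : (k : Mp).mat = (h (-1) * k₁).mat := by
    have e : ∀ i j, k₁.mat i j = -(k : Mp).mat i j := fun _ _ => rfl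
    refine SL_ext ?_ ?_ ?_ ?_ <;>
    simp [mat_mul, HS.mul_00, HS.mul_01, HS.mul_10, HS.mul_11, h_00, h_01, h_10, h_11, e, inv_neg]
  rcases eq_or_eq_negOne_mul hm with e | e
  · rw [extend_of_eq γ (z := ⟨_, h_neg_one_mem_center⟩) h1 e, gamma_h_sq hγ]
  · rw [extend_of_eq γ (z := ⟨_, negOne_mem_center⟩ * ⟨_, h_neg_one_mem_center⟩) h1
      (by rw [e, Subgroup.coe_mul, mul_assoc]), map_mul, mul_pow, gamma_h_sq hγ, hγ]
    simp

theorem extend_ne_one (hγ : γ ⟨negOne, negOne_mem_center⟩ = -1) {k : K0}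
    (hk : ‖(k : Mp).mat 0 0 + 1‖ ≤ ‖(4 : ℚ_[2])‖) : extend γ k ≠ 1 := by
  intro h1
  have h2 := congrArg Units.val (extend_sq hγ hk)
  rw [h1, one_pow, Units.val_neg, Units.val_one] at h2
  norm_num at h2

theorem cocycle_K1 (k : ((Gamma1Four.map inclSL).comap proj : Subgroup Mp))
    (k' : ((Gamma1Four.map inclSL).comap proj : Subgroup Mp)) :
    ((k : Mp) * k').sgn = (k : Mp).sgn * (k' : Mp).sgn := by
  obtain ⟨A, hA, eA⟩ := k.2
  obtain ⟨B, hB, eB⟩ := k'.2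
  rw [sgn_mul]
  change inclSL A = (k : Mp).mat at eA
  change inclSL B = (k' : Mp).mat at eB
  rw [← eA, ← eB, HS.cocycle_Gamma1 hA hB, mul_one]

theorem relIndex_K1 : K1.relIndex ((Gamma1Four.map inclSL).comap proj) ≠ 0 := by
  let f : ((Gamma1Four.map inclSL).comap proj : Subgroup Mp) →* ℤˣ :=
    MonoidHom.mk' (fun k => (k : Mp).sgn) cocycle_K1
  have : K1.subgroupOf ((Gamma1Four.map inclSL).comap proj) = f.ker := by
    ext k
    exact ⟨fun hk => hk.2, fun hk => ⟨k.2, hk⟩⟩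
  rw [Subgroup.relIndex, this, Subgroup.index_ker]
  exact Nat.card_pos.ne'

theorem proj_surjective : Function.Surjective proj := fun A => ⟨⟨A, 1⟩, rfl⟩

theorem relIndex_fullCongr (m : ℕ) : (fullCongr m).relIndex maxCompact ≠ 0 := by
  unfold fullCongr maxCompact
  rw [Subgroup.relIndex_comap, Subgroup.map_comap_eq_self_of_surjective proj_surjective,
    MonoidHom.range_eq_map, Subgroup.relIndex_map_map, top_sup_eq, Subgroup.relIndex_top_right]
  have h1 : (GammaTwoPow (m + 2)).FiniteIndex := by
    have : Finite (SL(2, ZMod (2 ^ (m + 2)))) := inferInstance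
    unfold GammaTwoPow
    infer_instance
  exact (Subgroup.finiteIndex_of_le (le_sup_left (b := inclSL.ker))).index_ne_zero

theorem relIndex_congr (m : ℕ) : (congr m).relIndex maxCompact ≠ 0 := by
  refine Subgroup.relIndex_inf_ne_zero (Subgroup.relIndex_ne_zero_trans relIndex_K1 ?_)
    (relIndex_fullCongr m)
  have hle : fullCongr 0 ≤ (Gamma1Four.map inclSL).comap proj :=
    Subgroup.comap_mono (Subgroup.map_mono HS.GammaTwoPow_two_le)
  intro h
  exact relIndex_fullCongr 0 (Subgroup.relIndex_eq_zero_of_le_left hle h)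

theorem congr_conj (g : Mp) (m : ℕ) : ∃ m', ∀ x ∈ congr m', g * x * g⁻¹ ∈ congr m := by
  have comp : ∀ {g g' : Mp}, (∀ m, ∃ m', ∀ x ∈ congr m', g * x * g⁻¹ ∈ congr m) →
      (∀ m, ∃ m', ∀ x ∈ congr m', g' * x * g'⁻¹ ∈ congr m) →
      ∀ m, ∃ m', ∀ x ∈ congr m', g * g' * x * (g * g')⁻¹ ∈ congr m := by
    intro g g' h1 h2 m
    obtain ⟨m₁, h1⟩ := h1 m
    obtain ⟨m₂, h2⟩ := h2 m₁
    refine ⟨m₂, fun x hx => ?_⟩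
    convert h1 _ (h2 x hx) using 1
    group
  have ht : ∀ i : ℕ, ∀ m, ∃ m', ∀ x ∈ congr m', t ^ i * x * (t ^ i)⁻¹ ∈ congr m := by
    intro i
    induction i with
    | zero => exact fun m => ⟨m, fun x hx => by simpa using hx⟩
    | succ i ih =>
      rw [pow_succ]
      exact comp ih fun m => ⟨m + 2, fun x hx => t_conj_congr hx⟩
  have hj : ∀ j ∈ maxCompact, ∀ m, ∃ m', ∀ x ∈ congr m', j * x * j⁻¹ ∈ congr m :=
    fun j hj m => ⟨m, congr_normal m j hj⟩
  obtain ⟨j, hj1, i, j', hj2, rfl⟩ := cartan g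
  exact comp (comp (hj j hj1) (ht i)) (hj j' hj2) m

theorem isOpen_iff (S : Subgroup Mp) : IsOpen (S : Set Mp) ↔ ∃ m, congr m ≤ S := by
  constructor
  · intro hS
    obtain ⟨n, hn⟩ := hS 1 (one_mem S)
    refine ⟨n, fun g hg => ?_⟩
    obtain ⟨⟨-, hs⟩, A, hA, hg⟩ := hg
    have := hn A (HS.GammaTwoPow_anti (Nat.le_add_right n 2) hA)
    rwa [one_mul, show (⟨inclSL A, 1⟩ : Mp) = g from Mp.ext hg hs.symm] at this
  · rintro ⟨m, hm⟩ g hg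
    refine ⟨m + 2, fun k hk => mul_mem hg (hm ⟨?_, k, hk, rfl⟩)⟩
    exact ⟨⟨k, HS.GammaTwoPow_two_le (HS.GammaTwoPow_anti (Nat.le_add_left 2 m) hk), rfl⟩, rfl⟩

theorem t_upper_inv (b : ℚ_[2]) : t * upper b * t⁻¹ = upper (4⁻¹ * b) := by
  have := t_upper (4⁻¹ * b)
  rw [mul_inv_cancel_left₀ (by norm_num)] at this
  rw [← this]
  group

/-- Conjugation by `t w` takes `n b` to `n' (-4 b)` and `n' b` to `n (-b / 4)`; it therefore
preserves the triangular decomposition of `K₁`. -/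
theorem u_conj (k : K0) : ∃ k' : K0, t * w 1 * k = k' * (t * w 1) ∧ extend γ k' = extend γ k := by
  obtain ⟨z, k₁, e⟩ := K0_decomp k
  have h1 : t * w 1 * k₁ * (t * w 1)⁻¹ ∈ K1 := by
    obtain ⟨y, x, a, e, hy, hx, ha, ha4⟩ := K1_triangular k₁.2
    have hk := mem_K1_iff.1 k₁.2
    have comp : ∀ k : Mp, t * w 1 * k * (t * w 1)⁻¹ = t * (w 1 * k * (w 1)⁻¹) * t⁻¹ :=
      fun k => by group
    refine conj_mem_of_triangular e ?_ ?_ ?_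
    · rw [comp, w_upper, t_lower]
      refine lower_mem_K1 ?_
      rw [norm_mul, norm_neg, hy]
      exact mul_le_of_le_one_right (norm_nonneg _) hk.2.2.1
    · rw [comp, w_h, t_h]
      exact (h_inv_mem_congr (m := 0) (by rw [ha]; exact ha4.trans_eq (by norm_num))).1
    · rw [comp, w_lower, t_upper_inv]
      refine upper_mem_K1 ?_
      rw [norm_mul, norm_neg, hx, norm_inv]
      exact (inv_mul_le_iff₀ (norm_pos_iff.2 (by norm_num))).2 (by
        rw [mul_one]; exact hk.2.2.2.1)
  have hz : (z : Mp) ∈ K0 := by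
    rw [show (z : Mp) = k * (k₁ : Mp)⁻¹ by rw [e, mul_inv_cancel_right]]
    exact mul_mem k.2 (inv_mem (K1_le_K0 k₁.2))
  refine ⟨⟨_, mul_mem hz (K1_le_K0 h1)⟩, ?_, ?_⟩
  · rw [e]
    have := Subgroup.mem_center_iff.1 z.2 (t * w 1)
    rw [← mul_assoc, this]
    group
  · rw [extend_of_eq γ (z := z) h1 rfl, extend_of_eq γ k₁.2 e]

theorem norm_two_pow_mul_le (m : ℕ) (x : ℚ_[2]) : ‖2 ^ m * x‖ ≤ ‖x‖ := by
  rw [norm_mul, norm_pow, norm_two]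
  exact mul_le_of_le_one_left (norm_nonneg _) (pow_le_one₀ (by norm_num) (by norm_num))

theorem t_pow_lower (m : ℕ) (b : ℚ_[2]) : t ^ m * lower b * (t ^ m)⁻¹ = lower (4 ^ m * b) := by
  induction m generalizing b with
  | zero => simp
  | succ m ih =>
    have : t ^ (m + 1) * lower b * (t ^ (m + 1))⁻¹ =
      t ^ m * (t * lower b * t⁻¹) * (t ^ m)⁻¹ := by rw [pow_succ]; group
    rw [this, t_lower, ih, ← mul_assoc, pow_succ]

theorem t_pow_h (m : ℕ) (x : ℚ_[2]ˣ) : t ^ m * h x * (t ^ m)⁻¹ = h x := by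
  induction m with
  | zero => simp
  | succ m ih =>
    have : t ^ (m + 1) * h x * (t ^ (m + 1))⁻¹ =
      t ^ m * (t * h x * t⁻¹) * (t ^ m)⁻¹ := by rw [pow_succ]; group
    rw [this, t_h, ih]

theorem K0_triangular (k : K0) : ∃ z : K0, ∃ b l, (∀ g, z * g = g * (z : Mp)) ∧ ‖b‖ ≤ 1 ∧
    (∀ m : ℕ, t ^ m * l * (t ^ m)⁻¹ ∈ congr 0) ∧ (k : Mp) = z * upper b * l := by
  obtain ⟨z, k₁, e⟩ := K0_decomp k
  obtain ⟨y, x, a, e1, hy, hx, ha, ha4⟩ := K1_triangular k₁.2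
  have hk := mem_K1_iff.1 k₁.2
  have hz : (z : Mp) ∈ K0 := by
    rw [show (z : Mp) = k * (k₁ : Mp)⁻¹ by rw [e, mul_inv_cancel_right]]
    exact mul_mem k.2 (inv_mem (K1_le_K0 k₁.2))
  refine ⟨⟨z, hz⟩, y, h a * lower x, fun g => (Subgroup.mem_center_iff.1 z.2 g).symm,
    by rw [hy]; exact hk.2.2.1, fun m => ?_, ?_⟩
  · rw [show t ^ m * (h a * lower x) * (t ^ m)⁻¹ =
      t ^ m * h a * (t ^ m)⁻¹ * (t ^ m * lower x * (t ^ m)⁻¹) by group, t_pow_h, t_pow_lower]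
    refine mul_mem (h_mem_congr ?_) (lower_mem_congr ?_)
    · rw [ha]; exact ha4.trans_eq (by norm_num)
    · rw [show (4 : ℚ_[2]) ^ m = 2 ^ (2 * m) by rw [pow_mul]; norm_num]
      refine (norm_two_pow_mul_le _ _).trans ?_
      rw [hx]
      exact hk.2.2.2.1.trans_eq (by norm_num)
  · rw [e, e1, mul_assoc, mul_assoc]

end Mp

/-! ### Double cosets of `K₀` -/

namespace Mp

open LocalShimura

theorem norm_sub_one_le {x : ℚ_[2]} (hx : ‖x‖ = 1) : ‖x - 1‖ ≤ ‖(2 : ℚ_[2])‖ := by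
  obtain ⟨y, rfl⟩ := exists_padicInt hx.le
  rcases HS.parity y with h | h
  · have := (two_pow_dvd_iff 1 y).1 (by rwa [pow_one])
    rw [hx, pow_one, norm_two] at this
    norm_num at this
  · have := (two_pow_dvd_iff 1 (y - 1)).1 (by rwa [pow_one])
    rwa [pow_one, coe_sub_one] at this

theorem norm_two_mul_sub_le {x : ℚ_[2]} (hx : ‖x‖ = 1) : ‖2 * (x - 1)‖ ≤ ‖(4 : ℚ_[2])‖ := by
  rw [show (4 : ℚ_[2]) = 2 * 2 by norm_num, norm_mul, norm_mul]
  exact mul_le_mul_of_nonneg_left (norm_sub_one_le hx) (norm_nonneg _)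

theorem two_mul_norm_le {x y : ℚ_[2]} (h : ‖x‖ < ‖y‖) : 2 * ‖x‖ ≤ ‖y‖ := by
  have hy : y ≠ 0 := norm_pos_iff.1 ((norm_nonneg _).trans_lt h)
  obtain ⟨z, hz, e⟩ := exists_two_mul (norm_div_lt_one h)
  rw [div_eq_iff hy] at e
  rw [e, norm_mul, norm_mul, norm_two]
  nlinarith [norm_nonneg y]

section Conj

variable (g : Mp) (e : ℚ_[2])

theorem conj_upper_00 : (g * upper e * g⁻¹).mat 0 0 = 1 - e * g.mat 0 0 * g.mat 1 0 := by
  have := HS.det_eq g.mat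
  simp only [mat_mul, mat_inv, HS.mul_00, HS.mul_01, inv_00, inv_10, upper_00, upper_01, upper_10,
    upper_11]
  linear_combination this

theorem conj_upper_01 : (g * upper e * g⁻¹).mat 0 1 = e * g.mat 0 0 ^ 2 := by
  simp only [mat_mul, mat_inv, HS.mul_00, HS.mul_01, inv_01, inv_11, upper_00, upper_01, upper_10,
    upper_11]
  ring

theorem conj_upper_10 : (g * upper e * g⁻¹).mat 1 0 = -(e * g.mat 1 0 ^ 2) := by
  simp only [mat_mul, mat_inv, HS.mul_10, HS.mul_11, inv_00, inv_10, upper_00, upper_01, upper_10,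
    upper_11]
  ring

theorem conj_upper_11 : (g * upper e * g⁻¹).mat 1 1 = 1 + e * g.mat 0 0 * g.mat 1 0 := by
  have := HS.det_eq g.mat
  simp only [mat_mul, mat_inv, HS.mul_10, HS.mul_11, inv_01, inv_11, upper_00, upper_01, upper_10,
    upper_11]
  linear_combination this

theorem conj_lower_00 : (g * lower e * g⁻¹).mat 0 0 = 1 + e * g.mat 0 1 * g.mat 1 1 := by
  have := HS.det_eq g.mat
  simp only [mat_mul, mat_inv, HS.mul_00, HS.mul_01, inv_00, inv_10, lower_00, lower_01, lower_10,
    lower_11]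
  linear_combination this

theorem conj_lower_01 : (g * lower e * g⁻¹).mat 0 1 = -(e * g.mat 0 1 ^ 2) := by
  simp only [mat_mul, mat_inv, HS.mul_00, HS.mul_01, inv_01, inv_11, lower_00, lower_01, lower_10,
    lower_11]
  ring

theorem conj_lower_10 : (g * lower e * g⁻¹).mat 1 0 = e * g.mat 1 1 ^ 2 := by
  simp only [mat_mul, mat_inv, HS.mul_10, HS.mul_11, inv_00, inv_10, lower_00, lower_01, lower_10,
    lower_11]
  ring

theorem conj_lower_11 : (g * lower e * g⁻¹).mat 1 1 = 1 - e * g.mat 0 1 * g.mat 1 1 := by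
  have := HS.det_eq g.mat
  simp only [mat_mul, mat_inv, HS.mul_10, HS.mul_11, inv_01, inv_11, lower_00, lower_01, lower_10,
    lower_11]
  linear_combination this

end Conj

variable {γ : Subgroup.center Mp →* ℂˣ}

/-- No function of the Hecke algebra is supported on `K₀ g K₀` if `‖c‖ = ‖2a‖` and `‖a‖ ≥ 1`: then
`g` conjugates the unipotent element `n(a⁻²)`, on which the character is trivial, to an element of
`K₀` whose diagonal is congruent to `-1` modulo `4`. -/
theorem exists_ne_of_norm_c {g : Mp} (hγ : γ ⟨negOne, negOne_mem_center⟩ = -1)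
    (ha : 1 ≤ ‖g.mat 0 0‖) (hc : ‖g.mat 1 0‖ = ‖2 * g.mat 0 0‖) :
    ∃ k k' : K0, k * g = g * k' ∧ extend γ k ≠ extend γ k' := by
  have ha0 : g.mat 0 0 ≠ 0 := norm_pos_iff.1 (by linarith)
  have hx : ‖((g.mat 0 0) ^ 2)⁻¹‖ ≤ 1 := by
    rw [norm_inv, norm_pow]
    exact inv_le_one_of_one_le₀ (one_le_pow₀ ha)
  have hv : ‖g.mat 1 0 / (2 * g.mat 0 0)‖ = 1 := by
    rw [norm_div, hc]; exact div_self (norm_ne_zero_iff.2 (mul_ne_zero two_ne_zero ha0))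
  have hv2 := norm_two_mul_sub_le hv
  have hca : g.mat 1 0 = 2 * g.mat 0 0 * (g.mat 1 0 / (2 * g.mat 0 0)) := by field_simp
  generalize g.mat 1 0 / (2 * g.mat 0 0) = v at hv hv2 hca
  have h2v : ‖2 * v‖ ≤ 1 := by rw [norm_mul, hv, norm_two]; norm_num
  have e1 : ((g.mat 0 0) ^ 2)⁻¹ * g.mat 0 0 * g.mat 1 0 = 2 * v := by
    rw [hca]; field_simp
  have hk : g * upper ((g.mat 0 0) ^ 2)⁻¹ * g⁻¹ ∈ K0 := by
    rw [mem_K0_iff, conj_upper_00, conj_upper_01, conj_upper_10, conj_upper_11, e1, hca]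
    refine ⟨?_, ?_, ?_, ?_⟩
    · rw [sub_eq_add_neg]
      exact (Padic.nonarchimedean _ _).trans (max_le (by simp) (by rwa [norm_neg]))
    · rw [inv_mul_cancel₀ (pow_ne_zero 2 ha0), norm_one]
    · rw [show ((g.mat 0 0) ^ 2)⁻¹ * (2 * g.mat 0 0 * v) ^ 2 = 4 * v ^ 2 by field_simp; ring,
        norm_neg, norm_mul, norm_pow, hv, one_pow, mul_one]
    · exact (Padic.nonarchimedean _ _).trans (max_le (by simp) h2v)
  refine ⟨⟨_, hk⟩, ⟨_, K1_le_K0 (upper_mem_K1 hx)⟩, inv_mul_cancel_right _ _, ?_⟩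
  rw [extend_K1 γ (k := ⟨_, K1_le_K0 (upper_mem_K1 hx)⟩) (upper_mem_K1 hx)]
  refine extend_ne_one hγ ?_
  rwa [conj_upper_00, e1, show 1 - 2 * v + 1 = -(2 * (v - 1)) by ring, norm_neg]

/-- No function of the Hecke algebra is supported on `K₀ g K₀` if `‖2b‖ = ‖d‖` and `‖d‖ ≥ 1`. -/
theorem exists_ne_of_norm_b {g : Mp} (hγ : γ ⟨negOne, negOne_mem_center⟩ = -1)
    (hd : 1 ≤ ‖g.mat 1 1‖) (hb : ‖2 * g.mat 0 1‖ = ‖g.mat 1 1‖) :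
    ∃ k k' : K0, k * g = g * k' ∧ extend γ k ≠ extend γ k' := by
  have hd0 : g.mat 1 1 ≠ 0 := norm_pos_iff.1 (by linarith)
  have hx : ‖4 * ((g.mat 1 1) ^ 2)⁻¹‖ ≤ ‖(4 : ℚ_[2])‖ := by
    rw [norm_mul, norm_inv, norm_pow]
    exact mul_le_of_le_one_right (norm_nonneg _) (inv_le_one_of_one_le₀ (one_le_pow₀ hd))
  have hv : ‖-(2 * g.mat 0 1 / g.mat 1 1)‖ = 1 := by
    rw [norm_neg, norm_div, hb]; exact div_self (norm_ne_zero_iff.2 hd0)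
  have hv2 := norm_two_mul_sub_le hv
  have hbd : g.mat 0 1 = -(2⁻¹ * g.mat 1 1 * -(2 * g.mat 0 1 / g.mat 1 1)) := by field_simp
  generalize -(2 * g.mat 0 1 / g.mat 1 1) = v at hv hv2 hbd
  have h2v : ‖2 * v‖ ≤ 1 := by rw [norm_mul, hv, norm_two]; norm_num
  have e1 : 4 * ((g.mat 1 1) ^ 2)⁻¹ * g.mat 0 1 * g.mat 1 1 = -(2 * v) := by
    rw [hbd]; field_simp; ring
  have hk : g * lower (4 * ((g.mat 1 1) ^ 2)⁻¹) * g⁻¹ ∈ K0 := by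
    rw [mem_K0_iff, conj_lower_00, conj_lower_01, conj_lower_10, conj_lower_11, e1, hbd]
    refine ⟨?_, ?_, ?_, ?_⟩
    · exact (Padic.nonarchimedean _ _).trans (max_le (by simp) (by rwa [norm_neg]))
    · rw [show 4 * ((g.mat 1 1) ^ 2)⁻¹ * (-(2⁻¹ * g.mat 1 1 * v)) ^ 2 = v ^ 2 by field_simp; ring,
        norm_neg, norm_pow, hv, one_pow]
    · rw [inv_mul_cancel_right₀ (pow_ne_zero 2 hd0)]
    · rw [sub_neg_eq_add]
      exact (Padic.nonarchimedean _ _).trans (max_le (by simp) h2v)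
  refine ⟨⟨_, hk⟩, ⟨_, K1_le_K0 (lower_mem_K1 hx)⟩, inv_mul_cancel_right _ _, ?_⟩
  rw [extend_K1 γ (k := ⟨_, K1_le_K0 (lower_mem_K1 hx)⟩) (lower_mem_K1 hx)]
  refine extend_ne_one hγ ?_
  rwa [conj_lower_00, e1, show 1 + -(2 * v) + 1 = -(2 * (v - 1)) by ring, norm_neg]

theorem exists_ne_of_inv {g : Mp} (h : ∃ k k' : K0, k * g⁻¹ = g⁻¹ * k' ∧ extend γ k ≠ extend γ k') :
    ∃ k k' : K0, k * g = g * k' ∧ extend γ k ≠ extend γ k' := by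
  obtain ⟨k, k', e, hne⟩ := h
  refine ⟨k', k, ?_, hne.symm⟩
  rw [eq_inv_mul_iff_mul_eq, ← mul_assoc, mul_inv_eq_iff_eq_mul] at e
  exact e.symm

theorem norm_div_le_four {a b : ℚ_[2]} (hb : b ≠ 0) (h : 4 * ‖a‖ ≤ ‖b‖) :
    ‖a / b‖ ≤ ‖(4 : ℚ_[2])‖ := by
  rw [norm_div, div_le_iff₀ (norm_pos_iff.2 hb), norm_four]
  linarith

/-- The double cosets of `K₀` that support functions of the Hecke algebra are represented by the
`tᵐ` and the `tᵐw`. -/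
theorem bruhat (hγ : γ ⟨negOne, negOne_mem_center⟩ = -1) (g : Mp) :
    (∃ k k' : K0, ∃ m : ℤ, g = k * t ^ m * k' ∨ g = k * (t ^ m * w 1) * k') ∨
    ∃ k k' : K0, k * g = g * k' ∧ extend γ k ≠ extend γ k' := by
  have hdet := HS.det_eq g.mat
  by_cases hC : ‖g.mat 0 0‖ ≤ ‖g.mat 1 0‖ ∧ ‖g.mat 1 1‖ ≤ ‖g.mat 1 0‖
  · left
    have hc : g.mat 1 0 ≠ 0 := by
      intro hc
      have ha := hC.1
      rw [hc, norm_zero, norm_le_zero_iff] at ha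
      simp [hc, ha] at hdet
    obtain ⟨m, hm⟩ := exists_norm_zpow hc
    refine ⟨⟨_, K1_le_K0 (upper_mem_K1 (norm_div_le_one hc hC.1))⟩,
      ⟨(w 1)⁻¹ * ((t ^ m)⁻¹ * (upper (-(g.mat 0 0 / g.mat 1 0)) * g)), ?_⟩, m, Or.inr ?_⟩
    · rw [mem_K0_iff, w_inv_mul_00, w_inv_mul_01, w_inv_mul_10, w_inv_mul_11, t_inv_mul_00,
        t_inv_mul_01, t_inv_mul_10, t_inv_mul_11, upper_mul_00, upper_mul_01, upper_mul_10,
        upper_mul_11, (pivot_c hc).1, (pivot_c hc).2, (hm _).1, (hm _).1, norm_neg, norm_neg,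
        (hm _).2, (hm _).2]
      exact ⟨by simp [hc], norm_div_le_one hc hC.2, by simp, by simp [hc]⟩
    · simp only [upper_neg]; group
  by_cases hB : 4 * ‖g.mat 0 0‖ ≤ ‖g.mat 0 1‖ ∧ 4 * ‖g.mat 1 1‖ ≤ ‖g.mat 0 1‖
  · left
    have hb : g.mat 0 1 ≠ 0 := by
      intro hb
      have ha := hB.1
      rw [hb, norm_zero] at ha
      have ha := norm_le_zero_iff.1 (by linarith : ‖g.mat 0 0‖ ≤ 0)
      simp [hb, ha] at hdet
    obtain ⟨m, hm⟩ := exists_norm_zpow (inv_ne_zero hb)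
    refine ⟨⟨_, K1_le_K0 (lower_mem_K1 (norm_div_le_four hb hB.2))⟩,
      ⟨(w 1)⁻¹ * ((t ^ m)⁻¹ * (lower (-(g.mat 1 1 / g.mat 0 1)) * g)), ?_⟩, m, Or.inr ?_⟩
    · rw [mem_K0_iff, w_inv_mul_00, w_inv_mul_01, w_inv_mul_10, w_inv_mul_11, t_inv_mul_00,
        t_inv_mul_01, t_inv_mul_10, t_inv_mul_11, lower_mul_00, lower_mul_01, lower_mul_10,
        lower_mul_11, (pivot_b hb).1, (pivot_b hb).2, norm_neg, norm_neg, (hm _).1, (hm _).1,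
        (hm _).2, (hm _).2]
      refine ⟨by simp [hb], by simp, ?_, by simp [hb]⟩
      rw [inv_mul_eq_div]
      exact norm_div_le_four hb hB.1
    · simp only [lower_neg]; group
  have pos : 0 < max ‖g.mat 0 0‖ ‖g.mat 1 1‖ := by
    by_contra! h0
    have h1 := norm_le_zero_iff.1 ((le_max_left _ _).trans h0)
    have h2 := norm_le_zero_iff.1 ((le_max_right _ _).trans h0)
    exact hC (by rw [h1, h2, norm_zero]; exact ⟨norm_nonneg _, norm_nonneg _⟩)
  -- In what follows `p` is the diagonal entry of larger absolute value.
  have key : ∀ p : ℚ_[2], ‖g.mat 0 0‖ ≤ ‖p‖ → ‖g.mat 1 1‖ ≤ ‖p‖ → p ≠ 0 →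
      ‖g.mat 1 0‖ < ‖p‖ → ‖g.mat 0 1‖ < 4 * ‖p‖ →
      1 ≤ ‖p‖ ∧ (‖g.mat 1 0‖ = ‖2 * p‖ ∨ ‖2 * g.mat 0 1‖ = ‖p‖ ∨
        (4 * ‖g.mat 1 0‖ ≤ ‖p‖ ∧ ‖g.mat 0 1‖ ≤ ‖p‖)) := by
    intro p ha hd hp hc hb
    have hc2 := two_mul_norm_le hc
    have hb2 : ‖g.mat 0 1‖ ≤ 2 * ‖p‖ := by
      have h4 : ‖g.mat 0 1‖ < ‖p / 4‖ := by
        rw [norm_div, norm_four, div_inv_eq_mul]; linarith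
      have := two_mul_norm_le h4
      rw [norm_div, norm_four, div_inv_eq_mul] at this
      linarith
    refine ⟨?_, ?_⟩
    · by_contra! h1
      have h2 : ‖g.mat 0 0 * g.mat 1 1‖ < 1 := norm_mul_lt_one (ha.trans h1.le) (hd.trans_lt h1)
      have h3 : ‖g.mat 0 1 * g.mat 1 0‖ < 1 := by
        rw [norm_mul]
        have := mul_le_mul hb2 hc2 (by positivity) (by positivity)
        nlinarith [norm_nonneg p]
      have h4 : ‖g.mat 0 0 * g.mat 1 1 - g.mat 0 1 * g.mat 1 0‖ < 1 := by
        rw [sub_eq_add_neg]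
        exact (Padic.nonarchimedean _ _).trans_lt (max_lt h2 (by rwa [norm_neg]))
      rw [hdet, norm_one] at h4
      exact lt_irrefl _ h4
    · by_cases h1 : ‖g.mat 1 0‖ = ‖2 * p‖
      · exact Or.inl h1
      by_cases h2 : ‖2 * g.mat 0 1‖ = ‖p‖
      · exact Or.inr (Or.inl h2)
      refine Or.inr (Or.inr ⟨?_, ?_⟩)
      · have h3 : ‖g.mat 1 0‖ < ‖2 * p‖ := by
          refine lt_of_le_of_ne ?_ h1
          rw [norm_mul, norm_two]; linarith
        have := two_mul_norm_le h3
        rw [norm_mul, norm_two] at this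
        linarith
      · have h3 : ‖2 * g.mat 0 1‖ < ‖p‖ := by
          refine lt_of_le_of_ne ?_ h2
          rw [norm_mul, norm_two]; linarith
        have := two_mul_norm_le h3
        rw [norm_mul, norm_two] at this
        linarith
  rcases le_total ‖g.mat 1 1‖ ‖g.mat 0 0‖ with hda | hda
  · rw [max_eq_left hda] at pos
    have ha := norm_pos_iff.1 pos
    obtain ⟨h1, hc | hb | ⟨hc, hb⟩⟩ := key (g.mat 0 0) le_rfl hda ha
      (by by_contra! h; exact hC ⟨h, hda.trans h⟩) (by
        by_contra! h; exact hB ⟨h, by linarith⟩)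
    · exact Or.inr (exists_ne_of_norm_c hγ h1 hc)
    · refine Or.inr (exists_ne_of_inv (exists_ne_of_norm_b hγ ?_ ?_))
      · rwa [mat_inv, inv_11]
      · rwa [mat_inv, inv_11, inv_01, mul_neg, norm_neg]
    · left
      obtain ⟨m, hm⟩ := exists_norm_zpow (inv_ne_zero ha)
      refine ⟨⟨_, K1_le_K0 (lower_mem_K1 (norm_div_le_four ha hc))⟩,
        ⟨(t ^ m)⁻¹ * (lower (-(g.mat 1 0 / g.mat 0 0)) * g), ?_⟩, m, Or.inl ?_⟩
      · rw [mem_K0_iff, t_inv_mul_00, t_inv_mul_01, t_inv_mul_10, t_inv_mul_11, lower_mul_00,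
          lower_mul_01, lower_mul_10, lower_mul_11, (pivot_a ha).1, (pivot_a ha).2, (hm _).1,
          (hm _).1, (hm _).2, (hm _).2]
        refine ⟨by simp [ha], ?_, by simp, by simp [ha]⟩
        rw [inv_mul_eq_div]
        exact norm_div_le_one ha hb
      · simp only [lower_neg]; group
  · rw [max_eq_right hda] at pos
    have hd := norm_pos_iff.1 pos
    obtain ⟨h1, hc | hb | ⟨hc, hb⟩⟩ := key (g.mat 1 1) hda le_rfl hd
      (by by_contra! h; exact hC ⟨hda.trans h, h⟩) (by
        by_contra! h; exact hB ⟨by linarith, h⟩)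
    · refine Or.inr (exists_ne_of_inv (exists_ne_of_norm_c hγ ?_ ?_))
      · rwa [mat_inv, inv_00]
      · rwa [mat_inv, inv_00, inv_10, norm_neg]
    · exact Or.inr (exists_ne_of_norm_b hγ h1 hb)
    · left
      obtain ⟨m, hm⟩ := exists_norm_zpow hd
      refine ⟨⟨_, K1_le_K0 (upper_mem_K1 (norm_div_le_one hd hb))⟩,
        ⟨(t ^ m)⁻¹ * (upper (-(g.mat 0 1 / g.mat 1 1)) * g), ?_⟩, m, Or.inl ?_⟩
      · rw [mem_K0_iff, t_inv_mul_00, t_inv_mul_01, t_inv_mul_10, t_inv_mul_11, upper_mul_00,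
          upper_mul_01, upper_mul_10, upper_mul_11, (pivot_d hd).1, (pivot_d hd).2, (hm _).1,
          (hm _).1, (hm _).2, (hm _).2]
        exact ⟨by simp [hd], by simp, norm_div_le_four hd hc, by simp [hd]⟩
      · simp only [upper_neg]; group

end Mp

/-! ### The equivalence for the double cover -/

namespace Mp

open LocalShimura

variable (γ : Subgroup.center Mp →* ℂˣ)

/-- The double cover with the character of `K₀` that extends `γ`. -/
noncomputable def datum (hγ : γ ⟨negOne, negOne_mem_center⟩ = -1) :
    IwahoriDatum K0 (extend γ) where
  q := 4
  hq := Or.inr rfl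
  J := maxCompact
  U := congr
  n := upper
  n' := lower
  t := t
  w := w 1
  K_le := K0_le_maxCompact
  U_le := (congr_le_K1 0).trans K1_le_K0
  χ_U _ hk := extend_K1 γ (congr_le_K1 0 hk)
  U_anti := congr_antitone
  U_normal := congr_normal
  U_index := relIndex_congr
  U_conj := congr_conj
  n_add := upper_add
  n'_add := lower_add
  n_mem _ hb := K1_le_K0 (upper_mem_K1 hb)
  χ_n _ hb := extend_K1 γ (upper_mem_K1 hb)
  n_mem_U b hb := upper_mem_congr (hb.trans_eq (by norm_num))
  n'_mem _ := lower_mem_maxCompact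
  n'_mem_U b hb := lower_mem_congr (hb.trans_eq (by norm_num))
  n'_small m := ⟨m + 2, fun i hi b hb => lower_mem_congr (by
    rw [Nat.cast_ofNat, show (4 : ℚ_[2]) = 2 ^ 2 by norm_num, ← pow_mul, norm_mul, norm_pow,
      norm_pow, norm_two]
    exact (mul_le_of_le_one_right (by positivity) hb).trans
      (pow_le_pow_of_le_one (by norm_num) (by norm_num) (by omega)))⟩
  t_n b := by rw [t_upper, Nat.cast_ofNat]
  t_n' b := by rw [t_lower, Nat.cast_ofNat]
  w_mem := w_mem_maxCompact
  w_n := w_upper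
  w_t := w_t
  w_sq_mem := by rw [w_mul_w]; exact h_neg_one_mem
  w_sq_comm g := by rw [w_mul_w]; exact h_neg_one_comm g
  u_conj := u_conj
  K_decomp := K0_triangular
  kappa := kappa
  iwasawa := iwasawa
  cartan := cartan
  bruhat := bruhat hγ
  disjoint := disjoint
  n'_notMem j h1 h2 hm := by
    have h10 := (mem_K0_iff.1 hm).2.2.1
    rw [lower_10, norm_four] at h10
    have h3 := (Padic.norm_int_le_pow_iff_dvd (p := 2) j 2).1 (by
      rw [Int.cast_natCast]; exact h10.trans_eq (by norm_num))
    norm_num at h3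
    omega

variable {γ}

theorem center_comm_of_mat_eq {z : Mp} (hz : z.mat = -1) (g : Mp) : z * g = g * z := by
  have : z ∈ Subgroup.center Mp := by
    rw [show z = ⟨-1, z.sgn⟩ from Mp.ext hz rfl]
    exact neg_one_mem_center _
  exact (Subgroup.mem_center_iff.1 this g).symm

/-- The relations of `typeProperty_of_q_eq_four` hold by construction for the elements `z` and `k` of
`Mp` that solve them. A computation with matrices shows that `z` lies above `-1`, so that it is
central with `χ(z)² = -1`, and that `k` lies above `n(-1)`. -/
theorem typeProperty (hγ : γ ⟨negOne, negOne_mem_center⟩ = -1) : TypeProperty K0 (extend γ) := by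
  let l : Mp := lift 5 (-4) 4 (-3) (by norm_num)
  have hl : l ∈ congr 0 := by
    rw [mem_congr_iff]
    change (1 : ℤˣ) = 1 ∧ ‖(5 : ℚ_[2]) - 1‖ ≤ _ ∧ ‖(-4 : ℚ_[2])‖ ≤ _ ∧ ‖(4 : ℚ_[2])‖ ≤ _ ∧
      ‖(-3 : ℚ_[2]) - 1‖ ≤ _
    norm_num
  have l00 : l.mat 0 0 = 5 := rfl
  have l01 : l.mat 0 1 = -4 := rfl
  have l10 : l.mat 1 0 = 4 := rfl
  have l11 : l.mat 1 1 = -3 := rfl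
  have hz : (lower 2 * upper 1 * (lower 2)⁻¹ * l⁻¹ * upper 1).mat = -1 := by
    refine SL_ext ?_ ?_ ?_ ?_ <;>
    simp [HS.mul_00, HS.mul_01, HS.mul_10, HS.mul_11, lower_00, lower_01, lower_10, lower_11,
      mat_mul, mat_inv, inv_00, inv_01, inv_10, inv_11, upper_00, upper_01, upper_10, upper_11,
      l00, l01, l10, l11] <;> norm_num
  have hk : ((lower 2)⁻¹ * upper 2⁻¹ * lower 2 * (t * w 1)⁻¹).mat = (upper (-1)).mat := by
    refine SL_ext ?_ ?_ ?_ ?_ <;>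
    simp [HS.mul_00, HS.mul_01, HS.mul_10, HS.mul_11, lower_00, lower_01, lower_10, lower_11,
      mat_mul, mat_inv, inv_00, inv_01, inv_10, inv_11, upper_00, upper_01, upper_10, upper_11,
      t, h_00, h_01, h_10, h_11, w_00, w_01, w_10, w_11]
    norm_num
  have hzK : lower 2 * upper 1 * (lower 2)⁻¹ * l⁻¹ * upper 1 ∈ K0 := by
    have e : ∀ i j, (-1 : SL(2, ℚ_[2])) i j = -(1 : Matrix (Fin 2) (Fin 2) ℚ_[2]) i j :=
      fun _ _ => rfl
    rw [mem_K0_iff, hz, e, e, e, e]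
    simp
  have hkK : (lower 2)⁻¹ * upper 2⁻¹ * lower 2 * (t * w 1)⁻¹ ∈ K0 := by
    rw [mem_K0_iff, hk, upper_00, upper_01, upper_10, upper_11]
    simp
  refine (datum γ hγ).typeProperty_of_q_eq_four rfl (z := ⟨_, hzK⟩) (k := ⟨_, hkK⟩)
    (center_comm_of_mat_eq hz) ?_ hl ?_ ?_
  · have := extend_sq hγ (k := ⟨_, hzK⟩) (by
      change ‖(lower 2 * upper 1 * (lower 2)⁻¹ * l⁻¹ * upper 1).mat 0 0 + 1‖ ≤ _
      rw [hz, show (-1 : SL(2, ℚ_[2])) 0 0 = -1 from rfl]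
      simp)
    rw [← Units.val_pow_eq_pow_val, this, Units.val_neg, Units.val_one]
  · change lower 2 * upper 1 = lower 2 * upper 1 * (lower 2)⁻¹ * l⁻¹ * upper 1 * upper (-1) * l *
      lower 2
    rw [upper_neg]
    group
  · change upper 2⁻¹ * lower 2 = lower 2 * ((lower 2)⁻¹ * upper 2⁻¹ * lower 2 * (t * w 1)⁻¹) *
      (t * w 1)
    group

theorem isOpen_iff_datum (hγ : γ ⟨negOne, negOne_mem_center⟩ = -1) (S : Subgroup Mp) :
    IsOpen (S : Set Mp) ↔ ∃ m, (datum γ hγ).U m ≤ S := isOpen_iff S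

theorem isEquivalence_A (hγ : γ ⟨negOne, negOne_mem_center⟩ = -1) : (A γ).IsEquivalence :=
  isEquivalence_isotypicFunctor (isOpen_ker_extend γ) (datum γ hγ).orbitFinite (typeProperty hγ)
    (fun _ _ _ _ hρ => (datum γ hγ).isOpen_fixer (isOpen_iff_datum hγ) hρ)
    (fun _ _ _ _ => (datum γ hγ).finiteDimensional_invariants (isOpen_iff_datum hγ))

/-! ### The Hecke algebra of the double cover -/
theorem lower_neg_one : lower (-1) = upper (-1) * w 1 * upper (-1) := by
  have hS : ∀ A : SL(2, ℚ_[2]), A 1 0 = -1 → cocycleS A = 1 := fun A h => by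
    unfold cocycleS
    rw [h]
    refine if_neg fun h' => ?_
    rw [show (-1 : ℚ_[2]) = ((-1 : ℤ) : ℚ_[2]) by norm_num, Padic.valuation_intCast] at h'
    simp [padicValInt] at h'
  have hX : ∀ A : SL(2, ℚ_[2]), A 1 0 = -1 → cocycleX A = -1 := fun A h => by
    rw [HS.X_of_ne (by rw [h]; norm_num), h]
  have h1 : (upper (-1) * w 1).mat 1 0 = -1 := by rw [upper_mul_10, w_10]; simp
  have h2 : (upper (-1) * w 1 * upper (-1)).mat 1 0 = -1 := by
    rw [mat_mul, HS.mul_10, upper_00, upper_10, h1]; simp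
  have hw : (w 1).mat 1 0 = -1 := by rw [w_10]; simp
  have hu : cocycleX (upper (-1)).mat = 1 := by rw [HS.X_of_eq (upper_10 _), upper_11]
  have hu' : cocycleS (upper (-1)).mat = 1 := cocycleS_of_eq_zero (by rw [upper_10, zero_mul])
  refine Mp.ext ?_ ?_
  · rw [mat_mul, mat_mul]
    refine SL_ext ?_ ?_ ?_ ?_ <;>
    simp [HS.mul_00, HS.mul_01, HS.mul_10, HS.mul_11, upper_00, upper_01, upper_10, upper_11,
      lower_00, lower_01, lower_10, lower_11, w_00, w_01, w_10, w_11]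
  · rw [sgn_mul, sgn_mul]
    unfold cocycle
    rw [← mat_mul, ← mat_mul, hX _ h1, hX _ h2, hX _ hw, hu, hS _ h1, hS _ h2, hS _ hw, hu',
      HS.of_sq ⟨1, by norm_num⟩, HS.sq_left ⟨1, by norm_num⟩]
    rfl

theorem br_mul_left (hγ : γ ⟨negOne, negOne_mem_center⟩ = -1) (k : K0) (g : Mp) :
    (datum γ hγ).br (k * g) = (extend γ k : ℂ) • (datum γ hγ).br g :=
  bracket_mul_left (datum γ hγ).orbitFinite k g

theorem br_mul_K1 (hγ : γ ⟨negOne, negOne_mem_center⟩ = -1) (g : Mp) {k k' : Mp} (hk : k ∈ K1)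
    (hk' : k' ∈ K1) : (datum γ hγ).br (k * g * k') = (datum γ hγ).br g := by
  have h1 := bracket_mul_right (datum γ hγ).orbitFinite (k * g) ⟨k', K1_le_K0 hk'⟩
  rw [extend_K1 γ (k := ⟨k', K1_le_K0 hk'⟩) hk', Units.val_one, one_smul] at h1
  have h2 := br_mul_left hγ ⟨k, K1_le_K0 hk⟩ g
  rw [extend_K1 γ (k := ⟨k, K1_le_K0 hk⟩) hk, Units.val_one, one_smul] at h2
  exact h1.trans h2

theorem extend_w_sq (h' : w 1 * w 1 ∈ K0) :
    extend γ ⟨w 1 * w 1, h'⟩ = γ ⟨h (-1), h_neg_one_mem_center⟩ :=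
  extend_of_eq γ (one_mem K1) (by rw [mul_one]; exact w_mul_w)

theorem br_lower_neg_one (hγ : γ ⟨negOne, negOne_mem_center⟩ = -1) :
    (datum γ hγ).br (lower (-1)) = (datum γ hγ).br (w 1) := by
  rw [lower_neg_one]
  exact br_mul_K1 hγ _ (upper_mem_K1 (by simp)) (upper_mem_K1 (by simp))

theorem br_lower_neg_two (hγ : γ ⟨negOne, negOne_mem_center⟩ = -1) :
    (datum γ hγ).br (lower (-2)) = 0 := by
  obtain ⟨k, k', e, hne⟩ := exists_ne_of_norm_c (g := lower (-2)) hγ (by rw [lower_00, norm_one])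
    (by rw [lower_10, lower_00, mul_one, norm_neg])
  exact bracket_eq_zero (datum γ hγ).orbitFinite e hne

theorem br_lower_neg_three (hγ : γ ⟨negOne, negOne_mem_center⟩ = -1) :
    (datum γ hγ).br (lower (-3)) =
      ((γ ⟨h (-1), h_neg_one_mem_center⟩)⁻¹ : ℂˣ) • (datum γ hγ).br (w 1) := by
  have e : lower (-3) = upper 1 * ((h (-1))⁻¹ * w 1) * (upper 1 * lower (-4)) := by
    have h1 : lower 1 = upper 1 * (w 1)⁻¹ * upper 1 := by
      have := congrArg (·⁻¹) lower_neg_one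
      simp only [lower_neg, inv_inv, upper_neg] at this
      rw [this]
      group
    rw [show (-3 : ℚ_[2]) = 1 + -4 by norm_num, lower_add, h1, ← w_mul_w]
    group
  rw [e, br_mul_K1 hγ _ (upper_mem_K1 (by simp))
    (mul_mem (upper_mem_K1 (by simp)) (lower_mem_K1 (by rw [norm_neg])))]
  refine (br_mul_left hγ ⟨_, inv_mem h_neg_one_mem⟩ _).trans ?_
  rw [extend_of_eq γ (z := ⟨_, h_neg_one_mem_center⟩⁻¹) (one_mem K1) (by rw [mul_one]; rfl),
    map_inv]
  rfl

theorem conj_eq_neg {x : ℂ} (hx : x ^ 2 = -1) : (starRingEnd ℂ) x = -x := by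
  have : (x - Complex.I) * (x + Complex.I) = 0 := by
    linear_combination hx - Complex.I_sq
  rcases mul_eq_zero.1 this with h | h
  · rw [sub_eq_zero.1 h, Complex.conj_I]
  · rw [eq_neg_of_add_eq_zero_left h, map_neg, Complex.conj_I]

/-- With `x = γ(h(-1))`, so that `x² = -1`, the generators are `2 (1 - x) [w]` and
`(1 - x) / √2 [u]`, where `[g]` denotes the averaged translate. The relation `T² = T + 2` holds since
`[w]² = x / 4 ([1] + [n'(-1)] + [n'(-2)] + [n'(-3)])`, where `[n'(-2)]` vanishes and the other terms
are multiples of `[1]` and `[w]`. -/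
theorem exists_algEquiv (hγ : γ ⟨negOne, negOne_mem_center⟩ = -1) :
    ∃ e : QuadraticHecke ≃ₐ[ℂ] H γ,
      (e QuadraticHecke.T).IsDoubleCoset (w 1)
        (((√2 : ℝ) : ℂ)⁻¹ * (starRingEnd ℂ) (zeta γ)) ∧
      (e QuadraticHecke.U).IsDoubleCoset (w (Units.mk0 2 two_ne_zero)⁻¹)
        ((starRingEnd ℂ) (zeta γ)) := by
  obtain ⟨x, hx⟩ : ∃ x : ℂˣ, x = γ ⟨h (-1), h_neg_one_mem_center⟩ := ⟨_, rfl⟩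
  have hx2 : (x : ℂ) ^ 2 = -1 := by
    rw [hx, ← Units.val_pow_eq_pow_val, gamma_h_sq hγ, Units.val_neg, Units.val_one]
  have hxinv : ((x⁻¹ : ℂˣ) : ℂ) = -x := by
    rw [Units.val_inv_eq_inv_val, inv_eq_iff_eq_inv, ← neg_inv, eq_neg_iff_add_eq_zero]
    have := x.ne_zero
    field_simp
    linear_combination hx2
  have hs : ((√2 : ℝ) : ℂ) ^ 2 = 2 := by
    rw [← Complex.ofReal_pow, Real.sq_sqrt (by norm_num)]; norm_num
  have hs0 : ((√2 : ℝ) : ℂ) ≠ 0 := by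
    intro h0; rw [h0] at hs; norm_num at hs
  have hζ : (starRingEnd ℂ) (zeta γ) = (1 - x) / (√2 : ℝ) := by
    unfold zeta
    rw [map_div₀, map_add, map_one, ← hx, conj_eq_neg hx2, Complex.conj_ofReal, sub_eq_add_neg]
  have hw : ((extend γ ⟨w 1 * w 1, (datum γ hγ).w_sq_mem⟩ : ℂˣ) : ℂ) = x := by
    rw [hx]; exact congrArg Units.val (extend_w_sq _)
  have hT : ((2 * (1 - x) : ℂ) • (datum γ hγ).br (datum γ hγ).w) *
      ((2 * (1 - x) : ℂ) • (datum γ hγ).br (datum γ hγ).w) =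
      (2 * (1 - x) : ℂ) • (datum γ hγ).br (datum γ hγ).w + 2 := by
    rw [smul_mul_smul_comm, (datum γ hγ).br_w_mul_br_w]
    change _ • (((extend γ ⟨w 1 * w 1, (datum γ hγ).w_sq_mem⟩ : ℂˣ) : ℂ) * ((4 : ℕ) : ℂ)⁻¹) •
      ∑ j ∈ Finset.range 4, (datum γ hγ).br (lower (-(j : ℚ_[2]))) =
      (2 * (1 - x) : ℂ) • (datum γ hγ).br (w 1) + 2
    rw [hw, Finset.sum_range_succ, Finset.sum_range_succ, Finset.sum_range_succ,
      Finset.sum_range_one, Nat.cast_one, Nat.cast_zero, Nat.cast_ofNat, Nat.cast_ofNat,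
      Nat.cast_ofNat, neg_zero,
      lower_zero, (datum γ hγ).br_one, br_lower_neg_one, br_lower_neg_two, br_lower_neg_three,
      add_zero, smul_smul, ← hx, Units.smul_def, hxinv]
    have h2 : (2 : HeckeAlgebra K0 (extend γ)) = (2 : ℂ) • 1 := by
      rw [← Algebra.algebraMap_eq_smul_one, map_ofNat]
    rw [h2]
    match_scalars
    · linear_combination (-2 + (x : ℂ)) * hx2
    · linear_combination (-(x : ℂ) ^ 2 + 3 * x - 2) * hx2
  have hU : ((1 - (x : ℂ)) / ((√2 : ℝ) : ℂ)) • (datum γ hγ).br (datum γ hγ).u *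
      ((1 - (x : ℂ)) / ((√2 : ℝ) : ℂ)) • (datum γ hγ).br (datum γ hγ).u = 1 := by
    rw [smul_mul_smul_comm, (datum γ hγ).br_u_sq, smul_smul]
    have : ((1 - (x : ℂ)) / ((√2 : ℝ) : ℂ)) * ((1 - (x : ℂ)) / ((√2 : ℝ) : ℂ)) * x = 1 := by
      field_simp
      linear_combination (-2 + (x : ℂ)) * hx2 - hs
    exact (congrArg (fun c : ℂ => (((1 - (x : ℂ)) / ((√2 : ℝ) : ℂ)) *
      ((1 - (x : ℂ)) / ((√2 : ℝ) : ℂ)) * c) • (1 : HeckeAlgebra K0 (extend γ))) hw).trans (by rw [this, one_smul])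
  obtain ⟨e, eT, eU⟩ := (datum γ hγ).exists_algEquiv hT hU
  refine ⟨e, ?_, ?_⟩
  · rw [eT]
    refine (datum γ hγ).isDoubleCoset_smul_br _ _ ?_
    rw [(datum γ hγ).br_w_apply, hζ]
    change (2 * (1 - x) : ℂ) * ((4 : ℕ) : ℂ)⁻¹ = _
    rw [inv_mul_eq_div, div_div, ← pow_two, hs]
    push_cast
    ring
  · rw [eU, ← t_mul_w]
    refine (datum γ hγ).isDoubleCoset_smul_br _ _ ?_
    rw [hζ]
    exact (congrArg _ (datum γ hγ).br_u_apply).trans (mul_one _)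

end Mp

/-! ### The correspondence -/
theorem mainTheorem3 (γ : Subgroup.center Mp →* ℂˣ)
    (hγ : γ ⟨Mp.negOne, Mp.negOne_mem_center⟩ = -1) :
    ∃ Φ : Mp.H γ ≃ₐ[ℂ] PGLTwo.H,
      (∃ (Tw U₁ : Mp.H γ) (Tw' U₁' : PGLTwo.H),
        HeckeAlgebra.IsDoubleCoset Tw (Mp.w 1)
          (((√2 : ℝ) : ℂ)⁻¹ * (starRingEnd ℂ) (Mp.zeta γ)) ∧
        HeckeAlgebra.IsDoubleCoset U₁ (Mp.w (Units.mk0 2 two_ne_zero)⁻¹)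
          ((starRingEnd ℂ) (Mp.zeta γ)) ∧
        HeckeAlgebra.IsDoubleCoset Tw' PGLTwo.w 1 ∧
        HeckeAlgebra.IsDoubleCoset U₁' PGLTwo.u 1 ∧
        Φ Tw = Tw' ∧ Φ U₁ = U₁') ∧
      (Mp.A γ).IsEquivalence ∧
      (restrictFinDim Φ).IsEquivalence ∧
      PGLTwo.A.IsEquivalence ∧
      ∃ Sh : Mp.R γ ≌ PGLTwo.R,
        Nonempty (Sh.functor ⋙ PGLTwo.A ⋙ restrictFinDim Φ ≅ Mp.A γ) := by
  obtain ⟨e₁, hT₁, hU₁⟩ := Mp.exists_algEquiv hγ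
  obtain ⟨e₂, hT₂, hU₂⟩ := PGLTwo.exists_algEquiv
  have h1 : (Mp.A γ).IsEquivalence := Mp.isEquivalence_A hγ
  have h2 : (restrictFinDim (e₁.symm.trans e₂)).IsEquivalence :=
    LocalShimura.isEquivalence_restrictFinDim _
  have h3 : PGLTwo.A.IsEquivalence := PGLTwo.isEquivalence_A
  exact ⟨e₁.symm.trans e₂, ⟨e₁ .T, e₁ .U, e₂ .T, e₂ .U, hT₁, hU₁, hT₂, hU₂, by simp, by simp⟩,
    h1, h2, h3, LocalShimura.exists_equivalence _ _ _⟩
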